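/- **Legendrian handle slides.** Let $n\ge 2$, let $(Y,\xi)$ be a $(2n-1)$-dimensional contact manifold (with $\xi$ not necessarily cooriented), and let $\Lambda,\Sigma\subset (Y,\xi)$ be disjoint Legendrian submanifolds, where $\Lambda=\ell(S^{n-1})$ is an embedded, parametrised sphere and $\Sigma$ is closed as a subset of $Y$. *Jets and fronts.* Let $J^1S^{n-1}=\{(x,y,z)\in\mathbb R^n\times\mathbb R^n\times\mathbb R:\ |x|=1,\ x\cdot y=0\}$ with the contact form $dz-y\cdot dx$ and front projection $(x,y,z)\mapsto (x,z)$. A standard neighbourhood of $\Lambda$ is a contactomorphism $N$ from an open neighbourhood $\Omega$ of the zero section of $J^1S^{n-1}$ onto an open subset of $Y$, with $N(x,0,0)=\ell(x)$. *Surgery.* On $\mathbb R^{2n}\ni(q,p)$ consider the Liouville form $\lambda=\sum_i (p_i\,dq_i+2q_i\,dp_i)$ and the flow $(q,p)\mapsto(e^{2t}q,e^{-t}p)$ of its Liouville vector field. The maps $\phi(x,y,z)=(q,p)=(x,\tfrac z2x+y)$ and $\psi(u,v,s)=(q,p)=(su-v,u)$ identify $J^1S^{n-1}$ with $\{|q|=1\}$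 and $\{|p|=1\}$ respectively, pulling $\lambda$ back to the canonical contact form. Following flow lines from $\{|q|=1,\,p\neq0\}$ to $\{|p|=1,\,q\ne0\}$ gives, through $\phi$ and $\psi$, a contactomorphism $\Phi$ of the complement of the zero section in $J^1S^{n-1}$. The surgered manifold $Y_\Lambda(-1)$ (respectively $Y_\Lambda(+1)$) is obtained by gluing $Y\setminus\Lambda$ and the open neighbourhood of the zero section in a second copy of $J^1S^{n-1}$ that consists of the zero section and of all $w$ off it with $\Phi(w)\in\Omega$ (respectively $\Phi^{-1}(w)\in\Omega$), along $w\mapsto N(\Phi(w))$ (respectively $w\mapsto N(\Phi^{-1}(w))$). It carries the contact structure given by $\xi$ and by $dz-y\cdot dx$ on the two pieces. *The initial front.* Let $e\in S^{n-1}$, $0<r<\pi$, $a>0$, $0<h<b$ and $\sigma\in\{1,-1\}$, and write $\theta(x)\in[0,\pi]$ for the angle between $x$ and $e$. Suppose that the box $B=\{(x,y,z):\theta(x)<r,\ -a<\sigma z<b\}$ is contained in $\Omega$ and that $$N^{-1}(\Sigma)\cap B=\{(x,0,\sigma h):\theta(x)<r\}.$$ So in the Darboux chart $N(B)$ the fronts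 of $\Lambda$ and $\Sigma$ are two parallel sheets, $\Sigma$ lying above ($\sigma=1$) or below ($\sigma=-1$) $\Lambda$. *The handleslid fronts.* Let $\varepsilon>0$. Consider smooth front curves $\tau\mapsto(\theta(\tau),A(\tau))$, $\tau\in\mathbb R$, with smooth slope function $P$, $A'=P\,\theta'$, of one of the following two kinds. - *Cusp:* $\theta(\tau)=r_0+\tau^2$, where $r_0,T>0$ and $r_0+T^2<r$; $P>0$ on $(0,T)$, $P<0$ on $(-T,0)$, $P'(0)>0$; $A(0)<0$, $A=h$ on $[T,\infty)$ and $A=-\varepsilon$ on $(-\infty,-T]$. - *Cone:* $\theta(\tau)=\tau$, where $0<T<r$; $P>0$ on $(-T,T)$, $A=h$ on $[T,\infty)$ and $A=-\varepsilon$ on $(-\infty,-T]$. Let $h_\Lambda(\Sigma)\subset Y$ be the union of $\Sigma\setminus N(B)$, of the image under $N$ of the Legendrian lift $$\left\{\left(\cos\theta(\tau)\,e+\sin\theta(\tau)\,u,\ \sigma P(\tau)\left(-\sin\theta(\tau)\,e+\cos\theta(\tau)\,u\right),\ \sigma A(\tau)\right):\ u\in S^{n-1},\ u\perp e,\ |\theta(\tau)|<r\right\}$$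 of the front obtained by rotating the curve about the axis through $e$, and of the part $N(\{(x,0,-\sigma\varepsilon):\theta(x)\ge r\})$ of the Reeb push-off of $\Lambda$ to the side opposite to $\Sigma$. In the cusp case its front in the Darboux chart has a spherical cusp edge $\{\theta=r_0\}$ joining the sheet of $\Sigma$, which crosses the front of $\Lambda$, to the push-off of $\Lambda$; in the cone case the two are joined through a cone singularity on the axis. **Proposition.** There is $\varepsilon_0>0$ such that for every $\varepsilon\in(0,\varepsilon_0)$ and for every front curve as above, $h_\Lambda(\Sigma)$ is an embedded Legendrian submanifold of $(Y,\xi)$, diffeomorphic to $\Sigma$ and disjoint from $\Lambda$, and moreover: - **A.** for a front curve of cusp type, $\Sigma$ and $h_\Lambda(\Sigma)$ are Legendrian isotopic in $Y_\Lambda(-1)$; - **B.** for a front curve of cone type, $\Sigma$ and $h_\Lambda(\Sigma)$ are Legendrian isotopic in $Y_\Lambda(+1)$. Both isotopies can be taken to be compactly supported, i.e. constant in time outside a compact subset of $\Sigma$. -/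

import Mathlib

open Set Topology
open scoped Manifold ContDiff RealInnerProductSpace

noncomputable section

namespace LegendrianSlide

/-! ### Contact manifolds and Legendrian submanifolds -/

section Contact

variable {m : ℕ}

/-- A field of linear subspaces of the tangent spaces of a `(2m+1)`-dimensional manifold. -/
abbrev TangentField (m : ℕ) (Y : Type*) [TopologicalSpace Y]
    [ChartedSpace (EuclideanSpace ℝ (Fin (2 * m + 1))) Y] :=
  ∀ y : Y, Submodule ℝ (TangentSpace (𝓡 (2 * m + 1)) y)

/-- `ξ` is a contact structure: in a chart around every point it is the kernel of a smooth nowhere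
vanishing 1-form `α` such that `dα` is non-degenerate on `ker α`. Here
`dα (v, w) = D_v α (w) - D_w α (v)`. No global coorientation is required. -/
def IsContactStructure {Y : Type*} [TopologicalSpace Y]
    [ChartedSpace (EuclideanSpace ℝ (Fin (2 * m + 1))) Y] (ξ : TangentField m Y) : Prop :=
  ∀ y₀ : Y, ∃ (U : Set (EuclideanSpace ℝ (Fin (2 * m + 1))))
    (α : EuclideanSpace ℝ (Fin (2 * m + 1)) → (EuclideanSpace ℝ (Fin (2 * m + 1)) →L[ℝ] ℝ)),
    IsOpen U ∧ U ⊆ (chartAt (EuclideanSpace ℝ (Fin (2 * m + 1))) y₀).target ∧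
    chartAt (EuclideanSpace ℝ (Fin (2 * m + 1))) y₀ y₀ ∈ U ∧ ContDiffOn ℝ ∞ α U ∧
    ∀ p ∈ U, α p ≠ 0 ∧
      (∀ v : TangentSpace (𝓡 (2 * m + 1)) p,
        mfderiv (𝓡 (2 * m + 1)) (𝓡 (2 * m + 1))
          (chartAt (EuclideanSpace ℝ (Fin (2 * m + 1))) y₀).symm p v ∈
            ξ ((chartAt (EuclideanSpace ℝ (Fin (2 * m + 1))) y₀).symm p) ↔ α p v = 0) ∧
      (∀ v : EuclideanSpace ℝ (Fin (2 * m + 1)), α p v = 0 → v ≠ 0 →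
        ∃ w : EuclideanSpace ℝ (Fin (2 * m + 1)), α p w = 0 ∧
          fderiv ℝ α p v w - fderiv ℝ α p w v ≠ 0)

/-- A smooth embedding of an `m`-dimensional manifold that is everywhere tangent to the field `ξ` on
a `(2m+1)`-dimensional manifold. -/
structure IsLegendrianEmbedding {L Y : Type*} [TopologicalSpace L]
    [ChartedSpace (EuclideanSpace ℝ (Fin m)) L] [TopologicalSpace Y]
    [ChartedSpace (EuclideanSpace ℝ (Fin (2 * m + 1))) Y] (ξ : TangentField m Y)
    (f : L → Y) : Prop where
  smooth : ContMDiff (𝓡 m) (𝓡 (2 * m + 1)) ∞ f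
  embedding : IsEmbedding f
  immersion : ∀ x, Function.Injective (mfderiv (𝓡 m) (𝓡 (2 * m + 1)) f x)
  tangent : ∀ x (v : TangentSpace (𝓡 m) x), mfderiv (𝓡 m) (𝓡 (2 * m + 1)) f x v ∈ ξ (f x)

/-- The subsets `S₀` and `S₁` are Legendrian isotopic, through a smooth family of Legendrian
embeddings of the manifold `L` that is constant in time outside a compact subset of `L`. -/
def LegendrianIsotopic (L : Type*) {Y : Type*} [TopologicalSpace L]
    [ChartedSpace (EuclideanSpace ℝ (Fin m)) L] [TopologicalSpace Y]
    [ChartedSpace (EuclideanSpace ℝ (Fin (2 * m + 1))) Y] (ξ : TangentField m Y)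
    (S₀ S₁ : Set Y) : Prop :=
  ∃ F : ℝ → L → Y,
    ContMDiffOn (𝓘(ℝ, ℝ).prod (𝓡 m)) (𝓡 (2 * m + 1)) ∞ (Function.uncurry F)
      (Icc (0 : ℝ) 1 ×ˢ univ) ∧
    (∀ t ∈ Icc (0 : ℝ) 1, IsLegendrianEmbedding ξ (F t)) ∧
    (∃ K : Set L, IsCompact K ∧ ∀ x ∉ K, ∀ t ∈ Icc (0 : ℝ) 1, F t x = F 0 x) ∧
    range (F 0) = S₀ ∧ range (F 1) = S₁

end Contact

/-! ### The 1-jet space of the round sphere -/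

/-- Euclidean space of dimension `m + 1`. -/
abbrev Euc (m : ℕ) := EuclideanSpace ℝ (Fin (m + 1))

/-- The round unit sphere of dimension `m`. -/
abbrev Sph (m : ℕ) := Metric.sphere (0 : Euc m) 1

/-- The 1-jet space `J¹(Sᵐ) = {(x, y, z) : ‖x‖ = 1, x · y = 0}`, identified with `Sᵐ × ℝᵐ⁺¹` by
`(x, y, z) ↦ (x, z x + y)`. -/
abbrev Jet (m : ℕ) := Sph m × Euc m

variable {m : ℕ}

/-- The jet with base point `x`, differential `y` (a vector orthogonal to `x`) and value `z`. -/
def jetMk (x : Sph m) (y : Euc m) (z : ℝ) : Jet m := (x, z • (x : Euc m) + y)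

/-- The coordinate `x` on the 1-jet space. -/
def jetPos (w : Jet m) : Euc m := w.1

/-- The coordinate `z` on the 1-jet space. -/
def jetHeight (w : Jet m) : ℝ := ⟪w.2, (w.1 : Euc m)⟫

/-- The coordinate `y` on the 1-jet space. -/
def jetSlope (w : Jet m) : Euc m := w.2 - jetHeight w • (w.1 : Euc m)

/-- The model with corners of the 1-jet space. -/
abbrev jetModel (m : ℕ) := (𝓡 m).prod 𝓘(ℝ, Euc m)

/-- The canonical contact form `dz - y · dx` on the 1-jet space. -/
def jetForm (w : Jet m) : TangentSpace (jetModel m) w →L[ℝ] ℝ :=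
  mvfderiv (jetModel m) jetHeight w -
    (innerSL ℝ (jetSlope w)).comp (mvfderiv (jetModel m) jetPos w)

/-! ### The critical Weinstein handle

The handle lives in `ℝᵐ⁺¹ × ℝᵐ⁺¹ ∋ (q, p)` with Liouville form `p dq + 2 q dp`. Its two boundary
pieces `{‖q‖ = 1}` and `{‖p‖ = 1}` are parametrised by the 1-jet space of the sphere, the belt sphere
`{q ∈ Sᵐ, p = 0}` and the attaching sphere `{q = 0, p ∈ Sᵐ}` being the zero sections. -/

/-- The strict contactomorphism `q = x`, `p = (z / 2) x + y` onto `{‖q‖ = 1}`. -/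
def plusHandle (w : Jet m) : Euc m × Euc m :=
  ((w.1 : Euc m), (jetHeight w / 2) • (w.1 : Euc m) + jetSlope w)

/-- The strict contactomorphism `q = s u - v`, `p = u` onto `{‖p‖ = 1}`. -/
def minusHandle (w : Jet m) : Euc m × Euc m :=
  (jetHeight w • (w.1 : Euc m) - jetSlope w, (w.1 : Euc m))

/-- The flow of the Liouville vector field `2 q ∂_q - p ∂_p`. -/
def liouvilleFlow (t : ℝ) (a : Euc m × Euc m) : Euc m × Euc m :=
  (Real.exp (2 * t) • a.1, Real.exp (-t) • a.2)

/-- A unit vector as a point of the sphere (and the default value `e` for other vectors). -/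
def toSph (e : Sph m) (v : Euc m) : Sph m :=
  open Classical in if h : v ∈ Metric.sphere (0 : Euc m) 1 then ⟨v, h⟩ else e

/-- The inverse of `plusHandle` on `{‖q‖ = 1}`. -/
def plusHandleInv (e : Sph m) (a : Euc m × Euc m) : Jet m :=
  jetMk (toSph e a.1) (a.2 - ⟪a.2, a.1⟫ • a.1) (2 * ⟪a.2, a.1⟫)

/-- The inverse of `minusHandle` on `{‖p‖ = 1}`. -/
def minusHandleInv (e : Sph m) (a : Euc m × Euc m) : Jet m :=
  jetMk (toSph e a.2) (⟪a.1, a.2⟫ • a.2 - a.1) ⟪a.1, a.2⟫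

/-- Follow the Liouville flow from `{‖q‖ = 1}` to `{‖p‖ = 1}`, at time `log ‖p‖`, in jet
coordinates. It is meaningful away from the zero section. -/
def transferFun (w : Jet m) : Jet m :=
  minusHandleInv w.1 (liouvilleFlow (Real.log ‖(plusHandle w).2‖) (plusHandle w))

/-- Follow the Liouville flow from `{‖p‖ = 1}` to `{‖q‖ = 1}`, at time `- (log ‖q‖) / 2`, in jet
coordinates. It is meaningful away from the zero section. -/
def transferInv (w : Jet m) : Jet m :=
  plusHandleInv w.1 (liouvilleFlow (-Real.log ‖(minusHandle w).1‖ / 2) (minusHandle w))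

lemma inner_self_sph (x : Sph m) : ⟪(x : Euc m), (x : Euc m)⟫ = 1 := by
  have h : ‖(x : Euc m)‖ = 1 := norm_eq_of_mem_sphere x
  rw [real_inner_self_eq_norm_sq, h]; norm_num

lemma norm_sph (x : Sph m) : ‖(x : Euc m)‖ = 1 := norm_eq_of_mem_sphere x

lemma coe_toSph {e : Sph m} {v : Euc m} (h : ‖v‖ = 1) : (toSph e v : Euc m) = v := by
  have h' : v ∈ Metric.sphere (0 : Euc m) 1 := by simpa using h
  simp only [toSph, dif_pos h']

lemma toSph_coe (e x : Sph m) : toSph e (x : Euc m) = x :=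
  Subtype.ext (coe_toSph (norm_sph x))

lemma jetMk_coords (w : Jet m) : jetMk w.1 (jetSlope w) (jetHeight w) = w := by
  ext1 <;> simp [jetMk, jetSlope]

lemma jetHeight_mk {x : Sph m} {y : Euc m} {z : ℝ} (h : ⟪y, (x : Euc m)⟫ = 0) :
    jetHeight (jetMk x y z) = z := by
  simp only [jetHeight, jetMk, inner_add_left, real_inner_smul_left, inner_self_sph, h]; ring

lemma jetSlope_mk {x : Sph m} {y : Euc m} {z : ℝ} (h : ⟪y, (x : Euc m)⟫ = 0) :
    jetSlope (jetMk x y z) = y := by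
  rw [jetSlope, jetHeight_mk h]; simp [jetMk]

lemma inner_jetSlope (w : Jet m) : ⟪jetSlope w, (w.1 : Euc m)⟫ = 0 := by
  simp only [jetSlope, inner_sub_left, real_inner_smul_left, inner_self_sph, jetHeight]; ring

lemma plusHandleInv_plusHandle (e : Sph m) (w : Jet m) : plusHandleInv e (plusHandle w) = w := by
  have h := inner_jetSlope w
  have h2 : ⟪(plusHandle w).2, (plusHandle w).1⟫ = jetHeight w / 2 := by
    simp only [plusHandle, inner_add_left, real_inner_smul_left, inner_self_sph, h]; ring
  rw [plusHandleInv, h2]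
  conv_rhs => rw [← jetMk_coords w]
  simp only [plusHandle, toSph_coe]
  congr 1
  · simp
  · ring

lemma plusHandle_plusHandleInv (e : Sph m) {a : Euc m × Euc m} (ha : ‖a.1‖ = 1) :
    plusHandle (plusHandleInv e a) = a := by
  have hc : (toSph e a.1 : Euc m) = a.1 := coe_toSph ha
  have h : ⟪a.2 - ⟪a.2, a.1⟫ • a.1, (toSph e a.1 : Euc m)⟫ = 0 := by
    rw [hc, inner_sub_left, real_inner_smul_left, real_inner_self_eq_norm_sq, ha]; ring
  rw [plusHandle, plusHandleInv, jetHeight_mk h, jetSlope_mk h]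
  ext1
  · simpa [jetMk] using hc
  · simp only [jetMk, hc]
    rw [mul_div_cancel_left₀ _ (two_ne_zero)]
    abel

lemma minusHandleInv_minusHandle (e : Sph m) (w : Jet m) :
    minusHandleInv e (minusHandle w) = w := by
  have h := inner_jetSlope w
  have h2 : ⟪(minusHandle w).1, (minusHandle w).2⟫ = jetHeight w := by
    simp only [minusHandle, inner_sub_left, real_inner_smul_left, inner_self_sph, h]; ring
  rw [minusHandleInv, h2]
  conv_rhs => rw [← jetMk_coords w]
  simp only [minusHandle, toSph_coe]
  congr 1
  abel

lemma minusHandle_minusHandleInv (e : Sph m) {a : Euc m × Euc m} (ha : ‖a.2‖ = 1) :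
    minusHandle (minusHandleInv e a) = a := by
  have hc : (toSph e a.2 : Euc m) = a.2 := coe_toSph ha
  have h : ⟪⟪a.1, a.2⟫ • a.2 - a.1, (toSph e a.2 : Euc m)⟫ = 0 := by
    rw [hc, inner_sub_left, real_inner_smul_left, real_inner_self_eq_norm_sq, ha]; ring
  rw [minusHandle, minusHandleInv, jetHeight_mk h, jetSlope_mk h]
  ext1
  · simp only [jetMk, hc]
    abel
  · simpa [jetMk] using hc

lemma liouvilleFlow_neg (t : ℝ) (a : Euc m × Euc m) :
    liouvilleFlow (-t) (liouvilleFlow t a) = a := by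
  ext1 <;> simp [liouvilleFlow, smul_smul, ← Real.exp_add]

lemma plusHandle_snd_norm_le (w : Jet m) : ‖(plusHandle w).2‖ ≤ 3 * ‖w.2‖ := by
  have h1 : |jetHeight w| ≤ ‖w.2‖ := by
    have := abs_real_inner_le_norm w.2 (w.1 : Euc m)
    rwa [norm_sph, mul_one] at this
  have h2 : (plusHandle w).2 = w.2 - (jetHeight w / 2) • (w.1 : Euc m) := by
    simp only [plusHandle, jetSlope]; module
  rw [h2]
  refine (norm_sub_le _ _).trans ?_
  rw [norm_smul, norm_sph, mul_one, Real.norm_eq_abs, abs_div, abs_two]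
  linarith [norm_nonneg w.2]

lemma plusHandle_snd_ne {w : Jet m} (hw : w.2 ≠ 0) : (plusHandle w).2 ≠ 0 := by
  intro h
  apply hw
  have := plusHandleInv_plusHandle w.1 w
  rw [plusHandleInv, h] at this
  rw [← this]; simp [jetMk]

lemma minusHandle_fst_norm (w : Jet m) : ‖(minusHandle w).1‖ = ‖w.2‖ := by
  have h := inner_jetSlope w
  have h1 : ‖(minusHandle w).1‖ ^ 2 = ‖w.2‖ ^ 2 := by
    conv_rhs => rw [show w.2 = jetHeight w • (w.1 : Euc m) + jetSlope w by simp [jetSlope]]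
    rw [minusHandle, ← real_inner_self_eq_norm_sq, ← real_inner_self_eq_norm_sq]
    simp only [inner_sub_left, inner_sub_right, inner_add_left, inner_add_right,
      real_inner_smul_left, real_inner_smul_right, h, real_inner_comm (jetSlope w)]
    ring
  exact (sq_eq_sq₀ (norm_nonneg _) (norm_nonneg _)).1 h1

lemma flow_log_snd {a : Euc m × Euc m} (ha : a.2 ≠ 0) :
    ‖(liouvilleFlow (Real.log ‖a.2‖) a).2‖ = 1 := by
  have h : 0 < ‖a.2‖ := norm_pos_iff.2 ha
  simp only [liouvilleFlow, norm_smul, Real.norm_eq_abs, Real.abs_exp]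
  rw [Real.exp_neg, Real.exp_log h]
  exact inv_mul_cancel₀ h.ne'

lemma flow_log_fst {a : Euc m × Euc m} (ha : a.1 ≠ 0) :
    ‖(liouvilleFlow (-Real.log ‖a.1‖ / 2) a).1‖ = 1 := by
  have h : 0 < ‖a.1‖ := norm_pos_iff.2 ha
  simp only [liouvilleFlow, norm_smul, Real.norm_eq_abs, Real.abs_exp]
  rw [show 2 * (-Real.log ‖a.1‖ / 2) = -Real.log ‖a.1‖ by ring, Real.exp_neg, Real.exp_log h]
  exact inv_mul_cancel₀ h.ne'

lemma minusHandle_transferFun {w : Jet m} (hw : w.2 ≠ 0) :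
    minusHandle (transferFun w) =
      liouvilleFlow (Real.log ‖(plusHandle w).2‖) (plusHandle w) :=
  minusHandle_minusHandleInv _ (flow_log_snd (plusHandle_snd_ne hw))

lemma minusHandle_fst_ne {w : Jet m} (hw : w.2 ≠ 0) : (minusHandle w).1 ≠ 0 := by
  rw [← norm_pos_iff, minusHandle_fst_norm]; exact norm_pos_iff.2 hw

lemma plusHandle_transferInv {w : Jet m} (hw : w.2 ≠ 0) :
    plusHandle (transferInv w) =
      liouvilleFlow (-Real.log ‖(minusHandle w).1‖ / 2) (minusHandle w) :=
  plusHandle_plusHandleInv _ (flow_log_fst (minusHandle_fst_ne hw))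

/-- The fibre norm of the transfer map. -/
lemma norm_transferFun {w : Jet m} (hw : w.2 ≠ 0) :
    ‖(transferFun w).2‖ = ‖(plusHandle w).2‖ ^ 2 := by
  have h : 0 < ‖(plusHandle w).2‖ := norm_pos_iff.2 (plusHandle_snd_ne hw)
  rw [← minusHandle_fst_norm, minusHandle_transferFun hw]
  simp only [liouvilleFlow, norm_smul, Real.norm_eq_abs, Real.abs_exp]
  rw [two_mul, Real.exp_add, Real.exp_log h]
  simp only [plusHandle, norm_sph]
  ring

lemma norm_plusHandle_transferInv {w : Jet m} (hw : w.2 ≠ 0) :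
    ‖(plusHandle (transferInv w)).2‖ ^ 2 = ‖w.2‖ := by
  have h : 0 < ‖(minusHandle w).1‖ := norm_pos_iff.2 (minusHandle_fst_ne hw)
  rw [plusHandle_transferInv hw]
  simp only [liouvilleFlow, norm_smul, Real.norm_eq_abs, Real.abs_exp]
  rw [show ‖(minusHandle w).2‖ = 1 from norm_sph _, mul_one, ← Real.exp_nat_mul,
    show ((2 : ℕ) : ℝ) * -(-Real.log ‖(minusHandle w).1‖ / 2) = Real.log ‖(minusHandle w).1‖ by
      push_cast; ring, Real.exp_log h, minusHandle_fst_norm]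

lemma transferFun_ne {w : Jet m} (hw : w.2 ≠ 0) : (transferFun w).2 ≠ 0 := by
  rw [← norm_pos_iff, norm_transferFun hw]
  exact pow_pos (norm_pos_iff.2 (plusHandle_snd_ne hw)) 2

lemma transferInv_ne {w : Jet m} (hw : w.2 ≠ 0) : (transferInv w).2 ≠ 0 := by
  intro h
  have h1 := plusHandle_snd_norm_le (transferInv w)
  have h2 := norm_plusHandle_transferInv hw
  rw [h, norm_zero, mul_zero] at h1
  have h3 : ‖(plusHandle (transferInv w)).2‖ = 0 := le_antisymm h1 (norm_nonneg _)
  rw [h3] at h2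
  exact hw (norm_eq_zero.1 (by rw [← h2]; norm_num))

lemma transferInv_transferFun {w : Jet m} (hw : w.2 ≠ 0) : transferInv (transferFun w) = w := by
  have h : 0 < ‖(plusHandle w).2‖ := norm_pos_iff.2 (plusHandle_snd_ne hw)
  have h1 : -Real.log ‖(minusHandle (transferFun w)).1‖ / 2 =
      -Real.log ‖(plusHandle w).2‖ := by
    rw [minusHandle_fst_norm, norm_transferFun hw, Real.log_pow]; push_cast; ring
  rw [transferInv, h1, minusHandle_transferFun hw, liouvilleFlow_neg, plusHandleInv_plusHandle]

lemma transferFun_transferInv {w : Jet m} (hw : w.2 ≠ 0) : transferFun (transferInv w) = w := by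
  have h1 : Real.log ‖(plusHandle (transferInv w)).2‖ =
      -(-Real.log ‖(minusHandle w).1‖ / 2) := by
    rw [minusHandle_fst_norm, ← norm_plusHandle_transferInv hw, Real.log_pow]; push_cast; ring
  rw [transferFun, h1, plusHandle_transferInv hw, liouvilleFlow_neg, minusHandleInv_minusHandle]

lemma continuous_jetHeight : Continuous (jetHeight (m := m)) := by
  unfold jetHeight; fun_prop

lemma continuous_jetSlope : Continuous (jetSlope (m := m)) := by
  have := continuous_jetHeight (m := m)
  unfold jetSlope; fun_prop

lemma continuous_plusHandle : Continuous (plusHandle (m := m)) := by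
  have := continuous_jetHeight (m := m)
  have := continuous_jetSlope (m := m)
  unfold plusHandle; fun_prop

lemma continuous_minusHandle : Continuous (minusHandle (m := m)) := by
  have := continuous_jetHeight (m := m)
  have := continuous_jetSlope (m := m)
  unfold minusHandle; fun_prop

lemma continuousOn_toSph {X : Type*} [TopologicalSpace X] {s : Set X} {e : X → Sph m}
    {g : X → Euc m} (hg : ContinuousOn g s) (h : ∀ x ∈ s, ‖g x‖ = 1) :
    ContinuousOn (fun x => toSph (e x) (g x)) s := by
  rw [IsInducing.subtypeVal.continuousOn_iff]
  exact hg.congr fun x hx => coe_toSph (h x hx)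

lemma continuousOn_jetMk {X : Type*} [TopologicalSpace X] {s : Set X} {x : X → Sph m}
    {y : X → Euc m} {z : X → ℝ} (hx : ContinuousOn x s) (hy : ContinuousOn y s)
    (hz : ContinuousOn z s) : ContinuousOn (fun a => jetMk (x a) (y a) (z a)) s := by
  have : ContinuousOn (fun a => (x a : Euc m)) s := continuous_subtype_val.comp_continuousOn hx
  exact hx.prodMk ((hz.smul this).add hy)

lemma continuousOn_flow {X : Type*} [TopologicalSpace X] {s : Set X} {t : X → ℝ}
    {a : X → Euc m × Euc m} (ht : ContinuousOn t s) (ha : ContinuousOn a s) :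
    ContinuousOn (fun x => liouvilleFlow (t x) (a x)) s := by
  unfold liouvilleFlow; fun_prop

lemma continuousOn_minusHandleInv {X : Type*} [TopologicalSpace X] {s : Set X} {e : X → Sph m}
    {a : X → Euc m × Euc m} (ha : ContinuousOn a s) (h : ∀ x ∈ s, ‖(a x).2‖ = 1) :
    ContinuousOn (fun x => minusHandleInv (e x) (a x)) s := by
  have hi : ContinuousOn (fun x => ⟪(a x).1, (a x).2⟫) s := ha.fst.inner ha.snd
  exact continuousOn_jetMk (continuousOn_toSph ha.snd h) ((hi.fun_smul ha.snd).fun_sub ha.fst) hi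

lemma continuousOn_plusHandleInv {X : Type*} [TopologicalSpace X] {s : Set X} {e : X → Sph m}
    {a : X → Euc m × Euc m} (ha : ContinuousOn a s) (h : ∀ x ∈ s, ‖(a x).1‖ = 1) :
    ContinuousOn (fun x => plusHandleInv (e x) (a x)) s := by
  have hi : ContinuousOn (fun x => ⟪(a x).2, (a x).1⟫) s := ha.snd.inner ha.fst
  exact continuousOn_jetMk (continuousOn_toSph ha.fst h) (ha.snd.fun_sub (hi.fun_smul ha.fst))
    (continuousOn_const.mul hi)

lemma continuousOn_transferFun :
    ContinuousOn (transferFun (m := m)) {w | w.2 ≠ 0} := by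
  have h0 : ContinuousOn (fun w : Jet m => Real.log ‖(plusHandle w).2‖) {w | w.2 ≠ 0} :=
    continuous_plusHandle.snd.norm.continuousOn.log
      fun w hw => norm_ne_zero_iff.2 (plusHandle_snd_ne hw)
  exact continuousOn_minusHandleInv (continuousOn_flow h0 continuous_plusHandle.continuousOn)
    fun w hw => flow_log_snd (plusHandle_snd_ne hw)

lemma continuousOn_transferInv :
    ContinuousOn (transferInv (m := m)) {w | w.2 ≠ 0} := by
  have h0 : ContinuousOn (fun w : Jet m => -Real.log ‖(minusHandle w).1‖ / 2) {w | w.2 ≠ 0} :=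
    (continuous_minusHandle.fst.norm.continuousOn.log
      fun w hw => norm_ne_zero_iff.2 (minusHandle_fst_ne hw)).neg.div_const 2
  exact continuousOn_plusHandleInv (continuousOn_flow h0 continuous_minusHandle.continuousOn)
    fun w hw => flow_log_fst (minusHandle_fst_ne hw)

lemma isOpen_nonzero : IsOpen {w : Jet m | w.2 ≠ 0} :=
  isOpen_ne.preimage continuous_snd

/-- The transfer through the handle from a punctured neighbourhood of the belt sphere to a punctured
neighbourhood of the attaching sphere. -/
def transferPlusMinus (m : ℕ) : OpenPartialHomeomorph (Jet m) (Jet m) where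
  toFun := transferFun
  invFun := transferInv
  source := {w | w.2 ≠ 0}
  target := {w | w.2 ≠ 0}
  map_source' _ hw := transferFun_ne hw
  map_target' _ hw := transferInv_ne hw
  left_inv' _ hw := transferInv_transferFun hw
  right_inv' _ hw := transferFun_transferInv hw
  open_source := isOpen_nonzero
  open_target := isOpen_nonzero
  continuousOn_toFun := continuousOn_transferFun
  continuousOn_invFun := continuousOn_transferInv

/-- The two kinds of contact surgery: `minus` is the `(-1)`-surgery, which attaches the critical
handle along `Λ`, and `plus` is the `(+1)`-surgery, which carves out the critical handle having `Λ`
as its belt sphere. -/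
inductive SurgerySign
  | minus
  | plus

/-- The gluing map of the surgery, from the complement of the zero section in the piece that is
glued in to the complement of the zero section in the standard neighbourhood of `Λ`. -/
def gluing (m : ℕ) : SurgerySign → OpenPartialHomeomorph (Jet m) (Jet m)
  | .minus => transferPlusMinus m
  | .plus => (transferPlusMinus m).symm

lemma gluing_source (κ : SurgerySign) : (gluing m κ).source = {w | w.2 ≠ 0} := by
  cases κ <;> rfl

lemma gluing_target (κ : SurgerySign) : (gluing m κ).target = {w | w.2 ≠ 0} := by
  cases κ <;> rfl

/-- The gluing map sends jets near the zero section to jets near the zero section. -/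
lemma gluing_small (κ : SurgerySign) {δ : ℝ} (hδ : 0 < δ) :
    ∃ ρ > 0, ∀ w : Jet m, w.2 ≠ 0 → ‖w.2‖ < ρ → ‖(gluing m κ w).2‖ < δ := by
  cases κ with
  | minus =>
    refine ⟨min 1 (δ / 9), by positivity, fun w hw h => ?_⟩
    change ‖(transferFun w).2‖ < δ
    rw [norm_transferFun hw]
    have h1 := plusHandle_snd_norm_le w
    have h2 : ‖w.2‖ < 1 := h.trans_le (min_le_left _ _)
    have h3 : ‖w.2‖ < δ / 9 := h.trans_le (min_le_right _ _)
    nlinarith [norm_nonneg (plusHandle w).2, norm_nonneg w.2]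
  | plus =>
    refine ⟨(δ / 4) ^ 2, by positivity, fun w hw h => ?_⟩
    change ‖(transferInv w).2‖ < δ
    have h1 := norm_plusHandle_transferInv hw
    have h2 : ‖(plusHandle (transferInv w)).2‖ < δ / 4 := by
      rw [← h1] at h
      exact lt_of_pow_lt_pow_left₀ 2 (by positivity) h
    have h3 : (transferInv w).2 = (plusHandle (transferInv w)).2 +
        ⟪(plusHandle (transferInv w)).2, (plusHandle (transferInv w)).1⟫ •
          (plusHandle (transferInv w)).1 := by
      conv_lhs => rw [← plusHandleInv_plusHandle w.1 (transferInv w)]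
      simp only [plusHandleInv, jetMk]
      rw [coe_toSph (show ‖(plusHandle (transferInv w)).1‖ = 1 from norm_sph _)]
      module
    have h4 : ‖(plusHandle (transferInv w)).1‖ = 1 := norm_sph _
    have h5 := abs_real_inner_le_norm (plusHandle (transferInv w)).2 (plusHandle (transferInv w)).1
    rw [h4, mul_one] at h5
    rw [h3]
    refine (norm_add_le _ _).trans_lt ?_
    rw [norm_smul, h4, mul_one, Real.norm_eq_abs]
    linarith

/-! ### Fronts in the 1-jet space of the sphere

The front projection is `(x, y, z) ↦ (x, z)`. Fronts are described near a point `e` of the sphere and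
are symmetric under the rotations fixing `e`. -/

/-- The open spherical cap of radius `r` around `e`. -/
def cap (e : Sph m) (r : ℝ) : Set (Sph m) :=
  {x | InnerProductGeometry.angle (x : Euc m) (e : Euc m) < r}

/-- The Darboux chart formed by all jets over a cap whose height lies in a given interval; `σ = ± 1`
says which direction is called upwards. -/
def frontBox (e : Sph m) (r a b σ : ℝ) : Set (Jet m) :=
  {w | w.1 ∈ cap e r ∧ -a < σ * jetHeight w ∧ σ * jetHeight w < b}

/-- A parametrised planar front curve: angle from the axis, height, and slope `dz / dθ`. -/
structure FrontCurve where
  /-- the (signed) angle from the axis -/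
  angle : ℝ → ℝ
  /-- the height -/
  height : ℝ → ℝ
  /-- the slope -/
  slope : ℝ → ℝ

/-- The Legendrian lift of the front obtained by rotating the part of a front curve lying at angle
less than `r` around the axis through `e`. -/
def FrontCurve.spunLift (c : FrontCurve) (e : Sph m) (r σ : ℝ) : Set (Jet m) :=
  {w | ∃ (u : Sph m) (τ : ℝ), ⟪(u : Euc m), (e : Euc m)⟫ = 0 ∧ |c.angle τ| < r ∧
    jetPos w = Real.cos (c.angle τ) • (e : Euc m) + Real.sin (c.angle τ) • (u : Euc m) ∧
    jetHeight w = σ * c.height τ ∧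
    jetSlope w = (σ * c.slope τ) •
      (-Real.sin (c.angle τ) • (e : Euc m) + Real.cos (c.angle τ) • (u : Euc m))}

/-- The generating curve of a spherical cusp edge of radius `r₀`. It comes in along the upper sheet
from height `h` at radius `r`, descends to a semicubical cusp at radius `r₀ > 0` and negative height
(so that it passes through height `0`), and goes out along the lower sheet, which descends to
height `-ε`. -/
def FrontCurve.IsCusp (c : FrontCurve) (r h ε : ℝ) : Prop :=
  ContDiff ℝ ∞ c.height ∧ ContDiff ℝ ∞ c.slope ∧
  ∃ r₀ T : ℝ, 0 < r₀ ∧ 0 < T ∧ r₀ + T ^ 2 < r ∧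
    (∀ τ, c.angle τ = r₀ + τ ^ 2) ∧
    (∀ τ, HasDerivAt c.height (c.slope τ * (2 * τ)) τ) ∧
    (∀ τ, 0 < τ → τ < T → 0 < c.slope τ) ∧ (∀ τ, -T < τ → τ < 0 → c.slope τ < 0) ∧
    0 < deriv c.slope 0 ∧ c.height 0 < 0 ∧
    (∀ τ, T ≤ τ → c.height τ = h) ∧ (∀ τ, τ ≤ -T → c.height τ = -ε)

/-- The generating curve of a cone singularity. It comes in from height `h` at radius `r`, crosses
the axis with non-zero slope, and goes on to height `-ε` on the other side of the axis. -/
def FrontCurve.IsCone (c : FrontCurve) (r h ε : ℝ) : Prop :=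
  ContDiff ℝ ∞ c.height ∧
  ∃ T : ℝ, 0 < T ∧ T < r ∧
    (∀ τ, c.angle τ = τ) ∧
    (∀ τ, HasDerivAt c.height (c.slope τ) τ) ∧
    (∀ τ, -T < τ → τ < T → 0 < c.slope τ) ∧
    (∀ τ, T ≤ τ → c.height τ = h) ∧ (∀ τ, τ ≤ -T → c.height τ = -ε)

/-! ### Standard neighbourhoods and contact surgery -/

section Surgery

variable {Y : Type*} [TopologicalSpace Y]
  [ChartedSpace (EuclideanSpace ℝ (Fin (2 * m + 1))) Y]

/-- A standard neighbourhood of a parametrised Legendrian sphere `ℓ`: a contactomorphism from an open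
neighbourhood of the zero section in the 1-jet space of the sphere onto an open subset of `Y` which
restricts to `ℓ` on the zero section. -/
structure StdNbhd (ξ : TangentField m Y) (ℓ : Sph m → Y) where
  /-- the underlying homeomorphism between open sets -/
  map : OpenPartialHomeomorph (Jet m) Y
  zero_mem : ∀ x : Sph m, ((x, 0) : Jet m) ∈ map.source
  map_zero : ∀ x : Sph m, map (x, 0) = ℓ x
  smooth : ContMDiffOn (jetModel m) (𝓡 (2 * m + 1)) ∞ map map.source
  smooth_symm : ContMDiffOn (𝓡 (2 * m + 1)) (jetModel m) ∞ map.symm map.target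
  contact : ∀ w ∈ map.source, ∀ v : TangentSpace (jetModel m) w,
    mfderiv (jetModel m) (𝓡 (2 * m + 1)) map w v ∈ ξ (map w) ↔ jetForm w v = 0

variable {ξ : TangentField m Y} {ℓ : Sph m → Y}

/-- The points of the surgered manifold: the sphere `Λ` is removed from `Y` and replaced by the zero
section (the core) of the piece that is glued in. -/
inductive Surgered (N : StdNbhd ξ ℓ) (κ : SurgerySign)
  | outer (y : Y) (hy : y ∉ range ℓ)
  | core (x : Sph m)

namespace StdNbhd

variable (N : StdNbhd ξ ℓ) (κ : SurgerySign)

/-- The identification of the punctured glued piece with the punctured neighbourhood of `Λ`. -/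
def overlap : OpenPartialHomeomorph (Jet m) Y := (gluing m κ).trans N.map

lemma overlap_source_ne {w : Jet m} (hw : w ∈ (N.overlap κ).source) : w.2 ≠ 0 := by
  have h : w ∈ (gluing m κ).source := hw.1
  rwa [gluing_source] at h

lemma overlap_not_mem {w : Jet m} (hw : w ∈ (N.overlap κ).source) :
    N.overlap κ w ∉ range ℓ := by
  rintro ⟨x, hx⟩
  have h1 : gluing m κ w ∈ N.map.source := hw.2
  have h2 : gluing m κ w ∈ (gluing m κ).target := (gluing m κ).map_source hw.1
  rw [gluing_target] at h2
  apply h2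
  have : N.map (gluing m κ w) = N.map (x, 0) := by rw [N.map_zero, hx]; rfl
  rw [N.map.injOn h1 (N.zero_mem x) this]

/-- The open piece that is glued in: the zero section together with all jets whose image under the
gluing map lies in the standard neighbourhood. -/
def piece : Set (Jet m) := {w | w.2 = 0} ∪ (N.overlap κ).source

lemma isOpen_piece : IsOpen (N.piece κ) := by
  have h0 : (univ : Set (Sph m)) ×ˢ ({0} : Set (Euc m)) ⊆ N.map.source := by
    rintro ⟨x, w⟩ ⟨-, rfl⟩
    exact N.zero_mem x
  obtain ⟨u, v, -, hv, hu, hv0, huv⟩ := generalized_tube_lemma (isCompact_univ (X := Sph m))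
    (isCompact_singleton (x := (0 : Euc m))) N.map.open_source h0
  obtain ⟨δ, hδ, hb⟩ := Metric.isOpen_iff.1 hv 0 (hv0 rfl)
  obtain ⟨ρ, hρ, h⟩ := gluing_small (m := m) κ hδ
  have : N.piece κ = {w | ‖w.2‖ < ρ} ∪ (N.overlap κ).source := by
    apply Subset.antisymm
    · rintro w (hw | hw)
      · left
        have hw' : w.2 = 0 := hw
        simpa [hw'] using hρ
      · exact Or.inr hw
    · rintro w (hw | hw)
      · by_cases h' : w.2 = 0
        · exact Or.inl h'
        · right
          refine ⟨((gluing_source κ).symm ▸ h' : w ∈ (gluing m κ).source), ?_⟩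
          exact huv ⟨hu (mem_univ _), hb (by simpa using h w h' hw)⟩
      · exact Or.inr hw
  rw [this]
  exact (isOpen_lt continuous_snd.norm continuous_const).union (N.overlap κ).open_source

/-- The inclusion of the complement of `Λ` into the surgered manifold. -/
def outerIncl (y : {y : Y // y ∉ range ℓ}) : Surgered N κ := .outer y.1 y.2

/-- The inclusion of the glued piece into the surgered manifold (meaningful on `N.piece κ`). -/
def pieceIncl (w : Jet m) : Surgered N κ :=
  open Classical in
  if h : w ∈ (N.overlap κ).source then .outer (N.overlap κ w) (N.overlap_not_mem κ h)
  else .core w.1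

lemma outerIncl_injective : Function.Injective (N.outerIncl κ) := by
  rintro ⟨y, hy⟩ ⟨y', hy'⟩ h
  simp only [outerIncl, Surgered.outer.injEq] at h
  exact Subtype.ext h

lemma pieceIncl_overlap {w : Jet m} (h : w ∈ (N.overlap κ).source) :
    N.pieceIncl κ w = N.outerIncl κ ⟨N.overlap κ w, N.overlap_not_mem κ h⟩ :=
  dif_pos h

lemma pieceIncl_core {w : Jet m} (h : w ∉ (N.overlap κ).source) :
    N.pieceIncl κ w = .core w.1 :=
  dif_neg h

lemma outerIncl_ne_core (y : {y : Y // y ∉ range ℓ}) (x : Sph m) :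
    N.outerIncl κ y ≠ .core x := by
  simp [outerIncl]

lemma eq_pieceIncl {w : Jet m} {y : {y : Y // y ∉ range ℓ}}
    (h : N.outerIncl κ y = N.pieceIncl κ w) :
    w ∈ (N.overlap κ).source ∧ N.overlap κ w = y := by
  by_cases h1 : w ∈ (N.overlap κ).source
  · rw [N.pieceIncl_overlap κ h1] at h
    exact ⟨h1, congrArg Subtype.val (N.outerIncl_injective κ h).symm⟩
  · rw [N.pieceIncl_core κ h1] at h
    exact (N.outerIncl_ne_core κ _ _ h).elim

/-- A subset of the surgered manifold is open iff its traces on the complement of `Λ` and on the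
glued piece are open. -/
instance instTopSurgered : TopologicalSpace (Surgered N κ) :=
  TopologicalSpace.coinduced (N.outerIncl κ) inferInstance ⊔
    TopologicalSpace.coinduced (fun w : N.piece κ => N.pieceIncl κ w) inferInstance

lemma isOpen_surgered {s : Set (Surgered N κ)} :
    IsOpen s ↔ IsOpen (N.outerIncl κ ⁻¹' s) ∧
      IsOpen ((fun w : N.piece κ => N.pieceIncl κ w) ⁻¹' s) :=
  Iff.rfl

lemma continuous_outerIncl : Continuous (N.outerIncl κ) :=
  continuous_def.2 fun _ hs => ((N.isOpen_surgered κ).1 hs).1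

lemma continuousOn_pieceIncl : ContinuousOn (N.pieceIncl κ) (N.piece κ) := by
  rw [continuousOn_iff_continuous_domRestrict]
  exact continuous_def.2 fun _ hs => ((N.isOpen_surgered κ).1 hs).2

lemma injOn_pieceIncl : InjOn (N.pieceIncl κ) (N.piece κ) := by
  have key : ∀ w ∈ N.piece κ, w ∉ (N.overlap κ).source → w.2 = 0 :=
    fun w hw h => hw.resolve_right h
  intro w hw w' hw' h
  by_cases h1 : w ∈ (N.overlap κ).source
  · rw [N.pieceIncl_overlap κ h1] at h
    obtain ⟨h2, h3⟩ := N.eq_pieceIncl κ h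
    exact (N.overlap κ).injOn h1 h2 h3.symm
  · by_cases h2 : w' ∈ (N.overlap κ).source
    · rw [N.pieceIncl_overlap κ h2] at h
      exact (h1 (N.eq_pieceIncl κ h.symm).1).elim
    · rw [N.pieceIncl_core κ h1, N.pieceIncl_core κ h2, Surgered.core.injEq] at h
      exact Prod.ext h ((key w hw h1).trans (key w' hw' h2).symm)

lemma isOpen_image_pieceIncl {s : Set (Jet m)} (hs : IsOpen s) (hsub : s ⊆ N.piece κ) :
    IsOpen (N.pieceIncl κ '' s) := by
  rw [isOpen_surgered]
  constructor
  · have : N.outerIncl κ ⁻¹' (N.pieceIncl κ '' s) =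
        Subtype.val ⁻¹' (N.overlap κ '' ((N.overlap κ).source ∩ s)) := by
      ext y
      constructor
      · rintro ⟨w, hw, h⟩
        obtain ⟨h1, h2⟩ := N.eq_pieceIncl κ h.symm
        exact ⟨w, ⟨h1, hw⟩, h2⟩
      · rintro ⟨w, ⟨h1, hw⟩, h⟩
        refine ⟨w, hw, ?_⟩
        rw [N.pieceIncl_overlap κ h1]
        exact congrArg _ (Subtype.ext h)
    rw [this]
    exact ((N.overlap κ).isOpen_image_source_inter hs).preimage continuous_subtype_val
  · have : (fun w : N.piece κ => N.pieceIncl κ w) ⁻¹' (N.pieceIncl κ '' s) =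
        Subtype.val ⁻¹' s := by
      ext ⟨w, hw⟩
      constructor
      · rintro ⟨w', hw', h⟩
        have := N.injOn_pieceIncl κ (hsub hw') hw h
        exact this ▸ hw'
      · exact fun h => ⟨w, h, rfl⟩
    rw [this]
    exact hs.preimage continuous_subtype_val

lemma isOpen_image_outerIncl {t : Set Y} (ht : IsOpen t) :
    IsOpen (N.outerIncl κ '' (Subtype.val ⁻¹' t)) := by
  rw [isOpen_surgered]
  constructor
  · rw [preimage_image_eq _ (N.outerIncl_injective κ)]
    exact ht.preimage continuous_subtype_val
  · have : (fun w : N.piece κ => N.pieceIncl κ w) ⁻¹' (N.outerIncl κ '' (Subtype.val ⁻¹' t)) =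
        Subtype.val ⁻¹' ((N.overlap κ).source ∩ N.overlap κ ⁻¹' t) := by
      ext ⟨w, hw⟩
      constructor
      · rintro ⟨y, hy, h⟩
        obtain ⟨h1, h2⟩ := N.eq_pieceIncl κ h
        refine ⟨h1, ?_⟩
        change N.overlap κ w ∈ t
        rw [h2]
        exact hy
      · rintro ⟨h1, h2⟩
        exact ⟨_, h2, (N.pieceIncl_overlap κ h1).symm⟩
    rw [this]
    exact ((N.overlap κ).isOpen_inter_preimage ht).preimage continuous_subtype_val

lemma isOpen_compl_range [T2Space Y] (N : StdNbhd ξ ℓ) : IsOpen (range ℓ)ᶜ := by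
  have h : ContinuousOn (fun x : Sph m => N.map (x, 0)) univ :=
    N.map.continuousOn.comp (by fun_prop) fun x _ => N.zero_mem x
  have h' : Continuous ℓ := by
    rw [continuousOn_univ] at h
    simpa only [N.map_zero] using h
  exact (isCompact_range h').isClosed.isOpen_compl

/-- The open subset `Y ∖ Λ` of the surgered manifold, viewed in `Y`. -/
def outerChart [T2Space Y] : OpenPartialHomeomorph (Surgered N κ) Y where
  toFun
    | .outer y _ => y
    | .core x => ℓ x
  invFun y := open Classical in
    if h : y ∉ range ℓ then .outer y h else .core ⟨EuclideanSpace.single 0 1, by simp⟩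
  source := range (N.outerIncl κ)
  target := (range ℓ)ᶜ
  map_source' := by rintro _ ⟨y, rfl⟩; exact y.2
  map_target' y hy := ⟨⟨y, hy⟩, (dif_pos hy).symm⟩
  left_inv' := by
    rintro _ ⟨y, rfl⟩
    exact dif_pos y.2
  right_inv' y hy := by
    have hy' : y ∉ range ℓ := hy
    simp only [dif_pos hy']
  open_source := by
    have := N.isOpen_image_outerIncl κ isOpen_univ
    rwa [preimage_univ, image_univ] at this
  open_target := N.isOpen_compl_range
  continuousOn_toFun := by
    rw [continuousOn_iff']
    refine fun t ht => ⟨_, N.isOpen_image_outerIncl κ ht, ?_⟩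
    ext p
    constructor
    · rintro ⟨h, y, rfl⟩
      exact ⟨⟨y, h, rfl⟩, ⟨y, rfl⟩⟩
    · rintro ⟨⟨y, h, rfl⟩, -⟩
      exact ⟨h, ⟨y, rfl⟩⟩
  continuousOn_invFun := by
    rw [continuousOn_iff_continuous_domRestrict]
    refine (N.continuous_outerIncl κ).congr ?_
    rintro ⟨y, hy⟩
    have hy' : y ∉ range ℓ := hy
    simp only [domRestrict, outerIncl, dif_pos hy']

/-- The open subset of the surgered manifold formed by the glued piece, viewed in the 1-jet
space. -/
def pieceChart : OpenPartialHomeomorph (Surgered N κ) (Jet m) :=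
  haveI : Nonempty (Jet m) := ⟨(⟨EuclideanSpace.single 0 1, by simp⟩, 0)⟩
  (OpenPartialHomeomorph.ofContinuousOpenRestrict
    ((N.injOn_pieceIncl κ).toPartialEquiv (N.pieceIncl κ) _)
    (N.continuousOn_pieceIncl κ)
    (by
      intro s hs
      have : (N.piece κ).domRestrict (N.pieceIncl κ) '' s =
          N.pieceIncl κ '' (Subtype.val '' s) := by
        rw [image_image]; rfl
      change IsOpen ((N.piece κ).domRestrict (N.pieceIncl κ) '' s)
      rw [this]
      refine N.isOpen_image_pieceIncl κ ((N.isOpen_piece κ).isOpenMap_subtype_val s hs) ?_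
      rintro _ ⟨w, -, rfl⟩
      exact w.2)
    (N.isOpen_piece κ)).symm

/-- A linear isomorphism between the model spaces of the 1-jet space and of `Y`. -/
def modelEquiv (m : ℕ) :
    (EuclideanSpace ℝ (Fin m) × Euc m) ≃L[ℝ] EuclideanSpace ℝ (Fin (2 * m + 1)) :=
  ContinuousLinearEquiv.ofFinrankEq (by
    rw [Module.finrank_prod, finrank_euclideanSpace_fin, finrank_euclideanSpace_fin,
      finrank_euclideanSpace_fin]
    ring)

/-- A chart of the 1-jet space around the zero jet at `x`, with values in `ℝ²ᵐ⁺¹`. -/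
def jetChart (x : Sph m) :
    OpenPartialHomeomorph (Jet m) (EuclideanSpace ℝ (Fin (2 * m + 1))) :=
  (chartAt (ModelProd (EuclideanSpace ℝ (Fin m)) (Euc m)) ((x, 0) : Jet m)).trans
    (modelEquiv m).toHomeomorph.toOpenPartialHomeomorph

lemma mem_outerChart_source [T2Space Y] (y : Y) (hy : y ∉ range ℓ) :
    (Surgered.outer y hy : Surgered N κ) ∈ (N.outerChart κ).source :=
  ⟨⟨y, hy⟩, rfl⟩

lemma outerChart_outer [T2Space Y] (y : Y) (hy : y ∉ range ℓ) :
    N.outerChart κ (.outer y hy) = y := rfl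

lemma pieceChart_source : (N.pieceChart κ).source = N.pieceIncl κ '' N.piece κ := rfl

lemma pieceChart_target : (N.pieceChart κ).target = N.piece κ := rfl

lemma pieceChart_symm (w : Jet m) : (N.pieceChart κ).symm w = N.pieceIncl κ w := rfl

lemma zero_mem_piece (x : Sph m) : ((x, 0) : Jet m) ∈ N.piece κ := Or.inl rfl

lemma pieceIncl_zero (x : Sph m) : N.pieceIncl κ (x, 0) = .core x :=
  N.pieceIncl_core κ fun h => N.overlap_source_ne κ h rfl

lemma core_mem_source (x : Sph m) : (Surgered.core x : Surgered N κ) ∈ (N.pieceChart κ).source :=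
  ⟨(x, 0), N.zero_mem_piece κ x, N.pieceIncl_zero κ x⟩

lemma pieceChart_core (x : Sph m) : N.pieceChart κ (.core x) = (x, 0) := by
  have h := (N.pieceChart κ).right_inv (N.zero_mem_piece κ x)
  rwa [pieceChart_symm, pieceIncl_zero] at h

/-- The smooth structure of the surgered manifold: the charts of `Y ∖ Λ` and those of the glued
piece. -/
instance instChartedSurgered [T2Space Y] :
    ChartedSpace (EuclideanSpace ℝ (Fin (2 * m + 1))) (Surgered N κ) where
  atlas := {c | ∃ y ∉ range ℓ, c = (N.outerChart κ).trans
      (chartAt (EuclideanSpace ℝ (Fin (2 * m + 1))) y)} ∪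
    {c | ∃ x, c = (N.pieceChart κ).trans (jetChart x)}
  chartAt
    | .outer y _ => (N.outerChart κ).trans (chartAt (EuclideanSpace ℝ (Fin (2 * m + 1))) y)
    | .core x => (N.pieceChart κ).trans (jetChart x)
  mem_chart_source
    | .outer y hy => ⟨N.mem_outerChart_source κ y hy, mem_chart_source _ y⟩
    | .core x => by
      refine ⟨N.core_mem_source κ x, ?_⟩
      change N.pieceChart κ (.core x) ∈ (jetChart x).source
      rw [pieceChart_core]
      exact ⟨mem_chart_source _ _, mem_univ _⟩
  chart_mem_atlas
    | .outer y hy => Or.inl ⟨y, hy, rfl⟩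
    | .core x => Or.inr ⟨x, rfl⟩

/-- The contact structure of the surgered manifold: it is `ξ` on `Y ∖ Λ`, and the kernel of the
canonical contact form along the core of the glued piece (hence on the whole glued piece, since the
gluing map is a contactomorphism). -/
def surgeredField [T2Space Y] : TangentField m (Surgered N κ)
  | .outer y hy => (ξ y).comap
      (mfderiv (𝓡 (2 * m + 1)) (𝓡 (2 * m + 1)) (N.outerChart κ)
        (.outer y hy : Surgered N κ)).toLinearMap
  | .core x => (LinearMap.ker (jetForm ((x, 0) : Jet m)).toLinearMap).comap
      (mfderiv (𝓡 (2 * m + 1)) (jetModel m) (N.pieceChart κ) (.core x : Surgered N κ)).toLinearMap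

/-- The trace of a subset of `Y` in the complement of `Λ`, viewed in the surgered manifold. -/
def inSurgered (S : Set Y) : Set (Surgered N κ) := N.outerIncl κ '' (Subtype.val ⁻¹' S)

/-- The handleslide of `S` along `Λ` with generating front curve `c`. Inside the Darboux chart
`frontBox e r a b σ` it is the union of the two sheets joined to each other according to `c`; outside
of it, it is `S` together with the Reeb push-off of `Λ` to height `-σ ε`. -/
def handleslide (e : Sph m) (r a b σ ε : ℝ) (c : FrontCurve) (S : Set Y) : Set Y :=
  (S \ N.map '' frontBox e r a b σ) ∪ N.map '' c.spunLift e r σ ∪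
    N.map '' {w | w.1 ∉ cap e r ∧ w = jetMk w.1 0 (-σ * ε)}

end StdNbhd

end Surgery

end LegendrianSlide

end

noncomputable section

namespace LegendrianSlide

section ChartLine

variable {E H M F : Type*} [NormedAddCommGroup E] [NormedSpace ℝ E] [TopologicalSpace H]
  {I : ModelWithCorners ℝ E H} [TopologicalSpace M] [ChartedSpace H M]
  [NormedAddCommGroup F] [NormedSpace ℝ F]

/-- The curve through `x` that is a straight line with velocity `v` in the preferred chart. -/
def chartLine (I : ModelWithCorners ℝ E H) (x : M) (v : E) (t : ℝ) : M :=
  (extChartAt I x).symm (extChartAt I x x + t • v)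

lemma chartLine_zero (x : M) (v : E) : chartLine I x v 0 = x := by
  simp [chartLine]

lemma hasDerivAt_comp_chartLine [I.Boundaryless] {g : M → F} {x : M}
    (hg : MDifferentiableAt I 𝓘(ℝ, F) g x) (v : E) :
    HasDerivAt (fun t => g (chartLine I x v t)) (mvfderiv I g x v) 0 := by
  obtain ⟨f', hf'⟩ : ∃ f' : E →L[ℝ] F, f' = mfderiv I 𝓘(ℝ, F) g x := ⟨_, rfl⟩
  have h1 : HasFDerivWithinAt (g ∘ (extChartAt I x).symm : E → F) f' (range I)
      (extChartAt I x x) := hf' ▸ hg.hasMFDerivAt.2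
  rw [I.range_eq_univ, hasFDerivWithinAt_univ] at h1
  have h4 : HasDerivAt (fun t : ℝ => extChartAt I x x + t • v) v 0 := by
    simpa using ((hasDerivAt_id (0 : ℝ)).smul_const v).const_add (extChartAt I x x)
  have h5 : HasFDerivAt (g ∘ (extChartAt I x).symm : E → F) f'
      (extChartAt I x x + (0 : ℝ) • v) := by
    rwa [zero_smul, add_zero]
  have h6 := h5.comp_hasDerivAt 0 h4
  rw [hf'] at h6
  exact h6

end ChartLine

variable {m : ℕ}

section ToJet

variable {E H M : Type*} [NormedAddCommGroup E] [NormedSpace ℝ E] [TopologicalSpace H]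
  {I : ModelWithCorners ℝ E H} [TopologicalSpace M] [ChartedSpace H M]

lemma contMDiffAt_sphere_iff {f : M → Sph m} {x : M} :
    ContMDiffAt I (𝓡 m) ∞ f x ↔ ContMDiffAt I 𝓘(ℝ, Euc m) ∞ (fun y => (f y : Euc m)) x := by
  have : Fact (Module.finrank ℝ (Euc m) = m + 1) := ⟨finrank_euclideanSpace_fin⟩
  constructor
  · intro h
    exact ContMDiffAt.comp x (contMDiff_coe_sphere (m := ∞) (n := m) (E := Euc m) (f x)) h
  · intro hf
    rw [contMDiffAt_iff_target]
    refine ⟨IsInducing.subtypeVal.continuousAt_iff.2 hf.continuousAt, ?_⟩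
    let v : Sph m := f x
    let U : _ ≃ₗᵢ[ℝ] _ :=
      (OrthonormalBasis.fromOrthogonalSpanSingleton (𝕜 := ℝ)
        m (ne_zero_of_mem_unit_sphere (-v))).repr
    have h : ContDiff ℝ ∞ U := U.contDiff
    have hn : ContDiffAt ℝ ∞ (stereoToFun (-v : Euc m)) (v : Euc m) := by
      refine (contDiffOn_stereoToFun (v := (-v : Euc m)) (n := ∞)).contDiffAt ?_
      refine (isOpen_ne_fun (by fun_prop) continuous_const).mem_nhds ?_
      have : ⟪(v : Euc m), (v : Euc m)⟫ = 1 := inner_self_sph v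
      change (innerSL ℝ (-v : Euc m)) (v : Euc m) ≠ 1
      simp only [innerSL_apply_apply, inner_neg_left, this]
      norm_num
    have H1 : ContDiffAt ℝ ∞ (U ∘ stereoToFun (-v : Euc m)) (v : Euc m) := h.contDiffAt.comp _ hn
    have H2 := ContDiffAt.comp_contMDiffAt (f := fun y => (f y : Euc m)) H1 hf
    exact H2

lemma contMDiffAt_jet_iff {f : M → Jet m} {x : M} :
    ContMDiffAt I (jetModel m) ∞ f x ↔ ContMDiffAt I 𝓘(ℝ, Euc m) ∞ (fun y => jetPos (f y)) x ∧
      ContMDiffAt I 𝓘(ℝ, Euc m) ∞ (fun y => (f y).2) x := by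
  rw [contMDiffAt_prod_iff]
  exact and_congr contMDiffAt_sphere_iff Iff.rfl

end ToJet

lemma contMDiff_jetPos : ContMDiff (jetModel m) 𝓘(ℝ, Euc m) ∞ (jetPos (m := m)) :=
  fun w => (contMDiffAt_jet_iff.1 (contMDiffAt_id (x := w))).1

lemma contMDiff_jetSnd : ContMDiff (jetModel m) 𝓘(ℝ, Euc m) ∞ (fun w : Jet m => w.2) :=
  fun w => (contMDiffAt_jet_iff.1 (contMDiffAt_id (x := w))).2

section Inner
variable {E H M : Type*} [NormedAddCommGroup E] [NormedSpace ℝ E] [TopologicalSpace H]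
  {I : ModelWithCorners ℝ E H} [TopologicalSpace M] [ChartedSpace H M]

lemma contMDiffAt_inner {f g : M → Euc m} {x : M} (hf : ContMDiffAt I 𝓘(ℝ, Euc m) ∞ f x)
    (hg : ContMDiffAt I 𝓘(ℝ, Euc m) ∞ g x) :
    ContMDiffAt I 𝓘(ℝ, ℝ) ∞ (fun y => ⟪f y, g y⟫) x :=
  ContDiffAt.comp_contMDiffAt (g := fun z : Euc m × Euc m => ⟪z.1, z.2⟫)
    (contDiff_inner.contDiffAt) (hf.prodMk_space hg)

end Inner

lemma contMDiff_jetHeight : ContMDiff (jetModel m) 𝓘(ℝ, ℝ) ∞ (jetHeight (m := m)) :=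
  fun w => contMDiffAt_inner (contMDiff_jetSnd w) (contMDiff_jetPos w)

lemma contMDiff_jetSlope : ContMDiff (jetModel m) 𝓘(ℝ, Euc m) ∞ (jetSlope (m := m)) :=
  contMDiff_jetSnd.sub (contMDiff_jetHeight.smul contMDiff_jetPos)

lemma contMDiff_plusHandle :
    ContMDiff (jetModel m) 𝓘(ℝ, Euc m × Euc m) ∞ (plusHandle (m := m)) :=
  contMDiff_jetPos.prodMk_space
    (((contMDiff_jetHeight.div_const 2).smul contMDiff_jetPos).add contMDiff_jetSlope)

lemma contMDiff_minusHandle :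
    ContMDiff (jetModel m) 𝓘(ℝ, Euc m × Euc m) ∞ (minusHandle (m := m)) :=
  ((contMDiff_jetHeight.smul contMDiff_jetPos).sub contMDiff_jetSlope).prodMk_space
    contMDiff_jetPos

/-- A point of the sphere. -/
def basePt (m : ℕ) : Sph m := ⟨EuclideanSpace.single 0 1, by simp⟩

/-- The projection of the handle along the Liouville flow to `{‖q‖ = 1}`, in jet coordinates. -/
def projQ (a : Euc m × Euc m) : Jet m :=
  plusHandleInv (basePt m) (‖a.1‖⁻¹ • a.1, √‖a.1‖ • a.2)

/-- The projection of the handle along the Liouville flow to `{‖p‖ = 1}`, in jet coordinates. -/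
def projP (a : Euc m × Euc m) : Jet m :=
  minusHandleInv (basePt m) (‖a.2‖ ^ 2 • a.1, ‖a.2‖⁻¹ • a.2)

section Proj
variable {a : Euc m × Euc m}

lemma norm_inv_smul {v : Euc m} (h : v ≠ 0) : ‖‖v‖⁻¹ • v‖ = 1 := by
  rw [norm_smul, norm_inv, norm_norm, inv_mul_cancel₀ (norm_ne_zero_iff.2 h)]

lemma plusHandle_projQ (h : a.1 ≠ 0) :
    plusHandle (projQ a) = (‖a.1‖⁻¹ • a.1, √‖a.1‖ • a.2) :=
  plusHandle_plusHandleInv _ (norm_inv_smul h)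

lemma minusHandle_projP (h : a.2 ≠ 0) :
    minusHandle (projP a) = (‖a.2‖ ^ 2 • a.1, ‖a.2‖⁻¹ • a.2) :=
  minusHandle_minusHandleInv _ (norm_inv_smul h)

lemma plusHandleInv_eq (e : Sph m) (h : ‖a.1‖ = 1) :
    plusHandleInv e a = (toSph e a.1, a.2 + ⟪a.2, a.1⟫ • a.1) := by
  simp only [plusHandleInv, jetMk, coe_toSph h]
  ext1
  · rfl
  · simp only; module

lemma minusHandleInv_eq (e : Sph m) (h : ‖a.2‖ = 1) :
    minusHandleInv e a = (toSph e a.2, (2 * ⟪a.1, a.2⟫) • a.2 - a.1) := by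
  simp only [minusHandleInv, jetMk, coe_toSph h]
  ext1
  · rfl
  · simp only; module

lemma toSph_congr {e e' : Sph m} {v : Euc m} (h : ‖v‖ = 1) : toSph e v = toSph e' v :=
  Subtype.ext ((coe_toSph h).trans (coe_toSph h).symm)

lemma plusHandleInv_congr (e e' : Sph m) (h : ‖a.1‖ = 1) :
    plusHandleInv e a = plusHandleInv e' a := by
  rw [plusHandleInv_eq e h, plusHandleInv_eq e' h, toSph_congr h]

lemma minusHandleInv_congr (e e' : Sph m) (h : ‖a.2‖ = 1) :
    minusHandleInv e a = minusHandleInv e' a := by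
  rw [minusHandleInv_eq e h, minusHandleInv_eq e' h, toSph_congr h]

lemma projQ_eq (h : a.1 ≠ 0) : projQ a = (toSph (basePt m) (‖a.1‖⁻¹ • a.1),
    √‖a.1‖ • a.2 + ⟪√‖a.1‖ • a.2, ‖a.1‖⁻¹ • a.1⟫ • (‖a.1‖⁻¹ • a.1)) :=
  plusHandleInv_eq _ (norm_inv_smul h)

lemma projP_eq (h : a.2 ≠ 0) : projP a = (toSph (basePt m) (‖a.2‖⁻¹ • a.2),
    (2 * ⟪‖a.2‖ ^ 2 • a.1, ‖a.2‖⁻¹ • a.2⟫) • (‖a.2‖⁻¹ • a.2) - ‖a.2‖ ^ 2 • a.1) :=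
  minusHandleInv_eq _ (norm_inv_smul h)

lemma jetPos_projQ (h : a.1 ≠ 0) : jetPos (projQ a) = ‖a.1‖⁻¹ • a.1 := by
  rw [projQ_eq h]; exact coe_toSph (norm_inv_smul h)

lemma jetPos_projP (h : a.2 ≠ 0) : jetPos (projP a) = ‖a.2‖⁻¹ • a.2 := by
  rw [projP_eq h]; exact coe_toSph (norm_inv_smul h)

lemma norm_projP (h : a.2 ≠ 0) : ‖(projP a).2‖ = ‖a.2‖ ^ 2 * ‖a.1‖ := by
  rw [← minusHandle_fst_norm, minusHandle_projP h, norm_smul, norm_pow, norm_norm]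

lemma projQ_flow {l : ℝ} (hl : 0 < l) (h : a.1 ≠ 0) :
    projQ (l ^ 2 • a.1, l⁻¹ • a.2) = projQ a := by
  have h1 : ‖l ^ 2 • a.1‖ = l ^ 2 * ‖a.1‖ := by
    rw [norm_smul, norm_pow, Real.norm_of_nonneg hl.le]
  have h2 : √(l ^ 2 * ‖a.1‖) = l * √‖a.1‖ := by
    rw [Real.sqrt_mul (by positivity), Real.sqrt_sq hl.le]
  have h3 : ‖a.1‖ ≠ 0 := norm_ne_zero_iff.2 h
  unfold projQ
  congr 1
  simp only [h1, h2, smul_smul]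
  congr 2 <;> field_simp

lemma projP_flow {l : ℝ} (hl : 0 < l) (h : a.2 ≠ 0) :
    projP (l ^ 2 • a.1, l⁻¹ • a.2) = projP a := by
  have h1 : ‖l⁻¹ • a.2‖ = l⁻¹ * ‖a.2‖ := by
    rw [norm_smul, norm_inv, Real.norm_of_nonneg hl.le]
  have h3 : ‖a.2‖ ≠ 0 := norm_ne_zero_iff.2 h
  unfold projP
  congr 1
  simp only [h1, smul_smul]
  congr 2 <;> field_simp

lemma projQ_inj {b : Euc m × Euc m} (ha : a.1 ≠ 0) (hb : b.1 ≠ 0) (h : projQ a = projQ b) :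
    ∃ l : ℝ, 0 < l ∧ b.1 = l ^ 2 • a.1 ∧ b.2 = l⁻¹ • a.2 := by
  have h1 := congrArg plusHandle h
  rw [plusHandle_projQ ha, plusHandle_projQ hb, Prod.mk.injEq] at h1
  have ha' : 0 < ‖a.1‖ := norm_pos_iff.2 ha
  have hb' : 0 < ‖b.1‖ := norm_pos_iff.2 hb
  have hsa := Real.sqrt_pos.2 ha'
  have hsb := Real.sqrt_pos.2 hb'
  refine ⟨√‖b.1‖ / √‖a.1‖, by positivity, ?_, ?_⟩
  · rw [div_pow, Real.sq_sqrt hb'.le, Real.sq_sqrt ha'.le, div_eq_mul_inv, mul_smul, h1.1,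
      smul_inv_smul₀ hb'.ne']
  · rw [inv_div, div_eq_inv_mul, mul_smul, h1.2, inv_smul_smul₀ hsb.ne']

lemma projP_inj {b : Euc m × Euc m} (ha : a.2 ≠ 0) (hb : b.2 ≠ 0) (h : projP a = projP b) :
    ∃ l : ℝ, 0 < l ∧ b.1 = l ^ 2 • a.1 ∧ b.2 = l⁻¹ • a.2 := by
  have h1 := congrArg minusHandle h
  rw [minusHandle_projP ha, minusHandle_projP hb, Prod.mk.injEq] at h1
  have ha' : 0 < ‖a.2‖ := norm_pos_iff.2 ha
  have hb' : 0 < ‖b.2‖ := norm_pos_iff.2 hb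
  refine ⟨‖a.2‖ / ‖b.2‖, by positivity, ?_, ?_⟩
  · rw [div_pow, div_eq_inv_mul, mul_smul, h1.1, inv_smul_smul₀ (by positivity)]
  · rw [inv_div, div_eq_mul_inv, mul_smul, h1.2, smul_inv_smul₀ hb'.ne']

lemma transferFun_eq (w : Jet m) (hw : w.2 ≠ 0) : transferFun w = projP (plusHandle w) := by
  have h0 := plusHandle_snd_ne hw
  have h : 0 < ‖(plusHandle w).2‖ := norm_pos_iff.2 h0
  have h2 := flow_log_snd h0
  rw [transferFun, minusHandleInv_congr _ (basePt m) h2, projP]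
  congr 1
  simp only [liouvilleFlow]
  rw [two_mul, Real.exp_add, Real.exp_neg, Real.exp_log h, pow_two]

lemma transferInv_eq (w : Jet m) (hw : w.2 ≠ 0) : transferInv w = projQ (minusHandle w) := by
  have h0 := minusHandle_fst_ne hw
  have h : 0 < ‖(minusHandle w).1‖ := norm_pos_iff.2 h0
  have h2 := flow_log_fst h0
  rw [transferInv, plusHandleInv_congr _ (basePt m) h2, projQ]
  congr 1
  simp only [liouvilleFlow]
  rw [show 2 * (-Real.log ‖(minusHandle w).1‖ / 2) = -Real.log ‖(minusHandle w).1‖ by ring,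
    show -(-Real.log ‖(minusHandle w).1‖ / 2) = Real.log ‖(minusHandle w).1‖ / 2 by ring,
    Real.exp_neg, Real.exp_log h, ← Real.log_sqrt h.le, Real.exp_log (Real.sqrt_pos.2 h)]

lemma projQ_snd_ne (h1 : a.1 ≠ 0) (h2 : a.2 ≠ 0) : (projQ a).2 ≠ 0 := by
  intro h
  have h3 := plusHandle_snd_norm_le (projQ a)
  rw [h, norm_zero, mul_zero, plusHandle_projQ h1] at h3
  have h4 := norm_le_zero_iff.1 h3
  have : 0 < ‖a.1‖ := norm_pos_iff.2 h1
  exact h2 ((smul_eq_zero.1 h4).resolve_left (Real.sqrt_pos.2 this).ne')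

lemma projQ_snd_eq_zero (h1 : a.1 ≠ 0) (h2 : a.2 = 0) : (projQ a).2 = 0 := by
  rw [projQ_eq h1]; simp [h2]

lemma projP_snd_ne (h1 : a.1 ≠ 0) (h2 : a.2 ≠ 0) : (projP a).2 ≠ 0 := by
  rw [← norm_ne_zero_iff, norm_projP h2]
  have := norm_pos_iff.2 h1
  have := norm_pos_iff.2 h2
  positivity

lemma projP_snd_eq_zero (h1 : a.1 = 0) (h2 : a.2 ≠ 0) : (projP a).2 = 0 := by
  rw [projP_eq h2]; simp [h1]

lemma transferFun_projQ (h1 : a.1 ≠ 0) (h2 : a.2 ≠ 0) : transferFun (projQ a) = projP a := by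
  have h3 : 0 < √‖a.1‖ := Real.sqrt_pos.2 (norm_pos_iff.2 h1)
  rw [transferFun_eq _ (projQ_snd_ne h1 h2), plusHandle_projQ h1]
  have h4 := projP_flow (a := a) (l := (√‖a.1‖)⁻¹) (inv_pos.2 h3) h2
  rw [← h4, inv_pow, Real.sq_sqrt (norm_nonneg _), inv_inv]

lemma transferInv_projP (h1 : a.1 ≠ 0) (h2 : a.2 ≠ 0) : transferInv (projP a) = projQ a := by
  rw [← transferFun_projQ h1 h2, transferInv_transferFun (projQ_snd_ne h1 h2)]

end Proj


/-! ### Derivatives of jets along curves -/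

/-- The Liouville form `p dq + 2 q dp` at `a`, evaluated at `b`. -/
def liouvilleForm (a b : Euc m × Euc m) : ℝ := ⟪a.2, b.1⟫ + 2 * ⟪a.1, b.2⟫

lemma hasDerivAt_flow {a : ℝ → Euc m × Euc m} {a' : Euc m × Euc m} {l : ℝ → ℝ} {l' t : ℝ}
    (ha : HasDerivAt a a' t) (hl : HasDerivAt l l' t) (h0 : l t ≠ 0) :
    ∃ b', HasDerivAt (fun s => ((l s) ^ 2 • (a s).1, (l s)⁻¹ • (a s).2)) b' t ∧
      liouvilleForm ((l t) ^ 2 • (a t).1, (l t)⁻¹ • (a t).2) b' = l t * liouvilleForm (a t) a' ∧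
      (b' = 0 → ∃ μ : ℝ, a' = ((2 * μ) • (a t).1, -μ • (a t).2)) := by
  have h1 := (hl.pow 2).fun_smul ha.fst
  have h2 := (hl.fun_inv h0).fun_smul ha.snd
  refine ⟨_, h1.prodMk h2, ?_, fun h => ⟨-l' / l t, ?_⟩⟩
  · simp only [liouvilleForm, inner_add_right, real_inner_smul_left, real_inner_smul_right,
      Pi.pow_apply, real_inner_comm (a t).1 (a t).2]
    field_simp
    simp only [Nat.add_one_sub_one]
    ring
  · rw [Prod.mk_eq_zero] at h
    obtain ⟨h3, h4⟩ := h
    ext1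
    · have h5 : a'.1 = (l t ^ 2)⁻¹ • (l t ^ 2 • a'.1) := by
        rw [inv_smul_smul₀ (pow_ne_zero 2 h0)]
      rw [Pi.pow_apply] at h3
      rw [h5, eq_neg_of_add_eq_zero_left h3, ← neg_smul, smul_smul]
      congr 1
      simp only [Nat.add_one_sub_one]
      field_simp
      ring
    · have h5 : a'.2 = l t • ((l t)⁻¹ • a'.2) := by
        rw [smul_inv_smul₀ h0]
      rw [h5, eq_neg_of_add_eq_zero_left h4, ← neg_smul, smul_smul]
      congr 1
      field_simp

lemma inner_deriv_eq_zero {b : ℝ → Euc m} {b' : Euc m} {t : ℝ} (hb : HasDerivAt b b' t)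
    (h : ∀ᶠ s in 𝓝 t, ‖b s‖ = 1) : ⟪b t, b'⟫ = 0 := by
  have h1 := hb.inner ℝ hb
  have h2 : (fun s => ⟪b s, b s⟫) =ᶠ[𝓝 t] fun _ => (1 : ℝ) := by
    filter_upwards [h] with s hs
    rw [real_inner_self_eq_norm_sq, hs]; norm_num
  have h3 := h1.unique ((hasDerivAt_const t (1 : ℝ)).congr_of_eventuallyEq h2)
  rw [real_inner_comm b' (b t)] at h3
  linarith [real_inner_comm b' (b t)]

lemma jet_snd_of_plusHandle (w : Jet m) : w.2 = (plusHandle w).2 +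
    ⟪(plusHandle w).2, (plusHandle w).1⟫ • (plusHandle w).1 := by
  have h2 : ⟪(plusHandle w).2, (plusHandle w).1⟫ = jetHeight w / 2 := by
    simp only [plusHandle, inner_add_left, real_inner_smul_left, inner_self_sph, inner_jetSlope]
    ring
  rw [h2]
  simp only [plusHandle, jetSlope]; module

lemma jet_snd_of_minusHandle (w : Jet m) :
    w.2 = (2 * ⟪(minusHandle w).1, (minusHandle w).2⟫) • (minusHandle w).2 - (minusHandle w).1 := by
  have h2 : ⟪(minusHandle w).1, (minusHandle w).2⟫ = jetHeight w := by
    simp only [minusHandle, inner_sub_left, real_inner_smul_left, inner_self_sph, inner_jetSlope]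
    ring
  rw [h2]
  simp only [minusHandle, jetSlope]; module

lemma hasDerivAt_of_plusHandle {b : ℝ → Euc m × Euc m} {b' : Euc m × Euc m} {t : ℝ}
    {w : ℝ → Jet m} (hb : HasDerivAt b b' t) (hw : ∀ᶠ s in 𝓝 t, plusHandle (w s) = b s) :
    ∃ x' z' : Euc m, HasDerivAt (fun s => jetPos (w s)) x' t ∧
      HasDerivAt (fun s => (w s).2) z' t ∧ ⟪z', jetPos (w t)⟫ = liouvilleForm (b t) b' ∧
      (x' = 0 → z' = 0 → b' = 0) := by
  have hpos : ∀ s, plusHandle (w s) = b s → jetPos (w s) = (b s).1 := fun s h => congrArg Prod.fst h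
  have hnorm : ∀ᶠ s in 𝓝 t, ‖(b s).1‖ = 1 := by
    filter_upwards [hw] with s hs
    rw [← hpos s hs]; exact norm_sph _
  have horth := inner_deriv_eq_zero hb.fst hnorm
  have hb1 : HasDerivAt (fun s => (b s).1) b'.1 t := hb.fst
  have hb2 : HasDerivAt (fun s => (b s).2) b'.2 t := hb.snd
  have h1 := hb2.add ((hb2.inner ℝ hb1).fun_smul hb1)
  have hnt : ⟪(b t).1, (b t).1⟫ = 1 := by
    rw [real_inner_self_eq_norm_sq, hnorm.self_of_nhds]; norm_num
  refine ⟨_, _, HasDerivAt.congr_of_eventuallyEq hb1 ?_, HasDerivAt.congr_of_eventuallyEq h1 ?_, ?_, ?_⟩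
  · filter_upwards [hw] with s hs using hpos s hs
  · filter_upwards [hw] with s hs
    rw [jet_snd_of_plusHandle, hs]; rfl
  · rw [hpos t hw.self_of_nhds]
    simp only [liouvilleForm, inner_add_left, real_inner_smul_left, hnt,
      real_inner_comm (b t).1 b'.1, horth]
    linarith [real_inner_comm b'.2 (b t).1]
  · intro h2 h3
    rw [h2] at h3
    simp only [inner_zero_right, zero_add, smul_zero] at h3
    have h4 := congrArg (fun z => ⟪z, (b t).1⟫) h3
    simp only [inner_add_left, real_inner_smul_left, hnt, inner_zero_left] at h4
    have h5 : ⟪b'.2, (b t).1⟫ = 0 := by linarith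
    rw [h5] at h3
    ext1
    · exact h2
    · simpa using h3

lemma hasDerivAt_of_minusHandle {b : ℝ → Euc m × Euc m} {b' : Euc m × Euc m} {t : ℝ}
    {w : ℝ → Jet m} (hb : HasDerivAt b b' t) (hw : ∀ᶠ s in 𝓝 t, minusHandle (w s) = b s) :
    ∃ x' z' : Euc m, HasDerivAt (fun s => jetPos (w s)) x' t ∧
      HasDerivAt (fun s => (w s).2) z' t ∧ ⟪z', jetPos (w t)⟫ = liouvilleForm (b t) b' ∧
      (x' = 0 → z' = 0 → b' = 0) := by
  have hpos : ∀ s, minusHandle (w s) = b s → jetPos (w s) = (b s).2 :=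
    fun s h => congrArg Prod.snd h
  have hnorm : ∀ᶠ s in 𝓝 t, ‖(b s).2‖ = 1 := by
    filter_upwards [hw] with s hs
    rw [← hpos s hs]; exact norm_sph _
  have horth := inner_deriv_eq_zero hb.snd hnorm
  have hb1 : HasDerivAt (fun s => (b s).1) b'.1 t := hb.fst
  have hb2 : HasDerivAt (fun s => (b s).2) b'.2 t := hb.snd
  have h1 := (((hb1.inner ℝ hb2).const_mul 2).fun_smul hb2).sub hb1
  have hnt : ⟪(b t).2, (b t).2⟫ = 1 := by
    rw [real_inner_self_eq_norm_sq, hnorm.self_of_nhds]; norm_num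
  refine ⟨_, _, HasDerivAt.congr_of_eventuallyEq hb2 ?_, HasDerivAt.congr_of_eventuallyEq h1 ?_, ?_, ?_⟩
  · filter_upwards [hw] with s hs using hpos s hs
  · filter_upwards [hw] with s hs
    rw [jet_snd_of_minusHandle, hs]; rfl
  · rw [hpos t hw.self_of_nhds]
    simp only [liouvilleForm, inner_sub_left, inner_add_left, real_inner_smul_left, hnt,
      real_inner_comm (b t).2 b'.2, horth]
    linarith [real_inner_comm b'.1 (b t).2]
  · intro h2 h3
    rw [h2] at h3
    simp only [inner_zero_right, zero_add, smul_zero] at h3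
    have h4 := congrArg (fun z => ⟪z, (b t).2⟫) h3
    simp only [inner_sub_left, real_inner_smul_left, hnt, inner_zero_left] at h4
    have h5 : ⟪b'.1, (b t).2⟫ = 0 := by linarith
    rw [h5] at h3
    ext1
    · simpa using h3
    · exact h2

lemma hasDerivAt_projQ {a : ℝ → Euc m × Euc m} {a' : Euc m × Euc m} {t : ℝ}
    (ha : HasDerivAt a a' t) (h0 : (a t).1 ≠ 0) :
    ∃ x' z' : Euc m, HasDerivAt (fun s => jetPos (projQ (a s))) x' t ∧
      HasDerivAt (fun s => (projQ (a s)).2) z' t ∧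
      (liouvilleForm (a t) a' = 0 → ⟪z', jetPos (projQ (a t))⟫ = 0) ∧
      (x' = 0 → z' = 0 → ∃ μ : ℝ, a' = ((2 * μ) • (a t).1, -μ • (a t).2)) := by
  have hn : 0 < ‖(a t).1‖ := norm_pos_iff.2 h0
  have hl0 : (√‖(a t).1‖)⁻¹ ≠ 0 := inv_ne_zero (Real.sqrt_pos.2 hn).ne'
  have ha1 : DifferentiableAt ℝ (fun s => (a s).1) t := HasDerivAt.differentiableAt ha.fst
  have hl : DifferentiableAt ℝ (fun s => (√‖(a s).1‖)⁻¹) t :=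
    ((ha1.norm ℝ h0).sqrt hn.ne').inv (Real.sqrt_pos.2 hn).ne'
  obtain ⟨b', hb, hlam, him⟩ := hasDerivAt_flow ha hl.hasDerivAt hl0
  have hev : ∀ᶠ s in 𝓝 t, (a s).1 ≠ 0 := ha1.continuousAt.eventually_ne h0
  obtain ⟨x', z', h1, h2, h3, h4⟩ := hasDerivAt_of_plusHandle (w := fun s => projQ (a s)) hb (by
    filter_upwards [hev] with s hs
    rw [plusHandle_projQ hs, inv_pow, Real.sq_sqrt (norm_nonneg _), inv_inv])
  refine ⟨x', z', h1, h2, fun h => ?_, fun h5 h6 => him (h4 h5 h6)⟩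
  rw [h3, hlam, h, mul_zero]

lemma hasDerivAt_projP {a : ℝ → Euc m × Euc m} {a' : Euc m × Euc m} {t : ℝ}
    (ha : HasDerivAt a a' t) (h0 : (a t).2 ≠ 0) :
    ∃ x' z' : Euc m, HasDerivAt (fun s => jetPos (projP (a s))) x' t ∧
      HasDerivAt (fun s => (projP (a s)).2) z' t ∧
      (liouvilleForm (a t) a' = 0 → ⟪z', jetPos (projP (a t))⟫ = 0) ∧
      (x' = 0 → z' = 0 → ∃ μ : ℝ, a' = ((2 * μ) • (a t).1, -μ • (a t).2)) := by
  have hn : ‖(a t).2‖ ≠ 0 := norm_ne_zero_iff.2 h0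
  have ha2 : DifferentiableAt ℝ (fun s => (a s).2) t := HasDerivAt.differentiableAt ha.snd
  have hl : DifferentiableAt ℝ (fun s => ‖(a s).2‖) t := ha2.norm ℝ h0
  obtain ⟨b', hb, hlam, him⟩ := hasDerivAt_flow ha hl.hasDerivAt hn
  have hev : ∀ᶠ s in 𝓝 t, (a s).2 ≠ 0 := ha2.continuousAt.eventually_ne h0
  obtain ⟨x', z', h1, h2, h3, h4⟩ := hasDerivAt_of_minusHandle (w := fun s => projP (a s)) hb (by
    filter_upwards [hev] with s hs using minusHandle_projP hs)
  refine ⟨x', z', h1, h2, fun h => ?_, fun h5 h6 => him (h4 h5 h6)⟩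
  rw [h3, hlam, h, mul_zero]

lemma hasDerivAt_plusHandle {w : ℝ → Jet m} {x' z' : Euc m} {t : ℝ}
    (hx : HasDerivAt (fun s => jetPos (w s)) x' t) (hz : HasDerivAt (fun s => (w s).2) z' t) :
    ∃ a', HasDerivAt (fun s => plusHandle (w s)) a' t ∧
      liouvilleForm (plusHandle (w t)) a' = ⟪z', jetPos (w t)⟫ := by
  have hh : HasDerivAt (fun s => jetHeight (w s)) (⟪(w t).2, x'⟫ + ⟪z', jetPos (w t)⟫) t :=
    hz.inner ℝ hx
  have hs : HasDerivAt (fun s => jetSlope (w s)) (z' - (jetHeight (w t) • x' +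
      (⟪(w t).2, x'⟫ + ⟪z', jetPos (w t)⟫) • jetPos (w t))) t := hz.sub (hh.fun_smul hx)
  have horth := inner_deriv_eq_zero hx (Filter.Eventually.of_forall fun s => norm_sph _)
  have hnt : ⟪jetPos (w t), jetPos (w t)⟫ = 1 := inner_self_sph _
  refine ⟨_, hx.prodMk (((hh.div_const 2).fun_smul hx).add hs), ?_⟩
  have hH : jetHeight (w t) = ⟪(w t).2, jetPos (w t)⟫ := rfl
  have hP : plusHandle (w t) = (jetPos (w t), (w t).2 - (jetHeight (w t) / 2) • jetPos (w t)) := by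
    ext1
    · rfl
    · simp only [plusHandle, jetSlope, jetPos]; module
  rw [hP]
  simp only [liouvilleForm, inner_add_right, inner_sub_right, inner_sub_left, real_inner_smul_left,
    real_inner_smul_right, hnt, horth]
  linarith [real_inner_comm z' (jetPos (w t))]

lemma hasDerivAt_minusHandle {w : ℝ → Jet m} {x' z' : Euc m} {t : ℝ}
    (hx : HasDerivAt (fun s => jetPos (w s)) x' t) (hz : HasDerivAt (fun s => (w s).2) z' t) :
    ∃ a', HasDerivAt (fun s => minusHandle (w s)) a' t ∧
      liouvilleForm (minusHandle (w t)) a' = ⟪z', jetPos (w t)⟫ := by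
  have hh : HasDerivAt (fun s => jetHeight (w s)) (⟪(w t).2, x'⟫ + ⟪z', jetPos (w t)⟫) t :=
    hz.inner ℝ hx
  have hs : HasDerivAt (fun s => jetSlope (w s)) (z' - (jetHeight (w t) • x' +
      (⟪(w t).2, x'⟫ + ⟪z', jetPos (w t)⟫) • jetPos (w t))) t := hz.sub (hh.fun_smul hx)
  have horth := inner_deriv_eq_zero hx (Filter.Eventually.of_forall fun s => norm_sph _)
  have hnt : ⟪jetPos (w t), jetPos (w t)⟫ = 1 := inner_self_sph _
  refine ⟨_, ((hh.fun_smul hx).sub hs).prodMk hx, ?_⟩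
  have hP : minusHandle (w t) = ((2 * jetHeight (w t)) • jetPos (w t) - (w t).2, jetPos (w t)) := by
    ext1
    · simp only [minusHandle, jetSlope, jetPos]; module
    · rfl
  rw [hP]
  simp only [liouvilleForm, inner_add_right, inner_sub_right, inner_sub_left, real_inner_smul_left,
    real_inner_smul_right, hnt, horth]
  linarith [real_inner_comm z' (jetPos (w t))]

section JetMaps

variable {E H M : Type*} [NormedAddCommGroup E] [NormedSpace ℝ E] [TopologicalSpace H]
  {I : ModelWithCorners ℝ E H} [TopologicalSpace M] [ChartedSpace H M]
  {g : M → Jet m} {x : M}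

lemma mdifferentiable_jetPos : MDifferentiable (jetModel m) 𝓘(ℝ, Euc m) (jetPos (m := m)) :=
  contMDiff_jetPos.mdifferentiable (by simp)

lemma mdifferentiable_jetSnd : MDifferentiable (jetModel m) 𝓘(ℝ, Euc m) (fun w : Jet m => w.2) :=
  contMDiff_jetSnd.mdifferentiable (by simp)

lemma mdifferentiable_jetHeight : MDifferentiable (jetModel m) 𝓘(ℝ, ℝ) (jetHeight (m := m)) :=
  contMDiff_jetHeight.mdifferentiable (by simp)

lemma hasDerivAt_comp_mfderiv [I.Boundaryless] {F : Type*} [NormedAddCommGroup F] [NormedSpace ℝ F] {k : Jet m → F}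
    (hk : MDifferentiable (jetModel m) 𝓘(ℝ, F) k)
    (hg : MDifferentiableAt I (jetModel m) g x) (v : E) :
    HasDerivAt (fun t => k (g (chartLine I x v t)))
      (mvfderiv (jetModel m) k (g x) (mfderiv I (jetModel m) g x v)) 0 := by
  have h1 := hasDerivAt_comp_chartLine ((hk (g x)).comp x hg) v
  have h2 : mvfderiv I (k ∘ g) x v =
      mvfderiv (jetModel m) k (g x) (mfderiv I (jetModel m) g x v) := by
    simp only [mvfderiv]
    rw [mfderiv_comp x (hk (g x)) hg]
    rfl
  rw [h2] at h1
  exact h1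

/-- The contact form of the derivative of a jet-valued map. -/
lemma jetForm_mfderiv [I.Boundaryless] (hg : MDifferentiableAt I (jetModel m) g x) (v : E) {z' : Euc m}
    (hz : HasDerivAt (fun t => (g (chartLine I x v t)).2) z' 0) :
    jetForm (g x) (mfderiv I (jetModel m) g x v) = ⟪z', jetPos (g x)⟫ := by
  have h1 := hasDerivAt_comp_mfderiv mdifferentiable_jetPos hg v
  have h2 := hasDerivAt_comp_mfderiv mdifferentiable_jetHeight hg v
  have hh := hz.inner ℝ h1
  have h3 := h2.unique hh
  have horth := inner_deriv_eq_zero h1 (Filter.Eventually.of_forall fun s => norm_sph _)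
  simp only [chartLine_zero] at h3 horth
  change mvfderiv (jetModel m) jetHeight (g x) (mfderiv I (jetModel m) g x v) -
    ⟪jetSlope (g x), mvfderiv (jetModel m) jetPos (g x) (mfderiv I (jetModel m) g x v)⟫ = _
  rw [h3, jetSlope, inner_sub_left, real_inner_smul_left]
  change _ - (_ - jetHeight (g x) * ⟪jetPos (g x), _⟫) = _
  rw [horth]
  ring

lemma deriv_eq_zero_of_mfderiv [I.Boundaryless] (hg : MDifferentiableAt I (jetModel m) g x) {v : E}
    {x' z' : Euc m} (hx : HasDerivAt (fun t => jetPos (g (chartLine I x v t))) x' 0)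
    (hz : HasDerivAt (fun t => (g (chartLine I x v t)).2) z' 0)
    (h : mfderiv I (jetModel m) g x v = 0) : x' = 0 ∧ z' = 0 := by
  have h1 := hasDerivAt_comp_mfderiv mdifferentiable_jetPos hg v
  have h2 := hasDerivAt_comp_mfderiv mdifferentiable_jetSnd hg v
  rw [h, map_zero] at h1 h2
  exact ⟨hx.unique h1, hz.unique h2⟩

variable {f : M → Euc m × Euc m}

lemma contMDiffAt_projQ (hf : ContMDiffAt I 𝓘(ℝ, Euc m × Euc m) ∞ f x) (h : (f x).1 ≠ 0) :
    ContMDiffAt I (jetModel m) ∞ (fun y => projQ (f y)) x := by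
  have hev : ∀ᶠ y in 𝓝 x, (f y).1 ≠ 0 :=
    (continuous_fst.continuousAt.comp hf.continuousAt).eventually_ne h
  rw [contMDiffAt_jet_iff]
  have hn : ContDiffAt ℝ ∞ (fun a : Euc m × Euc m => ‖a.1‖⁻¹ • a.1) (f x) :=
    ((contDiffAt_fst.norm ℝ h).inv (norm_ne_zero_iff.2 h)).smul contDiffAt_fst
  have hs : ContDiffAt ℝ ∞ (fun a : Euc m × Euc m => √‖a.1‖ • a.2) (f x) :=
    ((contDiffAt_fst.norm ℝ h).sqrt (norm_ne_zero_iff.2 h)).smul contDiffAt_snd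
  constructor
  · refine (ContDiffAt.comp_contMDiffAt hn hf).congr_of_eventuallyEq ?_
    filter_upwards [hev] with y hy using jetPos_projQ hy
  · refine (ContDiffAt.comp_contMDiffAt (hs.add ((hs.inner ℝ hn).smul hn)) hf).congr_of_eventuallyEq
      ?_
    filter_upwards [hev] with y hy
    rw [projQ_eq hy]; rfl

lemma contMDiffAt_projP (hf : ContMDiffAt I 𝓘(ℝ, Euc m × Euc m) ∞ f x) (h : (f x).2 ≠ 0) :
    ContMDiffAt I (jetModel m) ∞ (fun y => projP (f y)) x := by
  have hev : ∀ᶠ y in 𝓝 x, (f y).2 ≠ 0 :=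
    (continuous_snd.continuousAt.comp hf.continuousAt).eventually_ne h
  rw [contMDiffAt_jet_iff]
  have hn : ContDiffAt ℝ ∞ (fun a : Euc m × Euc m => ‖a.2‖⁻¹ • a.2) (f x) :=
    ((contDiffAt_snd.norm ℝ h).inv (norm_ne_zero_iff.2 h)).smul contDiffAt_snd
  have hs : ContDiffAt ℝ ∞ (fun a : Euc m × Euc m => ‖a.2‖ ^ 2 • a.1) (f x) :=
    ((contDiffAt_snd.norm ℝ h).pow 2).smul contDiffAt_fst
  constructor
  · refine (ContDiffAt.comp_contMDiffAt hn hf).congr_of_eventuallyEq ?_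
    filter_upwards [hev] with y hy using jetPos_projP hy
  · refine (ContDiffAt.comp_contMDiffAt (((contDiffAt_const (c := (2 : ℝ))).mul
      (hs.inner ℝ hn)).smul hn |>.sub hs) hf).congr_of_eventuallyEq ?_
    filter_upwards [hev] with y hy
    rw [projP_eq hy]; rfl

lemma isotropic_projQ [I.Boundaryless] (hf : ContMDiffAt I 𝓘(ℝ, Euc m × Euc m) ∞ f x) (h : (f x).1 ≠ 0) {v : E}
    {a' : Euc m × Euc m} (ha : HasDerivAt (fun t => f (chartLine I x v t)) a' 0)
    (hl : liouvilleForm (f x) a' = 0) :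
    jetForm (projQ (f x)) (mfderiv I (jetModel m) (fun y => projQ (f y)) x v) = 0 := by
  have h0 : (f (chartLine I x v 0)).1 ≠ 0 := by rwa [chartLine_zero]
  obtain ⟨x', z', -, hz, h1, -⟩ := hasDerivAt_projQ ha h0
  simp only [chartLine_zero] at h1
  exact (jetForm_mfderiv ((contMDiffAt_projQ hf h).mdifferentiableAt (by simp)) v hz).trans (h1 hl)

lemma isotropic_projP [I.Boundaryless] (hf : ContMDiffAt I 𝓘(ℝ, Euc m × Euc m) ∞ f x) (h : (f x).2 ≠ 0) {v : E}
    {a' : Euc m × Euc m} (ha : HasDerivAt (fun t => f (chartLine I x v t)) a' 0)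
    (hl : liouvilleForm (f x) a' = 0) :
    jetForm (projP (f x)) (mfderiv I (jetModel m) (fun y => projP (f y)) x v) = 0 := by
  have h0 : (f (chartLine I x v 0)).2 ≠ 0 := by rwa [chartLine_zero]
  obtain ⟨x', z', -, hz, h1, -⟩ := hasDerivAt_projP ha h0
  simp only [chartLine_zero] at h1
  exact (jetForm_mfderiv ((contMDiffAt_projP hf h).mdifferentiableAt (by simp)) v hz).trans (h1 hl)

lemma deriv_mem_of_mfderiv_projQ [I.Boundaryless] (hf : ContMDiffAt I 𝓘(ℝ, Euc m × Euc m) ∞ f x)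
    (h : (f x).1 ≠ 0) {v : E} {a' : Euc m × Euc m}
    (ha : HasDerivAt (fun t => f (chartLine I x v t)) a' 0)
    (hv : mfderiv I (jetModel m) (fun y => projQ (f y)) x v = 0) :
    ∃ μ : ℝ, a' = ((2 * μ) • (f x).1, -μ • (f x).2) := by
  have h0 : (f (chartLine I x v 0)).1 ≠ 0 := by rwa [chartLine_zero]
  obtain ⟨x', z', hx, hz, -, h1⟩ := hasDerivAt_projQ ha h0
  obtain ⟨h2, h3⟩ := deriv_eq_zero_of_mfderiv
    ((contMDiffAt_projQ hf h).mdifferentiableAt (by simp)) hx hz hv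
  simpa only [chartLine_zero] using h1 h2 h3

lemma deriv_mem_of_mfderiv_projP [I.Boundaryless] (hf : ContMDiffAt I 𝓘(ℝ, Euc m × Euc m) ∞ f x)
    (h : (f x).2 ≠ 0) {v : E} {a' : Euc m × Euc m}
    (ha : HasDerivAt (fun t => f (chartLine I x v t)) a' 0)
    (hv : mfderiv I (jetModel m) (fun y => projP (f y)) x v = 0) :
    ∃ μ : ℝ, a' = ((2 * μ) • (f x).1, -μ • (f x).2) := by
  have h0 : (f (chartLine I x v 0)).2 ≠ 0 := by rwa [chartLine_zero]
  obtain ⟨x', z', hx, hz, -, h1⟩ := hasDerivAt_projP ha h0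
  obtain ⟨h2, h3⟩ := deriv_eq_zero_of_mfderiv
    ((contMDiffAt_projP hf h).mdifferentiableAt (by simp)) hx hz hv
  simpa only [chartLine_zero] using h1 h2 h3

end JetMaps

/-! ### The gluing map is a contactomorphism -/

lemma contMDiffAt_gluing (κ : SurgerySign) {w : Jet m} (hw : w.2 ≠ 0) :
    ContMDiffAt (jetModel m) (jetModel m) ∞ (gluing m κ) w := by
  have hev : ∀ᶠ w' in 𝓝 w, w'.2 ≠ 0 := isOpen_nonzero.mem_nhds hw
  cases κ with
  | minus =>
    refine (contMDiffAt_projP (contMDiff_plusHandle w) (plusHandle_snd_ne hw)).congr_of_eventuallyEq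
      ?_
    filter_upwards [hev] with y hy using transferFun_eq y hy
  | plus =>
    refine (contMDiffAt_projQ (contMDiff_minusHandle w)
      (minusHandle_fst_ne hw)).congr_of_eventuallyEq ?_
    filter_upwards [hev] with y hy using transferInv_eq y hy

lemma jetForm_gluing (κ : SurgerySign) {w : Jet m} (hw : w.2 ≠ 0)
    {v : EuclideanSpace ℝ (Fin m) × Euc m} (hv : jetForm w v = 0) :
    jetForm (gluing m κ w) (mfderiv (jetModel m) (jetModel m) (gluing m κ) w v) = 0 := by
  have hev : ∀ᶠ w' in 𝓝 w, w'.2 ≠ 0 := isOpen_nonzero.mem_nhds hw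
  have h1 := hasDerivAt_comp_chartLine (mdifferentiable_jetPos w) v
  have h2 := hasDerivAt_comp_chartLine (mdifferentiable_jetSnd w) v
  have h3 := jetForm_mfderiv (I := jetModel m) mdifferentiableAt_id v h2
  rw [mfderiv_id] at h3
  have h4 := h3.symm.trans hv
  cases κ with
  | minus =>
    obtain ⟨a', ha, hl⟩ := hasDerivAt_plusHandle h1 h2
    have h6 : gluing m .minus =ᶠ[𝓝 w] fun y => projP (plusHandle y) := by
      filter_upwards [hev] with y hy using transferFun_eq y hy
    rw [chartLine_zero] at hl
    have h5 := isotropic_projP (contMDiff_plusHandle w) (plusHandle_snd_ne hw) ha (hl.trans h4)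
    rw [h6.mfderiv_eq, h6.eq_of_nhds]
    exact h5
  | plus =>
    obtain ⟨a', ha, hl⟩ := hasDerivAt_minusHandle h1 h2
    have h6 : gluing m .plus =ᶠ[𝓝 w] fun y => projQ (minusHandle y) := by
      filter_upwards [hev] with y hy using transferInv_eq y hy
    rw [chartLine_zero] at hl
    have h5 := isotropic_projQ (contMDiff_minusHandle w) (minusHandle_fst_ne hw) ha (hl.trans h4)
    rw [h6.mfderiv_eq, h6.eq_of_nhds]
    exact h5

/-! ### The geometry of the surgered manifold -/

lemma exists_tube {O : Set (Jet m)} (hO : IsOpen O) (h : ∀ x : Sph m, (x, (0 : Euc m)) ∈ O) :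
    ∃ δ > 0, ∀ w : Jet m, ‖w.2‖ ≤ δ → w ∈ O := by
  obtain ⟨u, v, -, hv, hu, hv0, huv⟩ := generalized_tube_lemma (isCompact_univ (X := Sph m))
    (isCompact_singleton (x := (0 : Euc m))) hO (by rintro ⟨x, w⟩ ⟨-, rfl⟩; exact h x)
  obtain ⟨δ, hδ, hb⟩ := Metric.isOpen_iff.1 hv 0 (hv0 rfl)
  refine ⟨δ / 2, by positivity, fun w hw => huv ⟨hu (mem_univ _), hb ?_⟩⟩
  rw [mem_ball_zero_iff]
  linarith

lemma isCompact_tube (δ : ℝ) : IsCompact {w : Jet m | ‖w.2‖ ≤ δ} := by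
  have : {w : Jet m | ‖w.2‖ ≤ δ} = univ ×ˢ Metric.closedBall 0 δ := by
    ext w; simp
  rw [this]
  exact isCompact_univ.prod (isCompact_closedBall _ _)

section

variable {Y : Type*} [TopologicalSpace Y]
  [ChartedSpace (EuclideanSpace ℝ (Fin (2 * m + 1))) Y]
  {ξ : TangentField m Y} {ℓ : Sph m → Y}

namespace StdNbhd

variable (N : StdNbhd ξ ℓ) (κ : SurgerySign)

lemma outerChart_symm [T2Space Y] {y : Y} (hy : y ∉ range ℓ) : (N.outerChart κ).symm y = .outer y hy :=
  dif_pos hy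

lemma isClosed_inSurgered {A : Set Y} (hA : IsClosed A) (hd : Disjoint (range ℓ) A) :
    IsClosed (N.inSurgered κ A) := by
  obtain ⟨δ, hδ, h⟩ := exists_tube (N.map.isOpen_inter_preimage hA.isOpen_compl) fun x =>
    ⟨N.zero_mem x, fun hx => disjoint_left.1 hd ⟨x, (N.map_zero x).symm⟩ hx⟩
  obtain ⟨ρ, hρ, hsm⟩ := gluing_small (m := m) κ hδ
  rw [← isOpen_compl_iff, isOpen_surgered]
  constructor
  · have : N.outerIncl κ ⁻¹' (N.inSurgered κ A)ᶜ = Subtype.val ⁻¹' Aᶜ := by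
      rw [preimage_compl, inSurgered, preimage_image_eq _ (N.outerIncl_injective κ)]; rfl
    rw [this]
    exact hA.isOpen_compl.preimage continuous_subtype_val
  · have : (fun w : N.piece κ => N.pieceIncl κ w) ⁻¹' (N.inSurgered κ A)ᶜ =
        Subtype.val ⁻¹' ({w | ‖w.2‖ < ρ} ∪ ((N.overlap κ).source ∩ N.overlap κ ⁻¹' Aᶜ)) := by
      ext ⟨w, hw⟩
      simp only [preimage_compl, mem_compl_iff, mem_preimage, mem_union, mem_ofPred_eq,
        mem_inter_iff]
      constructor
      · intro h1
        rcases hw with hw | hw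
        · left
          have : w.2 = 0 := hw
          rwa [this, norm_zero]
        · right
          refine ⟨hw, fun h2 => h1 ?_⟩
          rw [N.pieceIncl_overlap κ hw]
          exact ⟨_, h2, rfl⟩
      · rintro h1 ⟨y, hy, h2⟩
        obtain ⟨h3, h4⟩ := N.eq_pieceIncl κ h2
        rcases h1 with h1 | h1
        · have h5 := (h _ (hsm w (N.overlap_source_ne κ h3) h1).le).2
          apply h5
          change N.overlap κ w ∈ A
          rw [h4]; exact hy
        · apply h1.2
          change N.overlap κ w ∈ A
          rw [h4]; exact hy
    rw [this]
    exact ((isOpen_lt continuous_snd.norm continuous_const).union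
      ((N.overlap κ).isOpen_inter_preimage hA.isOpen_compl)).preimage continuous_subtype_val

variable [T2Space Y]

lemma _root_.OpenPartialHomeomorph.exists_separated {X Z : Type*} [TopologicalSpace X]
    [TopologicalSpace Z] [T2Space Z] (c : OpenPartialHomeomorph X Z) {x y : X}
    (hx : x ∈ c.source) (hy : y ∈ c.source) (hne : x ≠ y) :
    ∃ u v : Set X, IsOpen u ∧ IsOpen v ∧ x ∈ u ∧ y ∈ v ∧ Disjoint u v := by
  obtain ⟨u, v, hu, hv, hxu, hyv, huv⟩ := t2_separation (fun h => hne (c.injOn hx hy h))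
  refine ⟨c.source ∩ c ⁻¹' u, c.source ∩ c ⁻¹' v, c.isOpen_inter_preimage hu,
    c.isOpen_inter_preimage hv, ⟨hx, hxu⟩, ⟨hy, hyv⟩, ?_⟩
  rw [disjoint_left]
  exact fun z h1 h2 => disjoint_left.1 huv h1.2 h2.2

lemma exists_separated_core_outer (x : Sph m) {y : Y} (hy : y ∉ range ℓ) :
    ∃ u v : Set (Surgered N κ), IsOpen u ∧ IsOpen v ∧ .core x ∈ u ∧ .outer y hy ∈ v ∧
      Disjoint u v := by
  by_cases hyN : y ∈ (N.overlap κ).target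
  · refine (N.pieceChart κ).exists_separated (N.core_mem_source κ x) ?_ (by simp)
    refine ⟨(N.overlap κ).symm y, Or.inr ((N.overlap κ).map_target hyN), ?_⟩
    rw [N.pieceIncl_overlap κ ((N.overlap κ).map_target hyN)]
    simp only [outerIncl, (N.overlap κ).right_inv hyN]
  · have hyN' : y ∉ N.map.target := by
      intro h1
      apply hyN
      have h2 := N.map.map_target h1
      have h3 : N.map.symm y ∈ (gluing m κ).target := by
        rw [gluing_target]
        intro h4
        apply hy
        refine ⟨(N.map.symm y).1, ?_⟩
        rw [← N.map_zero]
        have : (((N.map.symm y).1, 0) : Jet m) = N.map.symm y := Prod.ext rfl h4.symm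
        rw [this, N.map.right_inv h1]
      rw [overlap, OpenPartialHomeomorph.trans_target]
      exact ⟨h1, h3⟩
    obtain ⟨δ, hδ, h⟩ := exists_tube N.map.open_source N.zero_mem
    obtain ⟨ρ, hρ, hsm⟩ := gluing_small (m := m) κ hδ
    have hK : IsClosed (N.map '' {w | ‖w.2‖ ≤ δ}) :=
      ((isCompact_tube δ).image_of_continuousOn (N.map.continuousOn.mono h)).isClosed
    refine ⟨N.pieceIncl κ '' (N.piece κ ∩ {w | ‖w.2‖ < ρ}),
      N.outerIncl κ '' (Subtype.val ⁻¹' (N.map '' {w | ‖w.2‖ ≤ δ})ᶜ),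
      N.isOpen_image_pieceIncl κ ((N.isOpen_piece κ).inter
        (isOpen_lt continuous_snd.norm continuous_const)) inter_subset_left,
      N.isOpen_image_outerIncl κ hK.isOpen_compl,
      ⟨(x, 0), ⟨N.zero_mem_piece κ x, by simpa using hρ⟩, N.pieceIncl_zero κ x⟩,
      ⟨⟨y, hy⟩, ?_, rfl⟩, ?_⟩
    · rintro ⟨w, hw, rfl⟩
      exact hyN' (N.map.map_source (h w hw))
    · rw [disjoint_left]
      rintro _ ⟨w, ⟨-, hw⟩, rfl⟩ ⟨z, hz, h2⟩
      obtain ⟨h3, h4⟩ := N.eq_pieceIncl κ h2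
      exact hz ⟨gluing m κ w, (hsm w (N.overlap_source_ne κ h3) hw).le, h4⟩

instance instT2Surgered : T2Space (Surgered N κ) where
  t2 p p' hne := by
    cases p with
    | outer y hy =>
      cases p' with
      | outer y' hy' =>
        exact (N.outerChart κ).exists_separated (N.mem_outerChart_source κ y hy)
          (N.mem_outerChart_source κ y' hy') hne
      | core x =>
        obtain ⟨u, v, hu, hv, h1, h2, h3⟩ := N.exists_separated_core_outer κ x hy
        exact ⟨v, u, hv, hu, h2, h1, h3.symm⟩
    | core x =>
      cases p' with
      | outer y' hy' => exact N.exists_separated_core_outer κ x hy'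
      | core x' =>
        exact (N.pieceChart κ).exists_separated (N.core_mem_source κ x)
          (N.core_mem_source κ x') hne

section Smooth

variable {E H M : Type*} [NormedAddCommGroup E] [NormedSpace ℝ E] [TopologicalSpace H]
  {I : ModelWithCorners ℝ E H} [TopologicalSpace M] [ChartedSpace H M]
  {x₀ : M}

lemma contMDiffAt_of_outer {F : M → Surgered N κ} {y : Y} {hy : y ∉ range ℓ}
    (h0 : F x₀ = .outer y hy) (hc : ContinuousAt F x₀)
    (hs : ContMDiffAt I (𝓡 (2 * m + 1)) ∞ (fun x => N.outerChart κ (F x)) x₀) :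
    ContMDiffAt I (𝓡 (2 * m + 1)) ∞ F x₀ := by
  rw [contMDiffAt_iff_target] at hs ⊢
  refine ⟨hc, ?_⟩
  have h1 := hs.2
  rw [h0] at h1 ⊢
  exact h1

lemma contMDiffAt_of_core {F : M → Surgered N κ} {x : Sph m}
    (h0 : F x₀ = .core x) (hc : ContinuousAt F x₀)
    (hs : ContMDiffAt I (jetModel m) ∞ (fun x => N.pieceChart κ (F x)) x₀) :
    ContMDiffAt I (𝓡 (2 * m + 1)) ∞ F x₀ := by
  rw [contMDiffAt_iff_target] at hs ⊢
  refine ⟨hc, ?_⟩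
  have h1 := hs.2
  rw [h0, pieceChart_core] at h1
  rw [h0]
  have h2 : ContDiffAt ℝ ∞ (modelEquiv m) ((extChartAt (jetModel m) ((x, 0) : Jet m))
      (N.pieceChart κ (F x₀))) := (modelEquiv m).contDiff.contDiffAt
  exact ContDiffAt.comp_contMDiffAt (f := fun z => extChartAt (jetModel m) ((x, 0) : Jet m)
    (N.pieceChart κ (F z))) h2 h1

end Smooth

lemma mdifferentiableAt_outerChart (y : Y) (hy : y ∉ range ℓ) :
    MDifferentiableAt (𝓡 (2 * m + 1)) (𝓡 (2 * m + 1)) (N.outerChart κ)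
      (.outer y hy : Surgered N κ) := by
  refine ContMDiffAt.mdifferentiableAt (n := ∞) ?_ (by simp)
  rw [contMDiffAt_iff]
  refine ⟨(N.outerChart κ).continuousAt (N.mem_outerChart_source κ y hy), ?_⟩
  set e := chartAt (EuclideanSpace ℝ (Fin (2 * m + 1))) (.outer y hy : Surgered N κ)
  refine ContDiffAt.contDiffWithinAt (contDiffAt_id.congr_of_eventuallyEq ?_)
  filter_upwards [e.open_target.mem_nhds (e.map_source (mem_chart_source _ _))] with z hz
  exact e.right_inv hz

lemma mdifferentiableAt_pieceChart (x : Sph m) :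
    MDifferentiableAt (𝓡 (2 * m + 1)) (jetModel m) (N.pieceChart κ)
      (.core x : Surgered N κ) := by
  refine ContMDiffAt.mdifferentiableAt (n := ∞) ?_ (by simp)
  rw [contMDiffAt_iff]
  refine ⟨(N.pieceChart κ).continuousAt (N.core_mem_source κ x), ?_⟩
  set e := chartAt (EuclideanSpace ℝ (Fin (2 * m + 1))) (.core x : Surgered N κ) with he
  refine ContDiffAt.contDiffWithinAt ((modelEquiv m).symm.contDiff.contDiffAt.congr_of_eventuallyEq
    ?_)
  filter_upwards [e.open_target.mem_nhds (e.map_source (mem_chart_source _ _))] with z hz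
  rw [pieceChart_core]
  have h : modelEquiv m (extChartAt (jetModel m) ((x, 0) : Jet m) (N.pieceChart κ (e.symm z))) =
      z := e.right_inv hz
  rw [ContinuousLinearEquiv.eq_symm_apply]
  exact h

section Maps

variable {E H M : Type*} [NormedAddCommGroup E] [NormedSpace ℝ E] [TopologicalSpace H]
  {I : ModelWithCorners ℝ E H} [TopologicalSpace M] [ChartedSpace H M]
  {x₀ : M}

section Outer
variable {F : M → Surgered N κ} {g : M → Y}

lemma contMDiffAt_of_eventuallyEq_outer (hF : F =ᶠ[𝓝 x₀] fun x => (N.outerChart κ).symm (g x))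
    (h0 : g x₀ ∉ range ℓ) (hg : ContMDiffAt I (𝓡 (2 * m + 1)) ∞ g x₀) :
    ContMDiffAt I (𝓡 (2 * m + 1)) ∞ F x₀ := by
  refine ContMDiffAt.congr_of_eventuallyEq ?_ hF
  refine N.contMDiffAt_of_outer κ (N.outerChart_symm κ h0) ?_ ?_
  · exact ((N.outerChart κ).symm.continuousAt h0).comp hg.continuousAt
  · refine hg.congr_of_eventuallyEq ?_
    filter_upwards [hg.continuousAt (N.isOpen_compl_range.mem_nhds h0)] with x hx
    exact (N.outerChart κ).right_inv hx

lemma mfderiv_outer (hF : F =ᶠ[𝓝 x₀] fun x => (N.outerChart κ).symm (g x))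
    (h0 : g x₀ ∉ range ℓ) (hg : ContMDiffAt I (𝓡 (2 * m + 1)) ∞ g x₀) :
    F x₀ = .outer (g x₀) h0 ∧ ∀ v : TangentSpace I x₀,
      mfderiv (𝓡 (2 * m + 1)) (𝓡 (2 * m + 1)) (N.outerChart κ) (F x₀)
        (mfderiv I (𝓡 (2 * m + 1)) F x₀ v) = mfderiv I (𝓡 (2 * m + 1)) g x₀ v := by
  have hF0 : F x₀ = .outer (g x₀) h0 := hF.eq_of_nhds.trans (N.outerChart_symm κ h0)
  refine ⟨hF0, fun v => ?_⟩
  have hd := (N.contMDiffAt_of_eventuallyEq_outer κ hF h0 hg).mdifferentiableAt (by simp)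
  have ho : MDifferentiableAt (𝓡 (2 * m + 1)) (𝓡 (2 * m + 1)) (N.outerChart κ) (F x₀) := by
    rw [hF0]; exact N.mdifferentiableAt_outerChart κ _ h0
  have h1 : (N.outerChart κ) ∘ F =ᶠ[𝓝 x₀] g := by
    filter_upwards [hg.continuousAt (N.isOpen_compl_range.mem_nhds h0), hF] with x hx hFx
    rw [Function.comp_apply, hFx]
    exact (N.outerChart κ).right_inv hx
  have h2 := mfderiv_comp x₀ ho hd
  rw [h1.mfderiv_eq] at h2
  rw [h2]
  rfl

lemma injective_mfderiv_outer (hF : F =ᶠ[𝓝 x₀] fun x => (N.outerChart κ).symm (g x))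
    (h0 : g x₀ ∉ range ℓ) (hg : ContMDiffAt I (𝓡 (2 * m + 1)) ∞ g x₀)
    (hi : Function.Injective (mfderiv I (𝓡 (2 * m + 1)) g x₀)) :
    Function.Injective (mfderiv I (𝓡 (2 * m + 1)) F x₀) := by
  intro v v' h
  apply hi
  rw [← (N.mfderiv_outer κ hF h0 hg).2, ← (N.mfderiv_outer κ hF h0 hg).2, h]

lemma tangent_outer (hF : F =ᶠ[𝓝 x₀] fun x => (N.outerChart κ).symm (g x))
    (h0 : g x₀ ∉ range ℓ) (hg : ContMDiffAt I (𝓡 (2 * m + 1)) ∞ g x₀) (v : TangentSpace I x₀)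
    (hv : mfderiv I (𝓡 (2 * m + 1)) g x₀ v ∈ ξ (g x₀)) :
    mfderiv I (𝓡 (2 * m + 1)) F x₀ v ∈ N.surgeredField κ (F x₀) := by
  obtain ⟨h1, h2⟩ := N.mfderiv_outer κ hF h0 hg
  have h3 := h2 v
  generalize mfderiv I (𝓡 (2 * m + 1)) F x₀ v = u at h3 ⊢
  generalize F x₀ = p at *
  subst h1
  change mfderiv (𝓡 (2 * m + 1)) (𝓡 (2 * m + 1)) (N.outerChart κ) _ u ∈ ξ (g x₀)
  rw [h3]
  exact hv

end Outer

section Piece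

variable {F : M → Surgered N κ} {g : M → Jet m}

lemma map_gluing (hg : ContMDiffAt I (jetModel m) ∞ g x₀) (h : g x₀ ∈ (N.overlap κ).source) :
    ContMDiffAt I (𝓡 (2 * m + 1)) ∞ (fun x => N.overlap κ (g x)) x₀ ∧
    (Function.Injective (mfderiv I (jetModel m) g x₀) →
      Function.Injective (mfderiv I (𝓡 (2 * m + 1)) (fun x => N.overlap κ (g x)) x₀)) ∧
    ∀ v, jetForm (g x₀) (mfderiv I (jetModel m) g x₀ v) = 0 →
      mfderiv I (𝓡 (2 * m + 1)) (fun x => N.overlap κ (g x)) x₀ v ∈ ξ (N.overlap κ (g x₀)) := by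
  have hne := N.overlap_source_ne κ h
  have h1 := contMDiffAt_gluing κ hne
  have h2 : gluing m κ (g x₀) ∈ N.map.source := h.2
  have h3 := N.smooth.contMDiffAt (N.map.open_source.mem_nhds h2)
  have h4 : ContMDiffAt (jetModel m) (𝓡 (2 * m + 1)) ∞ (N.overlap κ) (g x₀) := h3.comp _ h1
  have h5 : ContMDiffAt I (𝓡 (2 * m + 1)) ∞ (fun x => N.overlap κ (g x)) x₀ := h4.comp _ hg
  have d1 := hg.mdifferentiableAt (by simp)
  have d2 := h1.mdifferentiableAt (by simp)
  have d3 := h3.mdifferentiableAt (by simp)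
  have d4 := h4.mdifferentiableAt (by simp)
  have e1 : mfderiv I (𝓡 (2 * m + 1)) (fun x => N.overlap κ (g x)) x₀ =
    (mfderiv (jetModel m) (𝓡 (2 * m + 1)) (N.overlap κ) (g x₀)).comp
      (mfderiv I (jetModel m) g x₀) := mfderiv_comp x₀ d4 d1
  have e2 : mfderiv (jetModel m) (𝓡 (2 * m + 1)) (N.overlap κ) (g x₀) =
    (mfderiv (jetModel m) (𝓡 (2 * m + 1)) N.map (gluing m κ (g x₀))).comp
      (mfderiv (jetModel m) (jetModel m) (gluing m κ) (g x₀)) := mfderiv_comp _ d3 d2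
  refine ⟨h5, fun hi => ?_, fun v hv => ?_⟩
  · rw [e1]
    have hleft : MDifferentiableAt (𝓡 (2 * m + 1)) (jetModel m) (N.overlap κ).symm
        (N.overlap κ (g x₀)) := by
      have h6 : ContMDiffAt (𝓡 (2 * m + 1)) (jetModel m) ∞ N.map.symm (N.overlap κ (g x₀)) :=
        N.smooth_symm.contMDiffAt (N.map.open_target.mem_nhds (N.map.map_source h2))
      have h7 : N.map.symm (N.overlap κ (g x₀)) = gluing m κ (g x₀) := N.map.left_inv h2
      have h8 : ContMDiffAt (jetModel m) (jetModel m) ∞ (gluing m κ).symm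
          (N.map.symm (N.overlap κ (g x₀))) := by
        rw [h7]
        have h9 : (gluing m κ (g x₀)).2 ≠ 0 := by
          have := (gluing m κ).map_source h.1
          rwa [gluing_target] at this
        cases κ with
        | minus => exact contMDiffAt_gluing .plus h9
        | plus => exact contMDiffAt_gluing .minus h9
      exact (h8.comp _ h6).mdifferentiableAt (by simp)
    have hid : (N.overlap κ).symm ∘ N.overlap κ =ᶠ[𝓝 (g x₀)] id := by
      filter_upwards [(N.overlap κ).open_source.mem_nhds h] with w hw
      exact (N.overlap κ).left_inv hw
    have e3 := mfderiv_comp (g x₀) hleft d4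
    rw [hid.mfderiv_eq, mfderiv_id] at e3
    have hinj : Function.Injective (mfderiv (jetModel m) (𝓡 (2 * m + 1)) (N.overlap κ) (g x₀)) := by
      intro u u' huu
      have e4 : ∀ u, u = mfderiv (𝓡 (2 * m + 1)) (jetModel m) (N.overlap κ).symm
          (N.overlap κ (g x₀)) (mfderiv (jetModel m) (𝓡 (2 * m + 1)) (N.overlap κ) (g x₀) u) :=
        fun u => congrArg (fun A => A u) e3
      rw [e4 u, e4 u', huu]
    exact hinj.comp hi
  · rw [e1, e2]
    exact (N.contact _ h2 _).2 (jetForm_gluing κ hne hv)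

lemma eventuallyEq_outer_of_overlap (hF : F =ᶠ[𝓝 x₀] fun x => N.pieceIncl κ (g x))
    (hg : ContinuousAt g x₀) (h : g x₀ ∈ (N.overlap κ).source) :
    F =ᶠ[𝓝 x₀] fun x => (N.outerChart κ).symm (N.overlap κ (g x)) := by
  filter_upwards [hF, hg ((N.overlap κ).open_source.mem_nhds h)] with x hx hgx
  rw [hx, N.pieceIncl_overlap κ hgx, N.outerChart_symm κ (N.overlap_not_mem κ hgx)]
  rfl

/-- Maps into the glued piece are smooth, immersive and isotropic as soon as they are so in the
coordinates of the piece. -/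
lemma piece_map (hF : F =ᶠ[𝓝 x₀] fun x => N.pieceIncl κ (g x)) (hp : g x₀ ∈ N.piece κ)
    (hg : ContMDiffAt I (jetModel m) ∞ g x₀) :
    ContMDiffAt I (𝓡 (2 * m + 1)) ∞ F x₀ ∧
    (Function.Injective (mfderiv I (jetModel m) g x₀) →
      Function.Injective (mfderiv I (𝓡 (2 * m + 1)) F x₀)) ∧
    ∀ v, jetForm (g x₀) (mfderiv I (jetModel m) g x₀ v) = 0 →
      mfderiv I (𝓡 (2 * m + 1)) F x₀ v ∈ N.surgeredField κ (F x₀) := by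
  by_cases h : g x₀ ∈ (N.overlap κ).source
  · have h1 := N.eventuallyEq_outer_of_overlap κ hF hg.continuousAt h
    obtain ⟨h2, h3, h4⟩ := N.map_gluing κ hg h
    have h0 := N.overlap_not_mem κ h
    exact ⟨N.contMDiffAt_of_eventuallyEq_outer κ h1 h0 h2,
      fun hi => N.injective_mfderiv_outer κ h1 h0 h2 (h3 hi),
      fun v hv => N.tangent_outer κ h1 h0 h2 v (h4 v hv)⟩
  · have hz : (g x₀).2 = 0 := hp.resolve_right h
    have hF0 : F x₀ = .core (g x₀).1 := hF.eq_of_nhds.trans (N.pieceIncl_core κ h)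
    have hev : (fun x => N.pieceChart κ (F x)) =ᶠ[𝓝 x₀] g := by
      filter_upwards [hF, hg.continuousAt ((N.isOpen_piece κ).mem_nhds hp)] with x hx hgx
      rw [hx]
      exact (N.pieceChart κ).right_inv hgx
    have hcont : ContinuousAt F x₀ := by
      refine ContinuousAt.congr ?_ hF.symm
      exact ((N.continuousOn_pieceIncl κ).continuousAt
        ((N.isOpen_piece κ).mem_nhds hp)).comp hg.continuousAt
    have hs : ContMDiffAt I (𝓡 (2 * m + 1)) ∞ F x₀ :=
      N.contMDiffAt_of_core κ hF0 hcont (hg.congr_of_eventuallyEq hev)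
    have ho : MDifferentiableAt (𝓡 (2 * m + 1)) (jetModel m) (N.pieceChart κ) (F x₀) := by
      rw [hF0]; exact N.mdifferentiableAt_pieceChart κ _
    have e1 := mfderiv_comp x₀ ho (hs.mdifferentiableAt (by simp))
    have hev' : N.pieceChart κ ∘ F =ᶠ[𝓝 x₀] g := hev
    rw [hev'.mfderiv_eq] at e1
    have e2 : ∀ v, mfderiv I (jetModel m) g x₀ v = mfderiv (𝓡 (2 * m + 1)) (jetModel m)
          (N.pieceChart κ) (F x₀) (mfderiv I (𝓡 (2 * m + 1)) F x₀ v) := fun v => by rw [e1]; rfl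
    refine ⟨hs, fun hi v v' hvv => hi ?_, fun v hv => ?_⟩
    · rw [e2 v, e2 v', hvv]
    · replace e2 := e2 v
      generalize mfderiv I (𝓡 (2 * m + 1)) F x₀ v = u at e2 ⊢
      generalize mfderiv I (jetModel m) g x₀ v = u' at e2 hv
      generalize F x₀ = p at *
      subst hF0
      change jetForm ((g x₀).1, (0 : Euc m)) (mfderiv (𝓡 (2 * m + 1)) (jetModel m)
          (N.pieceChart κ) _ u) = 0
      rw [← e2]
      generalize g x₀ = w at *
      obtain ⟨w1, w2⟩ := w
      have hz' : w2 = 0 := hz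
      subst hz'
      exact hv

end Piece
end Maps

end StdNbhd

end

set_option linter.unusedSectionVars false

/-! ### Isotopies of discs through the glued piece -/

/-- Jets that avoid the part of a Legendrian submanifold outside of the Darboux chart once they are
moved by the gluing map. -/
def Admissible (κ : SurgerySign) (e : Sph m) (r a b σ δ₀ : ℝ) (w : Jet m) : Prop :=
  w.2 = 0 ∨ gluing m κ w ∈ frontBox e r a b σ ∨ ‖(gluing m κ w).2‖ ≤ δ₀

/-- Isotopies of Legendrian discs in the glued piece that are fixed near the boundary of the disc,
where they agree with the sheet at height `σ h`. -/
structure DiscFamily (κ : SurgerySign) (e : Sph m) (r a b h σ δ₀ : ℝ) (W : ℝ → Sph m → Jet m) :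
    Prop where
  smooth : ∀ t ∈ Icc (0 : ℝ) 1, ∀ x ∈ cap e r,
    ContMDiffAt (𝓘(ℝ, ℝ).prod (𝓡 m)) (jetModel m) ∞ (Function.uncurry W) (t, x)
  admissible : ∀ t ∈ Icc (0 : ℝ) 1, ∀ x ∈ cap e r, Admissible κ e r a b σ δ₀ (W t x)
  injOn : ∀ t ∈ Icc (0 : ℝ) 1, InjOn (W t) (cap e r)
  immersion : ∀ t ∈ Icc (0 : ℝ) 1, ∀ x ∈ cap e r,
    Function.Injective (mfderiv (𝓡 m) (jetModel m) (W t) x)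
  isotropic : ∀ t ∈ Icc (0 : ℝ) 1, ∀ x ∈ cap e r, ∀ v : EuclideanSpace ℝ (Fin m),
    jetForm (W t x) (mfderiv (𝓡 m) (jetModel m) (W t) x v) = 0
  static : ∃ r' < r, ∀ t ∈ Icc (0 : ℝ) 1, ∀ x ∈ cap e r,
    r' ≤ InnerProductGeometry.angle (x : Euc m) (e : Euc m) →
      (W t x).2 ≠ 0 ∧ gluing m κ (W t x) = jetMk x 0 (σ * h)

lemma continuous_angle_sph (e : Sph m) :
    Continuous fun x : Sph m => InnerProductGeometry.angle (x : Euc m) (e : Euc m) := by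
  rw [continuous_iff_continuousAt]
  intro x
  have h1 : (x : Euc m) ≠ 0 := ne_zero_of_mem_unit_sphere x
  have h2 : (e : Euc m) ≠ 0 := ne_zero_of_mem_unit_sphere e
  have h3 : ContinuousAt (fun y : Euc m × Euc m => InnerProductGeometry.angle y.1 y.2)
      ((x : Euc m), (e : Euc m)) := InnerProductGeometry.continuousAt_angle h1 h2
  exact h3.comp (f := fun y : Sph m => ((y : Euc m), (e : Euc m))) (by fun_prop)

lemma isOpen_cap (e : Sph m) (r : ℝ) : IsOpen (cap e r) :=
  isOpen_lt (continuous_angle_sph e) continuous_const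

lemma isOpen_frontBox (e : Sph m) (r a b σ : ℝ) : IsOpen (frontBox e r a b σ) := by
  have h : Continuous fun w : Jet m => jetHeight w := continuous_jetHeight
  exact ((isOpen_cap e r).preimage continuous_fst).inter
    ((isOpen_lt continuous_const (h.const_mul σ)).inter
      (isOpen_lt (h.const_mul σ) continuous_const))

lemma jetHeight_sheet (x : Sph m) (z : ℝ) : jetHeight (jetMk x 0 z) = z :=
  jetHeight_mk (by simp)

lemma contMDiff_sheet (z : ℝ) :
    ContMDiff (𝓡 m) (jetModel m) ∞ (fun x : Sph m => jetMk x 0 z) := by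
  intro x
  rw [contMDiffAt_jet_iff]
  have h1 : ContMDiffAt (𝓡 m) 𝓘(ℝ, Euc m) ∞ (fun y : Sph m => (y : Euc m)) x :=
    contMDiffAt_sphere_iff.1 contMDiffAt_id
  refine ⟨h1, ?_⟩
  have h2 : ContMDiffAt (𝓡 m) 𝓘(ℝ, Euc m) ∞ (fun y : Sph m => z • (y : Euc m)) x :=
    ContDiffAt.comp_contMDiffAt (contDiff_const_smul z).contDiffAt h1
  refine h2.congr_of_eventuallyEq (Filter.Eventually.of_forall fun y => ?_)
  simp [jetMk]

section Framework

variable {Y : Type*} [TopologicalSpace Y]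
  [ChartedSpace (EuclideanSpace ℝ (Fin (2 * m + 1))) Y]
  {ξ : TangentField m Y} {ℓ : Sph m → Y}
  {L : Type*}
  {N : StdNbhd ξ ℓ} {i : L → Y} {e : Sph m} {r a b h σ δ₀ : ℝ}

/-- The set of parameters of a submanifold that lie in the Darboux chart. -/
def sheetDomain (N : StdNbhd ξ ℓ) (i : L → Y) (e : Sph m) (r a b σ : ℝ) : Set L :=
  i ⁻¹' (N.map '' frontBox e r a b σ)

/-- The base point in the sphere of a parameter in the Darboux chart. -/
def sheetPos (N : StdNbhd ξ ℓ) (i : L → Y) (l : L) : Sph m := (N.map.symm (i l)).1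

/-- A Legendrian submanifold whose front in the Darboux chart is a sheet parallel to `Λ`, and which
avoids the tube of radius `δ₀` around `Λ`. -/
structure SheetSetting [TopologicalSpace L] [ChartedSpace (EuclideanSpace ℝ (Fin m)) L]
    (N : StdNbhd ξ ℓ) (i : L → Y) (e : Sph m) (r a b h σ δ₀ : ℝ) : Prop where
  legendrian : IsLegendrianEmbedding ξ i
  closed : IsClosed (range i)
  disj : Disjoint (range ℓ) (range i)
  sign : σ = 1 ∨ σ = -1
  ha : 0 < a
  hh : 0 < h
  hb : h < b
  box : frontBox e r a b σ ⊆ N.map.source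
  front : ∀ w ∈ frontBox e r a b σ, N.map w ∈ range i ↔ w = jetMk w.1 0 (σ * h)
  tube : ∀ w : Jet m, ‖w.2‖ ≤ δ₀ → w ∈ N.map.source ∧ N.map w ∉ range i

namespace SheetSetting

variable [TopologicalSpace L] [ChartedSpace (EuclideanSpace ℝ (Fin m)) L]
  (S : SheetSetting N i e r a b h σ δ₀)

include S

lemma mem_box {x : Sph m} (hx : x ∈ cap e r) : jetMk x 0 (σ * h) ∈ frontBox e r a b σ := by
  have : σ * (σ * h) = h := by rcases S.sign with rfl | rfl <;> ring
  have h1 := S.ha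
  have h2 := S.hh
  have h3 := S.hb
  refine ⟨hx, ?_⟩
  rw [jetHeight_sheet, this]
  constructor <;> linarith

lemma pos_spec {l : L} (hl : l ∈ sheetDomain N i e r a b σ) :
    sheetPos N i l ∈ cap e r ∧ N.map.symm (i l) = jetMk (sheetPos N i l) 0 (σ * h) ∧
      i l = N.map (jetMk (sheetPos N i l) 0 (σ * h)) := by
  obtain ⟨w, hw, hwl⟩ := hl
  have h1 : N.map.symm (i l) = w := by rw [← hwl, N.map.left_inv (S.box hw)]
  have h2 : sheetPos N i l = w.1 := by rw [sheetPos, h1]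
  have h3 := (S.front w hw).1 ⟨l, hwl.symm⟩
  rw [h2, h1, ← h3]
  exact ⟨hw.1, rfl, hwl.symm⟩

lemma exists_pos {x : Sph m} (hx : x ∈ cap e r) :
    ∃ l ∈ sheetDomain N i e r a b σ, sheetPos N i l = x ∧ i l = N.map (jetMk x 0 (σ * h)) := by
  have h1 := S.mem_box hx
  obtain ⟨l, hl⟩ := (S.front _ h1).2 rfl
  refine ⟨l, ⟨_, h1, hl.symm⟩, ?_, hl⟩
  rw [sheetPos, hl, N.map.left_inv (S.box h1)]
  rfl

lemma pos_injOn : InjOn (sheetPos N i) (sheetDomain N i e r a b σ) := by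
  intro l hl l' hl' h
  apply S.legendrian.embedding.injective
  rw [(S.pos_spec hl).2.2, (S.pos_spec hl').2.2, h]

lemma isOpen_domain : IsOpen (sheetDomain N i e r a b σ) :=
  (N.map.isOpen_image_of_subset_source (isOpen_frontBox e r a b σ) S.box).preimage
    S.legendrian.smooth.continuous

lemma contMDiffAt_pos {l : L} (hl : l ∈ sheetDomain N i e r a b σ) :
    ContMDiffAt (𝓡 m) (𝓡 m) ∞ (sheetPos N i) l := by
  have h1 : i l ∈ N.map.target := by
    obtain ⟨w, hw, hwl⟩ := hl
    rw [← hwl]; exact N.map.map_source (S.box hw)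
  have h2 := (N.smooth_symm.contMDiffAt (N.map.open_target.mem_nhds h1)).comp l
    (S.legendrian.smooth l)
  exact (contMDiffAt_prod_iff _).1 h2 |>.1

lemma injective_mfderiv_pos {l : L} (hl : l ∈ sheetDomain N i e r a b σ) :
    Function.Injective (mfderiv (𝓡 m) (𝓡 m) (sheetPos N i) l) := by
  have hX := (S.contMDiffAt_pos hl).mdifferentiableAt (by simp)
  have h0 := S.mem_box (S.pos_spec hl).1
  have hg : MDifferentiableAt (𝓡 m) (𝓡 (2 * m + 1))
      (fun x : Sph m => N.map (jetMk x 0 (σ * h))) (sheetPos N i l) :=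
    ((N.smooth.contMDiffAt (N.map.open_source.mem_nhds (S.box h0))).comp (sheetPos N i l)
      (contMDiff_sheet (σ * h) (sheetPos N i l))).mdifferentiableAt (by simp)
  have h1 := mfderiv_comp l hg hX
  have h2 : (fun x : Sph m => N.map (jetMk x 0 (σ * h))) ∘ sheetPos N i =ᶠ[𝓝 l] i := by
    filter_upwards [S.isOpen_domain.mem_nhds hl] with l' hl'
    exact (S.pos_spec hl').2.2.symm
  rw [h2.mfderiv_eq] at h1
  intro v v' hv
  apply S.legendrian.immersion l
  have h3 : ∀ u, mfderiv (𝓡 m) (𝓡 (2 * m + 1)) i l u =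
      mfderiv (𝓡 m) (𝓡 (2 * m + 1)) (fun x : Sph m => N.map (jetMk x 0 (σ * h))) (sheetPos N i l)
        (mfderiv (𝓡 m) (𝓡 m) (sheetPos N i) l u) := fun u => congrArg (fun A => A u) h1
  rw [h3 v, h3 v', hv]

lemma isCompact_core {r' : ℝ} (hr' : r' < r) :
    IsCompact {l | l ∈ sheetDomain N i e r a b σ ∧
      InnerProductGeometry.angle (sheetPos N i l : Euc m) (e : Euc m) ≤ r'} := by
  rw [S.legendrian.embedding.isInducing.isCompact_iff]
  have h1 : i '' {l | l ∈ sheetDomain N i e r a b σ ∧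
      InnerProductGeometry.angle (sheetPos N i l : Euc m) (e : Euc m) ≤ r'} =
      (fun x : Sph m => N.map (jetMk x 0 (σ * h))) ''
        {x | InnerProductGeometry.angle (x : Euc m) (e : Euc m) ≤ r'} := by
    ext y
    constructor
    · rintro ⟨l, ⟨hl, hl'⟩, rfl⟩
      exact ⟨_, hl', (S.pos_spec hl).2.2.symm⟩
    · rintro ⟨x, hx, rfl⟩
      obtain ⟨l, hl, h2, h3⟩ := S.exists_pos (x := x) (lt_of_le_of_lt hx hr')
      exact ⟨l, ⟨hl, by rw [h2]; exact hx⟩, h3⟩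
  rw [h1]
  refine IsCompact.image_of_continuousOn ?_ ?_
  · exact (isClosed_le (continuous_angle_sph e) continuous_const).isCompact
  · refine N.map.continuousOn.comp (contMDiff_sheet (σ * h)).continuous.continuousOn ?_
    intro x hx
    exact S.box (S.mem_box (lt_of_le_of_lt hx hr'))

end SheetSetting

variable [TopologicalSpace L] [ChartedSpace (EuclideanSpace ℝ (Fin m)) L] [T2Space Y]

open Classical in
/-- The maps into the surgered manifold obtained by replacing a disc in a sheet. -/
def slideMap (N : StdNbhd ξ ℓ) (κ : SurgerySign) (i : L → Y) (e : Sph m) (r a b σ : ℝ)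
    (W : Sph m → Jet m) (l : L) : Surgered N κ :=
  if l ∈ sheetDomain N i e r a b σ then N.pieceIncl κ (W (sheetPos N i l))
  else (N.outerChart κ).symm (i l)

section SlideMap

variable {κ : SurgerySign} (S : SheetSetting N i e r a b h σ δ₀)

lemma slideMap_of_mem {W : Sph m → Jet m} {l : L} (hl : l ∈ sheetDomain N i e r a b σ) :
    slideMap N κ i e r a b σ W l = N.pieceIncl κ (W (sheetPos N i l)) := if_pos hl

lemma slideMap_of_not_mem {W : Sph m → Jet m} {l : L} (hl : l ∉ sheetDomain N i e r a b σ) :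
    slideMap N κ i e r a b σ W l = (N.outerChart κ).symm (i l) := if_neg hl

include S

lemma SheetSetting.mem_overlap {w : Jet m} (hw : w.2 ≠ 0)
    (hA : Admissible κ e r a b σ δ₀ w) : w ∈ (N.overlap κ).source := by
  refine ⟨((gluing_source κ).symm ▸ hw : w ∈ (gluing m κ).source), ?_⟩
  rcases hA with hA | hA | hA
  · exact absurd hA hw
  · exact S.box hA
  · exact (S.tube _ hA).1

lemma SheetSetting.mem_piece {w : Jet m} (hA : Admissible κ e r a b σ δ₀ w) : w ∈ N.piece κ := by
  by_cases hw : w.2 = 0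
  · exact Or.inl hw
  · exact Or.inr (S.mem_overlap hw hA)

lemma SheetSetting.not_mem_range (l : L) : i l ∉ range ℓ :=
  fun hl => disjoint_left.1 S.disj hl ⟨l, rfl⟩

lemma SheetSetting.slideMap_static {W : Sph m → Jet m} {l : L}
    (hW : l ∈ sheetDomain N i e r a b σ → (W (sheetPos N i l)).2 ≠ 0 ∧
      gluing m κ (W (sheetPos N i l)) = jetMk (sheetPos N i l) 0 (σ * h)) :
    slideMap N κ i e r a b σ W l = (N.outerChart κ).symm (i l) := by
  by_cases hl : l ∈ sheetDomain N i e r a b σ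
  · obtain ⟨h1, h2⟩ := hW hl
    obtain ⟨h3, h4, h5⟩ := S.pos_spec hl
    have h6 : W (sheetPos N i l) ∈ (N.overlap κ).source :=
      S.mem_overlap h1 (Or.inr (Or.inl (h2 ▸ S.mem_box h3)))
    rw [slideMap_of_mem hl, N.pieceIncl_overlap κ h6, N.outerChart_symm κ (S.not_mem_range l)]
    have h7 : N.overlap κ (W (sheetPos N i l)) = i l := by
      rw [h5, ← h2]; rfl
    simp only [StdNbhd.outerIncl, h7]
  · exact slideMap_of_not_mem hl

lemma SheetSetting.slideMap_injective {W : Sph m → Jet m}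
    (hA : ∀ x ∈ cap e r, Admissible κ e r a b σ δ₀ (W x)) (hi : InjOn W (cap e r)) :
    Function.Injective (slideMap N κ i e r a b σ W) := by
  have key : ∀ l ∈ sheetDomain N i e r a b σ, ∀ l' ∉ sheetDomain N i e r a b σ,
      slideMap N κ i e r a b σ W l ≠ slideMap N κ i e r a b σ W l' := by
    intro l hl l' hl' heq
    rw [slideMap_of_mem hl, slideMap_of_not_mem hl', N.outerChart_symm κ (S.not_mem_range l')]
      at heq
    obtain ⟨h1, h2⟩ := N.eq_pieceIncl κ (y := ⟨i l', S.not_mem_range l'⟩) heq.symm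
    rcases hA _ (S.pos_spec hl).1 with h3 | h3 | h3
    · exact N.overlap_source_ne κ h1 h3
    · exact hl' ⟨_, h3, h2⟩
    · exact (S.tube _ h3).2 ⟨l', h2.symm⟩
  intro l l' heq
  by_cases hl : l ∈ sheetDomain N i e r a b σ
  · by_cases hl' : l' ∈ sheetDomain N i e r a b σ
    · rw [slideMap_of_mem hl, slideMap_of_mem hl'] at heq
      have h1 := (S.pos_spec hl).1
      have h2 := (S.pos_spec hl').1
      exact S.pos_injOn hl hl' (hi h1 h2 (N.injOn_pieceIncl κ (S.mem_piece (hA _ h1))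
        (S.mem_piece (hA _ h2)) heq))
    · exact absurd heq (key l hl l' hl')
  · by_cases hl' : l' ∈ sheetDomain N i e r a b σ
    · exact absurd heq.symm (key l' hl' l hl)
    · rw [slideMap_of_not_mem hl, slideMap_of_not_mem hl'] at heq
      exact S.legendrian.embedding.injective ((N.outerChart κ).symm.injOn (S.not_mem_range l)
        (S.not_mem_range l') heq)

/-- The maps of a disc family are Legendrian embeddings. -/
lemma SheetSetting.slideMap_legendrian {W : ℝ → Sph m → Jet m}
    (hW : DiscFamily κ e r a b h σ δ₀ W) {t : ℝ} (ht : t ∈ Icc (0 : ℝ) 1) :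
    IsLegendrianEmbedding (N.surgeredField κ) (slideMap N κ i e r a b σ (W t)) := by
  obtain ⟨r', hr', hst⟩ := hW.static
  set K : Set L := {l | l ∈ sheetDomain N i e r a b σ ∧
      InnerProductGeometry.angle (sheetPos N i l : Euc m) (e : Euc m) ≤ r'} with hKdef
  have hK : IsCompact K := S.isCompact_core hr'
  have : T2Space L := S.legendrian.embedding.t2Space
  have hstat : ∀ l, ¬ (l ∈ sheetDomain N i e r a b σ ∧
      InnerProductGeometry.angle (sheetPos N i l : Euc m) (e : Euc m) < r') →
      slideMap N κ i e r a b σ (W t) l = (N.outerChart κ).symm (i l) := by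
    intro l hl
    refine S.slideMap_static fun hl' => hst t ht _ (S.pos_spec hl').1 ?_
    by_contra h2
    exact hl ⟨hl', not_le.1 h2⟩
  have hWt : ∀ x ∈ cap e r, ContMDiffAt (𝓡 m) (jetModel m) ∞ (W t) x := fun x hx =>
    (hW.smooth t ht x hx).comp x
      ((contMDiffAt_const (c := t)).prodMk (contMDiffAt_id (x := x)))
  have hin : ∀ l ∈ sheetDomain N i e r a b σ, slideMap N κ i e r a b σ (W t) =ᶠ[𝓝 l]
      fun l' => N.pieceIncl κ (W t (sheetPos N i l')) := fun l hl => by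
    filter_upwards [S.isOpen_domain.mem_nhds hl] with l' hl' using slideMap_of_mem hl'
  have hout : ∀ l ∉ sheetDomain N i e r a b σ, slideMap N κ i e r a b σ (W t) =ᶠ[𝓝 l]
      fun l' => (N.outerChart κ).symm (i l') := fun l hl => by
    filter_upwards [hK.isClosed.isOpen_compl.mem_nhds (fun h2 => hl h2.1 : l ∈ Kᶜ)] with l' hl'
    exact hstat l' fun h2 => hl' ⟨h2.1, h2.2.le⟩
  have hg : ∀ l ∈ sheetDomain N i e r a b σ,
      ContMDiffAt (𝓡 m) (jetModel m) ∞ (fun l' => W t (sheetPos N i l')) l := fun l hl =>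
    (hWt _ (S.pos_spec hl).1).comp l (S.contMDiffAt_pos hl)
  have hdg : ∀ l ∈ sheetDomain N i e r a b σ,
      mfderiv (𝓡 m) (jetModel m) (fun l' => W t (sheetPos N i l')) l =
        (mfderiv (𝓡 m) (jetModel m) (W t) (sheetPos N i l)).comp
          (mfderiv (𝓡 m) (𝓡 m) (sheetPos N i) l) := fun l hl =>
    mfderiv_comp l ((hWt _ (S.pos_spec hl).1).mdifferentiableAt (by simp))
      ((S.contMDiffAt_pos hl).mdifferentiableAt (by simp))
  have hpc : ∀ l ∈ sheetDomain N i e r a b σ, W t (sheetPos N i l) ∈ N.piece κ := fun l hl =>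
    S.mem_piece (hW.admissible t ht _ (S.pos_spec hl).1)
  have hsm : ContMDiff (𝓡 m) (𝓡 (2 * m + 1)) ∞ (slideMap N κ i e r a b σ (W t)) := by
    intro l
    by_cases hl : l ∈ sheetDomain N i e r a b σ
    · exact (N.piece_map κ (hin l hl) (hpc l hl) (hg l hl)).1
    · exact N.contMDiffAt_of_eventuallyEq_outer κ (hout l hl) (S.not_mem_range l)
        (S.legendrian.smooth l)
  have hinj := S.slideMap_injective (hW.admissible t ht) (hW.injOn t ht)
  refine ⟨hsm, ?_, fun l => ?_, fun l v => ?_⟩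
  · refine (IsClosedEmbedding.of_continuous_injective_isClosedMap hsm.continuous hinj
      fun C hC => ?_).isEmbedding
    set V : Set L := {l | l ∈ sheetDomain N i e r a b σ ∧
      InnerProductGeometry.angle (sheetPos N i l : Euc m) (e : Euc m) < r'} with hVdef
    have hV : IsOpen V := by
      rw [isOpen_iff_mem_nhds]
      rintro l ⟨hl, hl'⟩
      have h1 : ContinuousAt (fun l => InnerProductGeometry.angle (sheetPos N i l : Euc m)
        (e : Euc m)) l := (continuous_angle_sph e).continuousAt.comp
          (S.contMDiffAt_pos hl).continuousAt
      filter_upwards [S.isOpen_domain.mem_nhds hl, h1 (isOpen_Iio.mem_nhds hl')] with l' h2 h3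
      exact ⟨h2, h3⟩
    have hCV : IsClosed (C \ V) := hC.sdiff hV
    have hic : IsClosedEmbedding i := ⟨S.legendrian.embedding, S.closed⟩
    have h1 : slideMap N κ i e r a b σ (W t) '' C =
        slideMap N κ i e r a b σ (W t) '' (C ∩ K) ∪ N.inSurgered κ (i '' (C \ V)) := by
      have h2 : N.inSurgered κ (i '' (C \ V)) = slideMap N κ i e r a b σ (W t) '' (C \ V) := by
        ext p
        constructor
        · rintro ⟨⟨_, hy⟩, ⟨l, hl, rfl⟩, rfl⟩
          exact ⟨l, hl, (hstat l hl.2).trans (N.outerChart_symm κ hy)⟩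
        · rintro ⟨l, hl, rfl⟩
          rw [hstat l hl.2, N.outerChart_symm κ (S.not_mem_range l)]
          exact ⟨⟨i l, S.not_mem_range l⟩, ⟨l, hl, rfl⟩, rfl⟩
      rw [h2, ← image_union]
      congr 1
      ext l
      constructor
      · intro hl
        by_cases h3 : l ∈ V
        · exact Or.inl ⟨hl, h3.1, h3.2.le⟩
        · exact Or.inr ⟨hl, h3⟩
      · rintro (hl | hl)
        · exact hl.1
        · exact hl.1
    rw [h1]
    refine IsClosed.union ?_ ?_
    · exact ((hK.inter_left hC).image hsm.continuous).isClosed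
    · refine N.isClosed_inSurgered κ (hic.isClosedMap _ hCV) ?_
      exact S.disj.mono_right (image_subset_range _ _)
  · by_cases hl : l ∈ sheetDomain N i e r a b σ
    · refine (N.piece_map κ (hin l hl) (hpc l hl) (hg l hl)).2.1 ?_
      rw [hdg l hl]
      exact (hW.immersion t ht _ (S.pos_spec hl).1).comp (S.injective_mfderiv_pos hl)
    · exact N.injective_mfderiv_outer κ (hout l hl) (S.not_mem_range l)
        (S.legendrian.smooth l) (S.legendrian.immersion l)
  · by_cases hl : l ∈ sheetDomain N i e r a b σ
    · refine (N.piece_map κ (hin l hl) (hpc l hl) (hg l hl)).2.2 v ?_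
      rw [hdg l hl]
      exact hW.isotropic t ht _ (S.pos_spec hl).1 _
    · exact N.tangent_outer κ (hout l hl) (S.not_mem_range l)
        (S.legendrian.smooth l) v (S.legendrian.tangent l v)

/-- The submanifold obtained from a sheet by replacing the disc in the Darboux chart. -/
def replaceDisc (N : StdNbhd ξ ℓ) (i : L → Y) (e : Sph m) (r a b σ : ℝ) (D : Set (Jet m)) :
    Set Y := (range i \ N.map '' frontBox e r a b σ) ∪ N.map '' D

lemma SheetSetting.range_slideMap {W : Sph m → Jet m}
    (hne : ∀ x ∈ cap e r, (W x).2 ≠ 0)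
    (hA : ∀ x ∈ cap e r, Admissible κ e r a b σ δ₀ (W x)) :
    (∀ l, ∃ y ∉ range ℓ, y ∈ replaceDisc N i e r a b σ ((fun x => gluing m κ (W x)) '' cap e r) ∧
      slideMap N κ i e r a b σ W l = (N.outerChart κ).symm y) ∧
    ∀ y ∈ replaceDisc N i e r a b σ ((fun x => gluing m κ (W x)) '' cap e r), y ∉ range ℓ ∧
      ∃ l, slideMap N κ i e r a b σ W l = (N.outerChart κ).symm y := by
  have hin : ∀ x ∈ cap e r, N.map (gluing m κ (W x)) ∉ range ℓ ∧
      N.pieceIncl κ (W x) = (N.outerChart κ).symm (N.map (gluing m κ (W x))) := fun x hx => by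
    have h1 := S.mem_overlap (hne x hx) (hA x hx)
    have h2 := N.overlap_not_mem κ h1
    refine ⟨h2, ?_⟩
    rw [N.pieceIncl_overlap κ h1]
    exact (N.outerChart_symm κ h2).symm
  constructor
  · intro l
    by_cases hl : l ∈ sheetDomain N i e r a b σ
    · obtain ⟨h1, h2⟩ := hin _ (S.pos_spec hl).1
      exact ⟨_, h1, Or.inr ⟨_, ⟨_, (S.pos_spec hl).1, rfl⟩, rfl⟩, (slideMap_of_mem hl).trans h2⟩
    · exact ⟨_, S.not_mem_range l, Or.inl ⟨⟨l, rfl⟩, hl⟩, slideMap_of_not_mem hl⟩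
  · rintro y (⟨⟨l, rfl⟩, hl⟩ | ⟨_, ⟨x, hx, rfl⟩, rfl⟩)
    · exact ⟨S.not_mem_range l, l, slideMap_of_not_mem hl⟩
    · obtain ⟨h1, h2⟩ := hin x hx
      obtain ⟨l, hl, h3, -⟩ := S.exists_pos hx
      exact ⟨h1, l, by rw [slideMap_of_mem hl, h3, h2]⟩

/-- A disc family that starts at the sheet and ends outside of the core is a compactly supported
Legendrian isotopy. -/
theorem SheetSetting.isotopic {W : ℝ → Sph m → Jet m}
    (hW : DiscFamily κ e r a b h σ δ₀ W)
    (h0 : ∀ x ∈ cap e r, (W 0 x).2 ≠ 0 ∧ gluing m κ (W 0 x) = jetMk x 0 (σ * h))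
    (h1 : ∀ x ∈ cap e r, (W 1 x).2 ≠ 0) :
    (∃ f : L → Y, IsLegendrianEmbedding ξ f ∧
      range f = replaceDisc N i e r a b σ ((fun x => gluing m κ (W 1 x)) '' cap e r)) ∧
    Disjoint (range ℓ) (replaceDisc N i e r a b σ ((fun x => gluing m κ (W 1 x)) '' cap e r)) ∧
    LegendrianIsotopic L (N.surgeredField κ) (N.inSurgered κ (range i))
      (N.inSurgered κ
        (replaceDisc N i e r a b σ ((fun x => gluing m κ (W 1 x)) '' cap e r))) := by
  have z0 : (0 : ℝ) ∈ Icc (0 : ℝ) 1 := ⟨le_rfl, zero_le_one⟩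
  have z1 : (1 : ℝ) ∈ Icc (0 : ℝ) 1 := ⟨zero_le_one, le_rfl⟩
  obtain ⟨hr1, hr2⟩ := S.range_slideMap h1 (hW.admissible 1 z1)
  have hdisj : Disjoint (range ℓ)
      (replaceDisc N i e r a b σ ((fun x => gluing m κ (W 1 x)) '' cap e r)) :=
    disjoint_right.2 fun y hy => (hr2 y hy).1
  refine ⟨?_, hdisj, ?_⟩
  · choose f hf1 hf2 hf3 using hr1
    have hF := S.slideMap_legendrian hW z1
    have hFf : slideMap N κ i e r a b σ (W 1) = fun l => (N.outerChart κ).symm (f l) := funext hf3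
    have hfF : f = fun l => N.outerChart κ (slideMap N κ i e r a b σ (W 1) l) := by
      funext l
      rw [hf3 l]
      exact ((N.outerChart κ).right_inv (hf1 l)).symm
    obtain ⟨r', hr', hst⟩ := hW.static
    have hK : IsCompact {l | l ∈ sheetDomain N i e r a b σ ∧
      InnerProductGeometry.angle (sheetPos N i l : Euc m) (e : Euc m) ≤ r'} := S.isCompact_core hr'
    have : T2Space L := S.legendrian.embedding.t2Space
    have hWt : ∀ x ∈ cap e r, ContMDiffAt (𝓡 m) (jetModel m) ∞ (W 1) x := fun x hx =>
      (hW.smooth 1 z1 x hx).comp x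
        ((contMDiffAt_const (c := (1 : ℝ))).prodMk (contMDiffAt_id (x := x)))
    have hfin : ∀ l ∈ sheetDomain N i e r a b σ,
        f =ᶠ[𝓝 l] fun l' => N.overlap κ (W 1 (sheetPos N i l')) := fun l hl => by
      filter_upwards [S.isOpen_domain.mem_nhds hl] with l' hl'
      have h3 := (S.pos_spec hl').1
      have h2 := S.mem_overlap (h1 _ h3) (hW.admissible 1 z1 _ h3)
      rw [hfF]
      simp only [slideMap_of_mem hl', N.pieceIncl_overlap κ h2]
      rfl
    have hfout : ∀ l ∉ sheetDomain N i e r a b σ, f =ᶠ[𝓝 l] i := fun l hl => by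
      filter_upwards [hK.isClosed.isOpen_compl.mem_nhds (fun h2 => hl h2.1)] with l' hl'
      rw [hfF]
      simp only
      rw [S.slideMap_static (W := W 1) fun h2 => hst 1 z1 _ (S.pos_spec h2).1
        (not_lt.1 fun h3 => hl' ⟨h2, h3.le⟩)]
      exact (N.outerChart κ).right_inv (S.not_mem_range l')
    have hgl : ∀ l (hl : l ∈ sheetDomain N i e r a b σ), _ := fun l hl =>
      N.map_gluing κ ((hWt _ (S.pos_spec hl).1).comp l (S.contMDiffAt_pos hl))
        (S.mem_overlap (h1 _ (S.pos_spec hl).1) (hW.admissible 1 z1 _ (S.pos_spec hl).1))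
    have hdg : ∀ l ∈ sheetDomain N i e r a b σ,
        mfderiv (𝓡 m) (jetModel m) (W 1 ∘ sheetPos N i) l =
          (mfderiv (𝓡 m) (jetModel m) (W 1) (sheetPos N i l)).comp
            (mfderiv (𝓡 m) (𝓡 m) (sheetPos N i) l) := fun l hl =>
      mfderiv_comp l ((hWt _ (S.pos_spec hl).1).mdifferentiableAt (by simp))
        ((S.contMDiffAt_pos hl).mdifferentiableAt (by simp))
    have hsm : ContMDiff (𝓡 m) (𝓡 (2 * m + 1)) ∞ f := fun l => by
      by_cases hl : l ∈ sheetDomain N i e r a b σ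
      · exact (hgl l hl).1.congr_of_eventuallyEq (hfin l hl)
      · exact (S.legendrian.smooth l).congr_of_eventuallyEq (hfout l hl)
    refine ⟨f, ⟨hsm, ?_, fun l => ?_, fun l v => ?_⟩, ?_⟩
    · have hc : Continuous fun l => (⟨f l, hf1 l⟩ : {y // y ∉ range ℓ}) :=
        hsm.continuous.subtype_mk _
      have hcomp : IsEmbedding (N.outerIncl κ ∘ fun l => (⟨f l, hf1 l⟩ : {y // y ∉ range ℓ})) := by
        have : (N.outerIncl κ ∘ fun l => (⟨f l, hf1 l⟩ : {y // y ∉ range ℓ})) =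
            slideMap N κ i e r a b σ (W 1) := by
          rw [hFf]; funext l
          exact (N.outerChart_symm κ (hf1 l)).symm
        rw [this]
        exact hF.embedding
      exact IsEmbedding.subtypeVal.comp (IsEmbedding.of_comp hc (N.continuous_outerIncl κ) hcomp)
    · by_cases hl : l ∈ sheetDomain N i e r a b σ
      · rw [(hfin l hl).mfderiv_eq]
        refine (hgl l hl).2.1 ?_
        rw [hdg l hl]
        exact (hW.immersion 1 z1 _ (S.pos_spec hl).1).comp (S.injective_mfderiv_pos hl)
      · rw [(hfout l hl).mfderiv_eq]
        exact S.legendrian.immersion l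
    · by_cases hl : l ∈ sheetDomain N i e r a b σ
      · rw [(hfin l hl).mfderiv_eq, (hfin l hl).eq_of_nhds]
        refine (hgl l hl).2.2 v ?_
        rw [hdg l hl]
        exact hW.isotropic 1 z1 _ (S.pos_spec hl).1 _
      · rw [(hfout l hl).mfderiv_eq, (hfout l hl).eq_of_nhds]
        exact S.legendrian.tangent l v
    · apply Subset.antisymm
      · rintro _ ⟨l, rfl⟩
        exact hf2 l
      · intro y hy
        obtain ⟨h2, l, h3⟩ := hr2 y hy
        refine ⟨l, ?_⟩
        rw [hfF]
        simp only [h3]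
        exact (N.outerChart κ).right_inv h2
  · obtain ⟨r', hr', hst⟩ := hW.static
    have hK : IsCompact {l | l ∈ sheetDomain N i e r a b σ ∧
      InnerProductGeometry.angle (sheetPos N i l : Euc m) (e : Euc m) ≤ r'} := S.isCompact_core hr'
    have : T2Space L := S.legendrian.embedding.t2Space
    have hstat : ∀ t ∈ Icc (0 : ℝ) 1, ∀ l ∉ {l | l ∈ sheetDomain N i e r a b σ ∧
        InnerProductGeometry.angle (sheetPos N i l : Euc m) (e : Euc m) ≤ r'},
        slideMap N κ i e r a b σ (W t) l = (N.outerChart κ).symm (i l) := by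
      intro t ht l hl
      refine S.slideMap_static fun hl' => hst t ht _ (S.pos_spec hl').1 ?_
      by_contra h2
      exact hl ⟨hl', (not_le.1 h2).le⟩
    refine ⟨fun t => slideMap N κ i e r a b σ (W t), ?_, fun t ht => S.slideMap_legendrian hW ht,
      ⟨_, hK, fun l hl t ht => (hstat t ht l hl).trans (hstat 0 z0 l hl).symm⟩, ?_, ?_⟩
    · rintro ⟨t, l⟩ ⟨ht, -⟩
      by_cases hl : l ∈ sheetDomain N i e r a b σ
      · refine ContMDiffAt.contMDiffWithinAt ?_
        refine (N.piece_map κ (g := fun p : ℝ × L => W p.1 (sheetPos N i p.2)) ?_ ?_ ?_).1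
        · have h2 : ∀ᶠ p : ℝ × L in 𝓝 (t, l), p.2 ∈ sheetDomain N i e r a b σ :=
            continuous_snd.continuousAt (S.isOpen_domain.mem_nhds hl)
          filter_upwards [h2] with p hp using slideMap_of_mem hp
        · exact S.mem_piece (hW.admissible t ht _ (S.pos_spec hl).1)
        · have h3 : ContMDiffAt (𝓘(ℝ, ℝ).prod (𝓡 m)) (𝓘(ℝ, ℝ).prod (𝓡 m)) ∞
              (fun p : ℝ × L => (p.1, sheetPos N i p.2)) (t, l) :=
            contMDiffAt_fst.prodMk (ContMDiffAt.comp (t, l) (g := sheetPos N i) (f := Prod.snd)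
              (S.contMDiffAt_pos hl) contMDiffAt_snd)
          exact (hW.smooth t ht _ (S.pos_spec hl).1).comp (t, l) h3
      · have h2 : ContMDiffAt (𝓘(ℝ, ℝ).prod (𝓡 m)) (𝓡 (2 * m + 1)) ∞
            (fun p : ℝ × L => (N.outerChart κ).symm (i p.2)) (t, l) :=
          N.contMDiffAt_of_eventuallyEq_outer κ (g := fun p : ℝ × L => i p.2)
            Filter.EventuallyEq.rfl (S.not_mem_range l)
            ((S.legendrian.smooth l).comp (t, l) contMDiffAt_snd)
        refine h2.contMDiffWithinAt.congr_of_eventuallyEq ?_ ?_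
        · have h3 : ∀ᶠ p : ℝ × L in 𝓝 (t, l), p.2 ∉ {l | l ∈ sheetDomain N i e r a b σ ∧
              InnerProductGeometry.angle (sheetPos N i l : Euc m) (e : Euc m) ≤ r'} :=
            continuous_snd.continuousAt
              (hK.isClosed.isOpen_compl.mem_nhds (fun h4 => hl h4.1))
          filter_upwards [nhdsWithin_le_nhds h3, self_mem_nhdsWithin] with p hp hp'
          exact hstat p.1 hp'.1 p.2 hp
        · exact hstat t ht l fun h4 => hl h4.1
    · apply Subset.antisymm
      · rintro _ ⟨l, rfl⟩
        refine ⟨⟨i l, S.not_mem_range l⟩, ⟨l, rfl⟩, ?_⟩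
        exact ((S.slideMap_static (W := W 0) fun h2 => h0 _ (S.pos_spec h2).1).trans
          (N.outerChart_symm κ (S.not_mem_range l))).symm
      · rintro _ ⟨⟨_, hy⟩, ⟨l, rfl⟩, rfl⟩
        exact ⟨l, (S.slideMap_static (W := W 0) fun h2 => h0 _ (S.pos_spec h2).1).trans
          (N.outerChart_symm κ hy)⟩
    · apply Subset.antisymm
      · rintro _ ⟨l, rfl⟩
        obtain ⟨y, h2, h3, h4⟩ := hr1 l
        refine ⟨⟨y, h2⟩, h3, ?_⟩
        simp only [h4]
        exact (N.outerChart_symm κ h2).symm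
      · rintro _ ⟨⟨y, hy⟩, hy', rfl⟩
        obtain ⟨h2, l, h3⟩ := hr2 y hy'
        refine ⟨l, ?_⟩
        simp only [h3]
        exact N.outerChart_symm κ hy

end SlideMap

end Framework

lemma DiscFamily.concat {κ : SurgerySign} {e : Sph m} {r a b h σ δ₀ : ℝ}
    {W₁ W₂ : ℝ → Sph m → Jet m} (h₁ : DiscFamily κ e r a b h σ δ₀ W₁)
    (h₂ : DiscFamily κ e r a b h σ δ₀ W₂) (hm : ∀ x ∈ cap e r, W₁ 1 x = W₂ 0 x) :
    DiscFamily κ e r a b h σ δ₀ (fun t => if t ≤ 1 / 2 then W₁ (Real.smoothTransition (4 * t))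
      else W₂ (Real.smoothTransition (4 * t - 3))) := by
  have hS : ∀ t : ℝ, Real.smoothTransition t ∈ Icc (0 : ℝ) 1 := fun t =>
    ⟨Real.smoothTransition.nonneg t, Real.smoothTransition.le_one t⟩
  have key : ∀ (P : (Sph m → Jet m) → Prop), (∀ t ∈ Icc (0 : ℝ) 1, P (W₁ t)) →
      (∀ t ∈ Icc (0 : ℝ) 1, P (W₂ t)) → ∀ t ∈ Icc (0 : ℝ) 1,
      P (if t ≤ 1 / 2 then W₁ (Real.smoothTransition (4 * t))
        else W₂ (Real.smoothTransition (4 * t - 3))) := by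
    intro P hP₁ hP₂ t _
    split_ifs
    · exact hP₁ _ (hS _)
    · exact hP₂ _ (hS _)
  have sm : ∀ (W : ℝ → Sph m → Jet m) (k : ℝ), DiscFamily κ e r a b h σ δ₀ W → ∀ t : ℝ,
      ∀ x ∈ cap e r, ContMDiffAt (𝓘(ℝ, ℝ).prod (𝓡 m)) (jetModel m) ∞
        (fun p : ℝ × Sph m => W (Real.smoothTransition (4 * p.1 - k)) p.2) (t, x) := by
    intro W k hW t x hx
    have h3 : ContMDiffAt (𝓘(ℝ, ℝ).prod (𝓡 m)) (𝓘(ℝ, ℝ).prod (𝓡 m)) ∞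
        (fun p : ℝ × Sph m => (Real.smoothTransition (4 * p.1 - k), p.2)) (t, x) := by
      refine ContMDiffAt.prodMk ?_ contMDiffAt_snd
      have h4 : ContDiff ℝ ∞ fun t : ℝ => Real.smoothTransition (4 * t - k) :=
        Real.smoothTransition.contDiff.comp (by fun_prop)
      exact h4.contMDiff.contMDiffAt.comp (t, x) contMDiffAt_fst
    exact (hW.smooth _ (hS _) x hx).comp (t, x) h3
  constructor
  · intro t _ x hx
    have hx' : ∀ᶠ p : ℝ × Sph m in 𝓝 (t, x), p.2 ∈ cap e r :=
      continuous_snd.continuousAt ((isOpen_cap e r).mem_nhds hx)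
    rcases lt_or_ge (1 / 4) t with ht | ht
    · rcases lt_or_ge t (3 / 4) with ht' | ht'
      · refine (sm W₁ 0 h₁ t x hx).congr_of_eventuallyEq ?_
        have h5 : ∀ᶠ p : ℝ × Sph m in 𝓝 (t, x), p.1 ∈ Ioo (1 / 4) (3 / 4) :=
          continuous_fst.continuousAt (isOpen_Ioo.mem_nhds ⟨ht, ht'⟩)
        filter_upwards [h5, hx'] with p hp hpx
        simp only [Function.uncurry]
        split_ifs with h6
        · rw [sub_zero]
        · rw [Real.smoothTransition.zero_of_nonpos (by linarith [hp.2]),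
            Real.smoothTransition.one_of_one_le (by linarith [hp.1]), hm _ hpx]
      · refine (sm W₂ 3 h₂ t x hx).congr_of_eventuallyEq ?_
        have h5 : ∀ᶠ p : ℝ × Sph m in 𝓝 (t, x), p.1 ∈ Ioi (1 / 2 : ℝ) :=
          continuous_fst.continuousAt (isOpen_Ioi.mem_nhds (by simp only [mem_Ioi]; linarith))
        filter_upwards [h5] with p hp
        simp only [Function.uncurry]
        rw [if_neg (not_le.2 hp)]
    · refine (sm W₁ 0 h₁ t x hx).congr_of_eventuallyEq ?_
      have h5 : ∀ᶠ p : ℝ × Sph m in 𝓝 (t, x), p.1 ∈ Iio (1 / 2 : ℝ) :=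
        continuous_fst.continuousAt (isOpen_Iio.mem_nhds (by simp only [mem_Iio]; linarith))
      filter_upwards [h5] with p hp
      simp only [Function.uncurry]
      rw [if_pos (le_of_lt hp), sub_zero]
  · exact key (fun w => ∀ x ∈ cap e r, Admissible κ e r a b σ δ₀ (w x)) h₁.admissible h₂.admissible
  · exact key (fun w => InjOn w (cap e r)) h₁.injOn h₂.injOn
  · exact key (fun w => ∀ x ∈ cap e r, Function.Injective (mfderiv (𝓡 m) (jetModel m) w x))
      h₁.immersion h₂.immersion
  · exact key (fun w => ∀ x ∈ cap e r, ∀ v : EuclideanSpace ℝ (Fin m),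
      jetForm (w x) (mfderiv (𝓡 m) (jetModel m) w x v) = 0) h₁.isotropic h₂.isotropic
  · obtain ⟨r₁, hr₁, hs₁⟩ := h₁.static
    obtain ⟨r₂, hr₂, hs₂⟩ := h₂.static
    refine ⟨max r₁ r₂, max_lt hr₁ hr₂, ?_⟩
    exact key (fun w => ∀ x ∈ cap e r,
      max r₁ r₂ ≤ InnerProductGeometry.angle (x : Euc m) (e : Euc m) →
      (w x).2 ≠ 0 ∧ gluing m κ (w x) = jetMk x 0 (σ * h))
      (fun t ht x hx hr => hs₁ t ht x hx (le_of_max_le_left hr))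
      (fun t ht x hx hr => hs₂ t ht x hx (le_of_max_le_right hr))

/-! ### Rotationally symmetric families in the handle -/

/-- The angle between a vector of unit length and the axis. -/
def axisAngle (e : Sph m) (x : Euc m) : ℝ := Real.arccos ⟪x, (e : Euc m)⟫

lemma axisAngle_eq (e x : Sph m) :
    axisAngle e x = InnerProductGeometry.angle (x : Euc m) (e : Euc m) := by
  rw [axisAngle, InnerProductGeometry.angle, norm_sph, norm_sph, mul_one, div_one]

lemma abs_inner_sph_le (e x : Sph m) : |⟪(x : Euc m), (e : Euc m)⟫| ≤ 1 := by
  have := abs_real_inner_le_norm (x : Euc m) (e : Euc m)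
  rwa [norm_sph, norm_sph, mul_one] at this

lemma cos_axisAngle (e x : Sph m) : Real.cos (axisAngle e x) = ⟪(x : Euc m), (e : Euc m)⟫ :=
  Real.cos_arccos (neg_le_of_abs_le (abs_inner_sph_le e x)) (le_of_abs_le (abs_inner_sph_le e x))

/-- The component of a vector orthogonal to the axis. -/
def offAxis (e : Sph m) (x : Euc m) : Euc m := x - ⟪x, (e : Euc m)⟫ • (e : Euc m)

lemma inner_offAxis (e : Sph m) (x : Euc m) : ⟪offAxis e x, (e : Euc m)⟫ = 0 := by
  simp only [offAxis, inner_sub_left, real_inner_smul_left, inner_self_sph]; ring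

lemma inner_offAxis_self (e x : Sph m) :
    ⟪offAxis e x, offAxis e (x : Euc m)⟫ = Real.sin (axisAngle e x) ^ 2 := by
  have h : ⟪offAxis e x, (x : Euc m)⟫ = 1 - ⟪(x : Euc m), (e : Euc m)⟫ ^ 2 := by
    simp only [offAxis, inner_sub_left, real_inner_smul_left, inner_self_sph,
      real_inner_comm (x : Euc m) (e : Euc m)]; ring
  have h2 : ⟪offAxis e x, offAxis e (x : Euc m)⟫ = ⟪offAxis e x, (x : Euc m)⟫ -
      ⟪(x : Euc m), (e : Euc m)⟫ * ⟪offAxis e x, (e : Euc m)⟫ := by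
    conv_lhs => enter [3]; rw [offAxis]
    rw [inner_sub_right, real_inner_smul_right]
  rw [h2, h, inner_offAxis, Real.sin_sq, cos_axisAngle]; ring

/-- The vector with given components along the axis and along the direction of `x` orthogonal to the
axis. -/
def spin (e : Sph m) (u v : ℝ) (x : Euc m) : Euc m :=
  u • (e : Euc m) + (v / Real.sin (axisAngle e x)) • offAxis e x

/-- Four functions of time and angle, the coordinates of a plane family in the handle. -/
structure PlaneFamily where
  /-- the axial component of `q` -/
  q₁ : ℝ → ℝ → ℝ
  /-- the radial component of `q` -/
  q₂ : ℝ → ℝ → ℝ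
  /-- the axial component of `p` -/
  p₁ : ℝ → ℝ → ℝ
  /-- the radial component of `p` -/
  p₂ : ℝ → ℝ → ℝ

namespace PlaneFamily

/-- The family obtained by rotation about the axis. -/
def spun (f : PlaneFamily) (e : Sph m) (s : ℝ) (x : Euc m) : Euc m × Euc m :=
  (spin e (f.q₁ s (axisAngle e x)) (f.q₂ s (axisAngle e x)) x,
    spin e (f.p₁ s (axisAngle e x)) (f.p₂ s (axisAngle e x)) x)

/-- Plane families which spin to families of isotropic immersed discs that are embedded modulo the
Liouville flow. -/
structure IsGood (f : PlaneFamily) (r : ℝ) : Prop where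
  smooth : ∀ s ∈ Icc (0 : ℝ) 1, ∀ R, 0 < R → R < r →
    ContDiffAt ℝ ∞ (Function.uncurry f.q₁) (s, R) ∧ ContDiffAt ℝ ∞ (Function.uncurry f.q₂) (s, R) ∧
    ContDiffAt ℝ ∞ (Function.uncurry f.p₁) (s, R) ∧ ContDiffAt ℝ ∞ (Function.uncurry f.p₂) (s, R)
  center : ∃ δ > 0, ∃ α β γ η : ℝ → ℝ, ContDiff ℝ ∞ α ∧ ContDiff ℝ ∞ β ∧ ContDiff ℝ ∞ γ ∧
    ContDiff ℝ ∞ η ∧ (∀ s ∈ Icc (0 : ℝ) 1, β s ≠ 0 ∨ η s ≠ 0) ∧ ∀ s R, 0 ≤ R → R < δ →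
      f.q₁ s R = α s * Real.cos R ∧ f.q₂ s R = β s * Real.sin R ∧
      f.p₁ s R = γ s * Real.cos R ∧ f.p₂ s R = η s * Real.sin R
  liouville : ∀ s ∈ Icc (0 : ℝ) 1, ∀ R, 0 < R → R < r →
    f.p₁ s R * deriv (f.q₁ s) R + f.p₂ s R * deriv (f.q₂ s) R +
      2 * (f.q₁ s R * deriv (f.p₁ s) R + f.q₂ s R * deriv (f.p₂ s) R) = 0
  immersion : ∀ s ∈ Icc (0 : ℝ) 1, ∀ R, 0 < R → R < r → ∀ ρ μ : ℝ,
    ρ * deriv (f.q₁ s) R = 2 * μ * f.q₁ s R → ρ * deriv (f.q₂ s) R = 2 * μ * f.q₂ s R →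
    ρ * deriv (f.p₁ s) R = -μ * f.p₁ s R → ρ * deriv (f.p₂ s) R = -μ * f.p₂ s R → ρ = 0
  off_axis : ∀ s ∈ Icc (0 : ℝ) 1, ∀ R, 0 < R → R < r → f.q₂ s R ≠ 0 ∨ f.p₂ s R ≠ 0
  injective : ∀ s ∈ Icc (0 : ℝ) 1, ∀ R R', 0 < R → R < r → 0 < R' → R' < r → ∀ l τ : ℝ, 0 < l →
    τ = 1 ∨ τ = -1 → f.q₁ s R' = l ^ 2 * f.q₁ s R → f.q₂ s R' = τ * (l ^ 2 * f.q₂ s R) →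
    f.p₁ s R' = l⁻¹ * f.p₁ s R → f.p₂ s R' = τ * (l⁻¹ * f.p₂ s R) → R = R'

end PlaneFamily

lemma inner_spin_axis (e : Sph m) (u v : ℝ) (x : Euc m) : ⟪spin e u v x, (e : Euc m)⟫ = u := by
  simp only [spin, inner_add_left, real_inner_smul_left, inner_self_sph, inner_offAxis]; ring

lemma inner_spin_spin (e x : Sph m) (hx : Real.sin (axisAngle e x) ≠ 0) (u v u' v' : ℝ) :
    ⟪spin e u v x, spin e u' v' (x : Euc m)⟫ = u * u' + v * v' := by
  simp only [spin, inner_add_left, inner_add_right, real_inner_smul_left, real_inner_smul_right,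
    inner_self_sph, inner_offAxis, inner_offAxis_self,
    real_inner_comm (offAxis e x) (e : Euc m)]
  field_simp
  ring

/-- The unit vector orthogonal to the axis. -/
def radial (e : Sph m) (x : Euc m) : Euc m := (Real.sin (axisAngle e x))⁻¹ • offAxis e x

lemma spin_eq (e : Sph m) (u v : ℝ) (x : Euc m) :
    spin e u v x = u • (e : Euc m) + v • radial e x := by
  rw [spin, radial, smul_smul, div_eq_mul_inv]

lemma norm_radial (e x : Sph m) (hx : Real.sin (axisAngle e x) ≠ 0) : ‖radial e (x : Euc m)‖ = 1 := by
  have h : ‖radial e (x : Euc m)‖ ^ 2 = 1 := by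
    rw [← real_inner_self_eq_norm_sq, radial, real_inner_smul_left, real_inner_smul_right,
      inner_offAxis_self]
    field_simp
  exact (pow_eq_one_iff_of_nonneg (norm_nonneg _) two_ne_zero).1 h

lemma inner_radial (e : Sph m) (x : Euc m) : ⟪radial e x, (e : Euc m)⟫ = 0 := by
  rw [radial, real_inner_smul_left, inner_offAxis, mul_zero]

lemma sph_eq_spin (e x : Sph m) (hx : Real.sin (axisAngle e x) ≠ 0) :
    (x : Euc m) = spin e (Real.cos (axisAngle e x)) (Real.sin (axisAngle e x)) x := by
  rw [spin, div_self hx, cos_axisAngle, offAxis]; module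

lemma sin_axisAngle_pos {e x : Sph m} {r : ℝ} (hr : r < Real.pi) (hx : x ∈ cap e r)
    (h0 : axisAngle e (x : Euc m) ≠ 0) :
    0 < axisAngle e (x : Euc m) ∧ axisAngle e (x : Euc m) < r ∧
      0 < Real.sin (axisAngle e (x : Euc m)) := by
  have h1 : 0 < axisAngle e (x : Euc m) := lt_of_le_of_ne (Real.arccos_nonneg _) (Ne.symm h0)
  have h2 : axisAngle e (x : Euc m) < r := by rw [axisAngle_eq]; exact hx
  exact ⟨h1, h2, Real.sin_pos_of_pos_of_lt_pi h1 (h2.trans hr)⟩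

lemma eq_axis_of_axisAngle {e x : Sph m} (h0 : axisAngle e (x : Euc m) = 0) : x = e := by
  have h1 := cos_axisAngle e x
  rw [h0, Real.cos_zero] at h1
  exact Subtype.ext ((inner_eq_one_iff_of_norm_eq_one (norm_sph x) (norm_sph e)).1 h1.symm)

lemma eq_or_eq_neg_of_smul {u u' : Euc m} {a b : ℝ} (hu : ‖u‖ = 1) (hu' : ‖u'‖ = 1)
    (h : a • u' = b • u) (hb : b ≠ 0) : ∃ τ : ℝ, (τ = 1 ∨ τ = -1) ∧ u' = τ • u := by
  have h1 : |a| = |b| := by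
    have := congrArg norm h
    rwa [norm_smul, norm_smul, hu, hu', mul_one, mul_one] at this
  rcases abs_eq_abs.1 h1 with rfl | rfl
  · exact ⟨1, Or.inl rfl, by rw [one_smul]; exact smul_right_injective _ hb h⟩
  · refine ⟨-1, Or.inr rfl, ?_⟩
    have h2 : b • u' = b • ((-1 : ℝ) • u) := by
      rw [smul_smul, mul_neg_one, neg_smul, ← h, neg_smul, neg_neg]
    exact smul_right_injective _ hb h2

lemma coeff_eq_of_smul {u u' : Euc m} {a b τ : ℝ} (hu : ‖u‖ = 1) (hτ : τ = 1 ∨ τ = -1)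
    (h1 : u' = τ • u) (h : a • u' = b • u) : a = τ * b := by
  have hu0 : u ≠ 0 := by rw [← norm_ne_zero_iff, hu]; exact one_ne_zero
  rw [h1, smul_smul] at h
  have h2 : a * τ = b := smul_left_injective ℝ hu0 h
  rcases hτ with rfl | rfl <;> linarith

namespace PlaneFamily

variable {f : PlaneFamily} {r : ℝ} (hf : f.IsGood r) (hr : r < Real.pi) {e : Sph m}

include hf hr

lemma IsGood.spun_injective {s : ℝ} (hs : s ∈ Icc (0 : ℝ) 1) {x x' : Sph m} (hx : x ∈ cap e r)
    (hx' : x' ∈ cap e r) {l : ℝ} (hl : 0 < l) (h1 : (f.spun e s x').1 = l ^ 2 • (f.spun e s x).1)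
    (h2 : (f.spun e s x').2 = l⁻¹ • (f.spun e s x).2) : x = x' := by
  simp only [spun, spin_eq, smul_add, smul_smul] at h1 h2
  have a1 := congrArg (fun v => ⟪v, (e : Euc m)⟫) h1
  have a2 := congrArg (fun v => ⟪v, (e : Euc m)⟫) h2
  simp only [inner_add_left, real_inner_smul_left, inner_self_sph, inner_radial, mul_one,
    mul_zero, add_zero] at a1 a2
  rw [a1] at h1
  rw [a2] at h2
  have b1 := add_left_cancel h1
  have b2 := add_left_cancel h2
  by_cases h0 : axisAngle e (x : Euc m) = 0
  · by_cases h0' : axisAngle e (x' : Euc m) = 0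
    · rw [eq_axis_of_axisAngle h0, eq_axis_of_axisAngle h0']
    · obtain ⟨c1, c2, c3⟩ := sin_axisAngle_pos hr hx' h0'
      have hu := norm_radial e x' c3.ne'
      have hu0 : radial e (x' : Euc m) ≠ 0 := by
        rw [← norm_ne_zero_iff, hu]; exact one_ne_zero
      have hz : radial e (x : Euc m) = 0 := by rw [radial, h0]; simp
      rw [hz, smul_zero] at b1 b2
      have d1 := (smul_eq_zero.1 b1).resolve_right hu0
      have d2 := (smul_eq_zero.1 b2).resolve_right hu0
      rcases hf.off_axis s hs _ c1 c2 with h | h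
      · exact absurd d1 h
      · exact absurd d2 h
  · obtain ⟨c1, c2, c3⟩ := sin_axisAngle_pos hr hx h0
    have hu := norm_radial e x c3.ne'
    have hu0 : radial e (x : Euc m) ≠ 0 := by
      rw [← norm_ne_zero_iff, hu]; exact one_ne_zero
    have hl2 : l ^ 2 ≠ 0 := by positivity
    by_cases h0' : axisAngle e (x' : Euc m) = 0
    · have hz : radial e (x' : Euc m) = 0 := by rw [radial, h0']; simp
      rw [hz, smul_zero] at b1 b2
      have d1 := (smul_eq_zero.1 b1.symm).resolve_right hu0
      have d2 := (smul_eq_zero.1 b2.symm).resolve_right hu0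
      rcases hf.off_axis s hs _ c1 c2 with h | h
      · exact absurd ((mul_eq_zero.1 d1).resolve_left hl2) h
      · exact absurd ((mul_eq_zero.1 d2).resolve_left (inv_ne_zero hl.ne')) h
    · obtain ⟨c1', c2', c3'⟩ := sin_axisAngle_pos hr hx' h0'
      have hu' := norm_radial e x' c3'.ne'
      obtain ⟨τ, hτ, hτu⟩ : ∃ τ : ℝ, (τ = 1 ∨ τ = -1) ∧
          radial e (x' : Euc m) = τ • radial e (x : Euc m) := by
        rcases hf.off_axis s hs _ c1 c2 with h | h
        · exact eq_or_eq_neg_of_smul hu hu' b1 (mul_ne_zero hl2 h)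
        · exact eq_or_eq_neg_of_smul hu hu' b2 (mul_ne_zero (inv_ne_zero hl.ne') h)
      have d1 := coeff_eq_of_smul hu hτ hτu b1
      have d2 := coeff_eq_of_smul hu hτ hτu b2
      have hR := hf.injective s hs _ _ c1 c2 c1' c2' l τ hl hτ a1 d1 a2 d2
      have hτ1 : τ = 1 := by
        rcases hτ with h | h
        · exact h
        · exfalso
          rw [← hR, h] at d1 d2
          rcases hf.off_axis s hs _ c1 c2 with h3 | h3
          · have : (1 + l ^ 2) * f.q₂ s (axisAngle e (x : Euc m)) = 0 := by linarith
            rcases mul_eq_zero.1 this with h4 | h4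
            · nlinarith [sq_nonneg l]
            · exact h3 h4
          · have : (1 + l⁻¹) * f.p₂ s (axisAngle e (x : Euc m)) = 0 := by linarith
            have hli := inv_pos.2 hl
            rcases mul_eq_zero.1 this with h4 | h4
            · linarith
            · exact h3 h4
      apply Subtype.ext
      rw [sph_eq_spin e x c3.ne', sph_eq_spin e x' c3'.ne', spin_eq, spin_eq, hτu, hτ1, hR, one_smul]

omit hf hr in
lemma contDiffAt_spin {n : WithTop ℕ∞} {u v : ℝ → ℝ → ℝ} {s : ℝ} {x : Euc m}
    (hc : ⟪x, (e : Euc m)⟫ ∈ Ioo (-1 : ℝ) 1)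
    (hu : ContDiffAt ℝ n (Function.uncurry u) (s, axisAngle e x))
    (hv : ContDiffAt ℝ n (Function.uncurry v) (s, axisAngle e x)) :
    ContDiffAt ℝ n (fun z : ℝ × Euc m =>
      spin e (u z.1 (axisAngle e z.2)) (v z.1 (axisAngle e z.2)) z.2) (s, x) := by
  have hi : ContDiffAt ℝ n (fun z : ℝ × Euc m => ⟪z.2, (e : Euc m)⟫) (s, x) :=
    contDiffAt_snd.inner ℝ contDiffAt_const
  have hR : ContDiffAt ℝ n (fun z : ℝ × Euc m => axisAngle e z.2) (s, x) :=
    (Real.contDiffAt_arccos hc.1.ne' hc.2.ne).comp (s, x) hi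
  have hp : ContDiffAt ℝ n (fun z : ℝ × Euc m => (z.1, axisAngle e z.2)) (s, x) :=
    contDiffAt_fst.prodMk hR
  have hu' := hu.comp (s, x) hp
  have hv' := hv.comp (s, x) hp
  have hs : Real.sin (axisAngle e x) ≠ 0 := by
    rw [axisAngle, Real.sin_arccos]
    refine (Real.sqrt_pos.2 ?_).ne'
    nlinarith [hc.1, hc.2]
  have hsin : ContDiffAt ℝ n (fun z : ℝ × Euc m => Real.sin (axisAngle e z.2)) (s, x) :=
    (Real.contDiff_sin.contDiffAt).comp (s, x) hR
  have ho : ContDiffAt ℝ n (fun z : ℝ × Euc m => offAxis e z.2) (s, x) :=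
    contDiffAt_snd.sub (hi.smul contDiffAt_const)
  exact (hu'.smul contDiffAt_const).add ((hv'.div hsin hs).smul ho)

omit hf hr in
lemma spin_center {α β : ℝ} (e x : Sph m) : spin e (α * Real.cos (axisAngle e x))
    (β * Real.sin (axisAngle e x)) (x : Euc m) =
      (α * ⟪(x : Euc m), (e : Euc m)⟫) • (e : Euc m) + β • offAxis e x := by
  rw [spin, cos_axisAngle]
  congr 1
  by_cases h : Real.sin (axisAngle e x) = 0
  · have h2 := inner_offAxis_self e x
    rw [h] at h2
    have h3 : offAxis e (x : Euc m) = 0 := by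
      rw [← inner_self_eq_zero (𝕜 := ℝ), h2]; norm_num
    rw [h3, smul_zero, smul_zero]
  · rw [mul_div_cancel_right₀ _ h]

omit hr in
lemma IsGood.eventually_center (e : Sph m) : ∃ α β γ η : ℝ → ℝ, ContDiff ℝ ∞ α ∧ ContDiff ℝ ∞ β ∧
    ContDiff ℝ ∞ γ ∧ ContDiff ℝ ∞ η ∧ (∀ s ∈ Icc (0 : ℝ) 1, β s ≠ 0 ∨ η s ≠ 0) ∧
    ∀ᶠ x : Sph m in 𝓝 e, ∀ s, f.spun e s x =
      ((α s * ⟪(x : Euc m), (e : Euc m)⟫) • (e : Euc m) + β s • offAxis e x,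
        (γ s * ⟪(x : Euc m), (e : Euc m)⟫) • (e : Euc m) + η s • offAxis e x) := by
  obtain ⟨δ, hδ, α, β, γ, η, h1, h2, h3, h4, h5, h6⟩ := hf.center
  refine ⟨α, β, γ, η, h1, h2, h3, h4, h5, ?_⟩
  have h7 : axisAngle e (e : Euc m) = 0 := by rw [axisAngle, inner_self_sph, Real.arccos_one]
  have h8 : ContinuousAt (fun x : Sph m => axisAngle e (x : Euc m)) e := by
    simp only [axisAngle_eq]; exact (continuous_angle_sph e).continuousAt
  have h9 : ∀ᶠ x : Sph m in 𝓝 e, axisAngle e (x : Euc m) < δ := by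
    refine h8 (isOpen_Iio.mem_nhds ?_)
    simp only [mem_Iio, h7]; exact hδ
  filter_upwards [h9] with x hx s
  obtain ⟨k1, k2, k3, k4⟩ := h6 s (axisAngle e (x : Euc m)) (Real.arccos_nonneg _) hx
  simp only [spun]
  rw [k1, k2, k3, k4, spin_center, spin_center]

lemma IsGood.contMDiffAt_spun {s : ℝ} (hs : s ∈ Icc (0 : ℝ) 1) {x : Sph m} (hx : x ∈ cap e r) :
    ContMDiffAt (𝓘(ℝ, ℝ).prod (𝓡 m)) 𝓘(ℝ, Euc m × Euc m) ∞
      (fun z : ℝ × Sph m => f.spun e z.1 (z.2 : Euc m)) (s, x) := by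
  have hcoe : ContMDiffAt (𝓘(ℝ, ℝ).prod (𝓡 m)) 𝓘(ℝ, ℝ × Euc m) ∞
      (fun z : ℝ × Sph m => (z.1, (z.2 : Euc m))) (s, x) := by
    refine ContMDiffAt.prodMk_space contMDiffAt_fst ?_
    exact contMDiffAt_sphere_iff.1 contMDiffAt_snd
  by_cases h0 : axisAngle e (x : Euc m) = 0
  · have hxe := eq_axis_of_axisAngle h0
    subst hxe
    obtain ⟨α, β, γ, η, h1, h2, h3, h4, h5, h6⟩ := hf.eventually_center x
    have hi : ContDiff ℝ ∞ (fun z : ℝ × Euc m => ⟪z.2, (x : Euc m)⟫) :=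
      contDiff_snd.inner ℝ contDiff_const
    have ho : ContDiff ℝ ∞ (fun z : ℝ × Euc m => offAxis x z.2) :=
      contDiff_snd.sub (hi.smul contDiff_const)
    have hG : ContDiff ℝ ∞ (fun z : ℝ × Euc m =>
        ((α z.1 * ⟪z.2, (x : Euc m)⟫) • (x : Euc m) + β z.1 • offAxis x z.2,
        (γ z.1 * ⟪z.2, (x : Euc m)⟫) • (x : Euc m) + η z.1 • offAxis x z.2)) :=
      ((((h1.comp contDiff_fst).mul hi).smul contDiff_const).add
        ((h2.comp contDiff_fst).smul ho)).prodMk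
      ((((h3.comp contDiff_fst).mul hi).smul contDiff_const).add
        ((h4.comp contDiff_fst).smul ho))
    refine (ContDiffAt.comp_contMDiffAt hG.contDiffAt hcoe).congr_of_eventuallyEq ?_
    have h7 : ∀ᶠ z : ℝ × Sph m in 𝓝 (s, x), ∀ s, f.spun x s z.2 =
      ((α s * ⟪(z.2 : Euc m), (x : Euc m)⟫) • (x : Euc m) + β s • offAxis x z.2,
        (γ s * ⟪(z.2 : Euc m), (x : Euc m)⟫) • (x : Euc m) + η s • offAxis x z.2) :=
      (continuous_snd.tendsto (s, x)).eventually h6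
    filter_upwards [h7] with z hz using hz z.1
  · obtain ⟨c1, c2, c3⟩ := sin_axisAngle_pos hr hx h0
    obtain ⟨k1, k2, k3, k4⟩ := hf.smooth s hs _ c1 c2
    have hc : ⟪(x : Euc m), (e : Euc m)⟫ ∈ Ioo (-1 : ℝ) 1 := by
      rw [← cos_axisAngle, mem_Ioo]
      have := Real.sin_sq_add_cos_sq (axisAngle e (x : Euc m))
      constructor <;> nlinarith
    exact ContDiffAt.comp_contMDiffAt (f := fun z : ℝ × Sph m => (z.1, (z.2 : Euc m)))
      (g := fun z : ℝ × Euc m => f.spun e z.1 z.2)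
      ((contDiffAt_spin hc k1 k2).prodMk (contDiffAt_spin hc k3 k4)) hcoe

/-- The derivative of a spun family along a curve on the sphere. -/
lemma IsGood.exists_deriv {s : ℝ} (hs : s ∈ Icc (0 : ℝ) 1) {γ : ℝ → Sph m} {w : Euc m}
    (hγ : HasDerivAt (fun t => (γ t : Euc m)) w 0) (hx : γ 0 ∈ cap e r) :
    ∃ a', HasDerivAt (fun t => f.spun e s (γ t : Euc m)) a' 0 ∧
      liouvilleForm (f.spun e s (γ 0 : Euc m)) a' = 0 ∧
      ∀ μ : ℝ, a' = ((2 * μ) • (f.spun e s (γ 0 : Euc m)).1, -μ • (f.spun e s (γ 0 : Euc m)).2) →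
        w = 0 := by
  have horth := inner_deriv_eq_zero hγ (Filter.Eventually.of_forall fun t => norm_sph (γ t))
  have hc : HasDerivAt (fun t => ⟪(γ t : Euc m), (e : Euc m)⟫) ⟪w, (e : Euc m)⟫ 0 := by
    simpa using hγ.inner ℝ (hasDerivAt_const (0 : ℝ) (e : Euc m))
  have ho : HasDerivAt (fun t => offAxis e (γ t : Euc m)) (w - ⟪w, (e : Euc m)⟫ • (e : Euc m)) 0 :=
    hγ.sub (hc.smul_const _)
  by_cases h0 : axisAngle e (γ 0 : Euc m) = 0
  · have hxe := eq_axis_of_axisAngle h0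
    obtain ⟨α, β, γ', η, -, -, -, -, h5, h6⟩ := hf.eventually_center e
    have hcont : ContinuousAt γ 0 := IsInducing.subtypeVal.continuousAt_iff.2 hγ.continuousAt
    have h6' : ∀ᶠ x : Sph m in 𝓝 (γ 0), ∀ s, f.spun e s x =
      ((α s * ⟪(x : Euc m), (e : Euc m)⟫) • (e : Euc m) + β s • offAxis e x,
        (γ' s * ⟪(x : Euc m), (e : Euc m)⟫) • (e : Euc m) + η s • offAxis e x) := by rwa [hxe]
    have h7 := hcont.eventually h6'
    have hwe : ⟪w, (e : Euc m)⟫ = 0 := by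
      rw [hxe] at horth; rw [real_inner_comm]; exact horth
    have hd := ((hc.const_mul (α s)).smul_const (e : Euc m)).add (ho.const_smul (β s))
    have hd' := ((hc.const_mul (γ' s)).smul_const (e : Euc m)).add (ho.const_smul (η s))
    have hoe : offAxis e (e : Euc m) = 0 := by simp [offAxis, inner_self_sph]
    have hval := h7.self_of_nhds s
    rw [hxe, hoe, inner_self_sph] at hval
    simp only [hwe, mul_zero, zero_smul, zero_add, sub_zero] at hd hd'
    refine ⟨(β s • w, η s • w), HasDerivAt.congr_of_eventuallyEq (hd.prodMk hd') ?_, ?_, ?_⟩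
    · filter_upwards [h7] with t ht using ht s
    · rw [hxe, hval]
      simp only [liouvilleForm, smul_zero, add_zero, real_inner_smul_left, real_inner_smul_right,
        real_inner_comm w (e : Euc m), hwe]
      ring
    · intro μ hμ
      rw [hxe, hval] at hμ
      simp only [smul_zero, add_zero, Prod.mk.injEq] at hμ
      have e1 := congrArg (fun v => ⟪w, v⟫) hμ.1
      have e2 := congrArg (fun v => ⟪w, v⟫) hμ.2
      simp only [real_inner_smul_right, hwe, mul_zero] at e1 e2
      rw [← inner_self_eq_zero (𝕜 := ℝ)]
      rcases h5 s hs with h | h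
      · exact (mul_eq_zero.1 e1).resolve_left h
      · exact (mul_eq_zero.1 e2).resolve_left h
  · obtain ⟨c1, c2, c3⟩ := sin_axisAngle_pos hr hx h0
    obtain ⟨k1, k2, k3, k4⟩ := hf.smooth s hs _ c1 c2
    set R := axisAngle e (γ 0 : Euc m) with hRdef
    have hcosR : Real.cos R = ⟪(γ 0 : Euc m), (e : Euc m)⟫ := cos_axisAngle e (γ 0)
    have hcI : ⟪(γ 0 : Euc m), (e : Euc m)⟫ ≠ -1 ∧ ⟪(γ 0 : Euc m), (e : Euc m)⟫ ≠ 1 := by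
      rw [← hcosR]
      have := Real.sin_sq_add_cos_sq R
      constructor <;> intro h <;> rw [h] at this <;> nlinarith
    have hR : ∃ ρ, HasDerivAt (fun t => axisAngle e (γ t : Euc m)) ρ 0 ∧
        ⟪w, (e : Euc m)⟫ = -(Real.sin R * ρ) := by
      refine ⟨_, (Real.hasDerivAt_arccos hcI.1 hcI.2).comp (0 : ℝ) hc, ?_⟩
      have : √(1 - ⟪(γ 0 : Euc m), (e : Euc m)⟫ ^ 2) = Real.sin R := by
        rw [hRdef, axisAngle, Real.sin_arccos]
      rw [this]; field_simp
    obtain ⟨ρ, hR, hwρ⟩ := hR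
    have slice : ∀ u : ℝ → ℝ → ℝ, ContDiffAt ℝ ∞ (Function.uncurry u) (s, R) →
        HasDerivAt (u s) (deriv (u s) R) R := by
      intro u hu
      have h1 : ContDiffAt ℝ ∞ (u s) R :=
        hu.comp R (contDiffAt_const.prodMk contDiffAt_id)
      exact (h1.differentiableAt (by simp)).hasDerivAt
    have hspin : ∀ u v : ℝ → ℝ → ℝ, HasDerivAt (u s) (deriv (u s) R) R →
        HasDerivAt (v s) (deriv (v s) R) R →
        HasDerivAt (fun t => spin e (u s (axisAngle e (γ t : Euc m)))
          (v s (axisAngle e (γ t : Euc m))) (γ t : Euc m))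
          ((deriv (u s) R * ρ) • (e : Euc m) +
          ((v s R / Real.sin R) • (w - ⟪w, (e : Euc m)⟫ • (e : Euc m)) +
          (((deriv (v s) R * ρ) * Real.sin R - v s R * (Real.cos R * ρ)) / Real.sin R ^ 2) •
            offAxis e (γ 0 : Euc m))) 0 := by
      intro u v hu hv
      have h1 : HasDerivAt (fun t => u s (axisAngle e (γ t : Euc m))) (deriv (u s) R * ρ) 0 :=
        HasDerivAt.comp (0 : ℝ) hu hR
      have h2 : HasDerivAt (fun t => v s (axisAngle e (γ t : Euc m))) (deriv (v s) R * ρ) 0 :=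
        HasDerivAt.comp (0 : ℝ) hv hR
      have h3 : HasDerivAt (fun t => Real.sin (axisAngle e (γ t : Euc m))) (Real.cos R * ρ) 0 :=
        HasDerivAt.comp (0 : ℝ) (h₂ := Real.sin) (Real.hasDerivAt_sin R) hR
      exact (h1.smul_const (e : Euc m)).add ((h2.fun_div h3 c3.ne').fun_smul ho)
    have hq := hspin f.q₁ f.q₂ (slice _ k1) (slice _ k2)
    have hp := hspin f.p₁ f.p₂ (slice _ k3) (slice _ k4)
    have hxy : (γ 0 : Euc m) = Real.cos R • (e : Euc m) + offAxis e (γ 0 : Euc m) := by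
      rw [hcosR, offAxis]; module
    have i1 : ⟪offAxis e (γ 0 : Euc m), w⟫ = Real.cos R * Real.sin R * ρ := by
      rw [hxy, inner_add_left, real_inner_smul_left, real_inner_comm w (e : Euc m), hwρ] at horth
      linarith
    have i2 := inner_offAxis e (γ 0 : Euc m)
    have i3 : ⟪offAxis e (γ 0 : Euc m), offAxis e (γ 0 : Euc m)⟫ = Real.sin R ^ 2 :=
      inner_offAxis_self e (γ 0)
    have i4 : ⟪(e : Euc m), offAxis e (γ 0 : Euc m)⟫ = 0 := by rw [real_inner_comm]; exact i2
    have i5 : ⟪(e : Euc m), w⟫ = -(Real.sin R * ρ) := by rw [real_inner_comm]; exact hwρ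
    refine ⟨_, hq.prodMk hp, ?_, ?_⟩
    · have hl := hf.liouville s hs R c1 c2
      simp only [liouvilleForm, spun, spin, ← hRdef, inner_add_left, inner_add_right,
        inner_sub_right, real_inner_smul_left, real_inner_smul_right, inner_self_sph, i1, i2, i3,
        i4, i5, hwρ]
      field_simp
      linear_combination (Real.sin R ^ 2 * ρ) * hl
    · intro μ hμ
      rw [Prod.mk.injEq] at hμ
      obtain ⟨m1, m2⟩ := hμ
      have e1 := congrArg (fun v => ⟪(e : Euc m), v⟫) m1
      have e2 := congrArg (fun v => ⟪(e : Euc m), v⟫) m2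
      have o1 := congrArg (fun v => ⟪offAxis e (γ 0 : Euc m), v⟫) m1
      have o2 := congrArg (fun v => ⟪offAxis e (γ 0 : Euc m), v⟫) m2
      simp only [spun, spin, ← hRdef, inner_add_left, inner_add_right,
        inner_sub_right, real_inner_smul_left, real_inner_smul_right, inner_self_sph, i1, i2, i3,
        i4, i5, hwρ] at e1 e2 o1 o2
      field_simp at e1 e2 o1 o2
      have hS := c3.ne'
      have hS2 : Real.sin R ^ 2 ≠ 0 := pow_ne_zero 2 hS
      have hρ : ρ = 0 := by
        refine hf.immersion s hs R c1 c2 ρ μ ?_ ?_ ?_ ?_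
        · exact mul_left_cancel₀ hS2 (by linear_combination e1)
        · exact mul_left_cancel₀ hS (by linear_combination o1)
        · exact mul_left_cancel₀ hS2 (by linear_combination e2)
        · exact mul_left_cancel₀ hS (by linear_combination o2)
      rw [hρ] at o1 o2 hwρ m1 m2
      have hμ : μ = 0 := by
        rcases hf.off_axis s hs R c1 c2 with h | h
        · have : (f.q₂ s R * Real.sin R) * μ = 0 := by linear_combination -(1 / 2) * o1
          exact (mul_eq_zero.1 this).resolve_left (mul_ne_zero h hS)
        · have : (f.p₂ s R * Real.sin R) * μ = 0 := by linear_combination o2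
          exact (mul_eq_zero.1 this).resolve_left (mul_ne_zero h hS)
      rw [mul_zero, neg_zero] at hwρ
      simp only [hμ, hwρ, mul_zero, zero_smul, zero_add, sub_zero, zero_mul, zero_div, add_zero,
        neg_zero] at m1 m2
      rcases hf.off_axis s hs R c1 c2 with h | h
      · exact (smul_eq_zero.1 m1).resolve_left (div_ne_zero h hS)
      · exact (smul_eq_zero.1 m2).resolve_left (div_ne_zero h hS)

end PlaneFamily

/-- The projection of the handle to the glued piece, in jet coordinates. -/
def coreProj : SurgerySign → Euc m × Euc m → Jet m
  | .minus => projQ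
  | .plus => projP

/-- The projection of the handle to the neighbourhood of `Λ`, in jet coordinates. -/
def outerProj : SurgerySign → Euc m × Euc m → Jet m
  | .minus => projP
  | .plus => projQ

/-- The component of a point of the handle that does not vanish over the glued piece. -/
def coreVec : SurgerySign → Euc m × Euc m → Euc m
  | .minus => Prod.fst
  | .plus => Prod.snd

/-- The component of a point of the handle that vanishes along the core. -/
def outerVec : SurgerySign → Euc m × Euc m → Euc m
  | .minus => Prod.snd
  | .plus => Prod.fst

lemma coreProj_snd_eq_zero (κ : SurgerySign) {a : Euc m × Euc m} (h1 : coreVec κ a ≠ 0)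
    (h2 : outerVec κ a = 0) : (coreProj κ a).2 = 0 := by
  cases κ with
  | minus => exact projQ_snd_eq_zero h1 h2
  | plus => exact projP_snd_eq_zero h2 h1

lemma coreProj_snd_ne (κ : SurgerySign) {a : Euc m × Euc m} (h1 : coreVec κ a ≠ 0)
    (h2 : outerVec κ a ≠ 0) : (coreProj κ a).2 ≠ 0 := by
  cases κ with
  | minus => exact projQ_snd_ne h1 h2
  | plus => exact projP_snd_ne h2 h1

lemma gluing_coreProj (κ : SurgerySign) {a : Euc m × Euc m} (h1 : coreVec κ a ≠ 0)
    (h2 : outerVec κ a ≠ 0) : gluing m κ (coreProj κ a) = outerProj κ a := by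
  cases κ with
  | minus => exact transferFun_projQ h1 h2
  | plus => exact transferInv_projP h2 h1

lemma coreProj_inj (κ : SurgerySign) {a b : Euc m × Euc m} (ha : coreVec κ a ≠ 0)
    (hb : coreVec κ b ≠ 0) (h : coreProj κ a = coreProj κ b) :
    ∃ l : ℝ, 0 < l ∧ b.1 = l ^ 2 • a.1 ∧ b.2 = l⁻¹ • a.2 := by
  cases κ with
  | minus => exact projQ_inj ha hb h
  | plus => exact projP_inj ha hb h

lemma coreProj_flow (κ : SurgerySign) {a b : Euc m × Euc m} (ha : coreVec κ a ≠ 0) {l : ℝ}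
    (hl : 0 < l) (h1 : b.1 = l ^ 2 • a.1) (h2 : b.2 = l⁻¹ • a.2) :
    coreProj κ a = coreProj κ b := by
  have : b = (l ^ 2 • a.1, l⁻¹ • a.2) := Prod.ext h1 h2
  rw [this]
  cases κ with
  | minus => exact (projQ_flow hl ha).symm
  | plus => exact (projP_flow hl ha).symm

section

variable {E H M : Type*} [NormedAddCommGroup E] [NormedSpace ℝ E] [TopologicalSpace H]
  {I : ModelWithCorners ℝ E H} [TopologicalSpace M] [ChartedSpace H M]
  {x : M} {f : M → Euc m × Euc m}

lemma contMDiffAt_coreProj (κ : SurgerySign) (hf : ContMDiffAt I 𝓘(ℝ, Euc m × Euc m) ∞ f x)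
    (h : coreVec κ (f x) ≠ 0) : ContMDiffAt I (jetModel m) ∞ (fun y => coreProj κ (f y)) x := by
  cases κ with
  | minus => exact contMDiffAt_projQ hf h
  | plus => exact contMDiffAt_projP hf h

lemma isotropic_coreProj (κ : SurgerySign) [I.Boundaryless]
    (hf : ContMDiffAt I 𝓘(ℝ, Euc m × Euc m) ∞ f x) (h : coreVec κ (f x) ≠ 0) {v : E}
    {a' : Euc m × Euc m} (ha : HasDerivAt (fun t => f (chartLine I x v t)) a' 0)
    (hl : liouvilleForm (f x) a' = 0) :
    jetForm (coreProj κ (f x)) (mfderiv I (jetModel m) (fun y => coreProj κ (f y)) x v) = 0 := by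
  cases κ with
  | minus => exact isotropic_projQ hf h ha hl
  | plus => exact isotropic_projP hf h ha hl

lemma deriv_mem_of_mfderiv_coreProj (κ : SurgerySign) [I.Boundaryless]
    (hf : ContMDiffAt I 𝓘(ℝ, Euc m × Euc m) ∞ f x) (h : coreVec κ (f x) ≠ 0) {v : E}
    {a' : Euc m × Euc m} (ha : HasDerivAt (fun t => f (chartLine I x v t)) a' 0)
    (hv : mfderiv I (jetModel m) (fun y => coreProj κ (f y)) x v = 0) :
    ∃ μ : ℝ, a' = ((2 * μ) • (f x).1, -μ • (f x).2) := by
  cases κ with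
  | minus => exact deriv_mem_of_mfderiv_projQ hf h ha hv
  | plus => exact deriv_mem_of_mfderiv_projP hf h ha hv

end

lemma injective_mvfderiv_coe_sph (x : Sph m) {v : EuclideanSpace ℝ (Fin m)}
    (h : mvfderiv (𝓡 m) (fun y : Sph m => (y : Euc m)) x v = 0) : v = 0 := by
  have : Fact (Module.finrank ℝ (Euc m) = m + 1) := ⟨finrank_euclideanSpace_fin⟩
  have h1 := injective_mvfderiv_subtypeVal_sphere (n := m) (E := Euc m) x
  exact (injective_iff_map_eq_zero _).1 h1 v h

namespace PlaneFamily

variable {f : PlaneFamily} {e : Sph m} {r a b h σ δ₀ : ℝ}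

/-- Good plane families define disc families. -/
theorem IsGood.discFamily (hf : f.IsGood r) (hr : r < Real.pi) (κ : SurgerySign)
    (hcore : ∀ s ∈ Icc (0 : ℝ) 1, ∀ x ∈ cap e r, coreVec κ (f.spun e s (x : Euc m)) ≠ 0)
    (hadm : ∀ s ∈ Icc (0 : ℝ) 1, ∀ x ∈ cap e r, outerVec κ (f.spun e s (x : Euc m)) = 0 ∨
      outerProj κ (f.spun e s (x : Euc m)) ∈ frontBox e r a b σ ∨
      ‖(outerProj κ (f.spun e s (x : Euc m))).2‖ ≤ δ₀)
    (hstat : ∃ r' < r, ∀ s ∈ Icc (0 : ℝ) 1, ∀ x ∈ cap e r, r' ≤ axisAngle e (x : Euc m) →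
      outerVec κ (f.spun e s (x : Euc m)) ≠ 0 ∧
      outerProj κ (f.spun e s (x : Euc m)) = jetMk x 0 (σ * h)) :
    DiscFamily κ e r a b h σ δ₀ (fun s x => coreProj κ (f.spun e s (x : Euc m))) := by
  have hsl : ∀ s ∈ Icc (0 : ℝ) 1, ∀ x ∈ cap e r,
      ContMDiffAt (𝓡 m) 𝓘(ℝ, Euc m × Euc m) ∞ (fun x : Sph m => f.spun e s (x : Euc m)) x :=
    fun s hs x hx => (hf.contMDiffAt_spun hr hs hx).comp x
      ((contMDiffAt_const (c := s)).prodMk (contMDiffAt_id (x := x)))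
  have hcurve : ∀ x : Sph m, ∀ v : EuclideanSpace ℝ (Fin m),
      HasDerivAt (fun t => ((chartLine (𝓡 m) x v t : Sph m) : Euc m))
        (mvfderiv (𝓡 m) (fun y : Sph m => (y : Euc m)) x v) 0 := fun x v =>
    hasDerivAt_comp_chartLine (g := fun y : Sph m => (y : Euc m))
      ((contMDiffAt_sphere_iff.1 (contMDiffAt_id (x := x))).mdifferentiableAt (by simp)) v
  refine ⟨fun s hs x hx => ?_, fun s hs x hx => ?_, fun s hs x hx x' hx' heq => ?_,
    fun s hs x hx => ?_, fun s hs x hx v => ?_, ?_⟩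
  · exact contMDiffAt_coreProj κ (f := fun z : ℝ × Sph m => f.spun e z.1 (z.2 : Euc m))
      (hf.contMDiffAt_spun hr hs hx) (hcore s hs x hx)
  · have h1 := hcore s hs x hx
    by_cases h2 : outerVec κ (f.spun e s (x : Euc m)) = 0
    · exact Or.inl (coreProj_snd_eq_zero κ h1 h2)
    · right
      rw [gluing_coreProj κ h1 h2]
      exact (hadm s hs x hx).resolve_left h2
  · obtain ⟨l, hl, h1, h2⟩ := coreProj_inj κ (hcore s hs x hx) (hcore s hs x' hx') heq
    exact hf.spun_injective hr hs hx hx' hl h1 h2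
  · rw [injective_iff_map_eq_zero]
    intro v hv
    have hc := hcurve x v
    have hx0 : chartLine (𝓡 m) x (v : EuclideanSpace ℝ (Fin m)) 0 = x := chartLine_zero x _
    obtain ⟨a', ha, -, him⟩ := hf.exists_deriv hr hs (e := e) hc (by rw [hx0]; exact hx)
    obtain ⟨μ, hμ⟩ := deriv_mem_of_mfderiv_coreProj κ (hsl s hs x hx) (hcore s hs x hx) ha hv
    rw [hx0] at him
    exact injective_mvfderiv_coe_sph x (him μ hμ)
  · have hc := hcurve x v
    have hx0 : chartLine (𝓡 m) x v 0 = x := chartLine_zero x _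
    obtain ⟨a', ha, hl, -⟩ := hf.exists_deriv hr hs (e := e) hc (by rw [hx0]; exact hx)
    rw [hx0] at hl
    exact isotropic_coreProj κ (hsl s hs x hx) (hcore s hs x hx) ha hl
  · obtain ⟨r', hr', hst⟩ := hstat
    refine ⟨r', hr', fun s hs x hx hrx => ?_⟩
    rw [← axisAngle_eq] at hrx
    obtain ⟨h1, h2⟩ := hst s hs x hx hrx
    have h3 := hcore s hs x hx
    exact ⟨coreProj_snd_ne κ h3 h1, (gluing_coreProj κ h3 h1).trans h2⟩

/-- The conditions on derivatives in `IsGood`, for given derivatives. -/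
def DerivGood (f : PlaneFamily) (s R : ℝ) : Prop :=
  ∃ d₁ d₂ d₃ d₄ : ℝ, HasDerivAt (f.q₁ s) d₁ R ∧ HasDerivAt (f.q₂ s) d₂ R ∧
    HasDerivAt (f.p₁ s) d₃ R ∧ HasDerivAt (f.p₂ s) d₄ R ∧
    f.p₁ s R * d₁ + f.p₂ s R * d₂ + 2 * (f.q₁ s R * d₃ + f.q₂ s R * d₄) = 0 ∧
    ∀ ρ μ : ℝ, ρ * d₁ = 2 * μ * f.q₁ s R → ρ * d₂ = 2 * μ * f.q₂ s R →
      ρ * d₃ = -μ * f.p₁ s R → ρ * d₄ = -μ * f.p₂ s R → ρ = 0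

lemma DerivGood.liouville {s R : ℝ} (hd : f.DerivGood s R) :
    f.p₁ s R * deriv (f.q₁ s) R + f.p₂ s R * deriv (f.q₂ s) R +
      2 * (f.q₁ s R * deriv (f.p₁ s) R + f.q₂ s R * deriv (f.p₂ s) R) = 0 := by
  obtain ⟨d₁, d₂, d₃, d₄, h1, h2, h3, h4, h5, -⟩ := hd
  rw [h1.deriv, h2.deriv, h3.deriv, h4.deriv]
  exact h5

lemma DerivGood.immersion {s R : ℝ} (hd : f.DerivGood s R) (ρ μ : ℝ)
    (k1 : ρ * deriv (f.q₁ s) R = 2 * μ * f.q₁ s R) (k2 : ρ * deriv (f.q₂ s) R = 2 * μ * f.q₂ s R)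
    (k3 : ρ * deriv (f.p₁ s) R = -μ * f.p₁ s R) (k4 : ρ * deriv (f.p₂ s) R = -μ * f.p₂ s R) :
    ρ = 0 := by
  obtain ⟨d₁, d₂, d₃, d₄, h1, h2, h3, h4, -, h6⟩ := hd
  rw [h1.deriv] at k1
  rw [h2.deriv] at k2
  rw [h3.deriv] at k3
  rw [h4.deriv] at k4
  exact h6 ρ μ k1 k2 k3 k4

/-- The plane family of handle points over the outer jets with angle `θ`, slope `P` and height
`A`. -/
def outer (κ : SurgerySign) (σ : ℝ) (θ P A : ℝ → ℝ → ℝ) : PlaneFamily :=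
  match κ with
  | .minus =>
    { q₁ := fun s R => σ * (A s R * Real.cos (θ s R) + P s R * Real.sin (θ s R))
      q₂ := fun s R => σ * (A s R * Real.sin (θ s R) - P s R * Real.cos (θ s R))
      p₁ := fun s R => Real.cos (θ s R)
      p₂ := fun s R => Real.sin (θ s R) }
  | .plus =>
    { q₁ := fun s R => Real.cos (θ s R)
      q₂ := fun s R => Real.sin (θ s R)
      p₁ := fun s R => σ * (A s R / 2 * Real.cos (θ s R) - P s R * Real.sin (θ s R))
      p₂ := fun s R => σ * (A s R / 2 * Real.sin (θ s R) + P s R * Real.cos (θ s R)) }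

/-- Families of planar Legendrian curves which spin to isotopies of Legendrian discs outside of the
core. -/
structure OuterGood (θ P A : ℝ → ℝ → ℝ) (r a b h δ₀ : ℝ) : Prop where
  smooth : ∀ s ∈ Icc (0 : ℝ) 1, ∀ R, 0 < R → R < r →
    ContDiffAt ℝ ∞ (Function.uncurry θ) (s, R) ∧ ContDiffAt ℝ ∞ (Function.uncurry P) (s, R) ∧
    ContDiffAt ℝ ∞ (Function.uncurry A) (s, R)
  center : ∃ δ > 0, ∃ (ε₁ ε₂ : ℝ) (α : ℝ → ℝ), ContDiff ℝ ∞ α ∧ ε₂ ≠ 0 ∧ ∀ s R, 0 ≤ R → R < δ →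
    Real.cos (θ s R) = ε₁ * Real.cos R ∧ Real.sin (θ s R) = ε₂ * Real.sin R ∧ P s R = 0 ∧
      A s R = α s
  deriv : ∀ s ∈ Icc (0 : ℝ) 1, ∀ R, 0 < R → R < r → ∃ dθ dP : ℝ, HasDerivAt (θ s) dθ R ∧
    HasDerivAt (P s) dP R ∧ HasDerivAt (A s) (P s R * dθ) R ∧ (dθ ≠ 0 ∨ dP ≠ 0)
  off_axis : ∀ s ∈ Icc (0 : ℝ) 1, ∀ R, 0 < R → R < r → Real.sin (θ s R) ≠ 0 ∨ P s R ≠ 0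
  injective : ∀ s ∈ Icc (0 : ℝ) 1, ∀ R R', 0 < R → R < r → 0 < R' → R' < r → ∀ τ : ℝ,
    τ = 1 ∨ τ = -1 → Real.cos (θ s R') = Real.cos (θ s R) →
    Real.sin (θ s R') = τ * Real.sin (θ s R) → P s R' = τ * P s R → A s R' = A s R → R = R'
  nonzero : ∀ s ∈ Icc (0 : ℝ) 1, ∀ R, 0 ≤ R → R < r → A s R ≠ 0 ∨ P s R ≠ 0
  admissible : ∀ s ∈ Icc (0 : ℝ) 1, ∀ R, 0 ≤ R → R < r →
    (|θ s R| < r ∧ -a < A s R ∧ A s R < b) ∨ A s R ^ 2 + P s R ^ 2 ≤ δ₀ ^ 2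
  static : ∃ r' < r, 0 < r' ∧ ∀ s ∈ Icc (0 : ℝ) 1, ∀ R, r' ≤ R → R < r →
    θ s R = R ∧ P s R = 0 ∧ A s R = h

variable {θ P A : ℝ → ℝ → ℝ}

lemma OuterGood.isGood (ho : OuterGood θ P A r a b h δ₀) (κ : SurgerySign)
    (hσ : σ = 1 ∨ σ = -1) : (outer κ σ θ P A).IsGood r := by
  have hσ2 : σ * σ = 1 := by rcases hσ with rfl | rfl <;> norm_num
  have hσ0 : σ ≠ 0 := fun h => by rw [h] at hσ2; norm_num at hσ2
  have trig : ∀ z, Real.cos z * Real.cos z + Real.sin z * Real.sin z = 1 := fun z => by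
    nlinarith [Real.sin_sq_add_cos_sq z]
  have hDG : ∀ s ∈ Icc (0 : ℝ) 1, ∀ R, 0 < R → R < r → (outer κ σ θ P A).DerivGood s R := by
    intro s hs R h0 hR
    obtain ⟨dθ, dP, h1, h2, h3, h4⟩ := ho.deriv s hs R h0 hR
    have hc := h1.cos
    have hsn := h1.sin
    have htr := trig (θ s R)
    cases κ with
    | minus =>
      refine ⟨_, _, _, _, ((h3.mul hc).add (h2.mul hsn)).const_mul σ,
        ((h3.mul hsn).sub (h2.mul hc)).const_mul σ, hc, hsn, ?_, ?_⟩
      · simp only [outer]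
        linear_combination (σ * P s R * dθ * 0) * htr
      · intro ρ μ k1 k2 k3 k4
        simp only [outer] at k1 k2 k3 k4
        have hμ : μ = 0 := by
          linear_combination (Real.cos (θ s R)) * k3 + Real.sin (θ s R) * k4 - μ * htr
        subst hμ
        by_contra hρ
        have hθ : dθ = 0 := by
          have : ρ * dθ = 0 := by
            linear_combination -(Real.sin (θ s R)) * k3 + Real.cos (θ s R) * k4 - ρ * dθ * htr
          exact (mul_eq_zero.1 this).resolve_left hρ
        subst hθ
        have hP : dP = 0 := by
          have : (ρ * σ) * dP = 0 := by
            linear_combination (Real.sin (θ s R)) * k1 - Real.cos (θ s R) * k2 - ρ * σ * dP * htr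
          exact (mul_eq_zero.1 this).resolve_left (mul_ne_zero hρ hσ0)
        rcases h4 with h4 | h4
        · exact h4 rfl
        · exact h4 hP
    | plus =>
      refine ⟨_, _, _, _, hc, hsn, ((((h3.div_const 2).mul hc).sub (h2.mul hsn)).const_mul σ),
        ((((h3.div_const 2).mul hsn).add (h2.mul hc)).const_mul σ), ?_, ?_⟩
      · simp only [outer]
        linear_combination (0 : ℝ) * htr
      · intro ρ μ k1 k2 k3 k4
        simp only [outer] at k1 k2 k3 k4
        have hμ : μ = 0 := by
          linear_combination -(1 / 2) * (Real.cos (θ s R)) * k1 -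
            (1 / 2) * Real.sin (θ s R) * k2 - μ * htr
        subst hμ
        by_contra hρ
        have hθ : dθ = 0 := by
          have : ρ * dθ = 0 := by
            linear_combination -(Real.sin (θ s R)) * k1 + Real.cos (θ s R) * k2 - ρ * dθ * htr
          exact (mul_eq_zero.1 this).resolve_left hρ
        subst hθ
        have hP : dP = 0 := by
          have : (ρ * σ) * dP = 0 := by
            linear_combination -(Real.sin (θ s R)) * k3 + Real.cos (θ s R) * k4 -
              ρ * σ * dP * htr
          exact (mul_eq_zero.1 this).resolve_left (mul_ne_zero hρ hσ0)
        rcases h4 with h4 | h4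
        · exact h4 rfl
        · exact h4 hP
  refine ⟨?_, ?_, fun s hs R h0 hR => (hDG s hs R h0 hR).liouville,
    fun s hs R h0 hR => (hDG s hs R h0 hR).immersion, ?_, ?_⟩
  · intro s hs R h0 hR
    obtain ⟨h1, h2, h3⟩ := ho.smooth s hs R h0 hR
    have hc := h1.cos
    have hsn := h1.sin
    cases κ with
    | minus =>
      exact ⟨contDiffAt_const.mul ((h3.mul hc).add (h2.mul hsn)),
        contDiffAt_const.mul ((h3.mul hsn).sub (h2.mul hc)), hc, hsn⟩
    | plus =>
      exact ⟨hc, hsn, contDiffAt_const.mul (((h3.div_const 2).mul hc).sub (h2.mul hsn)),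
        contDiffAt_const.mul (((h3.div_const 2).mul hsn).add (h2.mul hc))⟩
  · obtain ⟨δ, hδ, ε₁, ε₂, α, hα, hε, h1⟩ := ho.center
    cases κ with
    | minus =>
      refine ⟨δ, hδ, fun s => σ * (α s * ε₁), fun s => σ * (α s * ε₂), fun _ => ε₁, fun _ => ε₂,
        contDiff_const.mul (hα.mul contDiff_const), contDiff_const.mul (hα.mul contDiff_const),
        contDiff_const, contDiff_const, fun s _ => Or.inr hε, fun s R h0 hR => ?_⟩
      obtain ⟨k1, k2, k3, k4⟩ := h1 s R h0 hR
      simp only [outer, k1, k2, k3, k4]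
      refine ⟨?_, ?_, ?_, ?_⟩ <;> first | trivial | ring1
    | plus =>
      refine ⟨δ, hδ, fun _ => ε₁, fun _ => ε₂, fun s => σ * (α s / 2 * ε₁),
        fun s => σ * (α s / 2 * ε₂), contDiff_const, contDiff_const,
        contDiff_const.mul ((hα.div_const 2).mul contDiff_const),
        contDiff_const.mul ((hα.div_const 2).mul contDiff_const),
        fun s _ => Or.inl hε, fun s R h0 hR => ?_⟩
      obtain ⟨k1, k2, k3, k4⟩ := h1 s R h0 hR
      simp only [outer, k1, k2, k3, k4]
      refine ⟨?_, ?_, ?_, ?_⟩ <;> first | trivial | ring1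
  · intro s hs R h0 hR
    have h1 := ho.off_axis s hs R h0 hR
    cases κ with
    | minus =>
      simp only [outer]
      by_contra! h2
      obtain ⟨k1, k2⟩ := h2
      rw [k2, mul_zero, zero_sub] at k1
      rcases h1 with h1 | h1
      · exact h1 k2
      · have h3 := (mul_eq_zero.1 k1).resolve_left hσ0
        have h4 := (mul_eq_zero.1 (neg_eq_zero.1 h3)).resolve_left h1
        have := trig (θ s R)
        rw [h4, k2] at this
        norm_num at this
    | plus =>
      simp only [outer]
      by_contra! h2
      obtain ⟨k2, k1⟩ := h2
      rw [k2, mul_zero, zero_add] at k1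
      rcases h1 with h1 | h1
      · exact h1 k2
      · have h3 := (mul_eq_zero.1 k1).resolve_left hσ0
        have h4 := (mul_eq_zero.1 h3).resolve_left h1
        have := trig (θ s R)
        rw [h4, k2] at this
        norm_num at this
  · intro s hs R R' h0 hR h0' hR' l τ hl hτ
    have hτ2 : τ * τ = 1 := by rcases hτ with rfl | rfl <;> norm_num
    have t1 := trig (θ s R)
    have t2 := trig (θ s R')
    cases κ with
    | minus =>
      simp only [outer]
      intro k1 k2 k3 k4
      have hl1 : l = 1 := by
        rw [k3, k4] at t2
        have h5 : l⁻¹ * l⁻¹ = 1 := by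
          linear_combination t2 - l⁻¹ * l⁻¹ * t1 -
            l⁻¹ * l⁻¹ * Real.sin (θ s R) * Real.sin (θ s R) * hτ2
        have h6 : 0 < l⁻¹ := inv_pos.2 hl
        have h7 : l⁻¹ = 1 := by nlinarith
        exact inv_eq_one.1 h7
      subst hl1
      simp only [inv_one, one_pow, one_mul] at k1 k2 k3 k4
      rw [k3, k4] at k1 k2
      rw [k3, k4] at t2
      refine ho.injective s hs R R' h0 hR h0' hR' τ hτ k3 k4 ?_ ?_
      · have k5 : σ * (P s R') = σ * (τ * P s R) := by
          linear_combination (τ * Real.sin (θ s R)) * k1 - Real.cos (θ s R) * k2 -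
            σ * P s R' * t2 + σ * τ * P s R * t1
        exact mul_left_cancel₀ hσ0 k5
      · have k5 : σ * (A s R') = σ * (A s R) := by
          linear_combination (Real.cos (θ s R)) * k1 + (τ * Real.sin (θ s R)) * k2 -
            σ * A s R' * t2 + σ * A s R * t1 +
            (Real.sin (θ s R) * (σ * (A s R * Real.sin (θ s R) - P s R * Real.cos (θ s R)))) * hτ2
        exact mul_left_cancel₀ hσ0 k5
    | plus =>
      simp only [outer]
      intro k3 k4 k1 k2
      have hl1 : l = 1 := by
        rw [k3, k4] at t2
        have h5 : l ^ 4 = 1 := by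
          linear_combination t2 - l ^ 4 * t1 -
            l ^ 4 * Real.sin (θ s R) * Real.sin (θ s R) * hτ2
        exact (pow_eq_one_iff_of_nonneg hl.le (by norm_num)).1 h5
      subst hl1
      simp only [inv_one, one_pow, one_mul] at k1 k2 k3 k4
      rw [k3, k4] at k1 k2
      rw [k3, k4] at t2
      refine ho.injective s hs R R' h0 hR h0' hR' τ hτ k3 k4 ?_ ?_
      · have k5 : σ * (P s R') = σ * (τ * P s R) := by
          linear_combination -(τ * Real.sin (θ s R)) * k1 + Real.cos (θ s R) * k2 -
            σ * P s R' * t2 + σ * τ * P s R * t1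
        exact mul_left_cancel₀ hσ0 k5
      · have k5 : σ * (A s R') = σ * (A s R) := by
          linear_combination 2 * (Real.cos (θ s R)) * k1 + 2 * (τ * Real.sin (θ s R)) * k2 -
            σ * A s R' * t2 + σ * A s R * t1 + 2 *
            (Real.sin (θ s R) * (σ * (A s R / 2 * Real.sin (θ s R) +
              P s R * Real.cos (θ s R)))) * hτ2
        exact mul_left_cancel₀ hσ0 k5


lemma inner_spin_perp (e x : Sph m) {u v : ℝ} (h : u ^ 2 + v ^ 2 = 1)
    (hv : Real.sin (axisAngle e (x : Euc m)) = 0 → v = 0) :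
    ‖spin e u v (x : Euc m)‖ = 1 ∧ ⟪spin e (-v) u (x : Euc m), spin e u v (x : Euc m)⟫ = 0 := by
  by_cases h0 : Real.sin (axisAngle e (x : Euc m)) = 0
  · have hv0 := hv h0
    subst hv0
    have hu : |u| = 1 := by rw [← sq_eq_sq₀ (abs_nonneg u) zero_le_one, sq_abs]; linarith
    simp [spin, h0, norm_smul, hu]
  · refine ⟨?_, ?_⟩
    · rw [← pow_eq_one_iff_of_nonneg (norm_nonneg _) two_ne_zero, ← real_inner_self_eq_norm_sq,
        inner_spin_spin e x h0]
      linarith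
    · rw [inner_spin_spin e x h0]; ring

lemma norm_spin (e x : Sph m) {u v : ℝ} (h : u ^ 2 + v ^ 2 = 1)
    (hv : Real.sin (axisAngle e (x : Euc m)) = 0 → v = 0) : ‖spin e u v (x : Euc m)‖ = 1 :=
  (inner_spin_perp e x h hv).1

/-- The jet over the point at angle `ϑ` from the axis, in the direction of `x`, with radial slope
`P` and height `A`. -/
def spunJet (e x : Sph m) (σ ϑ P A : ℝ) : Jet m :=
  jetMk (toSph e (spin e (Real.cos ϑ) (Real.sin ϑ) (x : Euc m)))
    ((σ * P) • spin e (-Real.sin ϑ) (Real.cos ϑ) (x : Euc m)) (σ * A)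

section

variable {x : Sph m} {ϑ p A' : ℝ}
  (hx : Real.sin (axisAngle e (x : Euc m)) = 0 → Real.sin ϑ = 0 ∧ p = 0)

include hx

lemma jetPos_spunJet : jetPos (spunJet e x σ ϑ p A') =
    spin e (Real.cos ϑ) (Real.sin ϑ) (x : Euc m) :=
  coe_toSph (norm_spin e x (Real.cos_sq_add_sin_sq ϑ) fun h => (hx h).1)

lemma inner_spunJet : ⟪(σ * p) • spin e (-Real.sin ϑ) (Real.cos ϑ) (x : Euc m),
    (toSph e (spin e (Real.cos ϑ) (Real.sin ϑ) (x : Euc m)) : Euc m)⟫ = 0 := by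
  obtain ⟨h1, h2⟩ := inner_spin_perp e x (Real.cos_sq_add_sin_sq ϑ) fun h => (hx h).1
  rw [coe_toSph h1, real_inner_smul_left, h2, mul_zero]

lemma jetHeight_spunJet : jetHeight (spunJet e x σ ϑ p A') = σ * A' :=
  jetHeight_mk (inner_spunJet hx)

lemma jetSlope_spunJet : jetSlope (spunJet e x σ ϑ p A') =
    (σ * p) • spin e (-Real.sin ϑ) (Real.cos ϑ) (x : Euc m) :=
  jetSlope_mk (inner_spunJet hx)

lemma norm_spunJet (hσ : σ = 1 ∨ σ = -1) : ‖(spunJet e x σ ϑ p A').2‖ ^ 2 = A' ^ 2 + p ^ 2 := by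
  have hσ2 : σ ^ 2 = 1 := by rcases hσ with rfl | rfl <;> norm_num
  have h2 : p ^ 2 * ‖spin e (-Real.sin ϑ) (Real.cos ϑ) (x : Euc m)‖ ^ 2 = p ^ 2 := by
    by_cases h0 : Real.sin (axisAngle e (x : Euc m)) = 0
    · rw [(hx h0).2]; ring
    · rw [norm_spin e x (by rw [neg_sq, Real.sin_sq_add_cos_sq]) fun h => absurd h h0]; ring
  rw [spunJet, jetMk, norm_add_sq_real, norm_smul, norm_smul, norm_sph, real_inner_smul_left,
    real_inner_comm, inner_spunJet hx, mul_pow, mul_pow, norm_mul, norm_mul, mul_pow, mul_pow]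
  simp only [Real.norm_eq_abs, sq_abs]
  rw [hσ2]; linear_combination h2

/-- The handle points given by an outer plane family. -/
lemma outer_spun_minus {s : ℝ} (h1 : θ s (axisAngle e (x : Euc m)) = ϑ)
    (h2 : P s (axisAngle e (x : Euc m)) = p) (h3 : A s (axisAngle e (x : Euc m)) = A') :
    (outer .minus σ θ P A).spun e s (x : Euc m) = minusHandle (spunJet e x σ ϑ p A') := by
  have hp : ((spunJet e x σ ϑ p A').1 : Euc m) = spin e (Real.cos ϑ) (Real.sin ϑ) (x : Euc m) :=
    jetPos_spunJet hx
  rw [minusHandle, jetHeight_spunJet hx, jetSlope_spunJet hx, hp]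
  simp only [spun, outer, h1, h2, h3, spin_eq, Prod.mk.injEq, and_true]
  module

lemma outer_spun_plus {s : ℝ} (h1 : θ s (axisAngle e (x : Euc m)) = ϑ)
    (h2 : P s (axisAngle e (x : Euc m)) = p) (h3 : A s (axisAngle e (x : Euc m)) = A') :
    (outer .plus σ θ P A).spun e s (x : Euc m) = plusHandle (spunJet e x σ ϑ p A') := by
  have hp : ((spunJet e x σ ϑ p A').1 : Euc m) = spin e (Real.cos ϑ) (Real.sin ϑ) (x : Euc m) :=
    jetPos_spunJet hx
  rw [plusHandle, jetHeight_spunJet hx, jetSlope_spunJet hx, hp]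
  simp only [spun, outer, h1, h2, h3, spin_eq, Prod.mk.injEq, true_and]
  module

lemma outerProj_outer {κ : SurgerySign} {s : ℝ} (h1 : θ s (axisAngle e (x : Euc m)) = ϑ)
    (h2 : P s (axisAngle e (x : Euc m)) = p) (h3 : A s (axisAngle e (x : Euc m)) = A') :
    outerVec κ ((outer κ σ θ P A).spun e s (x : Euc m)) ≠ 0 ∧
      outerProj κ ((outer κ σ θ P A).spun e s (x : Euc m)) = spunJet e x σ ϑ p A' := by
  cases κ with
  | minus =>
    rw [outer_spun_minus hx h1 h2 h3]
    refine ⟨by rw [← norm_ne_zero_iff]; exact (norm_sph _).trans_ne one_ne_zero, ?_⟩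
    have h : ‖(minusHandle (spunJet e x σ ϑ p A')).2‖ = 1 := norm_sph _
    rw [outerProj, projP, h]
    simp only [one_pow, one_smul, inv_one]
    exact minusHandleInv_minusHandle _ _
  | plus =>
    rw [outer_spun_plus hx h1 h2 h3]
    refine ⟨by rw [← norm_ne_zero_iff]; exact (norm_sph _).trans_ne one_ne_zero, ?_⟩
    have h : ‖(plusHandle (spunJet e x σ ϑ p A')).1‖ = 1 := norm_sph _
    rw [outerProj, projQ, h]
    simp only [Real.sqrt_one, one_smul, inv_one]
    exact plusHandleInv_plusHandle _ _

lemma coreVec_outer {κ : SurgerySign} {s : ℝ} (hσ : σ = 1 ∨ σ = -1)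
    (h1 : θ s (axisAngle e (x : Euc m)) = ϑ)
    (h2 : P s (axisAngle e (x : Euc m)) = p) (h3 : A s (axisAngle e (x : Euc m)) = A')
    (h : A' ≠ 0 ∨ p ≠ 0) : coreVec κ ((outer κ σ θ P A).spun e s (x : Euc m)) ≠ 0 := by
  have hn : (spunJet e x σ ϑ p A').2 ≠ 0 := by
    rw [← norm_ne_zero_iff, ← pow_ne_zero_iff two_ne_zero, norm_spunJet hx hσ]
    rcases h with h | h <;> positivity
  cases κ with
  | minus => rw [outer_spun_minus hx h1 h2 h3]; exact minusHandle_fst_ne hn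
  | plus => rw [outer_spun_plus hx h1 h2 h3]; exact plusHandle_snd_ne hn

lemma spunJet_mem_frontBox {r a b : ℝ} (hσ : σ = 1 ∨ σ = -1) (hr : r ≤ Real.pi) (h : |ϑ| < r)
    (ha : -a < A') (hb : A' < b) : spunJet e x σ ϑ p A' ∈ frontBox e r a b σ := by
  have hσ2 : σ * (σ * A') = A' := by rcases hσ with rfl | rfl <;> ring
  refine ⟨?_, ?_⟩
  · change InnerProductGeometry.angle _ _ < r
    rw [← axisAngle_eq, axisAngle,
      show ((spunJet e x σ ϑ p A').1 : Euc m) = spin e (Real.cos ϑ) (Real.sin ϑ) (x : Euc m) from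
        jetPos_spunJet hx, inner_spin_axis, ← Real.cos_abs, Real.arccos_cos (abs_nonneg _)
        (h.le.trans hr)]
    exact h
  · rw [jetHeight_spunJet hx, hσ2]
    exact ⟨ha, hb⟩

end

lemma spunJet_self (e x : Sph m) (σ A : ℝ) :
    spunJet e x σ (axisAngle e (x : Euc m)) 0 A = jetMk x 0 (σ * A) := by
  have : spin e (Real.cos (axisAngle e (x : Euc m))) (Real.sin (axisAngle e (x : Euc m))) x =
      (x : Euc m) := by
    by_cases h : Real.sin (axisAngle e (x : Euc m)) = 0
    · have h2 := inner_offAxis_self e x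
      rw [h, zero_pow two_ne_zero, inner_self_eq_zero] at h2
      rw [spin, h2, smul_zero, add_zero, cos_axisAngle]
      exact (sub_eq_zero.1 h2).symm
    · exact (sph_eq_spin e x h).symm
  rw [spunJet, this, toSph_coe, mul_zero, zero_smul]

lemma OuterGood.axis (ho : OuterGood θ P A r a b h δ₀) (hr : r < Real.pi) {x : Sph m}
    (hx : x ∈ cap e r) {s : ℝ} (h0 : Real.sin (axisAngle e (x : Euc m)) = 0) :
    Real.sin (θ s (axisAngle e (x : Euc m))) = 0 ∧ P s (axisAngle e (x : Euc m)) = 0 := by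
  have hR : axisAngle e (x : Euc m) = 0 := by
    by_contra h
    exact (sin_axisAngle_pos hr hx h).2.2.ne' h0
  obtain ⟨δ, hδ, ε₁, ε₂, α, -, -, h1⟩ := ho.center
  obtain ⟨-, k1, k2, -⟩ := h1 s 0 le_rfl hδ
  rw [hR, k1, k2]; simp

lemma axisAngle_mem {x : Sph m} (hx : x ∈ cap e r) :
    0 ≤ axisAngle e (x : Euc m) ∧ axisAngle e (x : Euc m) < r :=
  ⟨Real.arccos_nonneg _, by rw [axisAngle_eq]; exact hx⟩

theorem OuterGood.discFamily (ho : OuterGood θ P A r a b h δ₀) (κ : SurgerySign)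
    (hσ : σ = 1 ∨ σ = -1) (hr : r < Real.pi) (hδ₀ : 0 ≤ δ₀) :
    DiscFamily κ e r a b h σ δ₀ (fun s x => coreProj κ ((outer κ σ θ P A).spun e s (x : Euc m))) := by
  refine (ho.isGood κ hσ).discFamily hr κ (fun s hs x hx => ?_) (fun s hs x hx => ?_) ?_
  · obtain ⟨h0, hR⟩ := axisAngle_mem hx
    exact coreVec_outer (ho.axis hr hx) hσ rfl rfl rfl (ho.nonzero s hs _ h0 hR)
  · obtain ⟨h0, hR⟩ := axisAngle_mem hx
    right
    rw [(outerProj_outer (ho.axis hr hx) rfl rfl rfl).2]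
    rcases ho.admissible s hs _ h0 hR with ⟨h1, h2, h3⟩ | h1
    · exact Or.inl (spunJet_mem_frontBox (ho.axis hr hx) hσ hr.le h1 h2 h3)
    · right
      rw [← sq_le_sq₀ (norm_nonneg _) hδ₀, norm_spunJet (ho.axis hr hx) hσ]
      exact h1
  · obtain ⟨r', hr', -, h1⟩ := ho.static
    refine ⟨r', hr', fun s hs x hx hR => ?_⟩
    obtain ⟨k1, k2, k3⟩ := h1 s hs _ hR (axisAngle_mem hx).2
    obtain ⟨h2, h3⟩ := outerProj_outer (κ := κ) (σ := σ) (ho.axis hr hx (s := s)) rfl rfl rfl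
    refine ⟨h2, ?_⟩
    rw [h3, k1, k2, k3, spunJet_self]

lemma OuterGood.gluing_discFamily (ho : OuterGood θ P A r a b h δ₀) (κ : SurgerySign)
    (hσ : σ = 1 ∨ σ = -1) (hr : r < Real.pi) {s : ℝ} (hs : s ∈ Icc (0 : ℝ) 1) {x : Sph m}
    (hx : x ∈ cap e r) :
    (coreProj κ ((outer κ σ θ P A).spun e s (x : Euc m))).2 ≠ 0 ∧
    gluing m κ (coreProj κ ((outer κ σ θ P A).spun e s (x : Euc m))) =
      spunJet e x σ (θ s (axisAngle e (x : Euc m))) (P s (axisAngle e (x : Euc m)))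
        (A s (axisAngle e (x : Euc m))) := by
  obtain ⟨h0, hR⟩ := axisAngle_mem hx
  have h1 := coreVec_outer (κ := κ) (ho.axis hr hx) hσ rfl rfl rfl (ho.nonzero s hs _ h0 hR)
  obtain ⟨h2, h3⟩ := outerProj_outer (κ := κ) (σ := σ) (ho.axis hr hx (s := s)) rfl rfl rfl
  exact ⟨coreProj_snd_ne κ h1 h2, (gluing_coreProj κ h1 h2).trans h3⟩

end PlaneFamily

/-! ### Smooth steps -/

/-- A smooth non-negative function supported in the unit interval. -/
def stepDensity (x : ℝ) : ℝ := expNegInvGlue (x * (1 - x))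

lemma contDiff_stepDensity : ContDiff ℝ ∞ stepDensity :=
  expNegInvGlue.contDiff.comp (by fun_prop)

lemma stepDensity_nonneg (x : ℝ) : 0 ≤ stepDensity x := expNegInvGlue.nonneg _

lemma stepDensity_pos {x : ℝ} (h0 : 0 < x) (h1 : x < 1) : 0 < stepDensity x :=
  expNegInvGlue.pos_of_pos (mul_pos h0 (sub_pos.2 h1))

lemma stepDensity_of_nonpos {x : ℝ} (h : x ≤ 0) : stepDensity x = 0 :=
  expNegInvGlue.zero_of_nonpos (by nlinarith)

lemma stepDensity_of_one_le {x : ℝ} (h : 1 ≤ x) : stepDensity x = 0 :=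
  expNegInvGlue.zero_of_nonpos (by nlinarith)

lemma integral_stepDensity_pos : 0 < ∫ t in (0 : ℝ)..1, stepDensity t :=
  intervalIntegral.intervalIntegral_pos_of_pos_on
    (contDiff_stepDensity.continuous.intervalIntegrable _ _)
    (fun _ hx => stepDensity_pos hx.1 hx.2) one_pos

/-- The derivative of the smooth step. -/
def stepDeriv (x : ℝ) : ℝ := stepDensity x / ∫ t in (0 : ℝ)..1, stepDensity t

/-- A smooth monotone function which vanishes on the negative reals and is `1` after `1`. -/
def step (x : ℝ) : ℝ := ∫ t in (0 : ℝ)..x, stepDeriv t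

lemma contDiff_stepDeriv : ContDiff ℝ ∞ stepDeriv := contDiff_stepDensity.div_const _

lemma stepDeriv_nonneg (x : ℝ) : 0 ≤ stepDeriv x :=
  div_nonneg (stepDensity_nonneg x) integral_stepDensity_pos.le

lemma stepDeriv_pos {x : ℝ} (h0 : 0 < x) (h1 : x < 1) : 0 < stepDeriv x :=
  div_pos (stepDensity_pos h0 h1) integral_stepDensity_pos

lemma stepDeriv_of_nonpos {x : ℝ} (h : x ≤ 0) : stepDeriv x = 0 := by
  rw [stepDeriv, stepDensity_of_nonpos h, zero_div]

lemma stepDeriv_of_one_le {x : ℝ} (h : 1 ≤ x) : stepDeriv x = 0 := by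
  rw [stepDeriv, stepDensity_of_one_le h, zero_div]

lemma hasDerivAt_step (x : ℝ) : HasDerivAt step (stepDeriv x) x :=
  (contDiff_stepDeriv.continuous.integral_hasStrictDerivAt 0 x).hasDerivAt

lemma contDiff_step : ContDiff ℝ ∞ step := by
  rw [contDiff_infty_iff_deriv]
  refine ⟨fun x => (hasDerivAt_step x).differentiableAt, ?_⟩
  rw [show deriv step = stepDeriv from funext fun x => (hasDerivAt_step x).deriv]
  exact contDiff_stepDeriv

lemma monotone_step : Monotone step :=
  monotone_of_hasDerivAt_nonneg hasDerivAt_step stepDeriv_nonneg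

lemma step_of_nonpos {x : ℝ} (h : x ≤ 0) : step x = 0 := by
  rw [step, intervalIntegral.integral_symm, neg_eq_zero]
  refine (intervalIntegral.integral_congr fun t ht => ?_).trans intervalIntegral.integral_zero
  rw [uIcc_of_le h] at ht
  exact stepDeriv_of_nonpos ht.2

lemma step_one : step 1 = 1 := by
  simp only [step, stepDeriv]
  rw [intervalIntegral.integral_div]
  exact div_self integral_stepDensity_pos.ne'

lemma step_of_one_le {x : ℝ} (h : 1 ≤ x) : step x = 1 := by
  have h1 := intervalIntegral.integral_add_adjacent_intervals
    (contDiff_stepDeriv.continuous.intervalIntegrable (μ := MeasureTheory.volume) 0 1)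
    (contDiff_stepDeriv.continuous.intervalIntegrable (μ := MeasureTheory.volume) 1 x)
  have h2 : ∫ t in (1 : ℝ)..x, stepDeriv t = 0 := by
    refine (intervalIntegral.integral_congr fun t ht => ?_).trans intervalIntegral.integral_zero
    rw [uIcc_of_le h] at ht
    exact stepDeriv_of_one_le ht.1
  rw [h2, add_zero] at h1
  rw [step, ← h1]
  exact step_one

lemma step_nonneg (x : ℝ) : 0 ≤ step x := by
  rw [← step_of_nonpos (min_le_right x 0)]
  exact monotone_step (min_le_left x 0)

lemma step_le_one (x : ℝ) : step x ≤ 1 := by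
  rw [← step_of_one_le (le_max_right x 1)]
  exact monotone_step (le_max_left x 1)

lemma step_half : step (1 / 2) = 1 / 2 := by
  have h1 := intervalIntegral.integral_add_adjacent_intervals
    (contDiff_stepDeriv.continuous.intervalIntegrable (μ := MeasureTheory.volume) 0 (1 / 2))
    (contDiff_stepDeriv.continuous.intervalIntegrable (μ := MeasureTheory.volume) (1 / 2) 1)
  have h2 : ∫ t in (1 / 2 : ℝ)..1, stepDeriv t = ∫ t in (0 : ℝ)..(1 / 2), stepDeriv t := by
    have h3 := intervalIntegral.integral_comp_sub_left (a := 0) (b := 1 / 2) stepDeriv 1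
    rw [sub_zero, show (1 : ℝ) - 1 / 2 = 1 / 2 by norm_num] at h3
    rw [← h3]
    refine intervalIntegral.integral_congr fun t _ => ?_
    simp only [stepDeriv, stepDensity]
    congr 2
    ring
  have h4 := step_one
  rw [step] at h4 ⊢
  linarith

lemma monotoneOn_stepDeriv : MonotoneOn stepDeriv (Iic (1 / 2)) := by
  intro x hx y hy hxy
  rw [mem_Iic] at hx hy
  exact div_le_div_of_nonneg_right (expNegInvGlue.monotone (by nlinarith))
    integral_stepDensity_pos.le

lemma antitoneOn_stepDeriv : AntitoneOn stepDeriv (Ici (1 / 2)) := by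
  intro x hx y hy hxy
  rw [mem_Ici] at hx hy
  exact div_le_div_of_nonneg_right (expNegInvGlue.monotone (by nlinarith))
    integral_stepDensity_pos.le

lemma step_mul_deriv_stepDeriv_nonpos (x : ℝ) : (2 * step x - 1) * deriv stepDeriv x ≤ 0 := by
  rcases lt_trichotomy x (1 / 2) with h | h | h
  · have h1 := monotone_step h.le
    rw [step_half] at h1
    have h2 : 0 ≤ deriv stepDeriv x := by
      rw [← derivWithin_of_mem_nhds (Iic_mem_nhds h)]
      exact monotoneOn_stepDeriv.derivWithin_nonneg
    nlinarith
  · rw [h, step_half]; norm_num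
  · have h1 := monotone_step h.le
    rw [step_half] at h1
    have h2 : deriv stepDeriv x ≤ 0 := by
      rw [← derivWithin_of_mem_nhds (Ici_mem_nhds h)]
      exact antitoneOn_stepDeriv.derivWithin_nonpos
    nlinarith

lemma hasDerivAt_stepDeriv (x : ℝ) : HasDerivAt stepDeriv (deriv stepDeriv x) x :=
  ((contDiff_stepDeriv.differentiable (by simp)) x).hasDerivAt

/-! ### The profile of the first isotopy -/

/-- The height of the disc after it has been pushed towards the zero section. -/
def profile (h h' ρ R : ℝ) : ℝ := h' + (h - h') * step (2 * R / ρ - 1)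

/-- The slope of `profile`. -/
def profileSlope (h h' ρ R : ℝ) : ℝ := (h - h') * (2 / ρ) * stepDeriv (2 * R / ρ - 1)

section Profile

variable {h h' ρ R : ℝ}

lemma hasDerivAt_profile : HasDerivAt (profile h h' ρ) (profileSlope h h' ρ R) R := by
  have h1 : HasDerivAt (fun R : ℝ => 2 * R / ρ - 1) (2 / ρ) R := by
    simpa using (((hasDerivAt_id R).const_mul 2).div_const ρ).sub_const 1
  have h2 := (((hasDerivAt_step (2 * R / ρ - 1)).comp R h1).const_mul (h - h')).const_add h'
  exact h2.congr_deriv (by rw [profileSlope]; ring)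

lemma contDiff_profile : ContDiff ℝ ∞ (profile h h' ρ) :=
  contDiff_const.add (contDiff_const.mul (contDiff_step.comp (by fun_prop)))

lemma contDiff_profileSlope : ContDiff ℝ ∞ (profileSlope h h' ρ) :=
  contDiff_const.mul (contDiff_stepDeriv.comp (by fun_prop))

lemma profile_of_le (hρ : 0 < ρ) (hR : R ≤ ρ / 2) : profile h h' ρ R = h' := by
  rw [profile, step_of_nonpos, mul_zero, add_zero]
  rw [sub_nonpos, div_le_one hρ]; linarith

lemma profileSlope_of_le (hρ : 0 < ρ) (hR : R ≤ ρ / 2) : profileSlope h h' ρ R = 0 := by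
  rw [profileSlope, stepDeriv_of_nonpos, mul_zero]
  rw [sub_nonpos, div_le_one hρ]; linarith

lemma profile_of_ge (hρ : 0 < ρ) (hR : ρ ≤ R) : profile h h' ρ R = h := by
  rw [profile, step_of_one_le]
  · ring
  · rw [le_sub_iff_add_le, le_div_iff₀ hρ]; linarith

lemma profileSlope_of_ge (hρ : 0 < ρ) (hR : ρ ≤ R) : profileSlope h h' ρ R = 0 := by
  rw [profileSlope, stepDeriv_of_one_le, mul_zero]
  rw [le_sub_iff_add_le, le_div_iff₀ hρ]; linarith

lemma le_profile (hh : h' ≤ h) : h' ≤ profile h h' ρ R := by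
  have := mul_nonneg (sub_nonneg.2 hh) (step_nonneg (2 * R / ρ - 1))
  rw [profile]; linarith

lemma profile_le (hh : h' ≤ h) : profile h h' ρ R ≤ h := by
  have := mul_le_mul_of_nonneg_left (step_le_one (2 * R / ρ - 1)) (sub_nonneg.2 hh)
  rw [profile]; linarith

lemma profileSlope_nonneg (hρ : 0 < ρ) (hh : h' ≤ h) : 0 ≤ profileSlope h h' ρ R :=
  mul_nonneg (mul_nonneg (sub_nonneg.2 hh) (by positivity)) (stepDeriv_nonneg _)

end Profile


/-- Pushing the disc towards the zero section. -/
theorem outerGood_profile {r a b h h' ρ δ₀ : ℝ} (hr : r < Real.pi) (ha : 0 < a) (hρ : 0 < ρ)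
    (hρr : ρ < r) (h0 : 0 < h') (hh : h' ≤ h) (hb : h < b) :
    PlaneFamily.OuterGood (fun _ R => R) (fun s R => s * profileSlope h h' ρ R)
      (fun s R => (1 - s) * h + s * profile h h' ρ R) r a b h δ₀ := by
  have hA : ∀ s ∈ Icc (0 : ℝ) 1, ∀ R, h' ≤ (1 - s) * h + s * profile h h' ρ R ∧
      (1 - s) * h + s * profile h h' ρ R ≤ h := by
    intro s hs R
    have h1 := le_profile (ρ := ρ) (R := R) hh
    have h2 := profile_le (ρ := ρ) (R := R) hh
    constructor <;> nlinarith [hs.1, hs.2]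
  constructor
  · intro s _ R _ _
    refine ⟨contDiff_snd.contDiffAt, ?_, ?_⟩
    · exact (contDiff_fst.mul (contDiff_profileSlope.comp contDiff_snd)).contDiffAt
    · exact (((contDiff_const.sub contDiff_fst).mul contDiff_const).add
        (contDiff_fst.mul (contDiff_profile.comp contDiff_snd))).contDiffAt
  · refine ⟨ρ / 2, by positivity, 1, 1, fun s => (1 - s) * h + s * h', by fun_prop, one_ne_zero,
      fun s R _ hR => ?_⟩
    rw [profileSlope_of_le hρ hR.le, profile_of_le hρ hR.le]
    simp
  · intro s _ R _ _
    refine ⟨1, _, hasDerivAt_id R, ((contDiff_profileSlope.differentiable (by simp)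
      R).hasDerivAt.const_mul s), ?_, Or.inl one_ne_zero⟩
    rw [mul_one]
    exact (hasDerivAt_profile.const_mul s).const_add _
  · intro s _ R h0 hR
    exact Or.inl (Real.sin_pos_of_pos_of_lt_pi h0 (hR.trans hr)).ne'
  · intro s _ R R' h0 hR h0' hR' τ _ hc _ _ _
    exact Real.injOn_cos ⟨h0.le, (hR.trans hr).le⟩ ⟨h0'.le, (hR'.trans hr).le⟩ hc.symm
  · intro s hs R _ _
    exact Or.inl (h0.trans_le (hA s hs R).1).ne'
  · intro s hs R k0 hR
    refine Or.inl ⟨by rwa [abs_of_nonneg k0], ?_, (hA s hs R).2.trans_lt hb⟩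
    linarith [(hA s hs R).1]
  · refine ⟨ρ, hρr, hρ, fun s _ R hR _ => ⟨rfl, ?_, ?_⟩⟩
    · rw [profileSlope_of_ge hρ hR, mul_zero]
    · rw [profile_of_ge hρ hR]; ring

lemma outerProj_flow (κ : SurgerySign) {a b : Euc m × Euc m} (ha : outerVec κ a ≠ 0) {l : ℝ}
    (hl : 0 < l) (h1 : b.1 = l ^ 2 • a.1) (h2 : b.2 = l⁻¹ • a.2) :
    outerProj κ a = outerProj κ b := by
  have : b = (l ^ 2 • a.1, l⁻¹ • a.2) := Prod.ext h1 h2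
  rw [this]
  cases κ with
  | minus => exact (projP_flow hl ha).symm
  | plus => exact (projQ_flow hl ha).symm

lemma norm_projQ_le {a : Euc m × Euc m} (h : a.1 ≠ 0) :
    ‖(projQ a).2‖ ^ 2 ≤ 4 * (‖a.1‖ * ‖a.2‖ ^ 2) := by
  have hn : ‖‖a.1‖⁻¹ • a.1‖ = 1 := norm_inv_smul h
  have h1 : ‖(projQ a).2‖ ≤ 2 * ‖√‖a.1‖ • a.2‖ := by
    rw [projQ_eq h]
    refine (norm_add_le _ _).trans ?_
    rw [norm_smul ⟪√‖a.1‖ • a.2, ‖a.1‖⁻¹ • a.1⟫, hn, mul_one, Real.norm_eq_abs, two_mul]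
    refine add_le_add_right ?_ _
    have := abs_real_inner_le_norm (√‖a.1‖ • a.2) (‖a.1‖⁻¹ • a.1)
    rwa [hn, mul_one] at this
  have h2 : ‖√‖a.1‖ • a.2‖ ^ 2 = ‖a.1‖ * ‖a.2‖ ^ 2 := by
    rw [norm_smul, mul_pow, Real.norm_of_nonneg (Real.sqrt_nonneg _), Real.sq_sqrt (norm_nonneg _)]
  calc ‖(projQ a).2‖ ^ 2 ≤ (2 * ‖√‖a.1‖ • a.2‖) ^ 2 := by gcongr
    _ = _ := by rw [mul_pow, h2]; norm_num

lemma norm_sq_spin_le (e x : Sph m) (u v : ℝ) : ‖spin e u v (x : Euc m)‖ ^ 2 ≤ u ^ 2 + v ^ 2 := by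
  by_cases h : Real.sin (axisAngle e (x : Euc m)) = 0
  · rw [spin, h, div_zero, zero_smul, add_zero, norm_smul, norm_sph, mul_one, Real.norm_eq_abs,
      sq_abs]
    exact le_add_of_nonneg_right (sq_nonneg v)
  · rw [← real_inner_self_eq_norm_sq, inner_spin_spin e x h]
    exact le_of_eq (by ring)

lemma spin_ne_zero {e x : Sph m} {u v : ℝ}
    (h : u ≠ 0 ∨ Real.sin (axisAngle e (x : Euc m)) ≠ 0 ∧ v ≠ 0) : spin e u v (x : Euc m) ≠ 0 := by
  intro h0
  rcases h with h | ⟨h1, h2⟩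
  · apply h
    rw [← inner_spin_axis e u v (x : Euc m), h0, inner_zero_left]
  · have h3 := inner_spin_spin e x h1 u v u v
    rw [h0, inner_zero_left] at h3
    have : 0 < v ^ 2 := by positivity
    nlinarith [sq_nonneg u]

namespace PlaneFamily

variable {f g : PlaneFamily} {e : Sph m}

/-- Two plane families which agree modulo the flow. -/
structure FlowRel (f g : PlaneFamily) (s t R l : ℝ) : Prop where
  q₁ : g.q₁ t R = l ^ 2 * f.q₁ s R
  q₂ : g.q₂ t R = l ^ 2 * f.q₂ s R
  p₁ : g.p₁ t R = l⁻¹ * f.p₁ s R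
  p₂ : g.p₂ t R = l⁻¹ * f.p₂ s R

lemma FlowRel.spun {s t l : ℝ} {x : Sph m} (h : FlowRel f g s t (axisAngle e (x : Euc m)) l) :
    (g.spun e t (x : Euc m)).1 = l ^ 2 • (f.spun e s (x : Euc m)).1 ∧
      (g.spun e t (x : Euc m)).2 = l⁻¹ • (f.spun e s (x : Euc m)).2 := by
  simp only [PlaneFamily.spun, spin_eq, h.q₁, h.q₂, h.p₁, h.p₂]
  constructor <;> module

lemma FlowRel.coreProj {s t l : ℝ} {x : Sph m} (h : FlowRel f g s t (axisAngle e (x : Euc m)) l)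
    (hl : 0 < l) (κ : SurgerySign) (h1 : coreVec κ (f.spun e s (x : Euc m)) ≠ 0) :
    coreProj κ (f.spun e s (x : Euc m)) = coreProj κ (g.spun e t (x : Euc m)) :=
  coreProj_flow κ h1 hl h.spun.1 h.spun.2

lemma FlowRel.outerVec_ne {s t l : ℝ} {x : Sph m} (h : FlowRel f g s t (axisAngle e (x : Euc m)) l)
    (κ : SurgerySign) (h1 : outerVec κ (g.spun e t (x : Euc m)) ≠ 0) :
    outerVec κ (f.spun e s (x : Euc m)) ≠ 0 := by
  intro h2
  apply h1
  cases κ with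
  | minus => exact h.spun.2.trans (by rw [show (f.spun e s (x : Euc m)).2 = 0 from h2, smul_zero])
  | plus => exact h.spun.1.trans (by rw [show (f.spun e s (x : Euc m)).1 = 0 from h2, smul_zero])

lemma FlowRel.outerProj {s t l : ℝ} {x : Sph m} (h : FlowRel f g s t (axisAngle e (x : Euc m)) l)
    (hl : 0 < l) (κ : SurgerySign) (h1 : outerVec κ (g.spun e t (x : Euc m)) ≠ 0) :
    outerProj κ (f.spun e s (x : Euc m)) = outerProj κ (g.spun e t (x : Euc m)) :=
  outerProj_flow κ (h.outerVec_ne κ h1) hl h.spun.1 h.spun.2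

end PlaneFamily

/-! ### Swinging the disc over the core of a `(+1)`-surgery -/

/-- The function interpolating between `-1` and `1`. -/
def swing (δ R : ℝ) : ℝ := 2 * step (R / δ - 1) - 1

/-- The derivative of `swing`. -/
def swingDeriv (δ R : ℝ) : ℝ := 2 / δ * stepDeriv (R / δ - 1)

section Swing

variable {δ R : ℝ}

lemma hasDerivAt_swing : HasDerivAt (swing δ) (swingDeriv δ R) R := by
  have h1 : HasDerivAt (fun R : ℝ => R / δ - 1) (1 / δ) R :=
    ((hasDerivAt_id R).div_const δ).sub_const 1
  have h2 := (((hasDerivAt_step (R / δ - 1)).comp R h1).const_mul 2).sub_const 1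
  exact h2.congr_deriv (by rw [swingDeriv]; ring)

lemma hasDerivAt_swingDeriv : HasDerivAt (swingDeriv δ)
    (2 / δ * (deriv stepDeriv (R / δ - 1) * (1 / δ))) R := by
  have h1 : HasDerivAt (fun R : ℝ => R / δ - 1) (1 / δ) R :=
    ((hasDerivAt_id R).div_const δ).sub_const 1
  exact ((hasDerivAt_stepDeriv (R / δ - 1)).comp R h1).const_mul (2 / δ)

lemma contDiff_swing : ContDiff ℝ ∞ (swing δ) :=
  (contDiff_const.mul (contDiff_step.comp (by fun_prop))).sub contDiff_const

lemma contDiff_swingDeriv : ContDiff ℝ ∞ (swingDeriv δ) :=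
  contDiff_const.mul (contDiff_stepDeriv.comp (by fun_prop))

lemma swingDeriv_nonneg (hδ : 0 < δ) : 0 ≤ swingDeriv δ R :=
  mul_nonneg (by positivity) (stepDeriv_nonneg _)

lemma swingDeriv_pos (hδ : 0 < δ) (h1 : δ < R) (h2 : R < 2 * δ) : 0 < swingDeriv δ R := by
  refine mul_pos (by positivity) (stepDeriv_pos ?_ ?_)
  · rw [sub_pos, lt_div_iff₀ hδ]; linarith
  · rw [sub_lt_iff_lt_add, div_lt_iff₀ hδ]; linarith

lemma swing_of_le (hδ : 0 < δ) (h : R ≤ δ) : swing δ R = -1 ∧ swingDeriv δ R = 0 := by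
  have : R / δ - 1 ≤ 0 := by rw [sub_nonpos, div_le_one hδ]; exact h
  rw [swing, swingDeriv, step_of_nonpos this, stepDeriv_of_nonpos this]
  norm_num

lemma swing_of_ge (hδ : 0 < δ) (h : 2 * δ ≤ R) : swing δ R = 1 ∧ swingDeriv δ R = 0 := by
  have : 1 ≤ R / δ - 1 := by rw [le_sub_iff_add_le, le_div_iff₀ hδ]; linarith
  rw [swing, swingDeriv, step_of_one_le this, stepDeriv_of_one_le this]
  norm_num

lemma abs_swing_le : |swing δ R| ≤ 1 := by
  have h1 := step_nonneg (R / δ - 1)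
  have h2 := step_le_one (R / δ - 1)
  rw [swing, abs_le]
  constructor <;> linarith

lemma swing_mul_deriv2_nonpos (hδ : 0 < δ) :
    swing δ R * (2 / δ * (deriv stepDeriv (R / δ - 1) * (1 / δ))) ≤ 0 := by
  have h := step_mul_deriv_stepDeriv_nonpos (R / δ - 1)
  have : swing δ R * (2 / δ * (deriv stepDeriv (R / δ - 1) * (1 / δ))) =
    (2 / δ * (1 / δ)) * ((2 * step (R / δ - 1) - 1) * deriv stepDeriv (R / δ - 1)) := by
    rw [swing]; ring
  rw [this]
  exact mul_nonpos_of_nonneg_of_nonpos (by positivity) h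

lemma exists_swingDeriv_le (hδ : 0 < δ) : ∃ M, 0 < M ∧ ∀ R, swingDeriv δ R ≤ M := by
  obtain ⟨B, hB⟩ := (isCompact_Icc (a := δ) (b := 2 * δ)).exists_bound_of_continuousOn
    (contDiff_swingDeriv (δ := δ)).continuous.continuousOn
  refine ⟨max B 1, by positivity, fun R => ?_⟩
  rcases le_or_gt R δ with h | h
  · rw [(swing_of_le hδ h).2]; positivity
  rcases le_or_gt (2 * δ) R with h' | h'
  · rw [(swing_of_ge hδ h').2]; positivity
  exact (le_abs_self _).trans ((hB R ⟨h.le, h'.le⟩).trans (le_max_left _ _))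

end Swing

/-- The family of discs that is pushed over the core of a `(+1)`-surgery. -/
def swingFamily (σ h h' ρ δ : ℝ) : PlaneFamily where
  q₁ s R := profile h h' ρ R ^ 2 / 4 *
    ((1 - s + s * swing δ R) * Real.cos R + s * swingDeriv δ R * Real.sin R)
  q₂ s R := profile h h' ρ R ^ 2 / 4 *
    ((1 - s + s * swing δ R) * Real.sin R - s * swingDeriv δ R * Real.cos R)
  p₁ _ R := σ * (Real.cos R - 2 * profileSlope h h' ρ R / profile h h' ρ R * Real.sin R)
  p₂ _ R := σ * (Real.sin R + 2 * profileSlope h h' ρ R / profile h h' ρ R * Real.cos R)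

section SwingFamily

variable {e : Sph m} {r a b h h' σ ρ δ δ₀ : ℝ}

lemma swingFamily_small {s R : ℝ} (hρ : 0 < ρ) (hR : R ≤ ρ / 2) :
    (swingFamily σ h h' ρ δ).q₁ s R = h' ^ 2 / 4 *
      ((1 - s + s * swing δ R) * Real.cos R + s * swingDeriv δ R * Real.sin R) ∧
    (swingFamily σ h h' ρ δ).q₂ s R = h' ^ 2 / 4 *
      ((1 - s + s * swing δ R) * Real.sin R - s * swingDeriv δ R * Real.cos R) ∧
    (swingFamily σ h h' ρ δ).p₁ s R = σ * Real.cos R ∧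
    (swingFamily σ h h' ρ δ).p₂ s R = σ * Real.sin R := by
  simp only [swingFamily, profile_of_le hρ hR, profileSlope_of_le hρ hR]
  norm_num

lemma swingFamily_large {s R : ℝ} (hδ : 0 < δ) (hR : 2 * δ ≤ R) :
    (swingFamily σ h h' ρ δ).q₁ s R = profile h h' ρ R ^ 2 / 4 * Real.cos R ∧
    (swingFamily σ h h' ρ δ).q₂ s R = profile h h' ρ R ^ 2 / 4 * Real.sin R := by
  obtain ⟨h1, h2⟩ := swing_of_ge hδ hR
  simp only [swingFamily, h1, h2]
  constructor <;> ring

lemma swingFamily_ne {R R' k τ : ℝ} (hr : r < Real.pi) (hδ : 0 < δ) (hδρ : 2 * δ < ρ / 2)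
    (hρ1 : ρ ≤ 1 / 2) (hδr : 2 * δ < Real.pi - r) (h0 : 0 < h') (hh : h' ≤ h) (hR0 : 0 < R)
    (hR : R ≤ 2 * δ) (hR' : ρ / 2 ≤ R') (hR'r : R' < r) (hτ : τ = 1 ∨ τ = -1)
    (h1 : Real.cos R' - 2 * profileSlope h h' ρ R' / profile h h' ρ R' * Real.sin R' =
      k * Real.cos R)
    (h2 : Real.sin R' + 2 * profileSlope h h' ρ R' / profile h h' ρ R' * Real.cos R' =
      τ * (k * Real.sin R)) : False := by
  have hρ : 0 < ρ := by linarith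
  set g := 2 * profileSlope h h' ρ R' / profile h h' ρ R' with hg
  have hg0 : 0 ≤ g := div_nonneg (mul_nonneg zero_le_two (profileSlope_nonneg hρ hh))
    (h0.le.trans (le_profile hh))
  have hpi := Real.pi_gt_three
  have hg1 : g = 0 ∨ R' < 1 / 2 := by
    rcases lt_or_ge R' ρ with h | h
    · right; linarith
    · left; rw [hg, profileSlope_of_ge hρ h]; simp
  rcases hτ with rfl | rfl
  · have h3 : Real.sin (R' - R) + g * Real.cos (R' - R) = 0 := by
      rw [Real.sin_sub, Real.cos_sub]
      linear_combination Real.cos R * h2 - Real.sin R * h1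
    have h4 : 0 < Real.sin (R' - R) := Real.sin_pos_of_pos_of_lt_pi (by linarith) (by linarith)
    rcases hg1 with h | h
    · rw [h] at h3; linarith
    · have h5 : 0 < Real.cos (R' - R) :=
        Real.cos_pos_of_mem_Ioo ⟨by linarith, by linarith⟩
      nlinarith
  · have h3 : Real.sin (R' + R) + g * Real.cos (R' + R) = 0 := by
      rw [Real.sin_add, Real.cos_add]
      linear_combination Real.cos R * h2 + Real.sin R * h1
    have h4 : 0 < Real.sin (R' + R) := Real.sin_pos_of_pos_of_lt_pi (by linarith) (by linarith)
    rcases hg1 with h | h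
    · rw [h] at h3; linarith
    · have h5 : 0 < Real.cos (R' + R) :=
        Real.cos_pos_of_mem_Ioo ⟨by linarith, by linarith⟩
      nlinarith

lemma eq_of_polar {R R' u u' τ : ℝ} (hR0 : 0 < R) (hR : R < Real.pi) (hR0' : 0 < R')
    (hR' : R' < Real.pi) (hu : 0 < u) (hu' : 0 < u') (hτ : τ = 1 ∨ τ = -1)
    (h1 : u' * Real.cos R' = u * Real.cos R) (h2 : u' * Real.sin R' = τ * (u * Real.sin R)) :
    R = R' := by
  have s1 := Real.sin_pos_of_pos_of_lt_pi hR0 hR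
  have s2 := Real.sin_pos_of_pos_of_lt_pi hR0' hR'
  have hτ1 : τ = 1 := by
    rcases hτ with h | h
    · exact h
    · rw [h] at h2
      have := mul_pos hu s1
      have := mul_pos hu' s2
      linarith
  have h3 : (u * u') * Real.sin (R' - R) = 0 := by
    rw [Real.sin_sub, ]
    rw [hτ1] at h2
    linear_combination (u * Real.cos R) * h2 - (u * Real.sin R) * h1
  have h4 := (mul_eq_zero.1 h3).resolve_left (mul_pos hu hu').ne'
  have h5 := (Real.sin_eq_zero_iff_of_lt_of_lt (by linarith) (by linarith)).1 h4
  linarith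

theorem isGood_swingFamily (hr : r < Real.pi) (hδ : 0 < δ) (hδρ : 2 * δ < ρ / 2) (hρ1 : ρ ≤ 1 / 2)
    (hδr : 2 * δ < Real.pi - r) (h0 : 0 < h') (hh : h' ≤ h)
    (hσ : σ = 1 ∨ σ = -1) : (swingFamily σ h h' ρ δ).IsGood r := by
  have hρ : 0 < ρ := by linarith
  have hσ0 : σ ≠ 0 := by rcases hσ with rfl | rfl <;> norm_num
  have hA : ∀ R, 0 < profile h h' ρ R := fun R => h0.trans_le (le_profile hh)
  have trig : ∀ z, Real.cos z * Real.cos z + Real.sin z * Real.sin z = 1 := fun z => by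
    nlinarith [Real.sin_sq_add_cos_sq z]
  have hpos : ∀ R, 0 < R → R < r → 0 < Real.sin R := fun R k1 k2 =>
    Real.sin_pos_of_pos_of_lt_pi k1 (k2.trans hr)
  have hDG : ∀ s R, (swingFamily σ h h' ρ δ).DerivGood s R := by
    intro s R
    have hc := Real.hasDerivAt_cos R
    have hs := Real.hasDerivAt_sin R
    have htr := trig R
    rcases le_or_gt R (2 * δ) with hR | hR
    · have hev : ∀ᶠ R' in 𝓝 R, R' ≤ ρ / 2 := by
        filter_upwards [Iio_mem_nhds (show R < ρ / 2 by linarith)] with R' hR' using le_of_lt hR'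
      have hj : HasDerivAt (fun R => 1 - s + s * swing δ R) (s * swingDeriv δ R) R :=
        (hasDerivAt_swing.const_mul s).const_add _
      have hk := (hasDerivAt_swingDeriv (δ := δ) (R := R)).const_mul s
      obtain ⟨v1, v2, v3, v4⟩ := swingFamily_small (σ := σ) (h := h) (h' := h') (δ := δ) (s := s)
        hρ hev.self_of_nhds
      refine ⟨_, _, _, _,
        (((hj.mul hc).add (hk.mul hs)).const_mul (h' ^ 2 / 4)).congr_of_eventuallyEq
          (hev.mono fun R' hR' => (swingFamily_small hρ hR').1),
        (((hj.mul hs).sub (hk.mul hc)).const_mul (h' ^ 2 / 4)).congr_of_eventuallyEq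
          (hev.mono fun R' hR' => (swingFamily_small hρ hR').2.1),
        (hc.const_mul σ).congr_of_eventuallyEq
          (hev.mono fun R' hR' => (swingFamily_small (s := s) (δ := δ) hρ hR').2.2.1),
        (hs.const_mul σ).congr_of_eventuallyEq
          (hev.mono fun R' hR' => (swingFamily_small (s := s) (δ := δ) hρ hR').2.2.2), ?_, ?_⟩
      · rw [v1, v2, v3, v4]
        ring
      · intro η μ k1 k2 k3 k4
        rw [v3] at k3
        rw [v4] at k4
        have : σ * η = 0 := by
          linear_combination Real.cos R * k4 - Real.sin R * k3 - σ * η * htr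
        exact (mul_eq_zero.1 this).resolve_left hσ0
    · have hev : ∀ᶠ R' in 𝓝 R, 2 * δ ≤ R' := by
        filter_upwards [Ioi_mem_nhds hR] with R' hR' using le_of_lt hR'
      obtain ⟨v1, v2⟩ := swingFamily_large (σ := σ) (h := h) (h' := h') (ρ := ρ) (s := s)
        hδ hR.le
      have hp := hasDerivAt_profile (h := h) (h' := h') (ρ := ρ) (R := R)
      have hps := ((contDiff_profileSlope (h := h) (h' := h') (ρ := ρ)).differentiable (by simp)
        R).hasDerivAt
      have hg := (hps.const_mul 2).div hp (hA R).ne'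
      have hA2 := (hp.pow 2).div_const 4
      have hAne := (hA R).ne'
      refine ⟨_, _, _, _, (hA2.mul hc).congr_of_eventuallyEq
          (hev.mono fun R' hR' => (swingFamily_large (σ := σ) hδ hR').1),
        (hA2.mul hs).congr_of_eventuallyEq
          (hev.mono fun R' hR' => (swingFamily_large (σ := σ) hδ hR').2),
        (hc.sub (hg.mul hs)).const_mul σ, (hs.add (hg.mul hc)).const_mul σ, ?_, ?_⟩
      · rw [v1, v2]
        simp only [swingFamily]
        simp only [Pi.pow_apply, Pi.div_apply]
        field_simp
        ring
      · intro η μ k1 k2 k3 k4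
        rw [v1] at k1
        rw [v2] at k2
        have : (profile h h' ρ R ^ 2 / 4) * η = 0 := by
          simp only [Pi.pow_apply] at k1 k2
          linear_combination Real.cos R * k2 - Real.sin R * k1 -
            (profile h h' ρ R ^ 2 / 4) * η * htr
        exact (mul_eq_zero.1 this).resolve_left (by positivity)
  refine ⟨?_, ?_, fun s _ R _ _ => (hDG s R).liouville,
    fun s _ R _ _ => (hDG s R).immersion, ?_, ?_⟩
  · intro s _ R _ _
    have a1 : ContDiff ℝ ∞ fun z : ℝ × ℝ => profile h h' ρ z.2 ^ 2 / 4 :=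
      ((contDiff_profile.comp contDiff_snd).pow 2).div_const 4
    have a2 : ContDiff ℝ ∞ fun z : ℝ × ℝ => 1 - z.1 + z.1 * swing δ z.2 :=
      (contDiff_const.sub contDiff_fst).add (contDiff_fst.mul (contDiff_swing.comp contDiff_snd))
    have a3 : ContDiff ℝ ∞ fun z : ℝ × ℝ => z.1 * swingDeriv δ z.2 :=
      contDiff_fst.mul (contDiff_swingDeriv.comp contDiff_snd)
    have a4 : ContDiff ℝ ∞ fun z : ℝ × ℝ => 2 * profileSlope h h' ρ z.2 / profile h h' ρ z.2 :=
      (contDiff_const.mul (contDiff_profileSlope.comp contDiff_snd)).div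
        (contDiff_profile.comp contDiff_snd) fun z => (hA z.2).ne'
    have a5 : ContDiff ℝ ∞ fun z : ℝ × ℝ => Real.cos z.2 := Real.contDiff_cos.comp contDiff_snd
    have a6 : ContDiff ℝ ∞ fun z : ℝ × ℝ => Real.sin z.2 := Real.contDiff_sin.comp contDiff_snd
    exact ⟨(a1.mul ((a2.mul a5).add (a3.mul a6))).contDiffAt,
      (a1.mul ((a2.mul a6).sub (a3.mul a5))).contDiffAt,
      (contDiff_const.mul (a5.sub (a4.mul a6))).contDiffAt,
      (contDiff_const.mul (a6.add (a4.mul a5))).contDiffAt⟩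
  · refine ⟨δ, hδ, fun s => h' ^ 2 / 4 * (1 - 2 * s), fun s => h' ^ 2 / 4 * (1 - 2 * s),
      fun _ => σ, fun _ => σ, by fun_prop, by fun_prop, by fun_prop, by fun_prop,
      fun _ _ => Or.inr hσ0, fun s R _ hR => ?_⟩
    obtain ⟨v1, v2, v3, v4⟩ := swingFamily_small (σ := σ) (h := h) (h' := h') (δ := δ) (s := s)
      hρ (show R ≤ ρ / 2 by linarith)
    obtain ⟨w1, w2⟩ := swing_of_le hδ hR.le
    rw [v1, v2, v3, v4, w1, w2]
    refine ⟨by ring, by ring, rfl, rfl⟩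
  · intro s _ R k0 kR
    rcases le_or_gt R (2 * δ) with hR | hR
    · right
      rw [(swingFamily_small hρ (show R ≤ ρ / 2 by linarith)).2.2.2]
      exact mul_ne_zero hσ0 (hpos R k0 kR).ne'
    · left
      rw [(swingFamily_large hδ hR.le).2]
      have := hA R
      have := hpos R k0 kR
      positivity
  · intro s _ R R' k0 kR k0' kR' l τ hl hτ k1 k2 k3 k4
    have hτ2 : τ * τ = 1 := by rcases hτ with rfl | rfl <;> norm_num
    have l1 := inv_pos.2 hl
    rcases le_or_gt R (2 * δ) with hR | hR
    · rcases le_or_gt R' (ρ / 2) with hR' | hR'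
      · rw [(swingFamily_small hρ (show R ≤ ρ / 2 by linarith)).2.2.1,
          (swingFamily_small hρ hR').2.2.1] at k3
        rw [(swingFamily_small hρ (show R ≤ ρ / 2 by linarith)).2.2.2,
          (swingFamily_small hρ hR').2.2.2] at k4
        refine eq_of_polar k0 (kR.trans hr) k0' (kR'.trans hr) l1 one_pos hτ ?_ ?_
        · exact mul_left_cancel₀ hσ0 (by linear_combination k3)
        · exact mul_left_cancel₀ hσ0 (by linear_combination k4)
      · exfalso
        rw [(swingFamily_small hρ (show R ≤ ρ / 2 by linarith)).2.2.1] at k3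
        rw [(swingFamily_small hρ (show R ≤ ρ / 2 by linarith)).2.2.2] at k4
        refine swingFamily_ne (k := l⁻¹) hr hδ hδρ hρ1 hδr h0 hh k0 hR hR'.le kR' hτ ?_ ?_
        · exact mul_left_cancel₀ hσ0 (k3.trans (by ring))
        · exact mul_left_cancel₀ hσ0 (k4.trans (by ring))
    · rcases le_or_gt R' (2 * δ) with hR' | hR'
      · rcases le_or_gt R (ρ / 2) with hR1 | hR1
        · rw [(swingFamily_small hρ hR1).2.2.1,
            (swingFamily_small hρ (show R' ≤ ρ / 2 by linarith)).2.2.1] at k3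
          rw [(swingFamily_small hρ hR1).2.2.2,
            (swingFamily_small hρ (show R' ≤ ρ / 2 by linarith)).2.2.2] at k4
          refine eq_of_polar k0 (kR.trans hr) k0' (kR'.trans hr) l1 one_pos hτ ?_ ?_
          · exact mul_left_cancel₀ hσ0 (by linear_combination k3)
          · exact mul_left_cancel₀ hσ0 (by linear_combination k4)
        · exfalso
          rw [(swingFamily_small hρ (show R' ≤ ρ / 2 by linarith)).2.2.1] at k3
          rw [(swingFamily_small hρ (show R' ≤ ρ / 2 by linarith)).2.2.2] at k4
          simp only [swingFamily] at k3 k4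
          have hll : l * l⁻¹ = 1 := mul_inv_cancel₀ hl.ne'
          refine swingFamily_ne (k := l) hr hδ hδρ hρ1 hδr h0 hh k0' hR' hR1.le kR hτ ?_ ?_
          · refine mul_left_cancel₀ hσ0 ?_
            linear_combination (-l) * k3 - σ * (Real.cos R - 2 * profileSlope h h' ρ R /
              profile h h' ρ R * Real.sin R) * hll
          · refine mul_left_cancel₀ hσ0 ?_
            linear_combination (-τ * l) * k4 - σ * (Real.sin R + 2 * profileSlope h h' ρ R /
              profile h h' ρ R * Real.cos R) * hll - σ * l * l⁻¹ * (Real.sin R +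
              2 * profileSlope h h' ρ R / profile h h' ρ R * Real.cos R) * hτ2
      · rw [(swingFamily_large hδ hR.le).1, (swingFamily_large hδ hR'.le).1] at k1
        rw [(swingFamily_large hδ hR.le).2, (swingFamily_large hδ hR'.le).2] at k2
        have u1 := hA R
        have u2 := hA R'
        exact eq_of_polar k0 (kR.trans hr) k0' (kR'.trans hr)
          (show 0 < l ^ 2 * (profile h h' ρ R ^ 2 / 4) by positivity)
          (show 0 < profile h h' ρ R' ^ 2 / 4 by positivity) hτ (k1.trans (by ring))
          (k2.trans (by ring))

open PlaneFamily

lemma swingFamily_flowRel {s R : ℝ} (h0 : 0 < h') (hh : h' ≤ h) (hδ : 0 < δ)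
    (hs : s = 0 ∨ 2 * δ ≤ R) : FlowRel (swingFamily σ h h' ρ δ)
      (outer .plus σ (fun _ R => R) (fun s R => s * profileSlope h h' ρ R)
        (fun s R => (1 - s) * h + s * profile h h' ρ R)) s 1 R (2 / profile h h' ρ R) := by
  have hA : 0 < profile h h' ρ R := h0.trans_le (le_profile hh)
  have hq : (swingFamily σ h h' ρ δ).q₁ s R = profile h h' ρ R ^ 2 / 4 * Real.cos R ∧
      (swingFamily σ h h' ρ δ).q₂ s R = profile h h' ρ R ^ 2 / 4 * Real.sin R := by
    rcases hs with rfl | hs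
    · simp [swingFamily]
    · exact swingFamily_large hδ hs
  constructor
  · rw [hq.1]; simp only [outer]; field_simp; ring
  · rw [hq.2]; simp only [outer]; field_simp; ring
  · simp only [outer, swingFamily]; field_simp; ring
  · simp only [outer, swingFamily]; field_simp; ring

lemma coreVec_swingFamily {s : ℝ} (hσ : σ = 1 ∨ σ = -1) (x : Sph m) :
    coreVec .plus ((swingFamily σ h h' ρ δ).spun e s (x : Euc m)) ≠ 0 := by
  have hσ0 : σ ≠ 0 := by rcases hσ with rfl | rfl <;> norm_num
  refine spin_ne_zero ?_
  by_contra! h1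
  obtain ⟨h2, h3⟩ := h1
  simp only [swingFamily] at h2 h3
  have h2' := (mul_eq_zero.1 h2).resolve_left hσ0
  by_cases h4 : Real.sin (axisAngle e (x : Euc m)) = 0
  · rw [h4, mul_zero, sub_zero] at h2'
    have := Real.sin_sq_add_cos_sq (axisAngle e (x : Euc m))
    rw [h4, h2'] at this
    norm_num at this
  · have h3' := (mul_eq_zero.1 (h3 h4)).resolve_left hσ0
    set g := 2 * profileSlope h h' ρ (axisAngle e (x : Euc m)) /
      profile h h' ρ (axisAngle e (x : Euc m))
    have := Real.sin_sq_add_cos_sq (axisAngle e (x : Euc m))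
    have h5 : 1 + g ^ 2 = 0 := by
      linear_combination (Real.cos (axisAngle e (x : Euc m)) - g *
        Real.sin (axisAngle e (x : Euc m))) * h2' + (Real.sin (axisAngle e (x : Euc m)) + g *
        Real.cos (axisAngle e (x : Euc m))) * h3' - (1 + g ^ 2) * this
    nlinarith [sq_nonneg g]

lemma swing_rotate_le {c v s w k M C : ℝ} (htr : v ^ 2 + c ^ 2 = 1) (hs : s ∈ Icc (0 : ℝ) 1)
    (hw : |w| ≤ 1) (hk : 0 ≤ k) (hkM : k ≤ M) :
    (C * ((1 - s + s * w) * c + s * k * v)) ^ 2 + (C * ((1 - s + s * w) * v - s * k * c)) ^ 2 ≤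
      (C * (1 + M)) ^ 2 := by
  obtain ⟨w1, w2⟩ := abs_le.1 hw
  have hj : (1 - s + s * w) ^ 2 ≤ 1 := by
    rw [sq_le_one_iff_abs_le_one, abs_le]
    constructor
    · linarith [mul_nonneg hs.1 (show 0 ≤ w + 1 by linarith), hs.2]
    · linarith [mul_nonneg hs.1 (show 0 ≤ 1 - w by linarith)]
  have hk1 : (s * k) ^ 2 ≤ M ^ 2 :=
    pow_le_pow_left₀ (mul_nonneg hs.1 hk) ((mul_le_of_le_one_left hk hs.2).trans hkM) 2
  have h1 : (1 - s + s * w) ^ 2 + (s * k) ^ 2 ≤ (1 + M) ^ 2 := by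
    linarith [show (1 + M) ^ 2 = 1 + 2 * M + M ^ 2 by ring, hk.trans hkM]
  calc _ = C ^ 2 * ((1 - s + s * w) ^ 2 + (s * k) ^ 2) := by
        linear_combination (C ^ 2 * ((1 - s + s * w) ^ 2 + (s * k) ^ 2)) * htr
    _ ≤ C ^ 2 * (1 + M) ^ 2 := mul_le_mul_of_nonneg_left h1 (sq_nonneg C)
    _ = _ := by ring

theorem discFamily_swingFamily {M : ℝ} (hr : r < Real.pi) (hδ : 0 < δ) (hδρ : 2 * δ < ρ / 2)
    (hρ1 : ρ ≤ 1 / 2) (hρr : ρ < r) (hδr : 2 * δ < Real.pi - r) (ha : 0 < a) (h0 : 0 < h')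
    (hh : h' ≤ h) (hb : h < b) (hσ : σ = 1 ∨ σ = -1) (hM : ∀ R, swingDeriv δ R ≤ M)
    (hδ₀ : 0 ≤ δ₀) (hM0 : h' * (1 + M) ≤ δ₀) :
    DiscFamily .plus e r a b h σ δ₀
      (fun s x => coreProj .plus ((swingFamily σ h h' ρ δ).spun e s (x : Euc m))) := by
  have hρ : 0 < ρ := by linarith
  have ho := outerGood_profile (δ₀ := δ₀) hr ha hρ hρr h0 hh hb
  have large : ∀ s, ∀ x ∈ cap e r, 2 * δ ≤ axisAngle e (x : Euc m) →
      outerVec .plus ((swingFamily σ h h' ρ δ).spun e s (x : Euc m)) ≠ 0 ∧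
      outerProj .plus ((swingFamily σ h h' ρ δ).spun e s (x : Euc m)) =
        spunJet e x σ (axisAngle e (x : Euc m))
          (1 * profileSlope h h' ρ (axisAngle e (x : Euc m)))
          ((1 - 1) * h + 1 * profile h h' ρ (axisAngle e (x : Euc m))) := by
    intro s x hx hR
    have hfr := swingFamily_flowRel (σ := σ) (ρ := ρ) h0 hh hδ (s := s) (Or.inr hR)
    have hA : 0 < profile h h' ρ (axisAngle e (x : Euc m)) := h0.trans_le (le_profile hh)
    obtain ⟨h2, h3⟩ := outerProj_outer (κ := .plus) (σ := σ) (θ := fun _ R => R)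
      (P := fun s R => s * profileSlope h h' ρ R)
      (A := fun s R => (1 - s) * h + s * profile h h' ρ R) (ho.axis hr hx (s := 1)) rfl rfl rfl
    exact ⟨hfr.outerVec_ne _ h2, (hfr.outerProj (by positivity) _ h2).trans h3⟩
  refine (isGood_swingFamily hr hδ hδρ hρ1 hδr h0 hh hσ).discFamily hr _
    (fun s _ x _ => coreVec_swingFamily hσ x) (fun s hs x hx => ?_) ?_
  · obtain ⟨k0, kR⟩ := axisAngle_mem hx
    rcases le_or_gt (2 * δ) (axisAngle e (x : Euc m)) with hR | hR
    · obtain ⟨-, h3⟩ := large s x hx hR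
      right; left
      rw [h3]
      refine spunJet_mem_frontBox (ho.axis hr hx (s := 1)) hσ hr.le ?_ ?_ ?_
      · rwa [abs_of_nonneg k0]
      · have := le_profile (ρ := ρ) (R := axisAngle e (x : Euc m)) hh
        linarith
      · have := profile_le (ρ := ρ) (R := axisAngle e (x : Euc m)) hh
        linarith
    · by_cases hq : outerVec .plus ((swingFamily σ h h' ρ δ).spun e s (x : Euc m)) = 0
      · exact Or.inl hq
      right; right
      obtain ⟨v1, v2, v3, v4⟩ := swingFamily_small (σ := σ) (h := h) (h' := h') (δ := δ) (s := s)
        hρ (show axisAngle e (x : Euc m) ≤ ρ / 2 by linarith)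
      have hM' := hM (axisAngle e (x : Euc m))
      have hd := swingDeriv_nonneg (R := axisAngle e (x : Euc m)) hδ
      have hM1 : 0 ≤ M := hd.trans hM'
      have htr := Real.sin_sq_add_cos_sq (axisAngle e (x : Euc m))
      set R := axisAngle e (x : Euc m) with hRdef
      have n1 : ‖((swingFamily σ h h' ρ δ).spun e s (x : Euc m)).1‖ ≤ h' ^ 2 / 4 * (1 + M) := by
        refine (sq_le_sq₀ (norm_nonneg _) (by positivity)).1 ((norm_sq_spin_le e x _ _).trans ?_)
        rw [← hRdef, v1, v2]
        exact swing_rotate_le htr hs (abs_swing_le) hd hM'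
      have n2 : ‖((swingFamily σ h h' ρ δ).spun e s (x : Euc m)).2‖ ^ 2 ≤ 1 := by
        refine (norm_sq_spin_le e x _ _).trans ?_
        rw [← hRdef, v3, v4]
        have hσ2 : σ ^ 2 = 1 := by rcases hσ with rfl | rfl <;> norm_num
        rw [mul_pow, mul_pow, hσ2]
        linarith
      have n3 := norm_projQ_le hq
      refine (sq_le_sq₀ (norm_nonneg _) hδ₀).1 (n3.trans ?_)
      calc 4 * (‖((swingFamily σ h h' ρ δ).spun e s (x : Euc m)).1‖ *
            ‖((swingFamily σ h h' ρ δ).spun e s (x : Euc m)).2‖ ^ 2)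
          ≤ 4 * (h' ^ 2 / 4 * (1 + M) * 1) := by gcongr
        _ ≤ (h' * (1 + M)) ^ 2 := by
          have : 0 ≤ h' ^ 2 * (1 + M) * M := by positivity
          nlinarith
        _ ≤ δ₀ ^ 2 := by gcongr
  · refine ⟨ρ, hρr, fun s hs x hx hR => ?_⟩
    obtain ⟨h2, h3⟩ := large s x hx (by linarith)
    refine ⟨h2, ?_⟩
    rw [h3, profileSlope_of_ge hρ hR, profile_of_ge hρ hR, mul_zero, spunJet_self]
    congr 1
    ring

end SwingFamily

/-! ### Straightening the disc after a `(+1)`-surgery -/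

section Swing

variable {h h' ρ δ R : ℝ}

/-- The squared norm of `swing + i swingDeriv`. -/
def swingSq (δ R : ℝ) : ℝ := swing δ R ^ 2 + swingDeriv δ R ^ 2

/-- The square root of the norm of `swing + i swingDeriv`. -/
def swingRoot (δ R : ℝ) : ℝ := √√(swingSq δ R)

/-- The angle from the axis of the disc after it has been pushed over the core. -/
def swingAngle (δ R : ℝ) : ℝ :=
  R - Real.pi / 2 + ((swingDeriv δ R : ℂ) + (swing δ R : ℂ) * Complex.I).arg

/-- The height of the disc after it has been pushed over the core. -/
def swingHeight (h h' ρ δ R : ℝ) : ℝ :=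
  h' * (swing δ R / swingRoot δ R) + (profile h h' ρ R - h')

/-- The slope of the disc after it has been pushed over the core. -/
def swingSlope (h h' ρ δ R : ℝ) : ℝ :=
  h' / 2 * (swingDeriv δ R / swingRoot δ R) + profileSlope h h' ρ R

lemma swing_ne_or (hδ : 0 < δ) : swing δ R ≠ 0 ∨ 0 < swingDeriv δ R := by
  rcases le_or_gt R δ with h1 | h1
  · left; rw [(swing_of_le hδ h1).1]; norm_num
  · rcases le_or_gt (2 * δ) R with h2 | h2
    · left; rw [(swing_of_ge hδ h2).1]; norm_num
    · exact Or.inr (swingDeriv_pos hδ h1 h2)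

lemma swingSq_pos (hδ : 0 < δ) : 0 < swingSq δ R := by
  rw [swingSq]
  rcases swing_ne_or (R := R) hδ with h | h <;> positivity

lemma swingRoot_pos (hδ : 0 < δ) : 0 < swingRoot δ R :=
  Real.sqrt_pos.2 (Real.sqrt_pos.2 (swingSq_pos hδ))

lemma swingRoot_sq : swingRoot δ R ^ 2 = √(swingSq δ R) := Real.sq_sqrt (Real.sqrt_nonneg _)

lemma swingRoot_pow_four (hδ : 0 < δ) : swingRoot δ R ^ 4 = swingSq δ R := by
  rw [show swingRoot δ R ^ 4 = (swingRoot δ R ^ 2) ^ 2 by ring, swingRoot_sq,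
    Real.sq_sqrt (swingSq_pos hδ).le]

lemma swingRoot_of_le (hδ : 0 < δ) (hR : R ≤ δ) : swingRoot δ R = 1 := by
  rw [swingRoot, swingSq, (swing_of_le hδ hR).1, (swing_of_le hδ hR).2]; norm_num

lemma swingRoot_of_ge (hδ : 0 < δ) (hR : 2 * δ ≤ R) : swingRoot δ R = 1 := by
  rw [swingRoot, swingSq, (swing_of_ge hδ hR).1, (swing_of_ge hδ hR).2]; norm_num

lemma swingAngle_of_le (hδ : 0 < δ) (hR : R ≤ δ) : swingAngle δ R = R - Real.pi := by
  rw [swingAngle, (swing_of_le hδ hR).1, (swing_of_le hδ hR).2]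
  rw [show ((0 : ℝ) : ℂ) + ((-1 : ℝ) : ℂ) * Complex.I = -Complex.I by push_cast; ring,
    Complex.arg_neg_I]
  ring

lemma swingAngle_of_ge (hδ : 0 < δ) (hR : 2 * δ ≤ R) : swingAngle δ R = R := by
  rw [swingAngle, (swing_of_ge hδ hR).1, (swing_of_ge hδ hR).2]
  rw [show ((0 : ℝ) : ℂ) + ((1 : ℝ) : ℂ) * Complex.I = Complex.I by push_cast; ring,
    Complex.arg_I]
  ring

lemma norm_swing : ‖(swingDeriv δ R : ℂ) + (swing δ R : ℂ) * Complex.I‖ = swingRoot δ R ^ 2 := by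
  rw [swingRoot_sq, Complex.norm_add_mul_I, swingSq, add_comm]

lemma cos_sin_swingAngle (hδ : 0 < δ) :
    Real.cos (swingAngle δ R) = (swing δ R * Real.cos R + swingDeriv δ R * Real.sin R) /
      swingRoot δ R ^ 2 ∧
    Real.sin (swingAngle δ R) = (swing δ R * Real.sin R - swingDeriv δ R * Real.cos R) /
      swingRoot δ R ^ 2 := by
  have h0 := swingRoot_pos (R := R) hδ
  have hz : (swingDeriv δ R : ℂ) + (swing δ R : ℂ) * Complex.I ≠ 0 := by
    rw [← norm_ne_zero_iff, norm_swing]; positivity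
  have h1 := Complex.cos_arg hz
  have h2 := Complex.sin_arg ((swingDeriv δ R : ℂ) + (swing δ R : ℂ) * Complex.I)
  rw [norm_swing] at h1 h2
  simp only [Complex.add_re, Complex.add_im, Complex.ofReal_re, Complex.ofReal_im, Complex.mul_re,
    Complex.mul_im, Complex.I_re, Complex.I_im, mul_zero, mul_one, sub_zero, zero_add,
    add_zero] at h1 h2
  have e : swingAngle δ R = (R + ((swingDeriv δ R : ℂ) + (swing δ R : ℂ) * Complex.I).arg) -
    Real.pi / 2 := by rw [swingAngle]; ring
  rw [e, Real.cos_sub_pi_div_two, Real.sin_sub_pi_div_two, Real.sin_add, Real.cos_add, h1, h2]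
  constructor <;> field_simp <;> ring

lemma swing_mem_slitPlane (hδ : 0 < δ) :
    (swingDeriv δ R : ℂ) + (swing δ R : ℂ) * Complex.I ∈ Complex.slitPlane := by
  rw [Complex.mem_slitPlane_iff]
  rcases swing_ne_or (R := R) hδ with h | h
  · right; simpa using h
  · left; simpa using h

lemma contDiff_swingAngle (hδ : 0 < δ) : ContDiff ℝ ∞ (swingAngle δ) := by
  have h1 : ContDiff ℝ ∞ fun R : ℝ => (swingDeriv δ R : ℂ) + (swing δ R : ℂ) * Complex.I :=
    (Complex.ofRealCLM.contDiff.comp contDiff_swingDeriv).add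
      ((Complex.ofRealCLM.contDiff.comp contDiff_swing).mul contDiff_const)
  have h2 : ContDiff ℝ ∞ fun R : ℝ =>
      Complex.log ((swingDeriv δ R : ℂ) + (swing δ R : ℂ) * Complex.I) :=
    contDiff_iff_contDiffAt.2 fun R =>
      ContDiffAt.comp (g := Complex.log) R
        ((Complex.contDiffAt_log (swing_mem_slitPlane hδ)).restrict_scalars ℝ) h1.contDiffAt
  have h3 : ContDiff ℝ ∞ fun R : ℝ =>
      (Complex.log ((swingDeriv δ R : ℂ) + (swing δ R : ℂ) * Complex.I)).im :=
    Complex.imCLM.contDiff.comp h2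
  simp only [Complex.log_im] at h3
  exact (contDiff_id.sub contDiff_const).add h3

/-- The second derivative of `swing`. -/
def swingDeriv2 (δ R : ℝ) : ℝ := 2 / δ * (deriv stepDeriv (R / δ - 1) * (1 / δ))

lemma hasDerivAt_swingAngle (hδ : 0 < δ) : HasDerivAt (swingAngle δ)
    (1 + (swingDeriv δ R ^ 2 - swing δ R * swingDeriv2 δ R) / swingSq δ R) R := by
  have h1 : HasDerivAt (fun R : ℝ => (swingDeriv δ R : ℂ) + (swing δ R : ℂ) * Complex.I)
      ((swingDeriv2 δ R : ℂ) + (swingDeriv δ R : ℂ) * Complex.I) R :=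
    hasDerivAt_swingDeriv.ofReal_comp.add (hasDerivAt_swing.ofReal_comp.mul_const _)
  have h2 := h1.clog_real (swing_mem_slitPlane hδ)
  have h3 := (Complex.imCLM.hasFDerivAt).comp_hasDerivAt R h2
  have h4 : HasDerivAt (fun R : ℝ => ((swingDeriv δ R : ℂ) + (swing δ R : ℂ) * Complex.I).arg)
      (((swingDeriv2 δ R : ℂ) + (swingDeriv δ R : ℂ) * Complex.I) /
        ((swingDeriv δ R : ℂ) + (swing δ R : ℂ) * Complex.I)).im R := by
    refine h3.congr_of_eventuallyEq (Filter.Eventually.of_forall fun R => ?_)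
    simp [Complex.log_im]
  refine (((hasDerivAt_id R).sub_const (Real.pi / 2)).add h4).congr_deriv ?_
  have hn : Complex.normSq ((swingDeriv δ R : ℂ) + (swing δ R : ℂ) * Complex.I) = swingSq δ R := by
    rw [Complex.normSq_add_mul_I, swingSq]; ring
  rw [Complex.div_im, hn]
  have := swingSq_pos (R := R) hδ
  simp
  field_simp

lemma swingAngle_deriv_pos (hδ : 0 < δ) :
    0 < 1 + (swingDeriv δ R ^ 2 - swing δ R * swingDeriv2 δ R) / swingSq δ R := by
  have h1 := swing_mul_deriv2_nonpos (R := R) hδ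
  have h2 : 0 ≤ (swingDeriv δ R ^ 2 - swing δ R * swingDeriv2 δ R) / swingSq δ R :=
    div_nonneg (by rw [swingDeriv2]; nlinarith [sq_nonneg (swingDeriv δ R)]) (swingSq_pos hδ).le
  linarith

lemma strictMono_swingAngle (hδ : 0 < δ) : StrictMono (swingAngle δ) :=
  strictMono_of_hasDerivAt_pos (fun _ => hasDerivAt_swingAngle hδ)
    fun _ => swingAngle_deriv_pos hδ

lemma contDiff_swingRoot (hδ : 0 < δ) : ContDiff ℝ ∞ (swingRoot δ) := by
  have h1 : ContDiff ℝ ∞ (swingSq δ) := (contDiff_swing.pow 2).add (contDiff_swingDeriv.pow 2)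
  exact (h1.sqrt fun R => (swingSq_pos hδ).ne').sqrt
    fun R => (Real.sqrt_pos.2 (swingSq_pos hδ)).ne'

lemma contDiff_swingHeight (hδ : 0 < δ) : ContDiff ℝ ∞ (swingHeight h h' ρ δ) :=
  (contDiff_const.mul (contDiff_swing.div (contDiff_swingRoot hδ) fun _ =>
    (swingRoot_pos hδ).ne')).add (contDiff_profile.sub contDiff_const)

lemma contDiff_swingSlope (hδ : 0 < δ) : ContDiff ℝ ∞ (swingSlope h h' ρ δ) :=
  (contDiff_const.mul (contDiff_swingDeriv.div (contDiff_swingRoot hδ) fun _ =>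
    (swingRoot_pos hδ).ne')).add contDiff_profileSlope

lemma hasDerivAt_swingHeight (hδ : 0 < δ) (hδρ : 2 * δ < ρ / 2) :
    HasDerivAt (swingHeight h h' ρ δ) (swingSlope h h' ρ δ R *
      (1 + (swingDeriv δ R ^ 2 - swing δ R * swingDeriv2 δ R) / swingSq δ R)) R := by
  have hw := swingRoot_pos (R := R) hδ
  have hn := swingSq_pos (R := R) hδ
  have hw4 := swingRoot_pow_four (R := R) hδ
  obtain ⟨d, hd⟩ : ∃ d, HasDerivAt (swingRoot δ) d R :=
    ⟨_, ((contDiff_swingRoot hδ).differentiable (by simp) R).hasDerivAt⟩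
  have hd4 : 4 * swingRoot δ R ^ 3 * d = 2 * swing δ R * swingDeriv δ R +
      2 * swingDeriv δ R * swingDeriv2 δ R := by
    have k1 : HasDerivAt (swingSq δ) (2 * swing δ R * swingDeriv δ R +
        2 * swingDeriv δ R * swingDeriv2 δ R) R := by
      have := (hasDerivAt_swing (δ := δ) (R := R)).pow 2 |>.add
        ((hasDerivAt_swingDeriv (δ := δ) (R := R)).pow 2)
      refine this.congr_deriv ?_
      simp only [swingDeriv2]
      push_cast
      ring
    have k2 : HasDerivAt (fun R => swingRoot δ R ^ 4) (4 * swingRoot δ R ^ 3 * d) R :=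
      (hd.pow 4).congr_deriv (by push_cast; ring)
    have k3 : (fun R => swingRoot δ R ^ 4) = swingSq δ := funext fun R => swingRoot_pow_four hδ
    rw [k3] at k2
    exact k2.unique k1
  have h1 := (((hasDerivAt_swing (δ := δ) (R := R)).div hd hw.ne').const_mul h').add
    ((hasDerivAt_profile (h := h) (h' := h') (ρ := ρ) (R := R)).sub_const h')
  refine h1.congr_deriv ?_
  have hps : profileSlope h h' ρ R *
      (1 + (swingDeriv δ R ^ 2 - swing δ R * swingDeriv2 δ R) / swingSq δ R) =
      profileSlope h h' ρ R := by
    rcases le_or_gt (2 * δ) R with hR | hR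
    · have e1 : swingDeriv2 δ R = 0 := by
        have : HasDerivAt (swingDeriv δ) (swingDeriv2 δ R) R := hasDerivAt_swingDeriv
        have h2 : deriv stepDeriv (R / δ - 1) ≤ 0 ∧ 0 ≤ deriv stepDeriv (R / δ - 1) := by
          have hx : 1 ≤ R / δ - 1 := by rw [le_sub_iff_add_le, le_div_iff₀ hδ]; linarith
          have h3 : IsLocalMin stepDeriv (R / δ - 1) :=
            Filter.Eventually.of_forall fun y => by
              rw [stepDeriv_of_one_le hx]; exact stepDeriv_nonneg y
          rw [h3.deriv_eq_zero]
          exact ⟨le_rfl, le_rfl⟩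
        rw [swingDeriv2, le_antisymm h2.1 h2.2]; ring
      rw [e1, (swing_of_ge hδ hR).2]; simp
    · rw [profileSlope_of_le (by linarith) (by linarith)]; simp
  rw [swingSlope, add_mul, hps]
  congr 1
  rw [← hw4]
  have hw0 := hw.ne'
  field_simp
  have hwS : swingRoot δ R ^ 4 = swing δ R ^ 2 + swingDeriv δ R ^ 2 := hw4
  linear_combination (-h' * swing δ R / 2) * hd4 + (h' * swingDeriv δ R) * hwS

lemma swingSlope_nonneg (hδ : 0 < δ) (hρ : 0 < ρ) (h0 : 0 < h') (hh : h' ≤ h) :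
    0 ≤ swingSlope h h' ρ δ R :=
  add_nonneg (mul_nonneg (by positivity) (div_nonneg (swingDeriv_nonneg hδ) (swingRoot_pos hδ).le))
    (profileSlope_nonneg hρ hh)

lemma swingHeight_of_le (hδ : 0 < δ) (hδρ : 2 * δ < ρ / 2) (hR : R ≤ δ) :
    swingHeight h h' ρ δ R = -h' ∧ swingSlope h h' ρ δ R = 0 := by
  rw [swingHeight, swingSlope, (swing_of_le hδ hR).1, (swing_of_le hδ hR).2,
    profile_of_le (by linarith) (by linarith), profileSlope_of_le (by linarith) (by linarith),
    swingRoot_of_le hδ hR]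
  constructor <;> ring

lemma swingHeight_of_ge (hδ : 0 < δ) (hR : 2 * δ ≤ R) :
    swingHeight h h' ρ δ R = profile h h' ρ R ∧ swingSlope h h' ρ δ R = profileSlope h h' ρ R := by
  rw [swingHeight, swingSlope, (swing_of_ge hδ hR).1, (swing_of_ge hδ hR).2,
    swingRoot_of_ge hδ hR]
  constructor <;> ring

lemma swingHeight_small_le {M : ℝ} (hδ : 0 < δ) (hδρ : 2 * δ < ρ / 2) (h0 : 0 < h')
    (hM : swingDeriv δ R ≤ M) (hR : R ≤ 2 * δ) :
    |swingHeight h h' ρ δ R| ≤ h' * (1 + M) ∧ |swingSlope h h' ρ δ R| ≤ h' * (1 + M) := by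
  have hw := swingRoot_pos (R := R) hδ
  have hd := swingDeriv_nonneg (R := R) hδ
  have hM0 := hd.trans hM
  have hs2 := (sq_le_one_iff_abs_le_one _).2 (abs_swing_le (δ := δ) (R := R))
  have hd2 := pow_le_pow_left₀ hd hM 2
  have hw4 : swingRoot δ R ^ 4 = swing δ R ^ 2 + swingDeriv δ R ^ 2 := swingRoot_pow_four hδ
  have hw1 : swingRoot δ R ≤ 1 + M := by
    refine (pow_le_pow_iff_left₀ hw.le (by linarith) (show (4 : ℕ) ≠ 0 by norm_num)).1 ?_
    rw [hw4]
    have : 0 ≤ M ^ 3 := by positivity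
    have : 0 ≤ M ^ 4 := by positivity
    nlinarith
  have ha : |swing δ R| ≤ swingRoot δ R ^ 2 := by
    refine abs_le_of_sq_le_sq ?_ (by positivity)
    nlinarith [sq_nonneg (swingDeriv δ R)]
  have hb : swingDeriv δ R ≤ swingRoot δ R ^ 2 := by
    refine (sq_le_sq₀ hd (by positivity)).1 ?_
    nlinarith [sq_nonneg (swing δ R)]
  rw [swingHeight, swingSlope, profile_of_le (by linarith) (by linarith),
    profileSlope_of_le (by linarith) (by linarith), sub_self, add_zero, add_zero]
  constructor
  · rw [abs_mul, abs_of_pos h0, abs_div, abs_of_pos hw]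
    refine mul_le_mul_of_nonneg_left ((div_le_iff₀ hw).2 ?_) h0.le
    nlinarith
  · rw [abs_mul, abs_of_pos (half_pos h0), abs_div, abs_of_pos hw, abs_of_nonneg hd]
    refine mul_le_mul (by linarith) ((div_le_iff₀ hw).2 ?_) (by positivity) h0.le
    nlinarith

lemma swingFamily_flowRel_outer {σ : ℝ} {θ P A : ℝ → ℝ → ℝ} (hδ : 0 < δ) (hδρ : 2 * δ < ρ / 2)
    (h0 : 0 < h') (hh : h' ≤ h) (hθ : θ 0 R = swingAngle δ R) (hP : P 0 R = swingSlope h h' ρ δ R)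
    (hA : A 0 R = swingHeight h h' ρ δ R) :
    PlaneFamily.FlowRel (swingFamily σ h h' ρ δ) (PlaneFamily.outer .plus σ θ P A) 1 0 R
      (2 / (profile h h' ρ R * swingRoot δ R)) := by
  have hw := swingRoot_pos (R := R) hδ
  have hp : 0 < profile h h' ρ R := h0.trans_le (le_profile hh)
  obtain ⟨hc, hs⟩ := cos_sin_swingAngle (R := R) hδ
  have hw4 : swingRoot δ R ^ 4 = swing δ R ^ 2 + swingDeriv δ R ^ 2 := swingRoot_pow_four hδ
  rcases le_or_gt R (2 * δ) with hR | hR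
  · obtain ⟨v1, v2, v3, v4⟩ := swingFamily_small (σ := σ) (h := h) (h' := h') (δ := δ) (s := 1)
      (show 0 < ρ by linarith) (show R ≤ ρ / 2 by linarith)
    have hp1 : profile h h' ρ R = h' := profile_of_le (by linarith) (by linarith)
    have hp2 : profileSlope h h' ρ R = 0 := profileSlope_of_le (by linarith) (by linarith)
    have hwne := hw.ne'
    have hne := h0.ne'
    constructor
    · rw [v1]; simp only [PlaneFamily.outer, hθ, hc, hp1]; field_simp; ring
    · rw [v2]; simp only [PlaneFamily.outer, hθ, hs, hp1]; field_simp; ring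
    · rw [v3]
      simp only [PlaneFamily.outer, hθ, hP, hA, hc, hs, hp1, swingHeight, swingSlope, hp2]
      field_simp
      linear_combination (-σ * h' * Real.cos R) * hw4
    · rw [v4]
      simp only [PlaneFamily.outer, hθ, hP, hA, hc, hs, hp1, swingHeight, swingSlope, hp2]
      field_simp
      linear_combination (-σ * h' * Real.sin R) * hw4
  · obtain ⟨v1, v2⟩ := swingFamily_large (σ := σ) (h := h) (h' := h') (ρ := ρ) (s := 1) hδ hR.le
    obtain ⟨k1, k2⟩ := swingHeight_of_ge (h := h) (h' := h') (ρ := ρ) hδ hR.le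
    rw [k1] at hA
    rw [k2] at hP
    rw [swingAngle_of_ge hδ hR.le] at hθ
    rw [swingRoot_of_ge hδ hR.le, mul_one]
    constructor
    · rw [v1]; simp only [PlaneFamily.outer, hθ]; field_simp; ring
    · rw [v2]; simp only [PlaneFamily.outer, hθ]; field_simp; ring
    · simp only [PlaneFamily.outer, swingFamily, hθ, hP, hA]; field_simp
    · simp only [PlaneFamily.outer, swingFamily, hθ, hP, hA]; field_simp

end Swing

/-! ### Cone curves -/

lemma eq_zero_of_hasDerivAt_of_const_right {f : ℝ → ℝ} {f' x k : ℝ} (hf : HasDerivAt f f' x)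
    (hc : ∀ y, x ≤ y → f y = k) : f' = 0 := by
  have h1 : HasDerivWithinAt f 0 (Ici x) x :=
    (hasDerivWithinAt_const x (Ici x) k).congr (fun y hy => hc y hy) (hc x le_rfl)
  exact (uniqueDiffWithinAt_Ici x).eq_deriv _ hf.hasDerivWithinAt h1

lemma eq_zero_of_hasDerivAt_of_const_left {f : ℝ → ℝ} {f' x k : ℝ} (hf : HasDerivAt f f' x)
    (hc : ∀ y, y ≤ x → f y = k) : f' = 0 := by
  have h1 : HasDerivWithinAt f 0 (Iic x) x :=
    (hasDerivWithinAt_const x (Iic x) k).congr (fun y hy => hc y hy) (hc x le_rfl)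
  exact (uniqueDiffWithinAt_Iic x).eq_deriv _ hf.hasDerivWithinAt h1

/-- The properties of a cone curve that are used below. -/
structure ConeData (A P : ℝ → ℝ) (T h ε : ℝ) : Prop where
  smooth : ContDiff ℝ ∞ A
  smooth_slope : ContDiff ℝ ∞ P
  deriv : ∀ τ, HasDerivAt A (P τ) τ
  pos : ∀ τ, -T < τ → τ < T → 0 < P τ
  slope_right : ∀ τ, T ≤ τ → P τ = 0
  slope_left : ∀ τ, τ ≤ -T → P τ = 0
  right : ∀ τ, T ≤ τ → A τ = h
  left : ∀ τ, τ ≤ -T → A τ = -ε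

lemma ConeData.nonneg {A P : ℝ → ℝ} {T h ε : ℝ} (hc : ConeData A P T h ε) (τ : ℝ) : 0 ≤ P τ := by
  rcases le_or_gt τ (-T) with h1 | h1
  · rw [hc.slope_left τ h1]
  · rcases le_or_gt T τ with h2 | h2
    · rw [hc.slope_right τ h2]
    · exact (hc.pos τ h1 h2).le

lemma FrontCurve.IsCone.exists_data {c : FrontCurve} {r h ε : ℝ} (hc : c.IsCone r h ε) :
    (∀ τ, c.angle τ = τ) ∧ ∃ T, 0 < T ∧ T < r ∧ ConeData c.height c.slope T h ε := by
  obtain ⟨h1, T, h2, h3, h4, h5, h6, h7, h8⟩ := hc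
  refine ⟨h4, T, h2, h3, h1, ?_, h5, h6, fun τ hτ => ?_, fun τ hτ => ?_, h7, h8⟩
  · rw [show c.slope = deriv c.height from funext fun τ => (h5 τ).deriv.symm]
    exact (contDiff_infty_iff_deriv.1 h1).2
  · exact eq_zero_of_hasDerivAt_of_const_right (h5 τ) fun y hy => h7 y (hτ.trans hy)
  · exact eq_zero_of_hasDerivAt_of_const_left (h5 τ) fun y hy => h8 y (hy.trans hτ)

section Cone

variable {A P : ℝ → ℝ} {T h h' ε ρ δ r a b δ₀ : ℝ}

/-- The heights of the interpolation between the swung disc and the cone. -/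
def coneHeight (A : ℝ → ℝ) (h h' ρ δ s R : ℝ) : ℝ :=
  (1 - s) * swingHeight h h' ρ δ R + s * A (swingAngle δ R)

lemma hasDerivAt_coneHeight (hc : ConeData A P T h ε) (hδ : 0 < δ) (hδρ : 2 * δ < ρ / 2) {s R : ℝ} :
    HasDerivAt (coneHeight A h h' ρ δ s) (
      ((1 - s) * swingSlope h h' ρ δ R + s * P (swingAngle δ R)) *
      (1 + (swingDeriv δ R ^ 2 - swing δ R * swingDeriv2 δ R) / swingSq δ R)) R := by
  have h1 := (hasDerivAt_swingHeight (h := h) (h' := h') (R := R) hδ hδρ).const_mul (1 - s)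
  have h2 := ((hc.deriv (swingAngle δ R)).comp R (hasDerivAt_swingAngle hδ)).const_mul s
  exact (h1.add h2).congr_deriv (by ring)

/-- The slopes of the interpolation between the swung disc and the cone. -/
def coneSlope (P : ℝ → ℝ) (h h' ρ δ s R : ℝ) : ℝ :=
  (1 - s) * swingSlope h h' ρ δ R + s * P (swingAngle δ R)

lemma coneSlope_nonneg (hc : ConeData A P T h ε) (hδ : 0 < δ) (hρ : 0 < ρ) (h0 : 0 < h')
    (hh : h' ≤ h) {s R : ℝ} (hs : s ∈ Icc (0 : ℝ) 1) : 0 ≤ coneSlope P h h' ρ δ s R :=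
  add_nonneg (mul_nonneg (sub_nonneg.2 hs.2) (swingSlope_nonneg hδ hρ h0 hh))
    (mul_nonneg hs.1 (hc.nonneg _))

lemma monotone_coneHeight (hc : ConeData A P T h ε) (hδ : 0 < δ) (hδρ : 2 * δ < ρ / 2)
    (h0 : 0 < h') (hh : h' ≤ h) {s : ℝ} (hs : s ∈ Icc (0 : ℝ) 1) :
    Monotone (coneHeight A h h' ρ δ s) :=
  monotone_of_hasDerivAt_nonneg (fun _ => hasDerivAt_coneHeight hc hδ hδρ) fun _ =>
    mul_nonneg (coneSlope_nonneg hc hδ (by linarith) h0 hh hs) (swingAngle_deriv_pos hδ).le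

lemma swingAngle_eq_zero (hδ : 0 < δ) {R : ℝ} (hR0 : 0 < R) (hR : R < Real.pi)
    (h : swingAngle δ R = 0) : 0 < swingDeriv δ R := by
  refine swingDeriv_pos hδ ?_ ?_
  · by_contra! h1
    rw [swingAngle_of_le hδ h1] at h
    linarith
  · by_contra! h1
    rw [swingAngle_of_ge hδ h1] at h
    linarith

lemma coneSlope_pos (hc : ConeData A P T h ε) (hT : 0 < T) (hδ : 0 < δ) (hρ : 0 < ρ) (h0 : 0 < h')
    (hh : h' ≤ h) {s R : ℝ} (hs : s ∈ Icc (0 : ℝ) 1) (hR0 : 0 < R) (hR : R < Real.pi)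
    (hθ : swingAngle δ R = 0) : 0 < coneSlope P h h' ρ δ s R := by
  have h1 := hc.pos 0 (by linarith) hT
  have h2 : 0 < swingSlope h h' ρ δ R :=
    add_pos_of_pos_of_nonneg (mul_pos (by positivity)
      (div_pos (swingAngle_eq_zero hδ hR0 hR hθ) (swingRoot_pos hδ))) (profileSlope_nonneg hρ hh)
  rw [coneSlope, hθ]
  rcases eq_or_lt_of_le hs.1 with h3 | h3
  · rw [← h3]; linarith
  · have := mul_nonneg (sub_nonneg.2 hs.2) h2.le
    have := mul_pos h3 h1
    linarith

lemma coneHeight_lt (hc : ConeData A P T h ε) (hT : 0 < T) (hδ : 0 < δ) (hδρ : 2 * δ < ρ / 2)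
    (h0 : 0 < h') (hh : h' ≤ h) {s R R' : ℝ} (hs : s ∈ Icc (0 : ℝ) 1) (hR0 : 0 < R)
    (hR' : R' < Real.pi) (h1 : swingAngle δ R < 0) (h2 : 0 < swingAngle δ R') :
    coneHeight A h h' ρ δ s R < coneHeight A h h' ρ δ s R' := by
  have hRR : R < R' := (strictMono_swingAngle hδ).lt_iff_lt.1 (h1.trans h2)
  obtain ⟨R₀, hR₀, hz⟩ := intermediate_value_Ioo hRR.le
    (contDiff_swingAngle hδ).continuous.continuousOn ⟨h1, h2⟩
  have hm := monotone_coneHeight (ρ := ρ) hc hδ hδρ h0 hh hs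
  refine lt_of_le_of_ne (hm hRR.le) fun heq => ?_
  have hconst : ∀ y ∈ Icc R R', coneHeight A h h' ρ δ s y = coneHeight A h h' ρ δ s R :=
    fun y hy => le_antisymm (heq ▸ hm hy.2) (hm hy.1)
  have hd := hasDerivAt_coneHeight (h' := h') (s := s) (R := R₀) hc hδ hδρ
  have hd0 : HasDerivAt (coneHeight A h h' ρ δ s) 0 R₀ :=
    (hasDerivAt_const R₀ (coneHeight A h h' ρ δ s R)).congr_of_eventuallyEq <| by
      filter_upwards [Icc_mem_nhds hR₀.1 hR₀.2] with y hy using hconst y hy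
  have := hd.unique hd0
  have h3 := mul_pos (coneSlope_pos (ρ := ρ) hc hT hδ (by linarith) h0 hh hs (hR0.trans hR₀.1)
    (hR₀.2.trans hR') hz) (swingAngle_deriv_pos (R := R₀) hδ)
  exact h3.ne' this

theorem outerGood_cone {M : ℝ} (hc : ConeData A P T h ε) (hT : 0 < T) (hTr : T < r)
    (hr : r < Real.pi) (hδ : 0 < δ) (hδρ : 2 * δ < ρ / 2) (hρr : ρ < r)
    (hδr : 2 * δ < Real.pi - r) (h0 : 0 < h') (hh : h' ≤ h) (hb : h < b) (hε : 0 < ε)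
    (hM : ∀ R, swingDeriv δ R ≤ M) (h'a : h' < a) (hεa : ε < a)
    (hMδ : h' * (1 + M) ≤ δ₀ / 2) (hεδ : ε ≤ δ₀ / 2) :
    PlaneFamily.OuterGood (fun _ R => swingAngle δ R) (coneSlope P h h' ρ δ)
      (coneHeight A h h' ρ δ) r a b h δ₀ := by
  have hρ : 0 < ρ := by linarith
  have hmono := strictMono_swingAngle hδ
  have hrange : ∀ R, 0 < R → R < r → -Real.pi < swingAngle δ R ∧ swingAngle δ R < r := by
    intro R k0 kR
    constructor
    · have := hmono k0
      rw [swingAngle_of_le hδ hδ.le] at this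
      linarith
    · have := hmono kR
      rwa [swingAngle_of_ge hδ (show 2 * δ ≤ r by linarith)] at this
  have hleft : ∀ R, R ≤ δ → A (swingAngle δ R) = -ε ∧ P (swingAngle δ R) = 0 := by
    intro R hR
    rw [swingAngle_of_le hδ hR]
    exact ⟨hc.left _ (by linarith), hc.slope_left _ (by linarith)⟩
  have h00 : ∀ s R, R ≤ δ → coneHeight A h h' ρ δ s R = (1 - s) * (-h') + s * (-ε) ∧
      coneSlope P h h' ρ δ s R = 0 := by
    intro s R hR
    obtain ⟨k1, k2⟩ := hleft R hR
    obtain ⟨k3, k4⟩ := swingHeight_of_le (h := h) (h' := h') hδ hδρ hR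
    rw [coneHeight, coneSlope, k1, k2, k3, k4]
    simp
  have hright : ∀ s R, max ρ T ≤ R → coneHeight A h h' ρ δ s R = h ∧
      coneSlope P h h' ρ δ s R = 0 := by
    intro s R hR
    have hR1 : ρ ≤ R := (le_max_left _ _).trans hR
    have hR2 : T ≤ R := (le_max_right _ _).trans hR
    obtain ⟨k3, k4⟩ := swingHeight_of_ge (h := h) (h' := h') (ρ := ρ) hδ
      (show 2 * δ ≤ R by linarith)
    rw [coneHeight, coneSlope, k3, k4, swingAngle_of_ge hδ (show 2 * δ ≤ R by linarith),
      profile_of_ge hρ hR1, profileSlope_of_ge hρ hR1, hc.right R hR2, hc.slope_right R hR2]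
    constructor <;> ring
  have hle : ∀ s ∈ Icc (0 : ℝ) 1, ∀ R, 0 ≤ R → R < r → -a < coneHeight A h h' ρ δ s R ∧
      coneHeight A h h' ρ δ s R < b := by
    intro s hs R k0 kR
    have hm := monotone_coneHeight (ρ := ρ) hc hδ hδρ h0 hh hs
    constructor
    · have := hm k0
      rw [(h00 s 0 hδ.le).1] at this
      refine lt_of_lt_of_le ?_ this
      rcases eq_or_lt_of_le hs.1 with h3 | h3
      · rw [← h3]; linarith
      · nlinarith [hs.2, mul_pos h3 (sub_pos.2 hεa)]
    · have := hm (kR.le.trans (le_max_left r (max ρ T)))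
      rw [(hright s _ (le_max_right _ _)).1] at this
      linarith
  constructor
  · intro s _ R _ _
    have a1 : ContDiff ℝ ∞ fun z : ℝ × ℝ => swingAngle δ z.2 :=
      (contDiff_swingAngle hδ).comp contDiff_snd
    refine ⟨a1.contDiffAt, ?_, ?_⟩
    · exact (((contDiff_const.sub contDiff_fst).mul ((contDiff_swingSlope hδ).comp
        contDiff_snd)).add (contDiff_fst.mul (hc.smooth_slope.comp a1))).contDiffAt
    · exact (((contDiff_const.sub contDiff_fst).mul ((contDiff_swingHeight hδ).comp
        contDiff_snd)).add (contDiff_fst.mul (hc.smooth.comp a1))).contDiffAt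
  · refine ⟨δ, hδ, -1, -1, fun s => (1 - s) * (-h') + s * (-ε), by fun_prop, by norm_num,
      fun s R _ hR => ⟨?_, ?_, (h00 s R hR.le).2, (h00 s R hR.le).1⟩⟩
    · rw [swingAngle_of_le hδ hR.le, Real.cos_sub_pi]; ring
    · rw [swingAngle_of_le hδ hR.le, Real.sin_sub_pi]; ring
  · intro s _ R _ _
    have hP : Differentiable ℝ (coneSlope P h h' ρ δ s) :=
      (((contDiff_const (c := 1 - s)).mul (contDiff_swingSlope hδ)).add
        ((contDiff_const (c := s)).mul (hc.smooth_slope.comp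
          (contDiff_swingAngle hδ)))).differentiable (n := ∞) (by simp)
    exact ⟨_, _, hasDerivAt_swingAngle hδ, (hP R).hasDerivAt, hasDerivAt_coneHeight hc hδ hδρ,
      Or.inl (swingAngle_deriv_pos hδ).ne'⟩
  · intro s hs R k0 kR
    by_contra! h1
    obtain ⟨h1, h2⟩ := h1
    obtain ⟨h3, h4⟩ := hrange R k0 kR
    have h5 := (Real.sin_eq_zero_iff_of_lt_of_lt h3 (h4.trans hr)).1 h1
    exact (coneSlope_pos hc hT hδ hρ h0 hh hs k0 (kR.trans hr) h5).ne' h2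
  · intro s hs R R' k0 kR k0' kR' τ hτ h1 h2 _ h4
    obtain ⟨a1, a2⟩ := hrange R k0 kR
    obtain ⟨b1, b2⟩ := hrange R' k0' kR'
    have h5 : |swingAngle δ R'| = |swingAngle δ R| := by
      rw [← Real.cos_abs, ← Real.cos_abs (swingAngle δ R)] at h1
      exact Real.injOn_cos ⟨abs_nonneg _, abs_le.2 ⟨by linarith, by linarith⟩⟩
        ⟨abs_nonneg _, abs_le.2 ⟨by linarith, by linarith⟩⟩ h1
    rcases abs_eq_abs.1 h5 with h6 | h6
    · exact (hmono.injective h6).symm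
    · rcases lt_trichotomy (swingAngle δ R) 0 with h7 | h7 | h7
      · exact absurd h4.symm (coneHeight_lt hc hT hδ hδρ h0 hh hs k0 (kR'.trans hr) h7
          (by linarith)).ne
      · exact (hmono.injective (by linarith)).symm
      · exact absurd h4 (coneHeight_lt hc hT hδ hδρ h0 hh hs k0' (kR.trans hr) (by linarith)
          h7).ne
  · intro s hs R k0 kR
    by_contra! h1
    obtain ⟨h1, h2⟩ := h1
    have n1 := mul_nonneg (sub_nonneg.2 hs.2) (swingSlope_nonneg (R := R) hδ hρ h0 hh)
    have n2 := mul_nonneg hs.1 (hc.nonneg (swingAngle δ R))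
    rw [coneSlope] at h2
    have e1 : (1 - s) * swingSlope h h' ρ δ R = 0 := by linarith
    have e2 : s * P (swingAngle δ R) = 0 := by linarith
    have hends : P (swingAngle δ R) = 0 → T ≤ swingAngle δ R ∨ swingAngle δ R ≤ -T := by
      intro h3
      by_contra! h4
      exact (hc.pos _ h4.2 h4.1).ne' h3
    rcases mul_eq_zero.1 e1 with h3 | h3
    · have hs1 : s = 1 := by linarith
      subst hs1
      rw [coneHeight] at h1
      rcases hends (by linarith) with h4 | h4
      · rw [hc.right _ h4] at h1; linarith
      · rw [hc.left _ h4] at h1; linarith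
    · have h4 : R ≤ δ ∨ 2 * δ ≤ R := by
        by_contra! h5
        have h6 := mul_pos (half_pos h0) (div_pos (swingDeriv_pos hδ h5.1 h5.2)
          (swingRoot_pos (R := R) hδ))
        have h7 := profileSlope_nonneg (h := h) (h' := h') (R := R) hρ hh
        rw [swingSlope] at h3
        linarith
      rcases h4 with h4 | h4
      · rw [(h00 s R h4).1] at h1
        rcases eq_or_lt_of_le hs.1 with h5 | h5
        · rw [← h5] at h1; linarith
        · nlinarith [hs.2, mul_pos h5 hε]
      · rw [coneHeight, (swingHeight_of_ge hδ h4).1] at h1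
        have hp : 0 < profile h h' ρ R := h0.trans_le (le_profile hh)
        rcases mul_eq_zero.1 e2 with h5 | h5
        · rw [h5] at h1; linarith
        · have h6 : A (swingAngle δ R) = h := by
            rcases hends h5 with h6 | h6
            · exact hc.right _ h6
            · rw [swingAngle_of_ge hδ h4] at h6; linarith
          rw [h6] at h1
          rcases eq_or_lt_of_le hs.1 with h7 | h7
          · rw [← h7] at h1; linarith
          · nlinarith [hs.2, mul_pos h7 (h0.trans_le hh), mul_nonneg (sub_nonneg.2 hs.2) hp.le]
  · intro s hs R k0 kR
    rcases lt_or_ge (-r) (swingAngle δ R) with h1 | h1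
    · refine Or.inl ⟨abs_lt.2 ⟨h1, ?_⟩, hle s hs R k0 kR⟩
      have := hmono kR
      rwa [swingAngle_of_ge hδ (show 2 * δ ≤ r by linarith)] at this
    · right
      have hR : R ≤ 2 * δ := by
        by_contra! h2
        rw [swingAngle_of_ge hδ h2.le] at h1
        linarith
      obtain ⟨b1, b2⟩ := swingHeight_small_le (h := h) hδ hδρ h0 (hM R) hR
      have e1 := hc.left (swingAngle δ R) (by linarith)
      have e2 := hc.slope_left (swingAngle δ R) (by linarith)
      have c1 : |coneHeight A h h' ρ δ s R| ≤ δ₀ / 2 := by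
        rw [coneHeight, e1]
        obtain ⟨d1, d2⟩ := abs_le.1 (b1.trans hMδ)
        rw [abs_le]
        constructor <;> nlinarith [hs.1, hs.2]
      have c2 : |coneSlope P h h' ρ δ s R| ≤ δ₀ / 2 := by
        rw [coneSlope, e2]
        obtain ⟨d1, d2⟩ := abs_le.1 (b2.trans hMδ)
        rw [abs_le]
        constructor <;> nlinarith [hs.1, hs.2]
      have c3 := pow_le_pow_left₀ (abs_nonneg _) c1 2
      have c4 := pow_le_pow_left₀ (abs_nonneg _) c2 2
      rw [sq_abs] at c3 c4
      nlinarith [sq_nonneg δ₀]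
  · refine ⟨max ρ T, max_lt hρr hTr, lt_max_of_lt_left hρ, fun s _ R hR _ => ?_⟩
    refine ⟨swingAngle_of_ge hδ ?_, (hright s R hR).2, (hright s R hR).1⟩
    linarith [(le_max_left ρ T).trans hR]

end Cone

lemma step_pos {x : ℝ} (h : 0 < x) : 0 < step x := by
  have h1 : step (min x 1 / 2) < step (min x 1) := by
    have h0 : 0 < min x 1 := lt_min h one_pos
    refine strictMonoOn_of_deriv_pos (convex_Icc 0 1) contDiff_step.continuous.continuousOn
      (fun y hy => ?_) ⟨by positivity, ?_⟩ ⟨h0.le, min_le_right _ _⟩ (half_lt_self h0)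
    · rw [interior_Icc] at hy
      rw [(hasDerivAt_step y).deriv]
      exact stepDeriv_pos hy.1 hy.2
    · linarith [min_le_right x 1]
  exact ((step_nonneg _).trans_lt h1).trans_le (monotone_step (min_le_left x 1))

lemma step_lt_one {x : ℝ} (h : x < 1) : step x < 1 := by
  have h1 : step (max x 0) < step 1 := by
    refine strictMonoOn_of_deriv_pos (convex_Icc 0 1) contDiff_step.continuous.continuousOn
      (fun y hy => ?_) ⟨le_max_right _ _, (max_lt h one_pos).le⟩ ⟨zero_le_one, le_rfl⟩
      (max_lt h one_pos)
    rw [interior_Icc] at hy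
    rw [(hasDerivAt_step y).deriv]
    exact stepDeriv_pos hy.1 hy.2
  rw [step_one] at h1
  exact (monotone_step (le_max_left x 0)).trans_lt h1

/-- A function that is the identity before `x₀` and constant after `x₀ + μ`. -/
def saturate (x₀ μ x : ℝ) : ℝ := x - μ * ∫ t in (0 : ℝ)..((x - x₀) / μ), step t

section Saturate

variable {x₀ μ x : ℝ}

lemma hasDerivAt_saturate (hμ : 0 < μ) :
    HasDerivAt (saturate x₀ μ) (1 - step ((x - x₀) / μ)) x := by
  have h1 := (contDiff_step.continuous.integral_hasStrictDerivAt 0 ((x - x₀) / μ)).hasDerivAt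
  have h2 : HasDerivAt (fun x => (x - x₀) / μ) (1 / μ) x :=
    ((hasDerivAt_id x).sub_const x₀).div_const μ
  refine ((hasDerivAt_id x).sub ((h1.comp x h2).const_mul μ)).congr_deriv ?_
  field_simp

lemma contDiff_saturate (hμ : 0 < μ) : ContDiff ℝ ∞ (saturate x₀ μ) := by
  rw [contDiff_infty_iff_deriv]
  refine ⟨fun x => (hasDerivAt_saturate hμ).differentiableAt, ?_⟩
  rw [show deriv (saturate x₀ μ) = fun x => 1 - step ((x - x₀) / μ) from
    funext fun x => (hasDerivAt_saturate hμ).deriv]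
  exact contDiff_const.sub (contDiff_step.comp (by fun_prop))

lemma monotone_saturate (hμ : 0 < μ) : Monotone (saturate x₀ μ) :=
  monotone_of_hasDerivAt_nonneg (fun _ => hasDerivAt_saturate hμ)
    fun _ => sub_nonneg.2 (step_le_one _)

lemma saturate_of_le (hμ : 0 < μ) (h : x ≤ x₀) : saturate x₀ μ x = x := by
  have h1 : ∫ t in (0 : ℝ)..((x - x₀) / μ), step t = 0 := by
    have h0 : (x - x₀) / μ ≤ 0 := div_nonpos_of_nonpos_of_nonneg (by linarith) hμ.le
    refine (intervalIntegral.integral_congr (g := fun _ => (0 : ℝ)) fun t ht => ?_).trans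
      intervalIntegral.integral_zero
    rw [uIcc_of_ge h0] at ht
    exact step_of_nonpos ht.2
  rw [saturate, h1, mul_zero, sub_zero]

lemma saturate_of_ge (hμ : 0 < μ) (h : x₀ + μ ≤ x) :
    saturate x₀ μ x = saturate x₀ μ (x₀ + μ) := by
  have h0 : 1 ≤ (x - x₀) / μ := by rw [le_div_iff₀ hμ]; linarith
  have h1 := intervalIntegral.integral_add_adjacent_intervals
    (contDiff_step.continuous.intervalIntegrable (μ := MeasureTheory.volume) 0 1)
    (contDiff_step.continuous.intervalIntegrable (μ := MeasureTheory.volume) 1 ((x - x₀) / μ))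
  have h2 : ∫ t in (1 : ℝ)..((x - x₀) / μ), step t = (x - x₀) / μ - 1 := by
    refine (intervalIntegral.integral_congr (g := fun _ => (1 : ℝ)) fun t ht => ?_).trans ?_
    · rw [uIcc_of_le h0] at ht
      exact step_of_one_le ht.1
    · simp
  rw [saturate, saturate, ← h1, h2, add_sub_cancel_left, div_self hμ.ne']
  field_simp
  ring

lemma lt_saturate (hμ : 0 < μ) : x₀ < saturate x₀ μ (x₀ + μ) := by
  have h1 := saturate_of_le hμ (le_refl x₀)
  have h2 : StrictMonoOn (saturate x₀ μ) (Icc x₀ (x₀ + μ)) := by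
    refine strictMonoOn_of_deriv_pos (convex_Icc _ _) (contDiff_saturate hμ).continuous.continuousOn
      fun y hy => ?_
    rw [interior_Icc] at hy
    rw [(hasDerivAt_saturate hμ).deriv, sub_pos]
    refine step_lt_one ?_
    rw [div_lt_one hμ]
    linarith [hy.2]
  have h3 := h2 (left_mem_Icc.2 (by linarith)) (right_mem_Icc.2 (by linarith)) (by linarith)
  linarith

lemma saturate_le (hμ : 0 < μ) : saturate x₀ μ (x₀ + μ) ≤ x₀ + μ := by
  rw [saturate, sub_le_self_iff]
  refine mul_nonneg hμ.le (intervalIntegral.integral_nonneg ?_ fun t _ => step_nonneg t)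
  rw [add_sub_cancel_left, div_self hμ.ne']; norm_num

end Saturate

/-! ### The fold -/

/-- Functions describing a disc pushed over the core of a `(-1)`-surgery: `C` is the cotangent of
the angle from the axis, `b` is proportional to the height, and `W` is a multiple of the derivative
of `C`. -/
structure FoldData (δ : ℝ) (C b W : ℝ → ℝ) (C₀ L : ℝ) : Prop where
  smooth_C : ∀ R, 0 < R → R < Real.pi → ContDiffAt ℝ ∞ C R
  smooth_b : ContDiff ℝ ∞ b
  deriv_C : ∀ R, 0 < R → R < Real.pi → HasDerivAt C (W R / Real.sin R ^ 2) R
  deriv_b : ∀ R, HasDerivAt b (-(Real.cos R * W R)) R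
  W_pos : ∀ R, 0 < R → R < 3 * δ → 0 < W R
  W_neg : ∀ R, 3 * δ < R → R < Real.pi → W R < 0
  C_left : ∀ R, R ≤ δ → C R = -(Real.cos R / Real.sin R)
  b_left : ∀ R, R ≤ δ → b R = -Real.sin R
  C_right : ∀ R, 5 * δ ≤ R → C R = Real.cos R / Real.sin R
  b_right : ∀ R, 5 * δ ≤ R → b R = Real.sin R
  W_right : ∀ R, 5 * δ ≤ R → W R = -1
  L_pos : 0 < L
  quad : ∀ R, |R - 3 * δ| ≤ δ / 2 → C R = C₀ - L * ((R - 3 * δ) / δ) ^ 2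
  lt_C₀ : Real.cos (3 * δ) / Real.sin (3 * δ) < C₀ - L / 4
  le_C : ∀ R, 3 * δ ≤ R → R ≤ 5 * δ → Real.cos R / Real.sin R ≤ C R

lemma cos_gt_of_le_half {x : ℝ} (h0 : 0 ≤ x) (h : x ≤ 1 / 2) : 7 / 8 ≤ Real.cos x := by
  have := Real.one_sub_sq_div_two_le_cos (x := x)
  nlinarith

lemma cos_mul_sin_sq_lt {x y : ℝ} (h0 : 0 ≤ x) (hxy : x < y) (hy : y ≤ 1 / 2) :
    Real.cos x * Real.sin x ^ 2 < Real.cos y * Real.sin y ^ 2 := by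
  have h1 := cos_gt_of_le_half h0 (hxy.le.trans hy)
  have h2 := cos_gt_of_le_half (h0.trans hxy.le) hy
  have h3 : Real.cos y < Real.cos x :=
    Real.cos_lt_cos_of_nonneg_of_le_pi h0 (by linarith [Real.pi_gt_three]) hxy
  rw [Real.sin_sq, Real.sin_sq]
  have h4 : 0 < (Real.cos x - Real.cos y) *
      (Real.cos x ^ 2 + Real.cos x * Real.cos y + Real.cos y ^ 2 - 1) :=
    mul_pos (sub_pos.2 h3) (by nlinarith)
  nlinarith

section Fold

variable (δ : ℝ)

/-- The cutoff between the inner part and the fold. -/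
def foldIn (R : ℝ) : ℝ := step (2 * (R / δ - 1) / 3)

/-- The cutoff between the fold and the outer part. -/
def foldOut (R : ℝ) : ℝ := step (2 * (R / δ - 7 / 2) / 3)

/-- The derivative of `foldIn`. -/
def foldInDeriv (R : ℝ) : ℝ := 2 / (3 * δ) * stepDeriv (2 * (R / δ - 1) / 3)

/-- The derivative of `foldOut`. -/
def foldOutDeriv (R : ℝ) : ℝ := 2 / (3 * δ) * stepDeriv (2 * (R / δ - 7 / 2) / 3)

/-- The bump at the fold. -/
def foldBump (R : ℝ) : ℝ :=
  saturate (1 / 4) (3 / 4) (1 / 4 + 3 / 4) - saturate (1 / 4) (3 / 4) (((R - 3 * δ) / δ) ^ 2)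

/-- The derivative of `foldBump`. -/
def foldBumpDeriv (R : ℝ) : ℝ :=
  -((1 - step ((((R - 3 * δ) / δ) ^ 2 - 1 / 4) / (3 / 4))) * (2 * ((R - 3 * δ) / δ) / δ))

/-- The cotangent at the fold. -/
def foldCot : ℝ := Real.cos (3 * δ) / Real.sin (3 * δ)

/-- The function `C` of the fold without its bump. -/
def foldBase (R : ℝ) : ℝ := foldCot δ - (1 - foldIn δ R) * (foldCot δ + Real.cos R / Real.sin R) -
  foldOut δ R * (foldCot δ - Real.cos R / Real.sin R)

/-- A multiple of the derivative of `foldBase`. -/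
def foldBaseDeriv (R : ℝ) : ℝ :=
  foldInDeriv δ R * (foldCot δ * Real.sin R ^ 2 + Real.sin R * Real.cos R) + (1 - foldIn δ R) -
    foldOutDeriv δ R * (foldCot δ * Real.sin R ^ 2 - Real.sin R * Real.cos R) - foldOut δ R

variable {δ} {R : ℝ}

lemma hasDerivAt_foldIn : HasDerivAt (foldIn δ) (foldInDeriv δ R) R := by
  have h1 : HasDerivAt (fun R : ℝ => 2 * (R / δ - 1) / 3) (2 * (1 / δ) / 3) R :=
    ((((hasDerivAt_id R).div_const δ).sub_const 1).const_mul 2).div_const 3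
  have h2 := (hasDerivAt_step (2 * (R / δ - 1) / 3)).comp R h1
  refine h2.congr_deriv ?_
  rw [foldInDeriv]; field_simp

lemma hasDerivAt_foldOut : HasDerivAt (foldOut δ) (foldOutDeriv δ R) R := by
  have h1 : HasDerivAt (fun R : ℝ => 2 * (R / δ - 7 / 2) / 3) (2 * (1 / δ) / 3) R :=
    ((((hasDerivAt_id R).div_const δ).sub_const (7 / 2)).const_mul 2).div_const 3
  have h2 := (hasDerivAt_step (2 * (R / δ - 7 / 2) / 3)).comp R h1
  refine h2.congr_deriv ?_
  rw [foldOutDeriv]; field_simp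

lemma contDiff_foldIn : ContDiff ℝ ∞ (foldIn δ) := contDiff_step.comp (by fun_prop)

lemma contDiff_foldOut : ContDiff ℝ ∞ (foldOut δ) := contDiff_step.comp (by fun_prop)

lemma contDiff_foldInDeriv : ContDiff ℝ ∞ (foldInDeriv δ) :=
  contDiff_const.mul (contDiff_stepDeriv.comp (by fun_prop))

lemma contDiff_foldOutDeriv : ContDiff ℝ ∞ (foldOutDeriv δ) :=
  contDiff_const.mul (contDiff_stepDeriv.comp (by fun_prop))

lemma foldIn_of_le (hδ : 0 < δ) (h : R ≤ δ) : foldIn δ R = 0 ∧ foldInDeriv δ R = 0 := by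
  have : 2 * (R / δ - 1) / 3 ≤ 0 := by
    have : R / δ ≤ 1 := (div_le_one hδ).2 h
    linarith
  rw [foldIn, foldInDeriv, step_of_nonpos this, stepDeriv_of_nonpos this]; simp

lemma foldIn_of_ge (hδ : 0 < δ) (h : 5 / 2 * δ ≤ R) : foldIn δ R = 1 ∧ foldInDeriv δ R = 0 := by
  have : 1 ≤ 2 * (R / δ - 1) / 3 := by
    have : 5 / 2 ≤ R / δ := (le_div_iff₀ hδ).2 h
    linarith
  rw [foldIn, foldInDeriv, step_of_one_le this, stepDeriv_of_one_le this]; simp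

lemma foldOut_of_le (hδ : 0 < δ) (h : R ≤ 7 / 2 * δ) : foldOut δ R = 0 ∧ foldOutDeriv δ R = 0 := by
  have : 2 * (R / δ - 7 / 2) / 3 ≤ 0 := by
    have : R / δ ≤ 7 / 2 := (div_le_iff₀ hδ).2 h
    linarith
  rw [foldOut, foldOutDeriv, step_of_nonpos this, stepDeriv_of_nonpos this]; simp

lemma foldOut_of_ge (hδ : 0 < δ) (h : 5 * δ ≤ R) : foldOut δ R = 1 ∧ foldOutDeriv δ R = 0 := by
  have : 1 ≤ 2 * (R / δ - 7 / 2) / 3 := by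
    have : 5 ≤ R / δ := (le_div_iff₀ hδ).2 h
    linarith
  rw [foldOut, foldOutDeriv, step_of_one_le this, stepDeriv_of_one_le this]; simp

lemma foldInDeriv_nonneg (hδ : 0 < δ) : 0 ≤ foldInDeriv δ R :=
  mul_nonneg (by positivity) (stepDeriv_nonneg _)

lemma foldOutDeriv_nonneg (hδ : 0 < δ) : 0 ≤ foldOutDeriv δ R :=
  mul_nonneg (by positivity) (stepDeriv_nonneg _)

lemma hasDerivAt_foldBump : HasDerivAt (foldBump δ) (foldBumpDeriv δ R) R := by
  have h1 : HasDerivAt (fun R : ℝ => ((R - 3 * δ) / δ) ^ 2) (2 * ((R - 3 * δ) / δ) / δ) R := by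
    have h2 : HasDerivAt (fun R : ℝ => (R - 3 * δ) / δ) (1 / δ) R :=
      ((hasDerivAt_id R).sub_const (3 * δ)).div_const δ
    exact (h2.pow 2).congr_deriv (by push_cast; ring)
  have h3 := ((hasDerivAt_saturate (x₀ := 1 / 4) (μ := 3 / 4) (x := ((R - 3 * δ) / δ) ^ 2)
    (by norm_num)).comp R h1).const_sub (saturate (1 / 4) (3 / 4) (1 / 4 + 3 / 4))
  exact h3

lemma contDiff_foldBump : ContDiff ℝ ∞ (foldBump δ) :=
  contDiff_const.sub ((contDiff_saturate (by norm_num)).comp (by fun_prop))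

lemma contDiff_foldBumpDeriv : ContDiff ℝ ∞ (foldBumpDeriv δ) := by
  have h : ContDiff ℝ ∞ fun R : ℝ => step ((((R - 3 * δ) / δ) ^ 2 - 1 / 4) / (3 / 4)) :=
    contDiff_step.comp (by fun_prop)
  have h2 : ContDiff ℝ ∞ fun R : ℝ => 2 * ((R - 3 * δ) / δ) / δ := by fun_prop
  exact ((contDiff_const.sub h).mul h2).neg

lemma foldBump_far (hδ : 0 < δ) (h : δ ≤ |R - 3 * δ|) :
    foldBump δ R = 0 ∧ foldBumpDeriv δ R = 0 := by
  have h1 : 1 ≤ ((R - 3 * δ) / δ) ^ 2 := by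
    rw [one_le_sq_iff_one_le_abs, abs_div, abs_of_pos hδ, one_le_div hδ]; exact h
  have h2 : 1 ≤ (((R - 3 * δ) / δ) ^ 2 - 1 / 4) / (3 / 4) := by
    rw [le_div_iff₀ (by norm_num)]; linarith
  have e := saturate_of_ge (x₀ := 1 / 4) (μ := 3 / 4) (x := ((R - 3 * δ) / δ) ^ 2) (by norm_num)
    (by linarith)
  exact ⟨by rw [foldBump, e, sub_self], by rw [foldBumpDeriv, step_of_one_le h2]; ring⟩

lemma foldBump_near (hδ : 0 < δ) (h : |R - 3 * δ| ≤ δ / 2) :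
    foldBump δ R = saturate (1 / 4) (3 / 4) (1 / 4 + 3 / 4) - ((R - 3 * δ) / δ) ^ 2 ∧
    foldBumpDeriv δ R = -(2 * ((R - 3 * δ) / δ) / δ) := by
  have h1 : ((R - 3 * δ) / δ) ^ 2 ≤ 1 / 4 := by
    rw [div_pow, div_le_iff₀ (by positivity), ← sq_abs]
    nlinarith [abs_nonneg (R - 3 * δ)]
  have h2 : (((R - 3 * δ) / δ) ^ 2 - 1 / 4) / (3 / 4) ≤ 0 :=
    div_nonpos_of_nonpos_of_nonneg (by linarith) (by norm_num)
  rw [foldBump, foldBumpDeriv, saturate_of_le (by norm_num) h1, step_of_nonpos h2]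
  simp

lemma foldBump_nonneg : 0 ≤ foldBump δ R := by
  rw [foldBump, sub_nonneg]
  rcases le_or_gt (((R - 3 * δ) / δ) ^ 2) (1 / 4 + 3 / 4) with h | h
  · exact monotone_saturate (by norm_num) h
  · exact (saturate_of_ge (by norm_num) h.le).le

lemma foldBumpDeriv_nonneg (hδ : 0 < δ) (h : R ≤ 3 * δ) : 0 ≤ foldBumpDeriv δ R := by
  rw [foldBumpDeriv, ← mul_neg]
  refine mul_nonneg (sub_nonneg.2 (step_le_one _)) ?_
  rw [neg_nonneg]
  exact div_nonpos_of_nonpos_of_nonneg (mul_nonpos_of_nonneg_of_nonpos zero_le_two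
    (div_nonpos_of_nonpos_of_nonneg (by linarith) hδ.le)) hδ.le

lemma foldBumpDeriv_nonpos (hδ : 0 < δ) (h : 3 * δ ≤ R) : foldBumpDeriv δ R ≤ 0 := by
  rw [foldBumpDeriv, neg_nonpos]
  refine mul_nonneg (sub_nonneg.2 (step_le_one _)) ?_
  exact div_nonneg (mul_nonneg zero_le_two (div_nonneg (by linarith) hδ.le)) hδ.le

lemma hasDerivAt_cot (h0 : 0 < R) (hR : R < Real.pi) :
    HasDerivAt (fun R => Real.cos R / Real.sin R) (-1 / Real.sin R ^ 2) R := by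
  have hs := Real.sin_pos_of_pos_of_lt_pi h0 hR
  refine ((Real.hasDerivAt_cos R).div (Real.hasDerivAt_sin R) hs.ne').congr_deriv ?_
  congr 1
  nlinarith [Real.sin_sq_add_cos_sq R]

lemma hasDerivAt_foldBase (h0 : 0 < R) (hR : R < Real.pi) :
    HasDerivAt (foldBase δ) (foldBaseDeriv δ R / Real.sin R ^ 2) R := by
  have hs := Real.sin_pos_of_pos_of_lt_pi h0 hR
  have hc := hasDerivAt_cot h0 hR
  have h1 := (((hasDerivAt_foldIn (δ := δ) (R := R)).const_sub 1).mul
    (hc.const_add (foldCot δ))).const_sub (foldCot δ)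
  have h2 := (hasDerivAt_foldOut (δ := δ) (R := R)).mul (hc.const_sub (foldCot δ))
  refine (h1.sub h2).congr_deriv ?_
  rw [foldBaseDeriv]
  field_simp
  ring

lemma contDiff_foldBaseDeriv : ContDiff ℝ ∞ (foldBaseDeriv δ) :=
  ((((contDiff_foldInDeriv).mul ((contDiff_const.mul (Real.contDiff_sin.pow 2)).add
    (Real.contDiff_sin.mul Real.contDiff_cos))).add (contDiff_const.sub contDiff_foldIn)).sub
    (contDiff_foldOutDeriv.mul ((contDiff_const.mul (Real.contDiff_sin.pow 2)).sub
    (Real.contDiff_sin.mul Real.contDiff_cos)))).sub contDiff_foldOut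

section Small

variable (hδ : 0 < δ) (hδ1 : 5 * δ ≤ 1 / 4)
include hδ hδ1

lemma foldCot_pos : 0 < foldCot δ :=
  div_pos (by linarith [cos_gt_of_le_half (x := 3 * δ) (by linarith) (by linarith)])
    (Real.sin_pos_of_pos_of_lt_pi (by linarith) (by linarith [Real.pi_gt_three]))

lemma foldBaseDeriv_nonneg (h0 : 0 < R) (hR : R ≤ 3 * δ) :
    (1 - foldIn δ R) ≤ foldBaseDeriv δ R := by
  have h1 := foldOut_of_le hδ (show R ≤ 7 / 2 * δ by linarith)
  have hs := Real.sin_pos_of_pos_of_lt_pi h0 (by linarith [Real.pi_gt_three])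
  have hc := cos_gt_of_le_half h0.le (show R ≤ 1 / 2 by linarith)
  have h2 := foldCot_pos hδ hδ1
  have h3 := foldInDeriv_nonneg (R := R) hδ
  rw [foldBaseDeriv, h1.1, h1.2]
  have : 0 ≤ foldInDeriv δ R * (foldCot δ * Real.sin R ^ 2 + Real.sin R * Real.cos R) := by
    have : 0 < Real.cos R := by linarith
    positivity
  linarith

omit hδ1 in
lemma foldBaseDeriv_le (hR : 3 * δ ≤ R) (hRpi : R < Real.pi) : foldBaseDeriv δ R ≤ -foldOut δ R := by
  have h1 := foldIn_of_ge hδ (show 5 / 2 * δ ≤ R by linarith)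
  have hs := Real.sin_pos_of_pos_of_lt_pi (show 0 < R by linarith) hRpi
  have hs3 : 0 < Real.sin (3 * δ) :=
    Real.sin_pos_of_pos_of_lt_pi (by linarith) (by linarith [Real.pi_gt_three])
  have h2 : foldCot δ * Real.sin R ^ 2 - Real.sin R * Real.cos R =
      Real.sin R * (Real.sin (R - 3 * δ) / Real.sin (3 * δ)) := by
    rw [foldCot, Real.sin_sub]; field_simp
  have h3 : 0 ≤ Real.sin (R - 3 * δ) := Real.sin_nonneg_of_nonneg_of_le_pi (by linarith)
    (by linarith)
  have h4 := foldOutDeriv_nonneg (R := R) hδ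
  rw [foldBaseDeriv, h1.1, h1.2, h2]
  have : 0 ≤ foldOutDeriv δ R * (Real.sin R * (Real.sin (R - 3 * δ) / Real.sin (3 * δ))) := by
    positivity
  linarith

lemma integral_foldBump_neg :
    ∫ R in δ..(5 * δ), Real.cos R * (Real.sin R ^ 2 * foldBumpDeriv δ R) < 0 := by
  set κ := Real.cos (3 * δ) * Real.sin (3 * δ) ^ 2 with hκ
  have c1 : Continuous fun R => Real.cos R * (Real.sin R ^ 2 * foldBumpDeriv δ R) :=
    Real.continuous_cos.mul ((Real.continuous_sin.pow 2).mul contDiff_foldBumpDeriv.continuous)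
  have c2 : Continuous fun R => κ * foldBumpDeriv δ R :=
    continuous_const.mul contDiff_foldBumpDeriv.continuous
  have h0 : ∫ R in δ..(5 * δ), κ * foldBumpDeriv δ R = 0 := by
    rw [intervalIntegral.integral_const_mul,
      intervalIntegral.integral_eq_sub_of_hasDerivAt (fun R _ => hasDerivAt_foldBump)
        (contDiff_foldBumpDeriv.continuous.intervalIntegrable _ _),
      (foldBump_far hδ (by rw [abs_of_nonneg] <;> linarith)).1,
      (foldBump_far hδ (by rw [abs_of_nonpos] <;> linarith)).1]
    simp
  have h1 : 0 < ∫ R in δ..(5 * δ), (κ * foldBumpDeriv δ R -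
      Real.cos R * (Real.sin R ^ 2 * foldBumpDeriv δ R)) := by
    refine intervalIntegral.integral_pos (by linarith) (c2.sub c1).continuousOn (fun R hR => ?_)
      ⟨11 / 4 * δ, ⟨by linarith, by linarith⟩, ?_⟩
    · have e : κ * foldBumpDeriv δ R - Real.cos R * (Real.sin R ^ 2 * foldBumpDeriv δ R) =
        (κ - Real.cos R * Real.sin R ^ 2) * foldBumpDeriv δ R := by ring
      rw [e]
      rcases lt_trichotomy R (3 * δ) with h | h | h
      · exact mul_nonneg (sub_nonneg.2 (cos_mul_sin_sq_lt (by linarith [hR.1]) h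
          (by linarith)).le) (foldBumpDeriv_nonneg hδ h.le)
      · rw [h, hκ, sub_self, zero_mul]
      · exact mul_nonneg_of_nonpos_of_nonpos (sub_nonpos.2 (cos_mul_sin_sq_lt (by linarith) h
          (by linarith [hR.2])).le) (foldBumpDeriv_nonpos hδ h.le)
    · have e : κ * foldBumpDeriv δ (11 / 4 * δ) - Real.cos (11 / 4 * δ) *
        (Real.sin (11 / 4 * δ) ^ 2 * foldBumpDeriv δ (11 / 4 * δ)) =
        (κ - Real.cos (11 / 4 * δ) * Real.sin (11 / 4 * δ) ^ 2) * foldBumpDeriv δ (11 / 4 * δ) := by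
        ring
      rw [e, (foldBump_near hδ (by rw [abs_of_nonpos] <;> linarith)).2]
      refine mul_pos (sub_pos.2 (cos_mul_sin_sq_lt (by linarith) (by linarith) (by linarith))) ?_
      rw [show (11 / 4 * δ - 3 * δ) / δ = -(1 / 4) by field_simp; ring]
      rw [show -(2 * -(1 / 4 : ℝ) / δ) = 1 / 2 / δ by ring]
      positivity
  rw [intervalIntegral.integral_sub (c2.intervalIntegrable _ _) (c1.intervalIntegrable _ _),
    h0] at h1
  linarith

omit hδ1 in
lemma foldBase_three : foldBase δ (3 * δ) = foldCot δ := by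
  rw [foldBase, (foldIn_of_ge hδ (by linarith)).1, (foldOut_of_le hδ (by linarith)).1]; ring

omit hδ1 in
lemma foldBase_of_ge (h : 5 * δ ≤ R) : foldBase δ R = Real.cos R / Real.sin R := by
  rw [foldBase, (foldIn_of_ge hδ (by linarith)).1, (foldOut_of_ge hδ h).1]; ring

lemma integral_foldBase_gt : -Real.sin (5 * δ) <
    ∫ R in δ..(5 * δ), Real.cos R * foldBaseDeriv δ R := by
  have hpi := Real.pi_gt_three
  have c1 : Continuous fun R => Real.cos R * foldBaseDeriv δ R :=
    Real.continuous_cos.mul contDiff_foldBaseDeriv.continuous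
  have hs5 : 0 < Real.sin (5 * δ) := Real.sin_pos_of_pos_of_lt_pi (by linarith) (by linarith)
  have hs3 : 0 < Real.sin (3 * δ) := Real.sin_pos_of_pos_of_lt_pi (by linarith) (by linarith)
  have a1 : 0 ≤ ∫ R in δ..(3 * δ), Real.cos R * foldBaseDeriv δ R := by
    refine intervalIntegral.integral_nonneg (by linarith) fun R hR => ?_
    have := cos_gt_of_le_half (x := R) (by linarith [hR.1]) (by linarith [hR.2])
    have := foldBaseDeriv_nonneg hδ hδ1 (R := R) (by linarith [hR.1]) hR.2
    have h3 : foldIn δ R ≤ 1 := step_le_one _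
    exact mul_nonneg (by linarith) (by linarith)
  have c3 : ContinuousOn (fun R => foldBaseDeriv δ R / Real.sin R ^ 2) (uIcc (3 * δ) (5 * δ)) := by
    rw [uIcc_of_le (by linarith)]
    refine contDiff_foldBaseDeriv.continuous.continuousOn.div
      (Real.continuous_sin.pow 2).continuousOn fun R hR => ?_
    exact pow_ne_zero 2 (Real.sin_pos_of_pos_of_lt_pi (by linarith [hR.1]) (by linarith [hR.2])).ne'
  have a2 : ∫ R in (3 * δ)..(5 * δ), foldBaseDeriv δ R / Real.sin R ^ 2 =
      -(Real.sin (2 * δ) / (Real.sin (3 * δ) * Real.sin (5 * δ))) := by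
    rw [intervalIntegral.integral_eq_sub_of_hasDerivAt (f := foldBase δ) (fun R hR => ?_)
      c3.intervalIntegrable, foldBase_three hδ, foldBase_of_ge hδ le_rfl, foldCot,
      show 2 * δ = 5 * δ - 3 * δ by ring, Real.sin_sub]
    · have h3 := hs3.ne'
      have h5 := hs5.ne'
      rw [div_sub_div _ _ h5 h3, ← neg_div]
      congr 1 <;> ring
    · rw [uIcc_of_le (by linarith)] at hR
      exact hasDerivAt_foldBase (by linarith [hR.1]) (by linarith [hR.2])
  have a3 : ∫ R in (3 * δ)..(5 * δ), Real.sin (5 * δ) ^ 2 * (foldBaseDeriv δ R / Real.sin R ^ 2) ≤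
      ∫ R in (3 * δ)..(5 * δ), Real.cos R * foldBaseDeriv δ R := by
    refine intervalIntegral.integral_mono_on (by linarith) (c3.intervalIntegrable.const_mul _)
      (c1.intervalIntegrable _ _) fun R hR => ?_
    have hsR : 0 < Real.sin R :=
      Real.sin_pos_of_pos_of_lt_pi (by linarith [hR.1]) (by linarith [hR.2])
    have h1 := foldBaseDeriv_le hδ hR.1 (by linarith [hR.2])
    have h2 : 0 ≤ foldOut δ R := step_nonneg _
    have h3 : Real.sin R ≤ Real.sin (5 * δ) :=
      Real.sin_le_sin_of_le_of_le_pi_div_two (by linarith [hR.1]) (by linarith) hR.2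
    have h4 := Real.cos_le_one R
    rw [mul_div_assoc', div_le_iff₀ (by positivity)]
    have h5 : Real.cos R * Real.sin R ^ 2 ≤ Real.sin (5 * δ) ^ 2 := by
      have := pow_le_pow_left₀ hsR.le h3 2
      nlinarith [sq_nonneg (Real.sin R)]
    nlinarith
  rw [intervalIntegral.integral_const_mul, a2] at a3
  have a4 : Real.sin (2 * δ) < Real.sin (3 * δ) :=
    Real.sin_lt_sin_of_lt_of_le_pi_div_two (by linarith) (by linarith) (by linarith)
  have a5 : Real.sin (5 * δ) ^ 2 * -(Real.sin (2 * δ) / (Real.sin (3 * δ) * Real.sin (5 * δ))) =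
      -(Real.sin (5 * δ) * (Real.sin (2 * δ) / Real.sin (3 * δ))) := by field_simp
  have a6 : Real.sin (2 * δ) / Real.sin (3 * δ) < 1 := (div_lt_one hs3).2 a4
  rw [a5] at a3
  rw [← intervalIntegral.integral_add_adjacent_intervals (b := 3 * δ)
    (c1.intervalIntegrable _ _) (c1.intervalIntegrable _ _)]
  nlinarith

theorem exists_foldData : ∃ (C b W : ℝ → ℝ) (C₀ L : ℝ), FoldData δ C b W C₀ L := by
  have hpi := Real.pi_gt_three
  have c1 : Continuous fun R => Real.cos R * foldBaseDeriv δ R :=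
    Real.continuous_cos.mul contDiff_foldBaseDeriv.continuous
  have c2 : Continuous fun R => Real.cos R * (Real.sin R ^ 2 * foldBumpDeriv δ R) :=
    Real.continuous_cos.mul ((Real.continuous_sin.pow 2).mul contDiff_foldBumpDeriv.continuous)
  have i0 := integral_foldBase_gt hδ hδ1
  have i1 := integral_foldBump_neg hδ hδ1
  set I0 := ∫ R in δ..(5 * δ), Real.cos R * foldBaseDeriv δ R with hI0
  set I1 := ∫ R in δ..(5 * δ), Real.cos R * (Real.sin R ^ 2 * foldBumpDeriv δ R) with hI1
  have hs1 : 0 < Real.sin δ := Real.sin_pos_of_pos_of_lt_pi hδ (by linarith)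
  obtain ⟨L, hL, hL0⟩ : ∃ L, 0 < L ∧ I0 + L * I1 = -(Real.sin (5 * δ) + Real.sin δ) := by
    refine ⟨(Real.sin (5 * δ) + Real.sin δ + I0) / (-I1), div_pos (by linarith) (by linarith), ?_⟩
    have := i1.ne
    field_simp
    ring
  set W : ℝ → ℝ := fun R => foldBaseDeriv δ R + L * (Real.sin R ^ 2 * foldBumpDeriv δ R) with hW
  have cW : ContDiff ℝ ∞ W := contDiff_foldBaseDeriv.add
    (contDiff_const.mul ((Real.contDiff_sin.pow 2).mul contDiff_foldBumpDeriv))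
  have cW' : Continuous fun R => Real.cos R * W R := Real.continuous_cos.mul cW.continuous
  have hWl : ∀ R, R ≤ δ → W R = 1 := by
    intro R hR
    simp only [hW]
    rw [foldBaseDeriv, (foldIn_of_le hδ hR).1, (foldIn_of_le hδ hR).2,
      (foldOut_of_le hδ (by linarith)).1, (foldOut_of_le hδ (by linarith)).2,
      (foldBump_far hδ (by rw [abs_of_nonpos] <;> linarith)).2]
    ring
  have hWr : ∀ R, 5 * δ ≤ R → W R = -1 := by
    intro R hR
    simp only [hW]
    rw [foldBaseDeriv, (foldIn_of_ge hδ (by linarith)).1, (foldIn_of_ge hδ (by linarith)).2,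
      (foldOut_of_ge hδ hR).1, (foldOut_of_ge hδ hR).2,
      (foldBump_far hδ (by rw [abs_of_nonneg] <;> linarith)).2]
    ring
  set b : ℝ → ℝ := fun R => Real.sin (5 * δ) - ∫ t in (5 * δ)..R, Real.cos t * W t with hb
  have db : ∀ R, HasDerivAt b (-(Real.cos R * W R)) R := fun R =>
    (cW'.integral_hasStrictDerivAt (5 * δ) R).hasDerivAt.const_sub _
  have hbδ : b δ = -Real.sin δ := by
    have e : ∫ t in (5 * δ)..δ, Real.cos t * W t = -(I0 + L * I1) := by
      have i2 : IntervalIntegrable (fun R => L * (Real.cos R * (Real.sin R ^ 2 * foldBumpDeriv δ R)))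
          MeasureTheory.volume δ (5 * δ) := (continuous_const.mul c2).intervalIntegrable _ _
      rw [intervalIntegral.integral_symm, hI0, hI1, ← intervalIntegral.integral_const_mul,
        ← intervalIntegral.integral_add (c1.intervalIntegrable _ _) i2]
      congr 1
      refine intervalIntegral.integral_congr fun t _ => ?_
      simp only [hW]; ring
    simp only [hb]
    rw [e, hL0]; ring
  refine ⟨fun R => foldBase δ R + L * foldBump δ R, b, W, foldCot δ +
    L * saturate (1 / 4) (3 / 4) (1 / 4 + 3 / 4), L, ?_⟩
  constructor
  · intro R h0 hR
    have hs := Real.sin_pos_of_pos_of_lt_pi h0 hR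
    have hcot : ContDiffAt ℝ ∞ (fun R => Real.cos R / Real.sin R) R :=
      Real.contDiff_cos.contDiffAt.div Real.contDiff_sin.contDiffAt hs.ne'
    exact ((contDiffAt_const.sub ((contDiffAt_const.sub contDiff_foldIn.contDiffAt).mul
      (contDiffAt_const.add hcot))).sub (contDiff_foldOut.contDiffAt.mul
      (contDiffAt_const.sub hcot))).add (contDiffAt_const.mul contDiff_foldBump.contDiffAt)
  · rw [contDiff_infty_iff_deriv]
    refine ⟨fun R => (db R).differentiableAt, ?_⟩
    rw [show deriv b = fun R => -(Real.cos R * W R) from funext fun R => (db R).deriv]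
    exact (Real.contDiff_cos.mul cW).neg
  · intro R h0 hR
    have hs := Real.sin_pos_of_pos_of_lt_pi h0 hR
    refine ((hasDerivAt_foldBase h0 hR).add (hasDerivAt_foldBump.const_mul L)).congr_deriv ?_
    simp only [hW]
    field_simp
  · exact db
  · intro R h0 hR
    have h1 := foldBaseDeriv_nonneg hδ hδ1 h0 hR.le
    have h2 := foldBumpDeriv_nonneg hδ hR.le
    have hs := Real.sin_pos_of_pos_of_lt_pi h0 (by linarith)
    simp only [hW]
    rcases lt_or_ge R (5 / 2 * δ) with h3 | h3
    · have h4 : foldIn δ R < 1 := by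
        refine step_lt_one ?_
        have : R / δ < 5 / 2 := (div_lt_iff₀ hδ).2 h3
        linarith
      have : 0 ≤ L * (Real.sin R ^ 2 * foldBumpDeriv δ R) := by positivity
      linarith
    · have h4 : foldIn δ R ≤ 1 := step_le_one _
      have h5 : 0 < foldBumpDeriv δ R := by
        rw [(foldBump_near hδ (by rw [abs_of_nonpos] <;> linarith)).2, neg_pos]
        exact div_neg_of_neg_of_pos (mul_neg_of_pos_of_neg two_pos
          (div_neg_of_neg_of_pos (by linarith) hδ)) hδ
      have : 0 < L * (Real.sin R ^ 2 * foldBumpDeriv δ R) := by positivity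
      linarith
  · intro R h0 hR
    have h1 := foldBaseDeriv_le hδ h0.le hR
    have h2 := foldBumpDeriv_nonpos hδ h0.le
    have hs := Real.sin_pos_of_pos_of_lt_pi (show 0 < R by linarith) hR
    have h6 : 0 < L * Real.sin R ^ 2 := by positivity
    simp only [hW]
    rcases lt_or_ge (7 / 2 * δ) R with h3 | h3
    · have h4 : 0 < foldOut δ R := by
        refine step_pos ?_
        have : 7 / 2 < R / δ := (lt_div_iff₀ hδ).2 h3
        linarith
      nlinarith
    · have h4 : 0 ≤ foldOut δ R := step_nonneg _
      have h5 : foldBumpDeriv δ R < 0 := by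
        rw [(foldBump_near hδ (by rw [abs_of_nonneg] <;> linarith)).2, neg_lt_zero]
        exact div_pos (mul_pos two_pos (div_pos (by linarith) hδ)) hδ
      nlinarith
  · intro R hR
    rw [foldBase, (foldIn_of_le hδ hR).1, (foldOut_of_le hδ (by linarith)).1,
      (foldBump_far hδ (by rw [abs_of_nonpos] <;> linarith)).1]
    ring
  · intro R hR
    have e : ∫ t in δ..R, Real.cos t * W t = Real.sin R - Real.sin δ := by
      rw [← integral_cos]
      refine intervalIntegral.integral_congr fun t ht => ?_
      rw [uIcc_of_ge hR] at ht
      simp only [hWl t ht.2, mul_one]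
    have e2 := intervalIntegral.integral_add_adjacent_intervals
      (cW'.intervalIntegrable (μ := MeasureTheory.volume) (5 * δ) δ)
      (cW'.intervalIntegrable (μ := MeasureTheory.volume) δ R)
    simp only [hb] at hbδ ⊢
    rw [← e2, e]
    linarith
  · intro R hR
    rw [foldBase_of_ge hδ hR, (foldBump_far hδ (by rw [abs_of_nonneg] <;> linarith)).1]
    ring
  · intro R hR
    have e : ∫ t in (5 * δ)..R, Real.cos t * W t = -(Real.sin R - Real.sin (5 * δ)) := by
      rw [← integral_cos, ← intervalIntegral.integral_neg]
      refine intervalIntegral.integral_congr fun t ht => ?_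
      rw [uIcc_of_le hR] at ht
      simp only [hWr t ht.1, mul_neg, mul_one]
    simp only [hb]
    rw [e]; ring
  · exact hWr
  · exact hL
  · intro R hR
    obtain ⟨k1, k2⟩ := abs_le.1 hR
    rw [(foldBump_near hδ hR).1, foldBase, (foldIn_of_ge hδ (by linarith)).1,
      (foldOut_of_le hδ (by linarith)).1]
    ring
  · have := lt_saturate (x₀ := 1 / 4) (μ := 3 / 4) (by norm_num)
    change foldCot δ < _
    nlinarith
  · intro R h0 hR
    have h1 : 0 ≤ L * foldBump δ R := mul_nonneg hL.le foldBump_nonneg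
    have h2 : Real.cos R / Real.sin R ≤ foldCot δ := by
      have hs := Real.sin_pos_of_pos_of_lt_pi (show 0 < R by linarith) (by linarith)
      have hs3 : 0 < Real.sin (3 * δ) := Real.sin_pos_of_pos_of_lt_pi (by linarith) (by linarith)
      rw [foldCot, div_le_div_iff₀ hs hs3]
      have h3 : 0 ≤ Real.sin (R - 3 * δ) := Real.sin_nonneg_of_nonneg_of_le_pi (by linarith)
        (by linarith)
      rw [Real.sin_sub] at h3
      linarith
    have h3 : foldOut δ R ≤ 1 := step_le_one _
    rw [foldBase, (foldIn_of_ge hδ (by linarith)).1]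
    nlinarith

end Small

end Fold

/-! ### Folding the disc over the core of a `(-1)`-surgery -/

/-- The axial momentum of the folded disc. -/
def foldP (δ : ℝ) (C : ℝ → ℝ) (R : ℝ) : ℝ := if R < δ then -Real.cos R else Real.sin R * C R

/-- The radial position of the folded disc. -/
def foldG (δ : ℝ) (C b : ℝ → ℝ) (R : ℝ) : ℝ :=
  if R < δ then -Real.sin R else b R / Real.sin R ^ 2 - Real.cos R * C R

/-- The family of discs that is pushed over the core of a `(-1)`-surgery. -/
def foldFamily (σ h h' ρ δ : ℝ) (C b : ℝ → ℝ) : PlaneFamily where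
  q₁ _ R := σ * (Real.cos R + profileSlope h h' ρ R / profile h h' ρ R * Real.sin R)
  q₂ s R := σ * ((1 - s) * Real.sin R + s * foldG δ C b R -
    profileSlope h h' ρ R / profile h h' ρ R * Real.cos R)
  p₁ s R := √(profile h h' ρ R) * ((1 - s) * Real.cos R + s * foldP δ C R)
  p₂ _ R := √(profile h h' ρ R) * Real.sin R

section FoldFamily

variable {e : Sph m} {r a b₀ h h' σ ρ δ δ₀ C₀ L : ℝ} {C b W : ℝ → ℝ}

namespace FoldData

variable (hF : FoldData δ C b W C₀ L) (hδ : 0 < δ) (hδ1 : 5 * δ ≤ 1 / 4)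

include hF hδ hδ1

omit hδ in
lemma foldP_of_pos {R : ℝ} (h0 : 0 < R) : foldP δ C R = Real.sin R * C R := by
  rw [foldP]
  split_ifs with h
  · have := (Real.sin_pos_of_pos_of_lt_pi h0 (by linarith [Real.pi_gt_three])).ne'
    rw [hF.C_left R h.le]; field_simp
  · rfl

omit hδ in
lemma foldG_of_pos {R : ℝ} (h0 : 0 < R) :
    foldG δ C b R = b R / Real.sin R ^ 2 - Real.cos R * C R := by
  rw [foldG]
  split_ifs with h
  · have := (Real.sin_pos_of_pos_of_lt_pi h0 (by linarith [Real.pi_gt_three])).ne'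
    rw [hF.C_left R h.le, hF.b_left R h.le]; field_simp
    linear_combination -(Real.sin_sq_add_cos_sq R)
  · rfl

lemma fold_of_ge {R : ℝ} (h0 : 5 * δ ≤ R) (hR : R < Real.pi) :
    foldP δ C R = Real.cos R ∧ foldG δ C b R = Real.sin R := by
  have := (Real.sin_pos_of_pos_of_lt_pi (show 0 < R by linarith) hR).ne'
  rw [hF.foldP_of_pos hδ1 (by linarith), hF.foldG_of_pos hδ1 (by linarith),
    hF.C_right R h0, hF.b_right R h0]
  constructor
  · field_simp
  · field_simp
    linear_combination -(Real.sin_sq_add_cos_sq R)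

omit hδ in
lemma hasDerivAt_foldP {R : ℝ} (h0 : 0 < R) (hR : R < Real.pi) :
    HasDerivAt (foldP δ C) (Real.cos R * C R + W R / Real.sin R) R := by
  have hs := (Real.sin_pos_of_pos_of_lt_pi h0 hR).ne'
  refine (((Real.hasDerivAt_sin R).mul (hF.deriv_C R h0 hR)).congr_deriv
    (by field_simp)).congr_of_eventuallyEq ?_
  filter_upwards [Ioi_mem_nhds h0] with y hy using hF.foldP_of_pos hδ1 hy

omit hδ in
lemma hasDerivAt_foldG {R : ℝ} (h0 : 0 < R) (hR : R < Real.pi) :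
    HasDerivAt (foldG δ C b) (-2 * (Real.cos R * W R / Real.sin R ^ 2) -
      2 * (b R * Real.cos R / Real.sin R ^ 3) + Real.sin R * C R) R := by
  have hs := (Real.sin_pos_of_pos_of_lt_pi h0 hR).ne'
  have h1 := ((hF.deriv_b R).div ((Real.hasDerivAt_sin R).pow 2) (pow_ne_zero 2 hs)).sub
    ((Real.hasDerivAt_cos R).mul (hF.deriv_C R h0 hR))
  refine (h1.congr_deriv ?_).congr_of_eventuallyEq ?_
  · simp only [Pi.pow_apply]
    field_simp
    push_cast
    ring
  · filter_upwards [Ioi_mem_nhds h0] with y hy using hF.foldG_of_pos hδ1 hy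

omit hδ in
lemma contDiffAt_foldP {R : ℝ} (h0 : 0 < R) (hR : R < Real.pi) : ContDiffAt ℝ ∞ (foldP δ C) R := by
  refine (Real.contDiff_sin.contDiffAt.mul (hF.smooth_C R h0 hR)).congr_of_eventuallyEq ?_
  filter_upwards [Ioi_mem_nhds h0] with y hy using hF.foldP_of_pos hδ1 hy

omit hδ in
lemma contDiffAt_foldG {R : ℝ} (h0 : 0 < R) (hR : R < Real.pi) :
    ContDiffAt ℝ ∞ (foldG δ C b) R := by
  have hs := (Real.sin_pos_of_pos_of_lt_pi h0 hR).ne'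
  refine ((hF.smooth_b.contDiffAt.div (Real.contDiff_sin.contDiffAt.pow 2)
    (pow_ne_zero 2 hs)).sub (Real.contDiff_cos.contDiffAt.mul
    (hF.smooth_C R h0 hR))).congr_of_eventuallyEq ?_
  filter_upwards [Ioi_mem_nhds h0] with y hy using hF.foldG_of_pos hδ1 hy

lemma exists_fold_bound : ∃ B, 0 < B ∧ ∀ R, 0 ≤ R → R ≤ 5 * δ →
    |foldP δ C R| ≤ B ∧ |foldG δ C b R| ≤ B := by
  have hpi := Real.pi_gt_three
  obtain ⟨B₁, h1⟩ := (isCompact_Icc (a := δ) (b := 5 * δ)).exists_bound_of_continuousOn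
    (f := foldP δ C) fun R hR => (hF.contDiffAt_foldP hδ1 (hδ.trans_le hR.1)
      (by linarith [hR.2])).continuousAt.continuousWithinAt
  obtain ⟨B₂, h2⟩ := (isCompact_Icc (a := δ) (b := 5 * δ)).exists_bound_of_continuousOn
    (f := foldG δ C b) fun R hR => (hF.contDiffAt_foldG hδ1 (hδ.trans_le hR.1)
      (by linarith [hR.2])).continuousAt.continuousWithinAt
  refine ⟨max 1 (max B₁ B₂), by positivity, fun R h0 hR => ?_⟩
  rcases lt_or_ge R δ with h | h
  · rw [foldP, foldG, if_pos h, if_pos h, abs_neg, abs_neg]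
    exact ⟨(Real.abs_cos_le_one R).trans (le_max_left _ _),
      (Real.abs_sin_le_one R).trans (le_max_left _ _)⟩
  · exact ⟨(h1 R ⟨h, hR⟩).trans ((le_max_left _ _).trans (le_max_right _ _)),
      (h2 R ⟨h, hR⟩).trans ((le_max_right _ _).trans (le_max_right _ _))⟩

end FoldData

lemma foldFamily_small {s R : ℝ} (hρ : 0 < ρ) (hR : R ≤ ρ / 2) :
    (foldFamily σ h h' ρ δ C b).q₁ s R = σ * Real.cos R ∧
    (foldFamily σ h h' ρ δ C b).q₂ s R = σ * ((1 - s) * Real.sin R + s * foldG δ C b R) ∧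
    (foldFamily σ h h' ρ δ C b).p₁ s R = √h' * ((1 - s) * Real.cos R + s * foldP δ C R) ∧
    (foldFamily σ h h' ρ δ C b).p₂ s R = √h' * Real.sin R := by
  simp only [foldFamily, profile_of_le hρ hR, profileSlope_of_le hρ hR]
  norm_num

lemma foldFamily_large {s R : ℝ} (hF : FoldData δ C b W C₀ L) (hδ : 0 < δ) (hδ1 : 5 * δ ≤ 1 / 4)
    (h0 : 5 * δ ≤ R) (hR : R < Real.pi) :
    (foldFamily σ h h' ρ δ C b).q₂ s R = σ * (Real.sin R -
      profileSlope h h' ρ R / profile h h' ρ R * Real.cos R) ∧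
    (foldFamily σ h h' ρ δ C b).p₁ s R = √(profile h h' ρ R) * Real.cos R := by
  obtain ⟨h1, h2⟩ := hF.fold_of_ge hδ hδ1 h0 hR
  simp only [foldFamily, h1, h2]
  constructor <;> ring

lemma foldFamily_norm_le {B s R : ℝ} (hσ : σ = 1 ∨ σ = -1) (hρ : 0 < ρ) (h0 : 0 < h')
    (hs : s ∈ Icc (0 : ℝ) 1) (hR : R ≤ ρ / 2) (hP : |foldP δ C R| ≤ B) (hG : |foldG δ C b R| ≤ B) :
    (foldFamily σ h h' ρ δ C b).q₁ s R ^ 2 + (foldFamily σ h h' ρ δ C b).q₂ s R ^ 2 ≤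
      (2 + B) ^ 2 ∧
    (foldFamily σ h h' ρ δ C b).p₁ s R ^ 2 + (foldFamily σ h h' ρ δ C b).p₂ s R ^ 2 ≤
      h' * (2 + B) ^ 2 := by
  obtain ⟨v1, v2, v3, v4⟩ := foldFamily_small (σ := σ) (h := h) (h' := h') (δ := δ) (s := s)
    (C := C) (b := b) hρ hR
  have hσ2 : σ ^ 2 = 1 := by rcases hσ with rfl | rfl <;> norm_num
  have hB : 0 ≤ B := (abs_nonneg _).trans hP
  have key : ∀ x y : ℝ, |x| ≤ 1 → |y| ≤ B → ((1 - s) * x + s * y) ^ 2 ≤ (1 + B) ^ 2 := by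
    intro x y hx hy
    rw [← sq_abs]
    refine pow_le_pow_left₀ (abs_nonneg _) ((abs_add_le _ _).trans ?_) 2
    rw [abs_mul, abs_mul, abs_of_nonneg hs.1, abs_of_nonneg (sub_nonneg.2 hs.2)]
    nlinarith [hs.1, hs.2, abs_nonneg x, abs_nonneg y]
  have k1 := key _ _ (Real.abs_cos_le_one R) hP
  have k2 := key _ _ (Real.abs_sin_le_one R) hG
  have c1 := Real.cos_sq_le_one R
  have c2 := Real.sin_sq_le_one R
  rw [v1, v2, v3, v4, mul_pow, mul_pow, mul_pow, mul_pow, hσ2, Real.sq_sqrt h0.le]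
  constructor
  · nlinarith
  · rw [← mul_add]
    refine mul_le_mul_of_nonneg_left ?_ h0.le
    nlinarith

/-- Points of the two parts of the folded disc do not lie on a common flow line. -/
lemma foldFamily_ne {B s R R' : ℝ} (hF : FoldData δ C b W C₀ L) (hδ : 0 < δ) (hδ1 : 5 * δ ≤ 1 / 4)
    (hr : r < Real.pi) (hδρ : 5 * δ < ρ / 2) (hρ1 : ρ ≤ 1 / 2)
    (h0 : 0 < h') (hh : h' ≤ h) (hσ : σ = 1 ∨ σ = -1) (hs : s ∈ Icc (0 : ℝ) 1)
    (hB : ∀ R, 0 ≤ R → R ≤ 5 * δ → |foldP δ C R| ≤ B ∧ |foldG δ C b R| ≤ B)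
    (hB1 : h' * (2 + B) ^ 3 < h) (hR0 : 0 < R) (hR : R < 5 * δ) (hR0' : ρ / 2 ≤ R')
    (hR' : R' < r)
    (h1 : σ * (foldFamily σ h h' ρ δ C b).q₁ s R * (foldFamily σ h h' ρ δ C b).p₂ s R ^ 2 =
      σ * (foldFamily σ h h' ρ δ C b).q₁ s R' * (foldFamily σ h h' ρ δ C b).p₂ s R' ^ 2)
    (h2 : ((foldFamily σ h h' ρ δ C b).q₁ s R ^ 2 + (foldFamily σ h h' ρ δ C b).q₂ s R ^ 2) *
      ((foldFamily σ h h' ρ δ C b).p₁ s R ^ 2 + (foldFamily σ h h' ρ δ C b).p₂ s R ^ 2) ^ 2 =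
      ((foldFamily σ h h' ρ δ C b).q₁ s R' ^ 2 + (foldFamily σ h h' ρ δ C b).q₂ s R' ^ 2) *
      ((foldFamily σ h h' ρ δ C b).p₁ s R' ^ 2 + (foldFamily σ h h' ρ δ C b).p₂ s R' ^ 2) ^ 2) :
    False := by
  have hρ : 0 < ρ := by linarith
  have hA : 0 < profile h h' ρ R' := h0.trans_le (le_profile hh)
  have hσ2 : σ ^ 2 = 1 := by rcases hσ with rfl | rfl <;> norm_num
  obtain ⟨w2, w3⟩ := foldFamily_large (σ := σ) (h := h) (h' := h') (ρ := ρ) (s := s)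
    hF hδ hδ1 (show 5 * δ ≤ R' by linarith) (hR'.trans hr)
  rcases le_or_gt R' (1 / 2) with h3 | h3
  · obtain ⟨v1, -, -, v4⟩ := foldFamily_small (σ := σ) (h := h) (h' := h') (δ := δ) (s := s)
      (C := C) (b := b) hρ (show R ≤ ρ / 2 by linarith)
    rw [v1, v4] at h1
    simp only [foldFamily] at h1
    rw [mul_pow, mul_pow, Real.sq_sqrt h0.le, Real.sq_sqrt hA.le] at h1
    have h4 : h' * (Real.cos R * Real.sin R ^ 2) = (profile h h' ρ R' * Real.cos R' +
        profileSlope h h' ρ R' * Real.sin R') * Real.sin R' ^ 2 := by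
      have e : (profile h h' ρ R' * Real.cos R' + profileSlope h h' ρ R' * Real.sin R') =
          profile h h' ρ R' * (Real.cos R' + profileSlope h h' ρ R' / profile h h' ρ R' *
            Real.sin R') := by field_simp
      rw [e]
      linear_combination h1 - (h' * (Real.cos R * Real.sin R ^ 2) - profile h h' ρ R' *
        (Real.cos R' + profileSlope h h' ρ R' / profile h h' ρ R' * Real.sin R') *
        Real.sin R' ^ 2) * hσ2
    have h5 := cos_mul_sin_sq_lt hR0.le (show R < R' by linarith) h3
    have h6 := Real.sin_pos_of_pos_of_lt_pi (show 0 < R' by linarith) (hR'.trans hr)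
    have h7 := cos_gt_of_le_half (show 0 ≤ R' by linarith) h3
    have h8 := profileSlope_nonneg (R := R') hρ hh
    have h9 : h' ≤ profile h h' ρ R' := le_profile hh
    have h10 : h' * (Real.cos R' * Real.sin R' ^ 2) ≤ (profile h h' ρ R' * Real.cos R' +
        profileSlope h h' ρ R' * Real.sin R') * Real.sin R' ^ 2 := by
      rw [← mul_assoc]
      refine mul_le_mul_of_nonneg_right ?_ (sq_nonneg _)
      have := mul_nonneg h8 h6.le
      have := mul_le_mul_of_nonneg_right h9 (show 0 ≤ Real.cos R' by linarith)
      linarith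
    have h11 := (mul_lt_mul_of_pos_left h5 h0).trans_le h10
    rw [h4] at h11
    exact lt_irrefl _ h11
  · obtain ⟨n1, n2⟩ := foldFamily_norm_le (h := h) hσ hρ h0 hs (show R ≤ ρ / 2 by linarith)
      (hB R hR0.le hR.le).1 (hB R hR0.le hR.le).2
    have hB0 : 0 ≤ B := (abs_nonneg _).trans (hB R hR0.le hR.le).1
    have e1 : ((foldFamily σ h h' ρ δ C b).q₁ s R' ^ 2 + (foldFamily σ h h' ρ δ C b).q₂ s R' ^ 2) *
        ((foldFamily σ h h' ρ δ C b).p₁ s R' ^ 2 + (foldFamily σ h h' ρ δ C b).p₂ s R' ^ 2) ^ 2 =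
        h ^ 2 := by
      rw [w2, w3]
      simp only [foldFamily, profileSlope_of_ge hρ (show ρ ≤ R' by linarith),
        profile_of_ge hρ (show ρ ≤ R' by linarith)]
      have ht := Real.sin_sq_add_cos_sq R'
      have hq := Real.sq_sqrt (h0.le.trans hh)
      have a1 : (σ * (Real.cos R' + 0 / h * Real.sin R')) ^ 2 +
          (σ * (Real.sin R' - 0 / h * Real.cos R')) ^ 2 = 1 := by
        rw [zero_div]
        linear_combination hσ2 + σ ^ 2 * ht
      have a2 : (√h * Real.cos R') ^ 2 + (√h * Real.sin R') ^ 2 = h := by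
        linear_combination hq + √h ^ 2 * ht
      rw [a1, a2, one_mul]
    rw [e1] at h2
    have e2 : h ^ 2 ≤ (h' * (2 + B) ^ 3) ^ 2 := by
      rw [← h2]
      calc _ ≤ (2 + B) ^ 2 * (h' * (2 + B) ^ 2) ^ 2 := by gcongr
        _ = _ := by ring
    have := (sq_le_sq₀ (h0.le.trans hh) (by positivity)).1 e2
    linarith

theorem isGood_foldFamily {B : ℝ} (hF : FoldData δ C b W C₀ L) (hδ : 0 < δ) (hδ1 : 5 * δ ≤ 1 / 4)
    (hr : r < Real.pi) (hδρ : 5 * δ < ρ / 2) (hρ1 : ρ ≤ 1 / 2)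
    (h0 : 0 < h') (hh : h' ≤ h) (hσ : σ = 1 ∨ σ = -1)
    (hB : ∀ R, 0 ≤ R → R ≤ 5 * δ → |foldP δ C R| ≤ B ∧ |foldG δ C b R| ≤ B)
    (hB1 : h' * (2 + B) ^ 3 < h) : (foldFamily σ h h' ρ δ C b).IsGood r := by
  have hρ : 0 < ρ := by linarith
  have hpi := Real.pi_gt_three
  have hσ0 : σ ≠ 0 := by rcases hσ with rfl | rfl <;> norm_num
  have hA : ∀ R, 0 < profile h h' ρ R := fun R => h0.trans_le (le_profile hh)
  have hpos : ∀ R, 0 < R → R < r → 0 < Real.sin R := fun R k1 k2 =>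
    Real.sin_pos_of_pos_of_lt_pi k1 (k2.trans hr)
  have hDG : ∀ s R, 0 < R → R < r → (foldFamily σ h h' ρ δ C b).DerivGood s R := by
    intro s R k0 kR
    have hc := Real.hasDerivAt_cos R
    have hs := Real.hasDerivAt_sin R
    have htr := Real.sin_sq_add_cos_sq R
    have hsR := hpos R k0 kR
    rcases lt_or_ge R (ρ / 2) with hR | hR
    · have hev : ∀ᶠ R' in 𝓝 R, R' ≤ ρ / 2 := by
        filter_upwards [Iio_mem_nhds hR] with R' hR' using le_of_lt hR'
      have hp := hF.hasDerivAt_foldP hδ1 k0 (kR.trans hr)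
      have hg := hF.hasDerivAt_foldG hδ1 k0 (kR.trans hr)
      obtain ⟨v1, v2, v3, v4⟩ := foldFamily_small (σ := σ) (h := h) (h' := h') (δ := δ) (s := s)
        (C := C) (b := b) hρ hR.le
      have hsq := (Real.sqrt_pos.2 h0).ne'
      refine ⟨_, _, _, _,
        (hc.const_mul σ).congr_of_eventuallyEq
          (hev.mono fun R' hR' => (foldFamily_small (s := s) (δ := δ) hρ hR').1),
        (((hs.const_mul (1 - s)).add (hg.const_mul s)).const_mul σ).congr_of_eventuallyEq
          (hev.mono fun R' hR' => (foldFamily_small (s := s) (δ := δ) hρ hR').2.1),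
        (((hc.const_mul (1 - s)).add (hp.const_mul s)).const_mul (√h')).congr_of_eventuallyEq
          (hev.mono fun R' hR' => (foldFamily_small (σ := σ) hρ hR').2.2.1),
        (hs.const_mul (√h')).congr_of_eventuallyEq
          (hev.mono fun R' hR' => (foldFamily_small (σ := σ) (s := s) (δ := δ) (C := C) (b := b)
            hρ hR').2.2.2), ?_, ?_⟩
      · rw [v1, v2, v3, v4, hF.foldP_of_pos hδ1 k0, hF.foldG_of_pos hδ1 k0]
        have := hsR.ne'
        field_simp
        linear_combination (0 : ℝ) * htr
      · intro η μ k1 k2 k3 k4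
        rw [v1] at k1
        rw [v4] at k4
        have e1 : η * Real.sin R = -2 * μ * Real.cos R :=
          mul_left_cancel₀ hσ0 (by linear_combination -k1)
        have e2 : η * Real.cos R = -μ * Real.sin R :=
          mul_left_cancel₀ hsq (by linear_combination k4)
        have hcR := cos_gt_of_le_half k0.le (show R ≤ 1 / 2 by linarith)
        have e3 : μ * (2 * Real.cos R ^ 2 - Real.sin R ^ 2) = 0 := by
          linear_combination Real.cos R * e1 - Real.sin R * e2
        have e4 : μ = 0 := (mul_eq_zero.1 e3).resolve_right (by nlinarith)
        rw [e4, neg_zero, zero_mul] at e2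
        exact (mul_eq_zero.1 e2).resolve_right (by linarith)
    · have hev : ∀ᶠ R' in 𝓝 R, 5 * δ ≤ R' ∧ R' < Real.pi := by
        filter_upwards [Ioi_mem_nhds (show 5 * δ < R by linarith),
          Iio_mem_nhds (kR.trans hr)] with R' hR' hR'' using ⟨le_of_lt hR', hR''⟩
      obtain ⟨v2, v3⟩ := foldFamily_large (σ := σ) (h := h) (h' := h') (ρ := ρ) (s := s)
        hF hδ hδ1 (show 5 * δ ≤ R by linarith) (kR.trans hr)
      have hp := hasDerivAt_profile (h := h) (h' := h') (ρ := ρ) (R := R)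
      have hps := ((contDiff_profileSlope (h := h) (h' := h') (ρ := ρ)).differentiable (by simp)
        R).hasDerivAt
      have hg := hps.div hp (hA R).ne'
      have hsq := hp.sqrt (hA R).ne'
      have hAne := (hA R).ne'
      have hsA := Real.sqrt_pos.2 (hA R)
      have hq := Real.sq_sqrt (hA R).le
      refine ⟨_, _, _, _, (hc.add (hg.mul hs)).const_mul σ,
        ((hs.sub (hg.mul hc)).const_mul σ).congr_of_eventuallyEq
          (hev.mono fun R' hR' => (foldFamily_large hF hδ hδ1 hR'.1 hR'.2).1),
        (hsq.mul hc).congr_of_eventuallyEq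
          (hev.mono fun R' hR' => (foldFamily_large (σ := σ) hF hδ hδ1 hR'.1 hR'.2).2),
        hsq.mul hs, ?_, ?_⟩
      · rw [v2, v3]
        simp only [foldFamily, Pi.div_apply]
        have hsne := hsA.ne'
        set S := √(profile h h' ρ R) with hS
        rw [← hq]
        field_simp
        linear_combination (0 : ℝ) * htr
      · intro η μ k1 k2 k3 k4
        rw [v3] at k3
        simp only [foldFamily] at k4
        have : √(profile h h' ρ R) * η = 0 := by
          linear_combination Real.cos R * k4 - Real.sin R * k3 -
            √(profile h h' ρ R) * η * htr
        exact (mul_eq_zero.1 this).resolve_left hsA.ne'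
  refine ⟨?_, ?_, fun s _ R k0 kR => (hDG s R k0 kR).liouville,
    fun s _ R k0 kR => (hDG s R k0 kR).immersion, ?_, ?_⟩
  · intro s _ R k0 kR
    have a4 : ContDiffAt ℝ ∞ (fun z : ℝ × ℝ => profileSlope h h' ρ z.2 / profile h h' ρ z.2)
        (s, R) := ((contDiff_profileSlope.comp contDiff_snd).div
        (contDiff_profile.comp contDiff_snd) fun z => (hA z.2).ne').contDiffAt
    have a5 : ContDiffAt ℝ ∞ (fun z : ℝ × ℝ => Real.cos z.2) (s, R) :=
      (Real.contDiff_cos.comp contDiff_snd).contDiffAt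
    have a6 : ContDiffAt ℝ ∞ (fun z : ℝ × ℝ => Real.sin z.2) (s, R) :=
      (Real.contDiff_sin.comp contDiff_snd).contDiffAt
    have a7 : ContDiffAt ℝ ∞ (fun z : ℝ × ℝ => √(profile h h' ρ z.2)) (s, R) :=
      ((contDiff_profile.comp contDiff_snd).sqrt fun z => (hA z.2).ne').contDiffAt
    have a8 : ContDiffAt ℝ ∞ (fun z : ℝ × ℝ => foldP δ C z.2) (s, R) :=
      ContDiffAt.comp (s, R) (hF.contDiffAt_foldP hδ1 k0 (kR.trans hr)) contDiffAt_snd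
    have a9 : ContDiffAt ℝ ∞ (fun z : ℝ × ℝ => foldG δ C b z.2) (s, R) :=
      ContDiffAt.comp (s, R) (hF.contDiffAt_foldG hδ1 k0 (kR.trans hr)) contDiffAt_snd
    have a1 : ContDiffAt ℝ ∞ (fun z : ℝ × ℝ => 1 - z.1) (s, R) :=
      contDiffAt_const.sub contDiffAt_fst
    exact ⟨contDiffAt_const.mul (a5.add (a4.mul a6)),
      contDiffAt_const.mul (((a1.mul a6).add (contDiffAt_fst.mul a9)).sub (a4.mul a5)),
      a7.mul ((a1.mul a5).add (contDiffAt_fst.mul a8)), a7.mul a6⟩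
  · refine ⟨δ, hδ, fun _ => σ, fun s => σ * (1 - 2 * s), fun s => √h' * (1 - 2 * s),
      fun _ => √h', by fun_prop, by fun_prop, by fun_prop, by fun_prop,
      fun _ _ => Or.inr (Real.sqrt_pos.2 h0).ne', fun s R _ hR => ?_⟩
    obtain ⟨v1, v2, v3, v4⟩ := foldFamily_small (σ := σ) (h := h) (h' := h') (δ := δ) (s := s)
      (C := C) (b := b) hρ (show R ≤ ρ / 2 by linarith)
    rw [v1, v2, v3, v4, foldP, foldG, if_pos hR, if_pos hR]
    refine ⟨rfl, by ring, by ring, rfl⟩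
  · intro s _ R k0 kR
    right
    exact mul_ne_zero (Real.sqrt_pos.2 (hA R)).ne' (hpos R k0 kR).ne'
  · intro s hs R R' k0 kR k0' kR' l τ hl hτ k1 k2 k3 k4
    have hτ2 : τ ^ 2 = 1 := by rcases hτ with rfl | rfl <;> norm_num
    have hll : l * l⁻¹ = 1 := mul_inv_cancel₀ hl.ne'
    have I1 : σ * (foldFamily σ h h' ρ δ C b).q₁ s R' * (foldFamily σ h h' ρ δ C b).p₂ s R' ^ 2 =
        σ * (foldFamily σ h h' ρ δ C b).q₁ s R * (foldFamily σ h h' ρ δ C b).p₂ s R ^ 2 := by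
      rw [k1, k4, mul_pow, mul_pow, hτ2, inv_pow]
      field_simp
    have I2 : ((foldFamily σ h h' ρ δ C b).q₁ s R' ^ 2 +
        (foldFamily σ h h' ρ δ C b).q₂ s R' ^ 2) * ((foldFamily σ h h' ρ δ C b).p₁ s R' ^ 2 +
        (foldFamily σ h h' ρ δ C b).p₂ s R' ^ 2) ^ 2 = ((foldFamily σ h h' ρ δ C b).q₁ s R ^ 2 +
        (foldFamily σ h h' ρ δ C b).q₂ s R ^ 2) * ((foldFamily σ h h' ρ δ C b).p₁ s R ^ 2 +
        (foldFamily σ h h' ρ δ C b).p₂ s R ^ 2) ^ 2 := by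
      rw [k1, k2, k3, k4, mul_pow, mul_pow, mul_pow, mul_pow, mul_pow τ, mul_pow l⁻¹, hτ2, inv_pow]
      field_simp
    have near : ∀ R R', 0 < R → R ≤ ρ / 2 → 0 < R' → R' ≤ ρ / 2 →
        σ * (foldFamily σ h h' ρ δ C b).q₁ s R' * (foldFamily σ h h' ρ δ C b).p₂ s R' ^ 2 =
        σ * (foldFamily σ h h' ρ δ C b).q₁ s R * (foldFamily σ h h' ρ δ C b).p₂ s R ^ 2 →
        ¬ R < R' := by
      intro R R' j0 jR j0' jR' hI hlt
      obtain ⟨v1, -, -, v4⟩ := foldFamily_small (σ := σ) (h := h) (h' := h') (δ := δ) (s := s)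
        (C := C) (b := b) hρ jR
      obtain ⟨w1, -, -, w4⟩ := foldFamily_small (σ := σ) (h := h) (h' := h') (δ := δ) (s := s)
        (C := C) (b := b) hρ jR'
      rw [v1, v4, w1, w4] at hI
      have h5 := cos_mul_sin_sq_lt j0.le hlt (show R' ≤ 1 / 2 by linarith)
      have h6 : (σ ^ 2 * √h' ^ 2) * (Real.cos R' * Real.sin R' ^ 2) =
          (σ ^ 2 * √h' ^ 2) * (Real.cos R * Real.sin R ^ 2) := by linear_combination hI
      have h7 : σ ^ 2 * √h' ^ 2 ≠ 0 :=
        mul_ne_zero (pow_ne_zero 2 hσ0) (pow_ne_zero 2 (Real.sqrt_pos.2 h0).ne')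
      exact h5.ne' (mul_left_cancel₀ h7 h6)
    rcases le_or_gt R (ρ / 2) with hR | hR
    · rcases le_or_gt R' (ρ / 2) with hR' | hR'
      · rcases lt_trichotomy R R' with hlt | heq | hlt
        · exact (near R R' k0 hR k0' hR' I1 hlt).elim
        · exact heq
        · exact (near R' R k0' hR' k0 hR I1.symm hlt).elim
      · rcases lt_or_ge R (5 * δ) with h3 | h3
        · exact (foldFamily_ne hF hδ hδ1 hr hδρ hρ1 h0 hh hσ hs hB hB1 k0 h3 hR'.le kR'
            I1.symm I2.symm).elim
        · have v3 := (foldFamily_large (σ := σ) (h := h) (h' := h') (ρ := ρ) (s := s) hF hδ hδ1 h3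
            (kR.trans hr)).2
          have w3 := (foldFamily_large (σ := σ) (h := h) (h' := h') (ρ := ρ) (s := s) hF hδ hδ1
            (show 5 * δ ≤ R' by linarith) (kR'.trans hr)).2
          rw [v3, w3] at k3
          simp only [foldFamily] at k4
          refine eq_of_polar k0 (kR.trans hr) k0' (kR'.trans hr)
            (mul_pos (inv_pos.2 hl) (Real.sqrt_pos.2 (hA R))) (Real.sqrt_pos.2 (hA R')) hτ
            (k3.trans (by ring)) (k4.trans (by ring))
    · rcases lt_or_ge R' (5 * δ) with h3 | h3
      · exact (foldFamily_ne hF hδ hδ1 hr hδρ hρ1 h0 hh hσ hs hB hB1 k0' h3 hR.le kR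
          I1 I2).elim
      · have v3 := (foldFamily_large (σ := σ) (h := h) (h' := h') (ρ := ρ) (s := s) hF hδ hδ1
          (show 5 * δ ≤ R by linarith) (kR.trans hr)).2
        have w3 := (foldFamily_large (σ := σ) (h := h) (h' := h') (ρ := ρ) (s := s) hF hδ hδ1
          h3 (kR'.trans hr)).2
        rw [v3, w3] at k3
        simp only [foldFamily] at k4
        refine eq_of_polar k0 (kR.trans hr) k0' (kR'.trans hr)
          (mul_pos (inv_pos.2 hl) (Real.sqrt_pos.2 (hA R))) (Real.sqrt_pos.2 (hA R')) hτ
          (k3.trans (by ring)) (k4.trans (by ring))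

open PlaneFamily

lemma foldFamily_flowRel {s R : ℝ} (hF : FoldData δ C b W C₀ L) (hδ : 0 < δ) (hδ1 : 5 * δ ≤ 1 / 4)
    (h0 : 0 < h') (hh : h' ≤ h) (hs : s = 0 ∨ 5 * δ ≤ R ∧ R < Real.pi) :
    FlowRel (foldFamily σ h h' ρ δ C b)
      (outer .minus σ (fun _ R => R) (fun s R => s * profileSlope h h' ρ R)
        (fun s R => (1 - s) * h + s * profile h h' ρ R)) s 1 R (√(profile h h' ρ R)) := by
  have hA : 0 < profile h h' ρ R := h0.trans_le (le_profile hh)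
  have hsA := (Real.sqrt_pos.2 hA).ne'
  have hq := Real.sq_sqrt hA.le
  have hv : (foldFamily σ h h' ρ δ C b).q₂ s R = σ * (Real.sin R -
      profileSlope h h' ρ R / profile h h' ρ R * Real.cos R) ∧
      (foldFamily σ h h' ρ δ C b).p₁ s R = √(profile h h' ρ R) * Real.cos R := by
    rcases hs with rfl | hs
    · simp [foldFamily]
    · exact foldFamily_large hF hδ hδ1 hs.1 hs.2
  constructor
  · rw [hq]; simp only [outer, foldFamily]; field_simp; ring
  · rw [hq, hv.1]; simp only [outer]; field_simp; ring
  · rw [hv.2]; simp only [outer]; field_simp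
  · simp only [outer, foldFamily]; field_simp

lemma coreVec_foldFamily {s : ℝ} (hF : FoldData δ C b W C₀ L) (hδ : 0 < δ) (hδ1 : 5 * δ ≤ 1 / 4)
    (hr : r < Real.pi) (hδρ : 5 * δ < ρ / 2) (hρ1 : ρ ≤ 1 / 2)
    (hσ : σ = 1 ∨ σ = -1) {x : Sph m} (hx : x ∈ cap e r) :
    coreVec .minus ((foldFamily σ h h' ρ δ C b).spun e s (x : Euc m)) ≠ 0 := by
  have hσ0 : σ ≠ 0 := by rcases hσ with rfl | rfl <;> norm_num
  obtain ⟨k0, kR⟩ := axisAngle_mem hx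
  refine spin_ne_zero ?_
  rcases le_or_gt (axisAngle e (x : Euc m)) (ρ / 2) with hR | hR
  · left
    rw [(foldFamily_small (by linarith) hR).1]
    have := cos_gt_of_le_half k0 (show axisAngle e (x : Euc m) ≤ 1 / 2 by linarith)
    exact mul_ne_zero hσ0 (by linarith)
  · have hs := Real.sin_pos_of_pos_of_lt_pi (show 0 < axisAngle e (x : Euc m) by linarith)
      (kR.trans hr)
    by_contra! h1
    obtain ⟨h2, h3⟩ := h1
    have h3 := h3 hs.ne'
    rw [(foldFamily_large hF hδ hδ1 (by linarith) (kR.trans hr)).1] at h3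
    simp only [foldFamily] at h2
    have h2' := (mul_eq_zero.1 h2).resolve_left hσ0
    have h3' := (mul_eq_zero.1 h3).resolve_left hσ0
    have := Real.sin_sq_add_cos_sq (axisAngle e (x : Euc m))
    have h5 : (1 : ℝ) = 0 := by
      linear_combination Real.cos (axisAngle e (x : Euc m)) * h2' +
        Real.sin (axisAngle e (x : Euc m)) * h3' - this
    norm_num at h5

theorem discFamily_foldFamily {B : ℝ} (hF : FoldData δ C b W C₀ L) (hδ : 0 < δ)
    (hδ1 : 5 * δ ≤ 1 / 4) (hr : r < Real.pi) (hδρ : 5 * δ < ρ / 2)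
    (hρ1 : ρ ≤ 1 / 2) (hρr : ρ < r) (ha : 0 < a) (h0 : 0 < h')
    (hh : h' ≤ h) (hb : h < b₀) (hσ : σ = 1 ∨ σ = -1)
    (hB : ∀ R, 0 ≤ R → R ≤ 5 * δ → |foldP δ C R| ≤ B ∧ |foldG δ C b R| ≤ B)
    (hB1 : h' * (2 + B) ^ 3 < h) (hB2 : h' * (2 + B) ^ 3 ≤ δ₀) :
    DiscFamily .minus e r a b₀ h σ δ₀
      (fun s x => coreProj .minus ((foldFamily σ h h' ρ δ C b).spun e s (x : Euc m))) := by
  have hρ : 0 < ρ := by linarith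
  have ho := outerGood_profile (δ₀ := δ₀) hr ha hρ hρr h0 hh hb
  have large : ∀ s, ∀ x ∈ cap e r, 5 * δ ≤ axisAngle e (x : Euc m) →
      outerVec .minus ((foldFamily σ h h' ρ δ C b).spun e s (x : Euc m)) ≠ 0 ∧
      outerProj .minus ((foldFamily σ h h' ρ δ C b).spun e s (x : Euc m)) =
        spunJet e x σ (axisAngle e (x : Euc m))
          (1 * profileSlope h h' ρ (axisAngle e (x : Euc m)))
          ((1 - 1) * h + 1 * profile h h' ρ (axisAngle e (x : Euc m))) := by
    intro s x hx hR
    have hfr := foldFamily_flowRel (σ := σ) (ρ := ρ) hF hδ hδ1 h0 hh (s := s)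
      (Or.inr ⟨hR, (axisAngle_mem hx).2.trans hr⟩)
    have hA : 0 < profile h h' ρ (axisAngle e (x : Euc m)) := h0.trans_le (le_profile hh)
    obtain ⟨h2, h3⟩ := outerProj_outer (κ := .minus) (σ := σ) (θ := fun _ R => R)
      (P := fun s R => s * profileSlope h h' ρ R)
      (A := fun s R => (1 - s) * h + s * profile h h' ρ R) (ho.axis hr hx (s := 1)) rfl rfl rfl
    exact ⟨hfr.outerVec_ne _ h2, (hfr.outerProj (Real.sqrt_pos.2 hA) _ h2).trans h3⟩
  refine (isGood_foldFamily hF hδ hδ1 hr hδρ hρ1 h0 hh hσ hB hB1).discFamily hr _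
    (fun s _ x hx => coreVec_foldFamily hF hδ hδ1 hr hδρ hρ1 hσ hx) (fun s hs x hx => ?_) ?_
  · obtain ⟨k0, kR⟩ := axisAngle_mem hx
    rcases le_or_gt (5 * δ) (axisAngle e (x : Euc m)) with hR | hR
    · obtain ⟨-, h3⟩ := large s x hx hR
      right; left
      rw [h3]
      refine spunJet_mem_frontBox (ho.axis hr hx (s := 1)) hσ hr.le ?_ ?_ ?_
      · rwa [abs_of_nonneg k0]
      · have := le_profile (ρ := ρ) (R := axisAngle e (x : Euc m)) hh
        linarith
      · have := profile_le (ρ := ρ) (R := axisAngle e (x : Euc m)) hh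
        linarith
    · by_cases hq : outerVec .minus ((foldFamily σ h h' ρ δ C b).spun e s (x : Euc m)) = 0
      · exact Or.inl hq
      right; right
      obtain ⟨n1, n2⟩ := foldFamily_norm_le (h := h) hσ hρ h0 hs
        (show axisAngle e (x : Euc m) ≤ ρ / 2 by linarith) (hB _ k0 hR.le).1 (hB _ k0 hR.le).2
      have hB0 : 0 ≤ B := (abs_nonneg _).trans (hB _ k0 hR.le).1
      have n1' : ‖((foldFamily σ h h' ρ δ C b).spun e s (x : Euc m)).1‖ ≤ 2 + B :=
        (sq_le_sq₀ (norm_nonneg _) (by positivity)).1 ((norm_sq_spin_le e x _ _).trans n1)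
      have n2' : ‖((foldFamily σ h h' ρ δ C b).spun e s (x : Euc m)).2‖ ^ 2 ≤ h' * (2 + B) ^ 2 :=
        (norm_sq_spin_le e x _ _).trans n2
      refine (norm_projP hq).le.trans (le_trans ?_ hB2)
      calc _ ≤ h' * (2 + B) ^ 2 * (2 + B) := by gcongr
        _ = _ := by ring
  · refine ⟨ρ, hρr, fun s hs x hx hR => ?_⟩
    obtain ⟨h2, h3⟩ := large s x hx (by linarith)
    refine ⟨h2, ?_⟩
    rw [h3, profileSlope_of_ge hρ hR, profile_of_ge hρ hR, mul_zero, spunJet_self]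
    congr 1
    ring

end FoldFamily

/-! ### Cotangents -/

lemma cot_le_cot {x y : ℝ} (h0 : 0 < x) (hxy : x ≤ y) (hy : y < Real.pi) :
    Real.cos y / Real.sin y ≤ Real.cos x / Real.sin x := by
  have h1 := Real.sin_pos_of_pos_of_lt_pi h0 (by linarith)
  have h2 := Real.sin_pos_of_pos_of_lt_pi (h0.trans_le hxy) hy
  have h3 := Real.sin_nonneg_of_nonneg_of_le_pi (sub_nonneg.2 hxy) (by linarith)
  rw [div_le_div_iff₀ h2 h1]
  rw [Real.sin_sub] at h3
  linarith

lemma cot_lt_cot {x y : ℝ} (h0 : 0 < x) (hxy : x < y) (hy : y < Real.pi) :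
    Real.cos y / Real.sin y < Real.cos x / Real.sin x := by
  have h1 := Real.sin_pos_of_pos_of_lt_pi h0 (by linarith)
  have h2 := Real.sin_pos_of_pos_of_lt_pi (h0.trans hxy) hy
  have h3 := Real.sin_pos_of_pos_of_lt_pi (sub_pos.2 hxy) (by linarith)
  rw [div_lt_div_iff₀ h2 h1]
  rw [Real.sin_sub] at h3
  linarith

lemma arctan_cot {x : ℝ} (h0 : 0 < x) (hx : x < Real.pi) :
    Real.arctan (Real.cos x / Real.sin x) = Real.pi / 2 - x := by
  have : Real.cos x / Real.sin x = Real.tan (Real.pi / 2 - x) := by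
    rw [Real.tan_eq_sin_div_cos, Real.sin_pi_div_two_sub, Real.cos_pi_div_two_sub]
  rw [this, Real.arctan_tan (by linarith) (by linarith)]

lemma arccot_le_iff {x t : ℝ} (h0 : 0 < x) (hx : x < Real.pi) :
    Real.pi / 2 - Real.arctan t ≤ x ↔ Real.cos x / Real.sin x ≤ t := by
  rw [← Real.arctan_strictMono.le_iff_le (a := Real.cos x / Real.sin x), arctan_cot h0 hx]
  constructor <;> intro h <;> linarith

lemma sqrt_one_add_cot_sq {c s : ℝ} (hs : 0 < s) (h : s ^ 2 + c ^ 2 = 1) :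
    √(1 + (c / s) ^ 2) = 1 / s := by
  have : 1 + (c / s) ^ 2 = (1 / s) ^ 2 := by
    field_simp
    linarith
  rw [this, Real.sqrt_sq (by positivity)]

/-! ### Cusp curves -/

/-- The properties of a cusp curve that are used below. -/
structure CuspData (A P : ℝ → ℝ) (T h ε : ℝ) : Prop where
  smooth : ContDiff ℝ ∞ A
  smooth_slope : ContDiff ℝ ∞ P
  deriv : ∀ τ, HasDerivAt A (P τ * (2 * τ)) τ
  pos : ∀ τ, 0 < τ → τ < T → 0 < P τ
  neg : ∀ τ, -T < τ → τ < 0 → P τ < 0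
  slope_deriv : 0 < _root_.deriv P 0
  zero_neg : A 0 < 0
  slope_right : ∀ τ, T ≤ τ → P τ = 0
  slope_left : ∀ τ, τ ≤ -T → P τ = 0
  right : ∀ τ, T ≤ τ → A τ = h
  left : ∀ τ, τ ≤ -T → A τ = -ε

lemma FrontCurve.IsCusp.exists_data {c : FrontCurve} {r h ε : ℝ} (hc : c.IsCusp r h ε) :
    ∃ r₀ T, 0 < r₀ ∧ 0 < T ∧ r₀ + T ^ 2 < r ∧ (∀ τ, c.angle τ = r₀ + τ ^ 2) ∧
      CuspData c.height c.slope T h ε := by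
  obtain ⟨h1, h2, r₀, T, h3, h4, h5, h6, h7, h8, h9, h10, h11, h12, h13⟩ := hc
  refine ⟨r₀, T, h3, h4, h5, h6, h1, h2, h7, h8, h9, h10, h11, fun τ hτ => ?_, fun τ hτ => ?_,
    h12, h13⟩
  · have := eq_zero_of_hasDerivAt_of_const_right (h7 τ) fun y hy => h12 y (hτ.trans hy)
    exact (mul_eq_zero.1 this).resolve_right (by linarith)
  · have := eq_zero_of_hasDerivAt_of_const_left (h7 τ) fun y hy => h13 y (hy.trans hτ)
    exact (mul_eq_zero.1 this).resolve_right (by linarith)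

namespace CuspData

variable {A P : ℝ → ℝ} {T h ε : ℝ} (hc : CuspData A P T h ε)

include hc

lemma slope_nonneg {τ : ℝ} (hτ : 0 < τ) : 0 ≤ P τ := by
  rcases lt_or_ge τ T with h | h
  · exact (hc.pos τ hτ h).le
  · rw [hc.slope_right τ h]

lemma slope_nonpos {τ : ℝ} (hτ : τ < 0) : P τ ≤ 0 := by
  rcases lt_or_ge (-T) τ with h | h
  · exact (hc.neg τ h hτ).le
  · rw [hc.slope_left τ h]

lemma monotone : Monotone A := by
  refine monotone_of_hasDerivAt_nonneg hc.deriv fun τ => ?_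
  rcases lt_trichotomy τ 0 with h | h | h
  · exact mul_nonneg_of_nonpos_of_nonpos (hc.slope_nonpos h) (by linarith)
  · simp [h]
  · exact mul_nonneg (hc.slope_nonneg h) (by linarith)

lemma lt_of_neg_of_pos (hT : 0 < T) {τ τ' : ℝ} (h1 : τ < 0) (h2 : 0 < τ') : A τ < A τ' := by
  have h3 : 0 < min τ' T := lt_min h2 hT
  have h4 : StrictMonoOn A (Icc 0 T) := by
    refine strictMonoOn_of_deriv_pos (convex_Icc _ _) hc.smooth.continuous.continuousOn
      fun y hy => ?_
    rw [interior_Icc] at hy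
    rw [(hc.deriv y).deriv]
    exact mul_pos (hc.pos y hy.1 hy.2) (by linarith [hy.1])
  calc A τ ≤ A 0 := hc.monotone h1.le
    _ < A (min τ' T) := h4 ⟨le_rfl, hT.le⟩ ⟨h3.le, min_le_right _ _⟩ h3
    _ ≤ A τ' := hc.monotone (min_le_left _ _)

lemma mem_Icc (τ : ℝ) : A τ ∈ Icc (-ε) h := by
  constructor
  · rw [← hc.left (min τ (-T)) (min_le_right _ _)]
    exact hc.monotone (min_le_left _ _)
  · rw [← hc.right (max τ T) (le_max_right _ _)]
    exact hc.monotone (le_max_left _ _)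

end CuspData

/-! ### Reparametrising the angle -/

lemma exists_decreasing_interpolation {f g f' g' : ℝ → ℝ} (hf : ContDiff ℝ ∞ f)
    (hg : ContDiff ℝ ∞ g) (hf' : ∀ x, HasDerivAt f (f' x) x) (hg' : ∀ x, HasDerivAt g (g' x) x)
    (hfn : ∀ x, f' x < 0) (hgn : ∀ x, g' x < 0) {c₁ c₂ : ℝ} (hc : c₁ < c₂) (hfg : g c₂ < f c₁) :
    ∃ D d : ℝ → ℝ, ContDiff ℝ ∞ D ∧ ContDiff ℝ ∞ d ∧ (∀ x, HasDerivAt D (-d x) x) ∧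
      (∀ x, 0 < d x) ∧ (∀ x ≤ c₁, D x = f x) ∧ ∀ x, c₂ ≤ x → D x = g x := by
  have fanti : StrictAnti f := strictAnti_of_hasDerivAt_neg hf' hfn
  have ganti : StrictAnti g := strictAnti_of_hasDerivAt_neg hg' hgn
  obtain ⟨μ, hμ, hμ0, hμc⟩ : ∃ μ, g (c₂ - μ) < f (c₁ + μ) ∧ 0 < μ ∧ μ < c₂ - c₁ := by
    have h1 : ∀ᶠ μ in 𝓝 (0 : ℝ), g (c₂ - μ) < f (c₁ + μ) := by
      refine ContinuousAt.eventually_lt ?_ ?_ (by simpa using hfg)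
      · exact (hg.continuous.comp (by fun_prop : Continuous fun μ : ℝ => c₂ - μ)).continuousAt
      · exact (hf.continuous.comp (by fun_prop : Continuous fun μ : ℝ => c₁ + μ)).continuousAt
    obtain ⟨μ, h2, h3⟩ := ((h1.filter_mono nhdsWithin_le_nhds).and
      (Ioo_mem_nhdsGT (sub_pos.2 hc))).exists
    exact ⟨μ, h2, h3⟩
  set k₁ := saturate c₁ μ (c₁ + μ)
  set k₂ := -saturate (-c₂) μ (-c₂ + μ)
  have hk : g k₂ < f k₁ := by
    have h1 : k₁ ≤ c₁ + μ := saturate_le hμ0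
    have h2 : c₂ - μ ≤ k₂ := by
      have : saturate (-c₂) μ (-c₂ + μ) ≤ -c₂ + μ := saturate_le hμ0
      change c₂ - μ ≤ -saturate (-c₂) μ (-c₂ + μ)
      linarith
    exact (ganti.antitone h2).trans_lt (hμ.trans_le (fanti.antitone h1))
  have hcc : 0 < c₂ - c₁ := sub_pos.2 hc
  set D : ℝ → ℝ := fun x => f (saturate c₁ μ x) + (g (-saturate (-c₂) μ (-x)) - g k₂) +
    (g k₂ - f k₁) * step ((x - c₁) / (c₂ - c₁))
  have cD : ContDiff ℝ ∞ D :=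
    ((hf.comp (contDiff_saturate hμ0)).add ((hg.comp ((contDiff_saturate hμ0).comp
      contDiff_neg).neg).sub contDiff_const)).add
      (contDiff_const.mul (contDiff_step.comp (by fun_prop)))
  have dD : ∀ x, HasDerivAt D (f' (saturate c₁ μ x) * (1 - step ((x - c₁) / μ)) +
      g' (-saturate (-c₂) μ (-x)) * (1 - step ((-x - -c₂) / μ)) +
      (g k₂ - f k₁) * (stepDeriv ((x - c₁) / (c₂ - c₁)) / (c₂ - c₁))) x := by
    intro x
    have h1 := (hf' (saturate c₁ μ x)).comp x (hasDerivAt_saturate (x₀ := c₁) hμ0)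
    have h2 := ((hasDerivAt_saturate (x₀ := -c₂) (x := -x) hμ0).comp x (hasDerivAt_neg x)).neg
    have h3 := ((hg' (-saturate (-c₂) μ (-x))).comp x h2).sub_const (g k₂)
    have h4 : HasDerivAt (fun x => (x - c₁) / (c₂ - c₁)) (1 / (c₂ - c₁)) x :=
      ((hasDerivAt_id x).sub_const c₁).div_const _
    have h5 := ((hasDerivAt_step ((x - c₁) / (c₂ - c₁))).comp x h4).const_mul (g k₂ - f k₁)
    exact ((h1.add h3).add h5).congr_deriv (by ring)
  refine ⟨D, fun x => -deriv D x, cD, (contDiff_infty_iff_deriv.1 cD).2.neg, fun x => ?_,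
    fun x => ?_, fun x hx => ?_, fun x hx => ?_⟩
  · rw [neg_neg]; exact (dD x).differentiableAt.hasDerivAt
  · change 0 < -deriv D x
    rw [(dD x).deriv, neg_pos]
    have t1 : f' (saturate c₁ μ x) * (1 - step ((x - c₁) / μ)) ≤ 0 :=
      mul_nonpos_of_nonpos_of_nonneg (hfn _).le (sub_nonneg.2 (step_le_one _))
    have t2 : g' (-saturate (-c₂) μ (-x)) * (1 - step ((-x - -c₂) / μ)) ≤ 0 :=
      mul_nonpos_of_nonpos_of_nonneg (hgn _).le (sub_nonneg.2 (step_le_one _))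
    have t3 : (g k₂ - f k₁) * (stepDeriv ((x - c₁) / (c₂ - c₁)) / (c₂ - c₁)) ≤ 0 :=
      mul_nonpos_of_nonpos_of_nonneg (by linarith) (div_nonneg (stepDeriv_nonneg _) hcc.le)
    rcases le_or_gt x c₁ with h1 | h1
    · have : step ((x - c₁) / μ) = 0 :=
        step_of_nonpos (div_nonpos_of_nonpos_of_nonneg (by linarith) hμ0.le)
      rw [this, sub_zero, mul_one] at t1 ⊢
      linarith [hfn (saturate c₁ μ x)]
    rcases le_or_gt c₂ x with h2 | h2
    · have : step ((-x - -c₂) / μ) = 0 :=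
        step_of_nonpos (div_nonpos_of_nonpos_of_nonneg (by linarith) hμ0.le)
      rw [this, sub_zero, mul_one] at t2 ⊢
      linarith [hgn (-saturate (-c₂) μ (-x))]
    · have h3 : 0 < stepDeriv ((x - c₁) / (c₂ - c₁)) :=
        stepDeriv_pos (div_pos (by linarith) hcc) ((div_lt_one hcc).2 (by linarith))
      have : (g k₂ - f k₁) * (stepDeriv ((x - c₁) / (c₂ - c₁)) / (c₂ - c₁)) < 0 :=
        mul_neg_of_neg_of_pos (by linarith) (div_pos h3 hcc)
      linarith
  · have h1 : step ((x - c₁) / (c₂ - c₁)) = 0 :=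
      step_of_nonpos (div_nonpos_of_nonpos_of_nonneg (by linarith) hcc.le)
    have h2 : saturate (-c₂) μ (-x) = saturate (-c₂) μ (-c₂ + μ) :=
      saturate_of_ge hμ0 (by linarith)
    change f (saturate c₁ μ x) + (g (-saturate (-c₂) μ (-x)) - g k₂) +
      (g k₂ - f k₁) * step ((x - c₁) / (c₂ - c₁)) = f x
    rw [h1, h2, saturate_of_le hμ0 hx]
    change f x + (g k₂ - g k₂) + (g k₂ - f k₁) * 0 = f x
    ring
  · have h1 : step ((x - c₁) / (c₂ - c₁)) = 1 :=
      step_of_one_le ((one_le_div hcc).2 (by linarith))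
    have h2 : saturate c₁ μ x = k₁ := saturate_of_ge hμ0 (by linarith)
    change f (saturate c₁ μ x) + (g (-saturate (-c₂) μ (-x)) - g k₂) +
      (g k₂ - f k₁) * step ((x - c₁) / (c₂ - c₁)) = g x
    rw [h1, h2, saturate_of_le hμ0 (show -x ≤ -c₂ by linarith), neg_neg]
    ring

/-- A reparametrisation of the cotangent of the angle by which the fold becomes a given parabola. -/
structure AngleData (D d : ℝ → ℝ) (r₀ r₁ η δ C₀ L : ℝ) : Prop where
  smooth : ContDiff ℝ ∞ D
  smooth_deriv : ContDiff ℝ ∞ d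
  deriv : ∀ x, HasDerivAt D (-d x) x
  pos : ∀ x, 0 < d x
  left : ∀ x ≤ Real.cos r₁ / Real.sin r₁, D x = Real.pi / 2 - Real.arctan x
  right : ∀ x, C₀ - L / 4 ≤ x → D x = r₀ + η ^ 2 * δ ^ 2 / L * (C₀ - x)

lemma AngleData.deriv_right {D d : ℝ → ℝ} {r₀ r₁ η δ C₀ L x : ℝ}
    (hD : AngleData D d r₀ r₁ η δ C₀ L) (hx : C₀ - L / 4 < x) : d x = η ^ 2 * δ ^ 2 / L := by
  have h1 : HasDerivAt D (η ^ 2 * δ ^ 2 / L * -1) x := by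
    refine HasDerivAt.congr_of_eventuallyEq
      ((((hasDerivAt_id x).const_sub C₀).const_mul _).const_add r₀) ?_
    filter_upwards [Ioi_mem_nhds hx] with y hy using hD.right y hy.le
  have := (hD.deriv x).unique h1
  linarith

lemma exists_angleData {r₀ r₁ η δ C₀ L : ℝ} (h0 : 0 < r₁) (hr : r₁ < Real.pi) (hη : 0 < η)
    (hδ : 0 < δ) (hL : 0 < L) (h1 : Real.cos r₁ / Real.sin r₁ < C₀ - L / 4)
    (h2 : r₀ + (η * δ / 2) ^ 2 < r₁) : ∃ D d, AngleData D d r₀ r₁ η δ C₀ L := by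
  have hν : 0 < η ^ 2 * δ ^ 2 / L := by positivity
  obtain ⟨D, d, k1, k2, k3, k4, k5, k6⟩ := exists_decreasing_interpolation
    (f := fun x => Real.pi / 2 - Real.arctan x)
    (g := fun x => r₀ + η ^ 2 * δ ^ 2 / L * (C₀ - x)) (f' := fun x => -(1 / (1 + x ^ 2)))
    (g' := fun x => η ^ 2 * δ ^ 2 / L * -1) (contDiff_const.sub Real.contDiff_arctan)
    (by fun_prop) (fun x => (Real.hasDerivAt_arctan x).const_sub _)
    (fun x => (((hasDerivAt_id x).const_sub C₀).const_mul _).const_add r₀)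
    (fun x => neg_lt_zero.2 (by positivity)) (fun x => by linarith) h1 (by
      rw [arctan_cot h0 hr]
      have : η ^ 2 * δ ^ 2 / L * (C₀ - (C₀ - L / 4)) = (η * δ / 2) ^ 2 := by field_simp; ring
      linarith)
  exact ⟨D, d, k1, k2, k3, k4, k5, k6⟩

/-! ### Estimates for the fold -/

namespace FoldData

variable {δ C₀ L : ℝ} {C b W : ℝ → ℝ} (hF : FoldData δ C b W C₀ L) (hδ : 0 < δ)
  (hδ1 : 5 * δ ≤ 1 / 4)

include hF

lemma continuousAt_C {R : ℝ} (h0 : 0 < R) (hR : R < Real.pi) : ContinuousAt C R :=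
  (hF.smooth_C R h0 hR).continuousAt

include hδ hδ1

lemma strictMonoOn_C : StrictMonoOn C (Ioc 0 (3 * δ)) := by
  have hpi := Real.pi_gt_three
  refine strictMonoOn_of_deriv_pos (convex_Ioc _ _) (fun R hR =>
    (hF.continuousAt_C hR.1 (by linarith [hR.2])).continuousWithinAt) fun R hR => ?_
  rw [interior_Ioc] at hR
  rw [(hF.deriv_C R hR.1 (by linarith [hR.2])).deriv]
  have := Real.sin_pos_of_pos_of_lt_pi hR.1 (by linarith [hR.2])
  have := hF.W_pos R hR.1 hR.2
  positivity

omit hδ1 in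
lemma strictAntiOn_C : StrictAntiOn C (Ico (3 * δ) Real.pi) := by
  refine strictAntiOn_of_deriv_neg (convex_Ico _ _) (fun R hR =>
    (hF.continuousAt_C (by linarith [hR.1]) hR.2).continuousWithinAt) fun R hR => ?_
  rw [interior_Ico] at hR
  rw [(hF.deriv_C R (by linarith [hR.1]) hR.2).deriv]
  have := Real.sin_pos_of_pos_of_lt_pi (show 0 < R by linarith [hR.1]) hR.2
  exact div_neg_of_neg_of_pos (hF.W_neg R hR.1 hR.2) (by positivity)

omit hδ1 in
lemma C_three : C (3 * δ) = C₀ := by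
  rw [hF.quad (3 * δ) (by rw [sub_self, abs_zero]; positivity)]; simp

lemma C_le {R : ℝ} (h0 : 0 < R) (hR : R < Real.pi) : C R ≤ C₀ := by
  have hpi := Real.pi_gt_three
  rw [← hF.C_three hδ]
  rcases le_or_gt R (3 * δ) with h | h
  · exact (hF.strictMonoOn_C hδ hδ1).monotoneOn ⟨h0, h⟩ ⟨by positivity, le_rfl⟩ h
  · exact (hF.strictAntiOn_C hδ).antitoneOn ⟨le_rfl, by linarith⟩ ⟨h.le, hR⟩ h.le

omit hδ hδ1 in
lemma cot_le_C {R : ℝ} (h0 : 3 * δ ≤ R) : Real.cos R / Real.sin R ≤ C R := by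
  rcases le_or_gt R (5 * δ) with h | h
  · exact hF.le_C R h0 h
  · exact (hF.C_right R h.le).ge

lemma b_neg {R : ℝ} (h0 : 0 < R) (hR : R ≤ 3 * δ) : b R < 0 := by
  have hpi := Real.pi_gt_three
  rcases le_or_gt R δ with h | h
  · rw [hF.b_left R h, neg_lt_zero]
    exact Real.sin_pos_of_pos_of_lt_pi h0 (by linarith)
  · have h1 : StrictAntiOn b (Icc δ (3 * δ)) := by
      refine strictAntiOn_of_deriv_neg (convex_Icc _ _) hF.smooth_b.continuous.continuousOn
        fun R hR => ?_
      rw [interior_Icc] at hR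
      rw [(hF.deriv_b R).deriv, neg_lt_zero]
      have := cos_gt_of_le_half (x := R) (by linarith [hR.1]) (by linarith [hR.2])
      exact mul_pos (by linarith) (hF.W_pos R (by linarith [hR.1]) hR.2)
    have h2 := h1 ⟨le_rfl, by linarith⟩ ⟨h.le, hR⟩ h
    rw [hF.b_left δ le_rfl] at h2
    have := Real.sin_pos_of_pos_of_lt_pi hδ (by linarith)
    linarith

lemma b_lt {R R' : ℝ} (h0 : 0 < R) (hR : R < 3 * δ) (hR' : 3 * δ < R') (hpi' : R' < Real.pi)
    (h : C R = C R') : b R < b R' := by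
  have hpi := Real.pi_gt_three
  rcases le_or_gt (5 * δ) R' with h1 | h1
  · rw [hF.b_right R' h1]
    exact (hF.b_neg hδ hδ1 h0 hR.le).trans (Real.sin_pos_of_pos_of_lt_pi (by linarith) hpi')
  set κ := Real.cos (3 * δ) * Real.sin (3 * δ) ^ 2 with hκ
  have hd : ∀ R, 0 < R → R < Real.pi → HasDerivAt (fun R => b R + κ * C R)
      (W R / Real.sin R ^ 2 * (κ - Real.cos R * Real.sin R ^ 2)) R := by
    intro R h0 hR
    have hs := (Real.sin_pos_of_pos_of_lt_pi h0 hR).ne'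
    refine ((hF.deriv_b R).add ((hF.deriv_C R h0 hR).const_mul κ)).congr_deriv ?_
    field_simp
    ring
  have hcont : ∀ s, s ⊆ Ioo 0 Real.pi → ContinuousOn (fun R => b R + κ * C R) s := fun s hs R hR =>
    (hd R (hs hR).1 (hs hR).2).continuousAt.continuousWithinAt
  have m1 : StrictMonoOn (fun R => b R + κ * C R) (Ioc 0 (3 * δ)) := by
    refine strictMonoOn_of_deriv_pos (convex_Ioc _ _) (hcont _ fun R hR =>
      ⟨hR.1, by linarith [hR.2]⟩) fun R hR => ?_
    rw [interior_Ioc] at hR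
    rw [(hd R hR.1 (by linarith [hR.2])).deriv]
    have := Real.sin_pos_of_pos_of_lt_pi hR.1 (by linarith [hR.2])
    exact mul_pos (div_pos (hF.W_pos R hR.1 hR.2) (by positivity))
      (sub_pos.2 (cos_mul_sin_sq_lt hR.1.le hR.2 (by linarith)))
  have m2 : StrictMonoOn (fun R => b R + κ * C R) (Icc (3 * δ) (5 * δ)) := by
    refine strictMonoOn_of_deriv_pos (convex_Icc _ _) (hcont _ fun R hR =>
      ⟨by linarith [hR.1], by linarith [hR.2]⟩) fun R hR => ?_
    rw [interior_Icc] at hR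
    have h3 : R < Real.pi := by linarith [hR.2]
    rw [(hd R (by linarith [hR.1]) h3).deriv]
    have := Real.sin_pos_of_pos_of_lt_pi (by linarith [hR.1]) h3
    exact mul_pos_of_neg_of_neg (div_neg_of_neg_of_pos (hF.W_neg R hR.1 h3) (by positivity))
      (sub_neg.2 (cos_mul_sin_sq_lt (by linarith) hR.1 (by linarith [hR.2])))
  have h3 := (m1 ⟨h0, hR.le⟩ ⟨by positivity, le_rfl⟩ hR).trans
    (m2 ⟨le_rfl, by linarith⟩ ⟨hR'.le, h1.le⟩ hR')
  simp only [h] at h3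
  linarith

lemma b_le {R : ℝ} (h0 : 3 * δ ≤ R) (hR : R ≤ 5 * δ) :
    b R ≤ Real.sin R - Real.cos R * Real.sin R ^ 2 * (C R - Real.cos R / Real.sin R) := by
  have hpi := Real.pi_gt_three
  have hd : ∀ R ∈ Icc (3 * δ) (5 * δ), HasDerivAt (fun R => b R - Real.sin R +
      Real.cos R * Real.sin R ^ 2 * (C R - Real.cos R / Real.sin R))
      (Real.sin R * (2 * Real.cos R ^ 2 - Real.sin R ^ 2) * (C R - Real.cos R / Real.sin R)) R := by
    intro R hR
    have k0 : 0 < R := by linarith [hR.1]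
    have kR : R < Real.pi := by linarith [hR.2]
    have hs := (Real.sin_pos_of_pos_of_lt_pi k0 kR).ne'
    refine (((hF.deriv_b R).sub (Real.hasDerivAt_sin R)).add
      (((Real.hasDerivAt_cos R).mul ((Real.hasDerivAt_sin R).pow 2)).mul
      ((hF.deriv_C R k0 kR).sub (hasDerivAt_cot k0 kR)))).congr_deriv ?_
    simp only [Pi.mul_apply, Pi.pow_apply, Pi.sub_apply]
    field_simp
    push_cast
    ring
  have hm : MonotoneOn (fun R => b R - Real.sin R +
      Real.cos R * Real.sin R ^ 2 * (C R - Real.cos R / Real.sin R)) (Icc (3 * δ) (5 * δ)) := by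
    refine monotoneOn_of_deriv_nonneg (convex_Icc _ _)
      (fun R hR => (hd R hR).continuousAt.continuousWithinAt)
      (fun R hR => (hd R (interior_subset hR)).differentiableAt.differentiableWithinAt)
      fun R hR => ?_
    have hR := interior_subset hR
    rw [(hd R hR).deriv]
    have := Real.sin_pos_of_pos_of_lt_pi (show 0 < R by linarith [hR.1]) (by linarith [hR.2])
    have hc := cos_gt_of_le_half (x := R) (by linarith [hR.1]) (by linarith [hR.2])
    have ht := Real.sin_sq_add_cos_sq R
    exact mul_nonneg (mul_nonneg this.le (by nlinarith)) (sub_nonneg.2 (hF.le_C R hR.1 hR.2))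
  have h1 := hm ⟨h0, hR⟩ ⟨by linarith, le_rfl⟩ hR
  simp only [hF.b_right _ le_rfl, hF.C_right _ le_rfl, sub_self, mul_zero, add_zero] at h1
  linarith

lemma slope_nonneg {R : ℝ} (h0 : 3 * δ ≤ R) (hR : R ≤ 5 * δ) :
    0 ≤ Real.sin R ^ 2 * Real.cos R * (1 + C R ^ 2) - b R * C R := by
  have hs := Real.sin_pos_of_pos_of_lt_pi (show 0 < R by linarith) (by linarith [Real.pi_gt_three])
  have hc := cos_gt_of_le_half (x := R) (by linarith) (by linarith)
  have ht := Real.sin_sq_add_cos_sq R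
  have h1 := hF.le_C R h0 hR
  have hc0 : 0 < Real.cos R := by linarith
  have hC : 0 < C R := (div_pos hc0 hs).trans_le h1
  have h2 := mul_le_mul_of_nonneg_right (hF.b_le hδ hδ1 h0 hR) hC.le
  have h3 : Real.sin R / (2 * Real.cos R) ≤ Real.cos R / Real.sin R := by
    rw [div_le_div_iff₀ (by positivity) hs]
    nlinarith
  have h4 : 0 ≤ 2 * Real.sin R ^ 2 * Real.cos R * (C R - Real.cos R / Real.sin R) *
      (C R - Real.sin R / (2 * Real.cos R)) :=
    mul_nonneg (mul_nonneg (by positivity) (by linarith)) (by linarith)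
  have h5 : 2 * Real.sin R ^ 2 * Real.cos R * (C R - Real.cos R / Real.sin R) *
      (C R - Real.sin R / (2 * Real.cos R)) = Real.sin R ^ 2 * Real.cos R * (1 + C R ^ 2) -
      (Real.sin R - Real.cos R * Real.sin R ^ 2 * (C R - Real.cos R / Real.sin R)) * C R := by
    field_simp
    linear_combination (-C R) * ht
  linarith

lemma exists_height_bound : ∃ M, 1 ≤ M ∧ ∀ R, 0 < R → R ≤ 5 * δ →
    |b R * √(1 + C R ^ 2)| ≤ M ∧
    |√(1 + C R ^ 2) * (Real.sin R ^ 2 * Real.cos R * (1 + C R ^ 2) - b R * C R)| ≤ M := by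
  have hpi := Real.pi_gt_three
  have hC : ContinuousOn C (Icc δ (5 * δ)) := fun R hR =>
    (hF.continuousAt_C (hδ.trans_le hR.1) (by linarith [hR.2])).continuousWithinAt
  have hS : ContinuousOn (fun R => √(1 + C R ^ 2)) (Icc δ (5 * δ)) :=
    (continuousOn_const.add (hC.pow 2)).sqrt
  have hb := hF.smooth_b.continuous.continuousOn (s := Icc δ (5 * δ))
  obtain ⟨B₁, h1⟩ := isCompact_Icc.exists_bound_of_continuousOn (hb.mul hS)
  obtain ⟨B₂, h2⟩ := isCompact_Icc.exists_bound_of_continuousOn (hS.mul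
    ((((Real.continuous_sin.pow 2).mul Real.continuous_cos).continuousOn.mul
      (continuousOn_const.add (hC.pow 2))).sub (hb.mul hC)))
  refine ⟨max 1 (max B₁ B₂), le_max_left _ _, fun R h0 hR => ?_⟩
  rcases lt_or_ge R δ with h | h
  · have hs := Real.sin_pos_of_pos_of_lt_pi h0 (by linarith)
    have ht := Real.sin_sq_add_cos_sq R
    rw [hF.C_left R h.le, hF.b_left R h.le, neg_sq, sqrt_one_add_cot_sq hs ht]
    have e1 : -Real.sin R * (1 / Real.sin R) = -1 := by field_simp
    have e2 : Real.sin R ^ 2 * Real.cos R * (1 + (Real.cos R / Real.sin R) ^ 2) -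
        -Real.sin R * -(Real.cos R / Real.sin R) = 0 := by
      field_simp
      linear_combination Real.cos R * ht
    rw [e1, e2, mul_zero, abs_zero, abs_neg, abs_one]
    exact ⟨le_max_left _ _, by positivity⟩
  · exact ⟨(h1 R ⟨h, hR⟩).trans ((le_max_left _ _).trans (le_max_right _ _)),
      (h2 R ⟨h, hR⟩).trans ((le_max_right _ _).trans (le_max_right _ _))⟩

end FoldData

/-! ### From the folded disc to the cusp -/

/-- The angle of the interpolation between the folded disc and the cusp. -/
def cuspAngle (δ : ℝ) (C D : ℝ → ℝ) (s R : ℝ) : ℝ :=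
  if R < δ then Real.pi - R else (1 - s) * (Real.pi / 2 - Real.arctan (C R)) + s * D (C R)

/-- The height of the folded disc. -/
def foldHeight (h h' ρ δ : ℝ) (C b : ℝ → ℝ) (R : ℝ) : ℝ :=
  if R < δ then -h' else h' * (b R * √(1 + C R ^ 2)) + (profile h h' ρ R - h')

/-- The slope of the folded disc. -/
def foldSlope (h h' ρ : ℝ) (C b : ℝ → ℝ) (R : ℝ) : ℝ :=
  h' * (√(1 + C R ^ 2) * (Real.sin R ^ 2 * Real.cos R * (1 + C R ^ 2) - b R * C R)) +
    profileSlope h h' ρ R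

/-- The height of the interpolation between the folded disc and the cusp. -/
def cuspHeight (A : ℝ → ℝ) (h h' ρ δ η : ℝ) (C b : ℝ → ℝ) (s R : ℝ) : ℝ :=
  (1 - s) * foldHeight h h' ρ δ C b R + s * A (η * (R - 3 * δ))

/-- The rate of change of the angle relative to the cotangent. -/
def cuspWeight (d C : ℝ → ℝ) (s R : ℝ) : ℝ := (1 - s) * (1 / (1 + C R ^ 2)) + s * d (C R)

/-- The rate of change of the height relative to the cotangent. -/
def cuspMoment (P d : ℝ → ℝ) (h h' ρ δ η : ℝ) (C b : ℝ → ℝ) (s R : ℝ) : ℝ :=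
  (1 - s) * (1 / (1 + C R ^ 2) * foldSlope h h' ρ C b R) +
    s * (d (C R) * P (η * (R - 3 * δ)))

/-- The slope of the interpolation between the folded disc and the cusp. -/
def cuspSlope (P d : ℝ → ℝ) (h h' ρ δ η : ℝ) (C b : ℝ → ℝ) (s R : ℝ) : ℝ :=
  if R < δ then 0 else cuspMoment P d h h' ρ δ η C b s R / cuspWeight d C s R

/-- The inequalities between the parameters of the interpolation. -/
structure CuspParams (r r₀ r₁ δ ρ h h' η T ε a b₀ M δ₀ : ℝ) : Prop where
  δ_pos : 0 < δ
  δ_le : 5 * δ ≤ 1 / 4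
  δρ : 5 * δ < ρ / 2
  ρr : ρ < r
  r_lt : r < Real.pi
  r₀_pos : 0 < r₀
  r₁_gt : 3 * δ < r₁
  r₁_lt : r₁ < r
  δr : δ < Real.pi - r
  h'_pos : 0 < h'
  h'_le : h' ≤ h
  hb : h < b₀
  η_pos : 0 < η
  T_pos : 0 < T
  Tη : T ≤ η * δ / 2
  ε_pos : 0 < ε
  εa : ε < a
  εδ : ε ≤ δ₀ / 2
  one_le_M : 1 ≤ M
  Ma : h' * M < a
  Mh : h' * M ≤ h
  Mδ : h' * M ≤ δ₀ / 2

section Cusp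

variable {A P D d C b W : ℝ → ℝ} {r r₀ r₁ δ ρ h h' η T ε a b₀ M δ₀ C₀ L : ℝ}
  (hF : FoldData δ C b W C₀ L) (hc : CuspData A P T h ε)
  (hD : AngleData D d r₀ r₁ η δ C₀ L)
  (hp : CuspParams r r₀ r₁ δ ρ h h' η T ε a b₀ M δ₀)

include hp

lemma CuspParams.ρ_pos : 0 < ρ := by linarith [hp.δ_pos, hp.δρ]

lemma CuspParams.r₁_pos : 0 < r₁ := by linarith [hp.δ_pos, hp.r₁_gt]

lemma CuspParams.r₁_lt_pi : r₁ < Real.pi := hp.r₁_lt.trans hp.r_lt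

include hc in
lemma slope_far {R : ℝ} (hR : δ / 2 ≤ |R - 3 * δ|) : P (η * (R - 3 * δ)) = 0 := by
  have h1 := hp.η_pos
  have h2 := hp.Tη
  rcases le_abs'.1 hR with h3 | h3
  · refine hc.slope_left _ ?_
    have := mul_le_mul_of_nonneg_left h3 h1.le
    linarith
  · refine hc.slope_right _ ?_
    have := mul_le_mul_of_nonneg_left h3 h1.le
    linarith

include hF in
lemma far_of_C_lt {R : ℝ} (hR : C R < C₀ - L / 4) : δ / 2 ≤ |R - 3 * δ| := by
  by_contra! h1
  have h2 := hF.quad R h1.le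
  have hδ := hp.δ_pos
  have h3 : ((R - 3 * δ) / δ) ^ 2 ≤ 1 / 4 := by
    rw [div_pow, div_le_iff₀ (by positivity), ← sq_abs]
    nlinarith [abs_nonneg (R - 3 * δ)]
  nlinarith [hF.L_pos]

include hD

lemma angle_left {x : ℝ} (h0 : 0 < x) (hx : x < Real.pi) (h : r₁ ≤ x) :
    D (Real.cos x / Real.sin x) = x := by
  rw [hD.left _ (cot_le_cot hp.r₁_pos h hx), arctan_cot h0 hx]
  ring

omit hp in
lemma strictAnti_angle : StrictAnti D :=
  strictAnti_of_hasDerivAt_neg hD.deriv fun x => neg_lt_zero.2 (hD.pos x)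

include hF

lemma angle_mem {R : ℝ} (h0 : 0 < R) (hR : R < Real.pi) : D (C R) ∈ Ioo 0 Real.pi := by
  have hanti := (strictAnti_angle hD).antitone
  constructor
  · have h1 := hanti (hF.C_le hp.δ_pos hp.δ_le h0 hR)
    rw [hD.right C₀ (by linarith [hF.L_pos]), sub_self, mul_zero, add_zero] at h1
    exact hp.r₀_pos.trans_le h1
  · rcases le_or_gt (C R) (Real.cos r₁ / Real.sin r₁) with h1 | h1
    · rw [hD.left _ h1]
      linarith [Real.neg_pi_div_two_lt_arctan (C R)]
    · have h2 := hanti h1.le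
      rw [angle_left hD hp hp.r₁_pos hp.r₁_lt_pi le_rfl] at h2
      exact h2.trans_lt hp.r₁_lt_pi

omit hD in
lemma one_add_C_left {R : ℝ} (h0 : 0 < R) (hR : R ≤ δ) :
    √(1 + C R ^ 2) = 1 / Real.sin R := by
  have hs := Real.sin_pos_of_pos_of_lt_pi h0 (by linarith [Real.pi_gt_three, hp.δ_le])
  rw [hF.C_left R hR, neg_sq, sqrt_one_add_cot_sq hs (Real.sin_sq_add_cos_sq R)]

omit hD in
lemma one_add_C_right {R : ℝ} (h0 : 5 * δ ≤ R) (hR : R < Real.pi) :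
    √(1 + C R ^ 2) = 1 / Real.sin R := by
  have hs := Real.sin_pos_of_pos_of_lt_pi (by linarith [hp.δ_pos]) hR
  rw [hF.C_right R h0, sqrt_one_add_cot_sq hs (Real.sin_sq_add_cos_sq R)]

omit hD in
lemma foldHeight_of_pos {R : ℝ} (h0 : 0 < R) :
    foldHeight h h' ρ δ C b R = h' * (b R * √(1 + C R ^ 2)) + (profile h h' ρ R - h') := by
  have hδρ := hp.δρ
  have hδ := hp.δ_pos
  rw [foldHeight]
  split_ifs with h1
  · have hs := Real.sin_pos_of_pos_of_lt_pi h0 (by linarith [Real.pi_gt_three, hp.δ_le])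
    rw [one_add_C_left hF hp h0 h1.le, hF.b_left R h1.le, profile_of_le hp.ρ_pos (by linarith)]
    field_simp
    ring
  · rfl

omit hD in
lemma foldHeight_of_ge {R : ℝ} (h0 : 5 * δ ≤ R) (hR : R < Real.pi) :
    foldHeight h h' ρ δ C b R = profile h h' ρ R := by
  have hR0 : 0 < R := by linarith [hp.δ_pos]
  have hs := Real.sin_pos_of_pos_of_lt_pi hR0 hR
  rw [foldHeight_of_pos hF hp hR0, one_add_C_right hF hp h0 hR, hF.b_right R h0]
  field_simp
  ring

omit hD in
lemma foldSlope_of_le {R : ℝ} (h0 : 0 < R) (hR : R ≤ δ) : foldSlope h h' ρ C b R = 0 := by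
  have hδρ := hp.δρ
  have hδ := hp.δ_pos
  have hs := Real.sin_pos_of_pos_of_lt_pi h0 (by linarith [Real.pi_gt_three, hp.δ_le])
  rw [foldSlope, profileSlope_of_le hp.ρ_pos (by linarith), hF.C_left R hR, hF.b_left R hR]
  have e2 : Real.sin R ^ 2 * Real.cos R * (1 + (-(Real.cos R / Real.sin R)) ^ 2) -
      -Real.sin R * -(Real.cos R / Real.sin R) = 0 := by
    field_simp
    linear_combination Real.cos R * Real.sin_sq_add_cos_sq R
  rw [e2, mul_zero, mul_zero, add_zero]

omit hD in
lemma foldSlope_of_ge {R : ℝ} (h0 : 5 * δ ≤ R) (hR : R < Real.pi) :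
    foldSlope h h' ρ C b R = profileSlope h h' ρ R := by
  have hs := Real.sin_pos_of_pos_of_lt_pi (by linarith [hp.δ_pos]) hR
  rw [foldSlope, hF.C_right R h0, hF.b_right R h0]
  have e2 : Real.sin R ^ 2 * Real.cos R * (1 + (Real.cos R / Real.sin R) ^ 2) -
      Real.sin R * (Real.cos R / Real.sin R) = 0 := by
    field_simp
    linear_combination Real.cos R * Real.sin_sq_add_cos_sq R
  rw [e2, mul_zero, mul_zero, zero_add]

lemma cuspAngle_of_pos {s R : ℝ} (h0 : 0 < R) :
    cuspAngle δ C D s R = (1 - s) * (Real.pi / 2 - Real.arctan (C R)) + s * D (C R) := by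
  rw [cuspAngle]
  split_ifs with h1
  · have hpi := Real.pi_gt_three
    have h2 : C R = Real.cos (Real.pi - R) / Real.sin (Real.pi - R) := by
      rw [hF.C_left R h1.le, Real.cos_pi_sub, Real.sin_pi_sub, neg_div]
    have h3 : 0 < Real.pi - R := by linarith [hp.δ_le]
    rw [h2, angle_left hD hp h3 (by linarith) (by linarith [hp.δr, hp.r₁_lt]),
      arctan_cot h3 (by linarith)]
    ring
  · rfl

lemma cuspAngle_mem {s R : ℝ} (hs : s ∈ Icc (0 : ℝ) 1) (h0 : 0 < R) (hR : R < Real.pi) :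
    cuspAngle δ C D s R ∈ Ioo 0 Real.pi := by
  rw [cuspAngle_of_pos hF hD hp h0]
  have h1 : Real.pi / 2 - Real.arctan (C R) ∈ Ioo 0 Real.pi :=
    ⟨by linarith [Real.arctan_lt_pi_div_two (C R)], by linarith [Real.neg_pi_div_two_lt_arctan (C R)]⟩
  exact convex_Ioo 0 Real.pi h1 (angle_mem hF hD hp h0 hR) (sub_nonneg.2 hs.2) hs.1 (by ring)

omit hp hF in
lemma cuspWeight_pos {s R : ℝ} (hs : s ∈ Icc (0 : ℝ) 1) : 0 < cuspWeight d C s R := by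
  have h1 : 1 / (1 + C R ^ 2) ∈ Ioi (0 : ℝ) := by rw [mem_Ioi]; positivity
  exact convex_Ioi 0 h1 (hD.pos (C R)) (sub_nonneg.2 hs.2) hs.1 (by ring)

omit hp hF in
lemma cuspAngle_C_inj {s t t' : ℝ} (hs : s ∈ Icc (0 : ℝ) 1)
    (h : (1 - s) * (Real.pi / 2 - Real.arctan t) + s * D t =
      (1 - s) * (Real.pi / 2 - Real.arctan t') + s * D t') : t = t' := by
  have key : ∀ t t', t < t' → (1 - s) * (Real.pi / 2 - Real.arctan t') + s * D t' <
      (1 - s) * (Real.pi / 2 - Real.arctan t) + s * D t := by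
    intro t t' h1
    have h2 := Real.arctan_strictMono h1
    have h3 := strictAnti_angle hD h1
    rcases eq_or_lt_of_le hs.1 with h4 | h4
    · rw [← h4]; linarith
    · have := mul_lt_mul_of_pos_left h3 h4
      have := mul_le_mul_of_nonneg_left h2.le (sub_nonneg.2 hs.2)
      linarith
  rcases lt_trichotomy t t' with h1 | h1 | h1
  · exact absurd h (key _ _ h1).ne'
  · exact h1
  · exact absurd h (key _ _ h1).ne

include hc in
omit hD in
lemma cuspSlope_of_pos {s R : ℝ} (h0 : 0 < R) : cuspSlope P d h h' ρ δ η C b s R =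
    cuspMoment P d h h' ρ δ η C b s R / cuspWeight d C s R := by
  rw [cuspSlope]
  split_ifs with h1
  · have hδ := hp.δ_pos
    rw [cuspMoment, foldSlope_of_le hF hp h0 h1.le,
      slope_far hc hp (by rw [abs_of_nonpos] <;> linarith)]
    simp
  · rfl

omit hD hp in
lemma hasDerivAt_sqrt_C {R : ℝ} (h0 : 0 < R) (hR : R < Real.pi) :
    HasDerivAt (fun R => √(1 + C R ^ 2)) (C R * (W R / Real.sin R ^ 2) / √(1 + C R ^ 2)) R := by
  have h1 := (((hF.deriv_C R h0 hR).pow 2).const_add 1).sqrt (x := R)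
    (by simp only [Pi.pow_apply]; positivity)
  refine h1.congr_deriv ?_
  simp only [Pi.pow_apply]
  push_cast
  field_simp

omit hD in
lemma hasDerivAt_foldHeight {R : ℝ} (h0 : 0 < R) (hR : R < Real.pi) :
    HasDerivAt (foldHeight h h' ρ δ C b)
      (-(W R / Real.sin R ^ 2) * (1 / (1 + C R ^ 2) * foldSlope h h' ρ C b R)) R := by
  have hs := Real.sin_pos_of_pos_of_lt_pi h0 hR
  have hS : 0 < √(1 + C R ^ 2) := Real.sqrt_pos.2 (by positivity)
  have hS2 : √(1 + C R ^ 2) ^ 2 = 1 + C R ^ 2 := Real.sq_sqrt (by positivity)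
  have h1 := (((hF.deriv_b R).mul (hasDerivAt_sqrt_C hF h0 hR)).const_mul h').add
    ((hasDerivAt_profile (h := h) (h' := h') (ρ := ρ) (R := R)).sub_const h')
  have h2 : profileSlope h h' ρ R * (W R + Real.sin R ^ 2 * (1 + C R ^ 2)) = 0 := by
    rcases le_or_gt R (ρ / 2) with h | h
    · rw [profileSlope_of_le hp.ρ_pos h, zero_mul]
    · have h5 : 5 * δ ≤ R := by linarith [hp.δρ]
      rw [hF.W_right R h5, hF.C_right R h5]
      have : -1 + Real.sin R ^ 2 * (1 + (Real.cos R / Real.sin R) ^ 2) = 0 := by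
        field_simp
        linear_combination Real.sin_sq_add_cos_sq R
      rw [this, mul_zero]
  refine (h1.congr_deriv ?_).congr_of_eventuallyEq ?_
  · rw [foldSlope]
    have hne : 1 + C R ^ 2 ≠ 0 := by positivity
    have e1 : C R ^ 2 = √(1 + C R ^ 2) ^ 2 - 1 := by linarith
    set S := √(1 + C R ^ 2)
    rw [← hS2]
    rw [← hS2] at h2
    field_simp
    linear_combination h2
  · filter_upwards [Ioi_mem_nhds h0] with y hy using foldHeight_of_pos hF hp hy

include hc

/-- The height and the angle of the cusp change at rates related by the slope. -/
lemma cusp_slope_eq {R : ℝ} (h0 : 0 < R) (hR : R < Real.pi) :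
    P (η * (R - 3 * δ)) * (2 * (η * (R - 3 * δ))) * η =
      -(W R / Real.sin R ^ 2) * (d (C R) * P (η * (R - 3 * δ))) := by
  have hδ := hp.δ_pos
  have hL := hF.L_pos
  rcases lt_or_ge |R - 3 * δ| (δ / 2) with h1 | h1
  · have h2 : HasDerivAt C (-(L * (2 * ((R - 3 * δ) / δ) * (1 / δ)))) R := by
      have h3 : HasDerivAt (fun R : ℝ => (R - 3 * δ) / δ) (1 / δ) R :=
        ((hasDerivAt_id R).sub_const _).div_const _
      refine ((((h3.pow 2).const_mul L).const_sub C₀).congr_deriv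
        (by push_cast; ring)).congr_of_eventuallyEq ?_
      have h4 : ∀ᶠ y in 𝓝 R, |y - 3 * δ| < δ / 2 :=
        ContinuousAt.eventually_lt (by fun_prop) continuousAt_const h1
      filter_upwards [h4] with y hy using hF.quad y hy.le
    have h5 := (hF.deriv_C R h0 hR).unique h2
    have h6 : C₀ - L / 4 < C R := by
      rw [hF.quad R h1.le]
      have h3 : ((R - 3 * δ) / δ) ^ 2 < 1 / 4 := by
        rw [div_pow, div_lt_iff₀ (by positivity), ← sq_abs]
        nlinarith [abs_nonneg (R - 3 * δ)]
      nlinarith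
    rw [h5, hD.deriv_right h6]
    field_simp
  · rw [slope_far hc hp h1]
    ring

omit hc in
lemma hasDerivAt_cuspAngle {s R : ℝ} (h0 : 0 < R) (hR : R < Real.pi) :
    HasDerivAt (cuspAngle δ C D s) (-(W R / Real.sin R ^ 2) * cuspWeight d C s R) R := by
  have hC := hF.deriv_C R h0 hR
  have h1 := ((((Real.hasDerivAt_arctan (C R)).comp R hC).const_sub (Real.pi / 2)).const_mul
    (1 - s)).add (((hD.deriv (C R)).comp R hC).const_mul s)
  refine (h1.congr_deriv ?_).congr_of_eventuallyEq ?_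
  · rw [cuspWeight]; ring
  · filter_upwards [Ioi_mem_nhds h0] with y hy using cuspAngle_of_pos hF hD hp hy

lemma hasDerivAt_cuspHeight {s R : ℝ} (hs : s ∈ Icc (0 : ℝ) 1) (h0 : 0 < R) (hR : R < Real.pi) :
    HasDerivAt (cuspHeight A h h' ρ δ η C b s) (cuspSlope P d h h' ρ δ η C b s R *
      (-(W R / Real.sin R ^ 2) * cuspWeight d C s R)) R := by
  have hw := (cuspWeight_pos (C := C) (R := R) hD hs).ne'
  have h2 : HasDerivAt (fun R : ℝ => η * (R - 3 * δ)) η R := by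
    simpa using ((hasDerivAt_id R).sub_const (3 * δ)).const_mul η
  have h1 := ((hasDerivAt_foldHeight hF hp h0 hR).const_mul (1 - s)).add
    (((hc.deriv _).comp R h2).const_mul s)
  refine h1.congr_deriv ?_
  rw [cusp_slope_eq hF hc hD hp h0 hR, cuspSlope_of_pos hF hc hp h0]
  have : cuspMoment P d h h' ρ δ η C b s R / cuspWeight d C s R *
      (-(W R / Real.sin R ^ 2) * cuspWeight d C s R) =
      -(W R / Real.sin R ^ 2) * cuspMoment P d h h' ρ δ η C b s R := by
    field_simp
  rw [this, cuspMoment]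
  ring

lemma contDiffAt_cusp {s R : ℝ} (hs : s ∈ Icc (0 : ℝ) 1) (h0 : 0 < R) (hR : R < Real.pi) :
    ContDiffAt ℝ ∞ (Function.uncurry (cuspAngle δ C D)) (s, R) ∧
    ContDiffAt ℝ ∞ (Function.uncurry (cuspSlope P d h h' ρ δ η C b)) (s, R) ∧
    ContDiffAt ℝ ∞ (Function.uncurry (cuspHeight A h h' ρ δ η C b)) (s, R) := by
  have hev : ∀ᶠ z : ℝ × ℝ in 𝓝 (s, R), 0 < z.2 :=
    continuous_snd.continuousAt.eventually (Ioi_mem_nhds h0)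
  have a1 : ContDiffAt ℝ ∞ (fun z : ℝ × ℝ => C z.2) (s, R) :=
    ContDiffAt.comp (s, R) (hF.smooth_C R h0 hR) contDiffAt_snd
  have a2 : ContDiffAt ℝ ∞ (fun z : ℝ × ℝ => 1 - z.1) (s, R) :=
    contDiffAt_const.sub contDiffAt_fst
  have a3 : ContDiffAt ℝ ∞ (fun z : ℝ × ℝ => Real.arctan (C z.2)) (s, R) :=
    Real.contDiff_arctan.contDiffAt.comp (s, R) a1
  have a4 : ContDiffAt ℝ ∞ (fun z : ℝ × ℝ => D (C z.2)) (s, R) :=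
    hD.smooth.contDiffAt.comp (s, R) a1
  have a5 : ContDiffAt ℝ ∞ (fun z : ℝ × ℝ => d (C z.2)) (s, R) :=
    hD.smooth_deriv.contDiffAt.comp (s, R) a1
  have a6 : ContDiffAt ℝ ∞ (fun z : ℝ × ℝ => 1 + C z.2 ^ 2) (s, R) :=
    contDiffAt_const.add (a1.pow 2)
  have a7 : ContDiffAt ℝ ∞ (fun z : ℝ × ℝ => √(1 + C z.2 ^ 2)) (s, R) :=
    a6.sqrt (by positivity)
  have a8 : ContDiffAt ℝ ∞ (fun z : ℝ × ℝ => b z.2) (s, R) :=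
    (hF.smooth_b.comp contDiff_snd).contDiffAt
  have a9 : ContDiffAt ℝ ∞ (fun z : ℝ × ℝ => Real.sin z.2 ^ 2 * Real.cos z.2) (s, R) :=
    (((Real.contDiff_sin.comp contDiff_snd).pow 2).mul
      (Real.contDiff_cos.comp contDiff_snd)).contDiffAt
  have a10 : ContDiffAt ℝ ∞ (fun z : ℝ × ℝ => foldSlope h h' ρ C b z.2) (s, R) :=
    (contDiffAt_const.mul (a7.mul ((a9.mul a6).sub (a8.mul a1)))).add
      (contDiff_profileSlope.comp contDiff_snd).contDiffAt
  have a11 : ContDiff ℝ ∞ (fun z : ℝ × ℝ => η * (z.2 - 3 * δ)) := by fun_prop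
  have a12 : ContDiffAt ℝ ∞ (fun z : ℝ × ℝ => 1 / (1 + C z.2 ^ 2)) (s, R) :=
    contDiffAt_const.div a6 (by positivity)
  refine ⟨?_, ?_, ?_⟩
  · refine ((a2.mul ((contDiffAt_const (c := Real.pi / 2)).sub a3)).add (contDiffAt_fst.mul a4)).congr_of_eventuallyEq ?_
    filter_upwards [hev] with z hz using cuspAngle_of_pos hF hD hp hz
  · have n1 : ContDiffAt ℝ ∞ (fun z : ℝ × ℝ => cuspMoment P d h h' ρ δ η C b z.1 z.2) (s, R) :=
      (a2.mul (a12.mul a10)).add (contDiffAt_fst.mul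
        (a5.mul (hc.smooth_slope.comp a11).contDiffAt))
    have n2 : ContDiffAt ℝ ∞ (fun z : ℝ × ℝ => cuspWeight d C z.1 z.2) (s, R) :=
      (a2.mul a12).add (contDiffAt_fst.mul a5)
    refine (n1.div n2 (cuspWeight_pos hD hs).ne').congr_of_eventuallyEq ?_
    filter_upwards [hev] with z hz using cuspSlope_of_pos hF hc hp hz
  · have n1 : ContDiffAt ℝ ∞ (fun z : ℝ × ℝ => foldHeight h h' ρ δ C b z.2) (s, R) := by
      refine (((contDiffAt_const (c := h')).mul (a8.mul a7)).add
        (((contDiff_profile (h := h) (h' := h') (ρ := ρ)).comp contDiff_snd).contDiffAt.sub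
        (contDiffAt_const (c := h')))).congr_of_eventuallyEq ?_
      filter_upwards [hev] with z hz using foldHeight_of_pos hF hp hz
    exact (a2.mul n1).add (contDiffAt_fst.mul (hc.smooth.comp a11).contDiffAt)

/-- The slope changes at the cusp edge. -/
lemma exists_cuspSlope_deriv {s R : ℝ} (hs : s ∈ Icc (0 : ℝ) 1) (h0 : 0 < R) (hR : R < Real.pi) :
    ∃ dP, HasDerivAt (cuspSlope P d h h' ρ δ η C b s) dP R ∧
      (-(W R / Real.sin R ^ 2) * cuspWeight d C s R ≠ 0 ∨ dP ≠ 0) := by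
  have hδ := hp.δ_pos
  have hδ1 := hp.δ_le
  have hsm : DifferentiableAt ℝ (cuspSlope P d h h' ρ δ η C b s) R := by
    have h1 := (contDiffAt_cusp hF hc hD hp hs h0 hR).2.1.differentiableAt (by simp)
    exact DifferentiableAt.comp R (g := Function.uncurry (cuspSlope P d h h' ρ δ η C b))
      (f := fun R => (s, R)) h1 (by fun_prop)
  have hsR := Real.sin_pos_of_pos_of_lt_pi h0 hR
  have hw := cuspWeight_pos (C := C) (R := R) hD hs
  by_cases h3 : R = 3 * δ
  · have hC0 : W R / Real.sin R ^ 2 = 0 := by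
      have h4 : HasDerivAt C (-(L * (2 * ((R - 3 * δ) / δ) * (1 / δ)))) R := by
        have h3' : HasDerivAt (fun R : ℝ => (R - 3 * δ) / δ) (1 / δ) R :=
          ((hasDerivAt_id R).sub_const _).div_const _
        refine ((((h3'.pow 2).const_mul L).const_sub C₀).congr_deriv
          (by push_cast; ring)).congr_of_eventuallyEq ?_
        have h4 : ∀ᶠ y in 𝓝 R, |y - 3 * δ| < δ / 2 :=
          ContinuousAt.eventually_lt (by fun_prop) continuousAt_const
            (by rw [h3, sub_self, abs_zero]; positivity)
        filter_upwards [h4] with y hy using hF.quad y hy.le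
      rw [(hF.deriv_C R h0 hR).unique h4, h3]
      simp
    have hW0 : W R = 0 := by
      rcases div_eq_zero_iff.1 hC0 with h | h
      · exact h
      · exact absurd h (by positivity)
    have dC : HasDerivAt C 0 R := hC0 ▸ hF.deriv_C R h0 hR
    have db : HasDerivAt b 0 R := by simpa [hW0] using hF.deriv_b R
    have dS : HasDerivAt (fun R => √(1 + C R ^ 2)) 0 R := by
      simpa [hC0] using hasDerivAt_sqrt_C hF h0 hR
    have dinv : HasDerivAt (fun R => 1 / (1 + C R ^ 2)) 0 R := by
      have := (hasDerivAt_const R (1 : ℝ)).div ((dC.pow 2).const_add 1)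
        (by simp only [Pi.pow_apply]; positivity)
      refine this.congr_deriv ?_
      simp
    have dd : HasDerivAt (fun R => d (C R)) 0 R := by
      exact (((hD.smooth_deriv.differentiable (by simp) (C R)).hasDerivAt).comp R dC).congr_deriv
        (mul_zero _)
    have dw : HasDerivAt (cuspWeight d C s) 0 R := by
      exact ((dinv.const_mul (1 - s)).add (dd.const_mul s)).congr_deriv (by simp)
    have hcR := cos_gt_of_le_half h0.le (show R ≤ 1 / 2 by linarith)
    have ht := Real.sin_sq_add_cos_sq R
    set κ' := Real.sin R * (2 * Real.cos R ^ 2 - Real.sin R ^ 2)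
    have hκ' : 0 < κ' := mul_pos hsR (by nlinarith)
    have dκ : HasDerivAt (fun R => Real.sin R ^ 2 * Real.cos R) κ' R := by
      refine (((Real.hasDerivAt_sin R).pow 2).mul (Real.hasDerivAt_cos R)).congr_deriv ?_
      simp only [Pi.pow_apply, κ']
      push_cast
      ring
    have dps : HasDerivAt (profileSlope h h' ρ) 0 R := by
      refine (hasDerivAt_const R (0 : ℝ)).congr_of_eventuallyEq ?_
      filter_upwards [Iio_mem_nhds (show R < ρ / 2 by linarith [hp.δρ])] with y hy
      exact profileSlope_of_le hp.ρ_pos (le_of_lt hy)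
    set F' := h' * (√(1 + C R ^ 2) * (κ' * (1 + C R ^ 2)))
    have hF' : 0 < F' := by
      have := hp.h'_pos
      have : 0 < √(1 + C R ^ 2) := Real.sqrt_pos.2 (by positivity)
      positivity
    have dF : HasDerivAt (foldSlope h h' ρ C b) F' R := by
      refine (((dS.mul ((dκ.mul ((dC.pow 2).const_add 1)).sub (db.mul dC))).const_mul h').add
        dps).congr_deriv ?_
      simp [F']
    have dP : HasDerivAt (fun R => P (η * (R - 3 * δ))) (deriv P 0 * η) R := by
      have h2 : HasDerivAt (fun R : ℝ => η * (R - 3 * δ)) η R := by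
        simpa using ((hasDerivAt_id R).sub_const (3 * δ)).const_mul η
      have h5 : HasDerivAt P (deriv P 0) (η * (R - 3 * δ)) := by
        rw [h3, sub_self, mul_zero]
        exact (hc.smooth_slope.differentiable (by simp) 0).hasDerivAt
      exact h5.comp R h2
    have dm : HasDerivAt (cuspMoment P d h h' ρ δ η C b s)
        ((1 - s) * (1 / (1 + C R ^ 2) * F') + s * (d (C R) * (deriv P 0 * η))) R := by
      refine (((dinv.mul dF).const_mul (1 - s)).add ((dd.mul dP).const_mul s)).congr_deriv ?_
      ring
    have hm : 0 < (1 - s) * (1 / (1 + C R ^ 2) * F') + s * (d (C R) * (deriv P 0 * η)) := by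
      have m1 : 1 / (1 + C R ^ 2) * F' ∈ Ioi (0 : ℝ) := by rw [mem_Ioi]; positivity
      have m2 : d (C R) * (deriv P 0 * η) ∈ Ioi (0 : ℝ) :=
        mul_pos (hD.pos _) (mul_pos hc.slope_deriv hp.η_pos)
      exact convex_Ioi 0 m1 m2 (sub_nonneg.2 hs.2) hs.1 (by ring)
    refine ⟨_, (dm.div dw hw.ne').congr_of_eventuallyEq ?_, Or.inr ?_⟩
    · filter_upwards [Ioi_mem_nhds h0] with y hy using cuspSlope_of_pos hF hc hp hy
    · rw [mul_zero, sub_zero]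
      positivity
  · refine ⟨_, hsm.hasDerivAt, Or.inl (mul_ne_zero (neg_ne_zero.2 (div_ne_zero ?_ (by positivity)))
      hw.ne')⟩
    rcases lt_or_gt_of_ne h3 with h4 | h4
    · exact (hF.W_pos R h0 h4).ne'
    · exact (hF.W_neg R h4 hR).ne

end Cusp

section Cusp

variable {A P D d C b W : ℝ → ℝ} {r r₀ r₁ δ ρ h h' η T ε a b₀ M δ₀ C₀ L : ℝ}
  (hF : FoldData δ C b W C₀ L) (hc : CuspData A P T h ε)
  (hD : AngleData D d r₀ r₁ η δ C₀ L)
  (hp : CuspParams r r₀ r₁ δ ρ h h' η T ε a b₀ M δ₀)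
  (hM : ∀ R, 0 < R → R ≤ 5 * δ → |b R * √(1 + C R ^ 2)| ≤ M ∧
    |√(1 + C R ^ 2) * (Real.sin R ^ 2 * Real.cos R * (1 + C R ^ 2) - b R * C R)| ≤ M)

include hp

include hc in
lemma height_left {R : ℝ} (hR : R ≤ 5 / 2 * δ) : A (η * (R - 3 * δ)) = -ε := by
  refine hc.left _ ?_
  have h1 := mul_le_mul_of_nonneg_left (show R - 3 * δ ≤ -(δ / 2) by linarith) hp.η_pos.le
  linarith [hp.Tη]

include hc in
lemma height_right {R : ℝ} (hR : 7 / 2 * δ ≤ R) : A (η * (R - 3 * δ)) = h := by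
  refine hc.right _ ?_
  have h1 := mul_le_mul_of_nonneg_left (show δ / 2 ≤ R - 3 * δ by linarith) hp.η_pos.le
  linarith [hp.Tη]

include hc in
lemma cusp_center {s R : ℝ} (hR : R < δ) : cuspAngle δ C D s R = Real.pi - R ∧
    cuspSlope P d h h' ρ δ η C b s R = 0 ∧
    cuspHeight A h h' ρ δ η C b s R = (1 - s) * -h' + s * -ε := by
  rw [cuspAngle, cuspSlope, cuspHeight, foldHeight, if_pos hR, if_pos hR, if_pos hR,
    height_left hc hp (by linarith [hp.δ_pos])]
  exact ⟨rfl, rfl, rfl⟩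

include hF hM in
lemma foldHeight_small {R : ℝ} (h0 : 0 < R) (hR : R ≤ 5 * δ) :
    |foldHeight h h' ρ δ C b R| ≤ h' * M ∧ |foldSlope h h' ρ C b R| ≤ h' * M := by
  obtain ⟨h1, h2⟩ := hM R h0 hR
  have h3 := hp.h'_pos
  have e : ∀ x, |h' * x| = h' * |x| := fun x => by rw [abs_mul, abs_of_pos h3]
  rw [foldHeight_of_pos hF hp h0, foldSlope, profile_of_le hp.ρ_pos (by linarith [hp.δρ]),
    profileSlope_of_le hp.ρ_pos (by linarith [hp.δρ]), sub_self, add_zero, add_zero, e, e]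
  exact ⟨mul_le_mul_of_nonneg_left h1 h3.le, mul_le_mul_of_nonneg_left h2 h3.le⟩

include hF hM in
lemma foldHeight_mem {R : ℝ} (h0 : 0 < R) (hR : R < Real.pi) :
    foldHeight h h' ρ δ C b R ∈ Ioo (-a) b₀ := by
  rcases le_or_gt R (5 * δ) with h1 | h1
  · obtain ⟨h2, h3⟩ := abs_le.1 (foldHeight_small hF hp hM h0 h1).1
    exact ⟨by linarith [hp.Ma], by linarith [hp.Mh, hp.hb]⟩
  · rw [foldHeight_of_ge hF hp h1.le hR]
    have h2 := le_profile (ρ := ρ) (R := R) hp.h'_le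
    have h3 := profile_le (ρ := ρ) (R := R) hp.h'_le
    exact ⟨by linarith [hp.h'_pos, hp.ε_pos, hp.εa], by linarith [hp.hb]⟩

include hF hc

include hM in
lemma cuspHeight_mem {s R : ℝ} (hs : s ∈ Icc (0 : ℝ) 1) (h0 : 0 ≤ R) (hR : R < Real.pi) :
    cuspHeight A h h' ρ δ η C b s R ∈ Ioo (-a) b₀ := by
  have h1 : foldHeight h h' ρ δ C b R ∈ Ioo (-a) b₀ := by
    rcases eq_or_lt_of_le h0 with h1 | h1
    · rw [← h1, foldHeight, if_pos hp.δ_pos]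
      have := hp.h'_pos
      have := mul_le_mul_of_nonneg_left hp.one_le_M hp.h'_pos.le
      exact ⟨by linarith [hp.Ma], by linarith [hp.h'_le, hp.hb]⟩
    · exact foldHeight_mem hF hp hM h1 hR
  obtain ⟨h2, h3⟩ := hc.mem_Icc (η * (R - 3 * δ))
  have h4 : A (η * (R - 3 * δ)) ∈ Ioo (-a) b₀ := ⟨by linarith [hp.εa], by linarith [hp.hb]⟩
  exact convex_Ioo (-a) b₀ h1 h4 (sub_nonneg.2 hs.2) hs.1 (by ring)

lemma cuspHeight_lt {s R R' : ℝ} (hs : s ∈ Icc (0 : ℝ) 1) (h0 : 0 < R) (h1 : R < 3 * δ)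
    (h2 : 3 * δ < R') (hR' : R' < Real.pi) (h3 : C R = C R') :
    cuspHeight A h h' ρ δ η C b s R < cuspHeight A h h' ρ δ η C b s R' := by
  have hδ := hp.δ_pos
  have hδρ := hp.δρ
  have k1 : foldHeight h h' ρ δ C b R < foldHeight h h' ρ δ C b R' := by
    rw [foldHeight_of_pos hF hp h0, foldHeight_of_pos hF hp (show 0 < R' by linarith),
      profile_of_le hp.ρ_pos (show R ≤ ρ / 2 by linarith), h3]
    have e1 := hF.b_lt hδ hp.δ_le h0 h1 h2 hR' h3
    have e2 := le_profile (ρ := ρ) (R := R') hp.h'_le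
    have e3 : 0 < √(1 + C R' ^ 2) := Real.sqrt_pos.2 (by positivity)
    have e4 := mul_lt_mul_of_pos_left (mul_lt_mul_of_pos_right e1 e3) hp.h'_pos
    linarith
  have k2 : A (η * (R - 3 * δ)) < A (η * (R' - 3 * δ)) :=
    hc.lt_of_neg_of_pos hp.T_pos (mul_neg_of_pos_of_neg hp.η_pos (by linarith))
      (mul_pos hp.η_pos (by linarith))
  have k3 : foldHeight h h' ρ δ C b R' - foldHeight h h' ρ δ C b R ∈ Ioi (0 : ℝ) := sub_pos.2 k1
  have k4 : A (η * (R' - 3 * δ)) - A (η * (R - 3 * δ)) ∈ Ioi (0 : ℝ) := sub_pos.2 k2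
  have k5 := convex_Ioi (0 : ℝ) k3 k4 (sub_nonneg.2 hs.2) hs.1 (by ring)
  simp only [smul_eq_mul, mem_Ioi] at k5
  rw [cuspHeight, cuspHeight]
  linarith

include hD in
lemma cusp_ne_zero {s R : ℝ} (hs : s ∈ Icc (0 : ℝ) 1) (h0 : 0 ≤ R) (hR : R < Real.pi) :
    cuspHeight A h h' ρ δ η C b s R ≠ 0 ∨ cuspSlope P d h h' ρ δ η C b s R ≠ 0 := by
  have hδ := hp.δ_pos
  have hh := hp.h'_pos
  have hδ1 := hp.δ_le
  rcases le_or_gt R (3 * δ) with h1 | h1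
  · left
    have k1 : foldHeight h h' ρ δ C b R ∈ Iio (0 : ℝ) := by
      rcases eq_or_lt_of_le h0 with h2 | h2
      · rw [← h2, foldHeight, if_pos hδ]
        exact neg_lt_zero.2 hh
      · rw [foldHeight_of_pos hF hp h2, profile_of_le hp.ρ_pos (by linarith [hp.δρ]), sub_self,
          add_zero]
        exact mul_neg_of_pos_of_neg hh (mul_neg_of_neg_of_pos (hF.b_neg hδ hδ1 h2 h1)
          (Real.sqrt_pos.2 (by positivity)))
    have k2 : A (η * (R - 3 * δ)) ∈ Iio (0 : ℝ) := by
      refine (hc.monotone ?_).trans_lt hc.zero_neg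
      exact mul_nonpos_of_nonneg_of_nonpos hp.η_pos.le (by linarith)
    have k5 := convex_Iio (0 : ℝ) k1 k2 (sub_nonneg.2 hs.2) hs.1 (by ring)
    exact (show cuspHeight A h h' ρ δ η C b s R < 0 from k5).ne
  · by_contra! h2
    obtain ⟨h2, h3⟩ := h2
    have hR0 : 0 < R := by linarith
    have hw := cuspWeight_pos (C := C) (R := R) hD hs
    rw [cuspSlope_of_pos hF hc hp hR0] at h3
    have h4 := (div_eq_zero_iff.1 h3).resolve_right hw.ne'
    have hsR := Real.sin_pos_of_pos_of_lt_pi hR0 hR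
    have n1 : 0 ≤ foldSlope h h' ρ C b R := by
      rcases le_or_gt R (5 * δ) with h5 | h5
      · exact add_nonneg (mul_nonneg hh.le (mul_nonneg (Real.sqrt_nonneg _)
          (hF.slope_nonneg hδ hδ1 h1.le h5))) (profileSlope_nonneg hp.ρ_pos hp.h'_le)
      · rw [foldSlope_of_ge hF hp h5.le hR]
        exact profileSlope_nonneg hp.ρ_pos hp.h'_le
    have n2 : 0 ≤ P (η * (R - 3 * δ)) := hc.slope_nonneg (mul_pos hp.η_pos (by linarith))
    have p1 : foldSlope h h' ρ C b R = 0 → 0 < foldHeight h h' ρ δ C b R := by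
      intro h5
      rcases le_or_gt R (5 * δ) with h6 | h6
      · have hc0 := cos_gt_of_le_half hR0.le (show R ≤ 1 / 2 by linarith)
        have hcR : 0 < Real.cos R := by linarith
        have hC : 0 < C R := (div_pos hcR hsR).trans_le (hF.le_C R h1.le h6)
        have hS : 0 < √(1 + C R ^ 2) := Real.sqrt_pos.2 (by positivity)
        have hps : profileSlope h h' ρ R = 0 := profileSlope_of_le hp.ρ_pos (by linarith [hp.δρ])
        rw [foldSlope, hps, add_zero] at h5
        have h7 := ((mul_eq_zero.1 ((mul_eq_zero.1 h5).resolve_left hh.ne')).resolve_left hS.ne')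
        have h8 : 0 < b R := by
          have : 0 < b R * C R := by
            have : 0 < Real.sin R ^ 2 * Real.cos R * (1 + C R ^ 2) := by positivity
            linarith
          exact (pos_iff_pos_of_mul_pos this).2 hC
        rw [foldHeight_of_pos hF hp hR0, profile_of_le hp.ρ_pos (by linarith [hp.δρ]), sub_self,
          add_zero]
        positivity
      · rw [foldHeight_of_ge hF hp h6.le hR]
        exact hh.trans_le (le_profile hp.h'_le)
    have p2 : P (η * (R - 3 * δ)) = 0 → 0 < A (η * (R - 3 * δ)) := by
      intro h5
      have h6 : T ≤ η * (R - 3 * δ) := by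
        by_contra! h7
        exact (hc.pos _ (mul_pos hp.η_pos (by linarith)) h7).ne' h5
      rw [hc.right _ h6]
      exact hh.trans_le hp.h'_le
    have hinv : 0 < 1 / (1 + C R ^ 2) := by positivity
    have hd := hD.pos (C R)
    have m1 := mul_nonneg (sub_nonneg.2 hs.2) (mul_nonneg hinv.le n1)
    have m2 := mul_nonneg hs.1 (mul_nonneg hd.le n2)
    rw [cuspMoment] at h4
    have z1 : (1 - s) * (1 / (1 + C R ^ 2) * foldSlope h h' ρ C b R) = 0 := by linarith
    have z2 : s * (d (C R) * P (η * (R - 3 * δ))) = 0 := by linarith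
    have y1 : s ≠ 1 → 0 < foldHeight h h' ρ δ C b R := fun hs1 => p1
      ((mul_eq_zero.1 ((mul_eq_zero.1 z1).resolve_left (sub_ne_zero.2 hs1.symm))).resolve_left
        hinv.ne')
    have y2 : s ≠ 0 → 0 < A (η * (R - 3 * δ)) := fun hs0 => p2
      ((mul_eq_zero.1 ((mul_eq_zero.1 z2).resolve_left hs0)).resolve_left hd.ne')
    rw [cuspHeight] at h2
    rcases eq_or_lt_of_le hs.1 with h5 | h5
    · have := y1 (by rw [← h5]; norm_num)
      rw [← h5] at h2
      linarith
    · have q2 := mul_pos h5 (y2 h5.ne')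
      rcases eq_or_lt_of_le hs.2 with h6 | h6
      · rw [h6] at h2 q2
        linarith
      · have := mul_pos (sub_pos.2 h6) (y1 h6.ne)
        linarith

include hM hD in
lemma cusp_admissible {s R : ℝ} (hs : s ∈ Icc (0 : ℝ) 1) (h0 : 0 ≤ R) (hR : R < r) :
    (|cuspAngle δ C D s R| < r ∧ -a < cuspHeight A h h' ρ δ η C b s R ∧
      cuspHeight A h h' ρ δ η C b s R < b₀) ∨
    cuspHeight A h h' ρ δ η C b s R ^ 2 + cuspSlope P d h h' ρ δ η C b s R ^ 2 ≤ δ₀ ^ 2 := by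
  have hδ := hp.δ_pos
  have hRpi := hR.trans hp.r_lt
  have h'M : h' ≤ h' * M := le_mul_of_one_le_right hp.h'_pos.le hp.one_le_M
  have small : ∀ x y : ℝ, |x| ≤ δ₀ / 2 → |y| ≤ δ₀ / 2 → x ^ 2 + y ^ 2 ≤ δ₀ ^ 2 := by
    intro x y hx hy
    have h1 := pow_le_pow_left₀ (abs_nonneg _) hx 2
    have h2 := pow_le_pow_left₀ (abs_nonneg _) hy 2
    rw [sq_abs] at h1 h2
    nlinarith [sq_nonneg δ₀]
  have hconv : ∀ x y : ℝ, |x| ≤ δ₀ / 2 → |y| ≤ δ₀ / 2 → |(1 - s) * x + s * y| ≤ δ₀ / 2 := by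
    intro x y hx hy
    exact abs_le.2 (convex_Icc (-(δ₀ / 2)) (δ₀ / 2) (abs_le.1 hx) (abs_le.1 hy)
      (sub_nonneg.2 hs.2) hs.1 (by ring))
  rcases lt_or_ge R δ with h1 | h1
  · right
    obtain ⟨-, h3, h4⟩ := cusp_center (C := C) (D := D) (d := d) (b := b) (s := s) hc hp h1
    rw [h3, h4]
    refine small _ _ (hconv _ _ ?_ ?_) (by rw [abs_zero]; linarith [hp.εδ, hp.ε_pos])
    · rw [abs_neg, abs_of_pos hp.h'_pos]; linarith [hp.Mδ]
    · rw [abs_neg, abs_of_pos hp.ε_pos]; exact hp.εδ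
  have hR0 : 0 < R := hδ.trans_le h1
  have hmem := cuspAngle_mem hF hD hp hs hR0 hRpi
  rcases lt_or_ge (cuspAngle δ C D s R) r with h2 | h2
  · left
    rw [abs_of_pos hmem.1]
    exact ⟨h2, cuspHeight_mem hF hc hp hM hs h0 hRpi⟩
  right
  rw [cuspAngle_of_pos hF hD hp hR0] at h2
  have hr0 : 0 < r := hp.r₁_pos.trans hp.r₁_lt
  have h3 : C R < Real.cos r₁ / Real.sin r₁ := by
    by_contra! h3
    have h4 := (arccot_le_iff hp.r₁_pos hp.r₁_lt_pi).2 h3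
    have h5 := (strictAnti_angle hD).antitone h3
    rw [angle_left hD hp hp.r₁_pos hp.r₁_lt_pi le_rfl] at h5
    have h6 := mul_le_mul_of_nonneg_left h4 (sub_nonneg.2 hs.2)
    have h7 := mul_le_mul_of_nonneg_left h5 hs.1
    linarith [hp.r₁_lt]
  rw [hD.left _ h3.le] at h2
  have h4 : R < 3 * δ := by
    by_contra! h4
    have h5 := (cot_lt_cot hR0 hR hp.r_lt).trans_le (hF.cot_le_C h4)
    have h6 := (arccot_le_iff hr0 hp.r_lt).2 h5.le
    have h7 : Real.pi / 2 - Real.arctan (C R) = r := by linarith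
    rw [sub_eq_iff_eq_add, ← sub_eq_iff_eq_add', ← arctan_cot hr0 hp.r_lt] at h7
    exact h5.ne (Real.arctan_injective h7)
  have hfar : δ / 2 ≤ |R - 3 * δ| := by
    refine far_of_C_lt hF hp (h3.trans_le ?_)
    exact (cot_le_cot (by positivity) hp.r₁_gt.le hp.r₁_lt_pi).trans hF.lt_C₀.le
  have hR2 : R ≤ 5 / 2 * δ := by
    rw [abs_of_neg (by linarith)] at hfar
    linarith
  obtain ⟨k1, k2⟩ := foldHeight_small hF hp hM hR0 (show R ≤ 5 * δ by linarith)
  refine small _ _ ?_ ?_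
  · rw [cuspHeight, height_left hc hp hR2]
    refine hconv _ _ (k1.trans hp.Mδ) ?_
    rw [abs_neg, abs_of_pos hp.ε_pos]; exact hp.εδ
  · rw [cuspSlope_of_pos hF hc hp hR0, cuspMoment, slope_far hc hp hfar, mul_zero, mul_zero,
      add_zero, ← mul_assoc, mul_div_right_comm, abs_mul]
    refine le_trans (mul_le_of_le_one_left (abs_nonneg _) ?_) (k2.trans hp.Mδ)
    have hw := cuspWeight_pos (C := C) (R := R) hD hs
    have e1 : 0 ≤ (1 - s) * (1 / (1 + C R ^ 2)) :=
      mul_nonneg (sub_nonneg.2 hs.2) (by positivity)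
    rw [abs_of_nonneg (div_nonneg e1 hw.le), div_le_one hw, cuspWeight]
    linarith [mul_nonneg hs.1 (hD.pos (C R)).le]

include hD in
lemma cusp_static {s R : ℝ} (h0 : max ρ r₁ ≤ R) (hR : R < Real.pi) :
    cuspAngle δ C D s R = R ∧ cuspSlope P d h h' ρ δ η C b s R = 0 ∧
    cuspHeight A h h' ρ δ η C b s R = h := by
  have h1 : ρ ≤ R := (le_max_left _ _).trans h0
  have h2 : r₁ ≤ R := (le_max_right _ _).trans h0
  have hδ := hp.δ_pos
  have hδρ := hp.δρ
  have h3 : 5 * δ ≤ R := by linarith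
  have hR0 : 0 < R := by linarith
  refine ⟨?_, ?_, ?_⟩
  · rw [cuspAngle_of_pos hF hD hp hR0, hF.C_right R h3, angle_left hD hp hR0 hR h2,
      arctan_cot hR0 hR]
    ring
  · rw [cuspSlope_of_pos hF hc hp hR0, cuspMoment, foldSlope_of_ge hF hp h3 hR,
      profileSlope_of_ge hp.ρ_pos h1, slope_far hc hp (by rw [abs_of_nonneg] <;> linarith)]
    simp
  · rw [cuspHeight, foldHeight_of_ge hF hp h3 hR, profile_of_ge hp.ρ_pos h1,
      height_right hc hp (by linarith)]
    ring

include hM hD in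
theorem outerGood_cusp : PlaneFamily.OuterGood (cuspAngle δ C D) (cuspSlope P d h h' ρ δ η C b)
    (cuspHeight A h h' ρ δ η C b) r a b₀ h δ₀ := by
  have hδ := hp.δ_pos
  refine ⟨fun s hs R h0 hR => contDiffAt_cusp hF hc hD hp hs h0 (hR.trans hp.r_lt), ?_, ?_, ?_,
    ?_, fun s hs R h0 hR => cusp_ne_zero hF hc hD hp hs h0 (hR.trans hp.r_lt),
    fun s hs R h0 hR => cusp_admissible hF hc hD hp hM hs h0 hR, ?_⟩
  · refine ⟨δ, hδ, -1, 1, fun s => (1 - s) * -h' + s * -ε, by fun_prop, one_ne_zero,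
      fun s R _ hR => ?_⟩
    obtain ⟨h1, h2, h3⟩ := cusp_center (C := C) (D := D) (d := d) (b := b) (s := s) hc hp hR
    rw [h1, h2, h3, Real.cos_pi_sub, Real.sin_pi_sub]
    exact ⟨by ring, by ring, rfl, rfl⟩
  · intro s hs R h0 hR
    have hRpi := hR.trans hp.r_lt
    obtain ⟨dP, h1, h2⟩ := exists_cuspSlope_deriv hF hc hD hp hs h0 hRpi
    exact ⟨_, dP, hasDerivAt_cuspAngle hF hD hp h0 hRpi, h1,
      hasDerivAt_cuspHeight hF hc hD hp hs h0 hRpi, h2⟩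
  · intro s hs R h0 hR
    have h1 := cuspAngle_mem hF hD hp hs h0 (hR.trans hp.r_lt)
    exact Or.inl (Real.sin_pos_of_pos_of_lt_pi h1.1 h1.2).ne'
  · intro s hs R R' h0 hR h0' hR' τ _ h1 _ _ h4
    have hRpi := hR.trans hp.r_lt
    have hRpi' := hR'.trans hp.r_lt
    have m1 := cuspAngle_mem hF hD hp hs h0 hRpi
    have m2 := cuspAngle_mem hF hD hp hs h0' hRpi'
    have h5 := Real.injOn_cos ⟨m2.1.le, m2.2.le⟩ ⟨m1.1.le, m1.2.le⟩ h1
    rw [cuspAngle_of_pos hF hD hp h0, cuspAngle_of_pos hF hD hp h0'] at h5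
    have h6 := (cuspAngle_C_inj hD hs h5).symm
    rcases lt_or_ge R (3 * δ) with a1 | a1
    · rcases le_or_gt R' (3 * δ) with a2 | a2
      · exact (hF.strictMonoOn_C hδ hp.δ_le).injOn ⟨h0, a1.le⟩ ⟨h0', a2⟩ h6
      · exact absurd h4 (cuspHeight_lt hF hc hp hs h0 a1 a2 hRpi' h6).ne'
    · rcases le_or_gt (3 * δ) R' with a2 | a2
      · exact (hF.strictAntiOn_C hδ).injOn ⟨a1, hRpi⟩ ⟨a2, hRpi'⟩ h6
      · rcases eq_or_lt_of_le a1 with a3 | a3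
        · exact (hF.strictMonoOn_C hδ hp.δ_le).injOn ⟨h0, a3.ge⟩ ⟨h0', a2.le⟩ h6
        · exact absurd h4 (cuspHeight_lt hF hc hp hs h0' a2 a3 hRpi h6.symm).ne
  · exact ⟨max ρ r₁, max_lt hp.ρr hp.r₁_lt, lt_max_of_lt_left hp.ρ_pos, fun s _ R h0 hR =>
      cusp_static hF hc hD hp h0 (hR.trans hp.r_lt)⟩

end Cusp

/-! ### Discs spun from a planar curve -/

open PlaneFamily

lemma exists_perp (hm : 1 ≤ m) (e : Sph m) : ∃ u : Sph m, ⟪(u : Euc m), (e : Euc m)⟫ = 0 := by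
  have : Fact (Module.finrank ℝ (Euc m) = m + 1) := ⟨by simp⟩
  have h1 := Submodule.finrank_orthogonal_span_singleton (𝕜 := ℝ) (n := m)
    (ne_zero_of_mem_unit_sphere e)
  obtain ⟨v, hv, hv0⟩ := (Submodule.one_le_finrank_iff).1 (hm.trans h1.ge) |> Submodule.exists_mem_ne_zero_of_ne_bot
  refine ⟨⟨‖v‖⁻¹ • v, by simp [norm_smul, hv0]⟩, ?_⟩
  rw [real_inner_smul_left, Submodule.mem_orthogonal_singleton_iff_inner_left.1 hv, mul_zero]

lemma exists_direction (hm : 1 ≤ m) (e x : Sph m) : ∃ u : Sph m, ⟪(u : Euc m), (e : Euc m)⟫ = 0 ∧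
    ∀ α β : ℝ, (Real.sin (axisAngle e (x : Euc m)) = 0 → β = 0) →
      spin e α β (x : Euc m) = α • (e : Euc m) + β • (u : Euc m) := by
  by_cases h : Real.sin (axisAngle e (x : Euc m)) = 0
  · obtain ⟨u, hu⟩ := exists_perp hm e
    exact ⟨u, hu, fun α β hβ => by rw [spin_eq, hβ h, zero_smul, zero_smul]⟩
  · exact ⟨⟨radial e (x : Euc m), by simpa using norm_radial e x h⟩, inner_radial e x,
      fun α β _ => spin_eq e α β x⟩

lemma exists_point {e u : Sph m} (hu : ⟪(u : Euc m), (e : Euc m)⟫ = 0) {R : ℝ} (h0 : 0 ≤ R)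
    (hR : R < Real.pi) : ∃ x : Sph m, axisAngle e (x : Euc m) = R ∧
    ∀ α β : ℝ, (R = 0 → β = 0) → spin e α β (x : Euc m) = α • (e : Euc m) + β • (u : Euc m) := by
  set v : Euc m := Real.cos R • (e : Euc m) + Real.sin R • (u : Euc m) with hv
  have h1 : ‖v‖ = 1 := by
    have h2 : ‖v‖ ^ 2 = 1 := by
      rw [← real_inner_self_eq_norm_sq, hv]
      simp only [inner_add_left, inner_add_right, real_inner_smul_left, real_inner_smul_right,
        inner_self_sph, hu, real_inner_comm (u : Euc m)]
      linear_combination Real.sin_sq_add_cos_sq R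
    exact (pow_eq_one_iff_of_nonneg (norm_nonneg _) two_ne_zero).1 h2
  have h3 : ⟪v, (e : Euc m)⟫ = Real.cos R := by
    simp only [hv, inner_add_left, real_inner_smul_left, inner_self_sph, hu]; ring
  have h4 : axisAngle e v = R := by rw [axisAngle, h3, Real.arccos_cos h0 hR.le]
  refine ⟨⟨v, by simpa using h1⟩, h4, fun α β hβ => ?_⟩
  rcases eq_or_lt_of_le h0 with h5 | h5
  · rw [spin_eq, hβ h5.symm, zero_smul, zero_smul]
  · have h6 := (Real.sin_pos_of_pos_of_lt_pi h5 hR).ne'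
    have h7 : offAxis e v = Real.sin R • (u : Euc m) := by
      rw [offAxis, h3, hv, add_sub_cancel_left]
    rw [spin_eq, radial, h4, h7, inv_smul_smul₀ h6]

lemma spin_self (e x : Sph m) :
    spin e (Real.cos (axisAngle e (x : Euc m))) (Real.sin (axisAngle e (x : Euc m))) (x : Euc m) =
      x :=
  (jetPos_spunJet (σ := 1) (p := 0) (A' := 0) fun h => ⟨h, rfl⟩).symm.trans
    (congrArg jetPos (spunJet_self e x 1 0))

lemma jet_ext {w w' : Jet m} (h1 : jetPos w = jetPos w') (h2 : jetHeight w = jetHeight w')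
    (h3 : jetSlope w = jetSlope w') : w = w' := by
  rw [← jetMk_coords w, ← jetMk_coords w', h2, h3, Subtype.ext (a1 := w.1) h1]

/-- The values of `θ`, `P` and `A` on `[0, r)` are those of a front curve inside the cap of radius
`r`, and of the push-off of the zero section outside. -/
structure FrontCurve.IsTraced (c : FrontCurve) (r ε : ℝ) (θ P A : ℝ → ℝ) : Prop where
  mem : ∀ R, 0 ≤ R → R < r →
    (|θ R| < r ∧ ∃ τ, c.angle τ = θ R ∧ c.slope τ = P R ∧ c.height τ = A R) ∨
    (r ≤ |θ R| ∧ |θ R| ≤ Real.pi ∧ P R = 0 ∧ A R = -ε)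
  inner : ∀ τ, |c.angle τ| < r →
    ∃ R, 0 < R ∧ R < r ∧ θ R = c.angle τ ∧ P R = c.slope τ ∧ A R = c.height τ
  far : ∀ ϑ, r ≤ ϑ → ϑ ≤ Real.pi → ∃ R, 0 ≤ R ∧ R < r ∧ |θ R| = ϑ ∧ P R = 0 ∧ A R = -ε
  axis : Real.sin (θ 0) = 0 ∧ P 0 = 0

theorem FrontCurve.IsTraced.image_eq {c : FrontCurve} {r ε σ : ℝ} {θ P A : ℝ → ℝ}
    (h : c.IsTraced r ε θ P A) (hm : 1 ≤ m) (e : Sph m) (hr : r < Real.pi) :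
    (fun x : Sph m => spunJet e x σ (θ (axisAngle e (x : Euc m))) (P (axisAngle e (x : Euc m)))
      (A (axisAngle e (x : Euc m)))) '' cap e r =
    c.spunLift e r σ ∪ {w | w.1 ∉ cap e r ∧ w = jetMk w.1 0 (-σ * ε)} := by
  have ax : ∀ x ∈ cap e r, Real.sin (axisAngle e (x : Euc m)) = 0 →
      Real.sin (θ (axisAngle e (x : Euc m))) = 0 ∧ P (axisAngle e (x : Euc m)) = 0 := by
    intro x hx h0
    have hR : axisAngle e (x : Euc m) = 0 := by
      by_contra h1
      exact (sin_axisAngle_pos hr hx h1).2.2.ne' h0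
    rw [hR]
    exact h.axis
  have mem_cap : ∀ x : Sph m, axisAngle e (x : Euc m) < r → x ∈ cap e r := fun x hx => by
    rwa [axisAngle_eq] at hx
  apply Subset.antisymm
  · rintro _ ⟨x, hx, rfl⟩
    have hax := ax x hx
    obtain ⟨k0, kR⟩ := axisAngle_mem hx
    rcases h.mem _ k0 kR with ⟨h1, τ, h2, h3, h4⟩ | ⟨h1, h2, h3, h4⟩
    · left
      obtain ⟨u, hu, hs⟩ := exists_direction hm e x
      refine ⟨u, τ, hu, by rwa [h2], ?_, ?_, ?_⟩
      · rw [jetPos_spunJet hax, hs _ _ fun h0 => (hax h0).1, h2]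
      · rw [jetHeight_spunJet hax, h4]
      · rw [jetSlope_spunJet hax, h2, h3]
        by_cases h0 : Real.sin (axisAngle e (x : Euc m)) = 0
        · rw [(hax h0).2, mul_zero, zero_smul, zero_smul]
        · rw [hs _ _ fun h5 => absurd h5 h0]
    · right
      constructor
      · intro h5
        have h6 := (axisAngle_mem h5).2
        rw [axisAngle, show ((spunJet e x σ (θ (axisAngle e (x : Euc m)))
          (P (axisAngle e (x : Euc m))) (A (axisAngle e (x : Euc m)))).1 : Euc m) = _ from
          jetPos_spunJet hax, inner_spin_axis, ← Real.cos_abs,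
          Real.arccos_cos (abs_nonneg _) h2] at h6
        exact h6.not_ge h1
      · simp only [spunJet, h3, h4, jetMk, mul_zero, zero_smul, mul_neg, neg_mul]
  · rintro w (⟨u, τ, hu, h1, h2, h3, h4⟩ | ⟨h1, h2⟩)
    · obtain ⟨R, k0, kR, k1, k2, k3⟩ := h.inner τ h1
      obtain ⟨x, hx, hs⟩ := exists_point hu k0.le (kR.trans hr)
      have hxc := mem_cap x (hx.trans_lt kR)
      have hax := ax x hxc
      refine ⟨x, hxc, jet_ext ?_ ?_ ?_⟩
      · rw [jetPos_spunJet hax, hs _ _ fun h0 => absurd h0 k0.ne', h2, hx, k1]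
      · rw [jetHeight_spunJet hax, h3, hx, k3]
      · rw [jetSlope_spunJet hax, hs _ _ fun h0 => absurd h0 k0.ne', h4, hx, k1, k2]
    · obtain ⟨R, k0, kR, k1, k2, k3⟩ := h.far (axisAngle e (w.1 : Euc m))
        (not_lt.1 fun h3 => h1 (mem_cap _ h3)) (Real.arccos_le_pi _)
      obtain ⟨u, hu, hs⟩ := exists_direction hm e w.1
      obtain ⟨v, hv, hw⟩ : ∃ v : Sph m, ⟪(v : Euc m), (e : Euc m)⟫ = 0 ∧
          (w.1 : Euc m) = Real.cos (θ R) • (e : Euc m) + Real.sin (θ R) • (v : Euc m) := by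
        have h5 := (spin_self e w.1).symm.trans (hs _ _ id)
        rw [← k1, Real.cos_abs] at h5
        rcases abs_choice (θ R) with h6 | h6 <;> rw [h6] at h5
        · exact ⟨u, hu, h5⟩
        · refine ⟨-u, (inner_neg_left _ _).trans (by rw [hu, neg_zero]), ?_⟩
          rw [h5, Real.sin_neg, neg_smul, ← smul_neg]
          rfl
      obtain ⟨x, hx, hs⟩ := exists_point hv k0 (kR.trans hr)
      refine ⟨x, mem_cap x (hx.trans_lt kR), ?_⟩
      have h5 : toSph e (spin e (Real.cos (θ R)) (Real.sin (θ R)) (x : Euc m)) = w.1 := by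
        rw [hs _ _ fun h0 => h0 ▸ h.axis.1, ← hw, toSph_coe]
      rw [h2]
      simp only [spunJet, hx, h5, k2, k3, mul_zero, zero_smul, mul_neg, neg_mul]

lemma ConeData.isTraced {c : FrontCurve} {T h h' ρ ε r δ : ℝ} (hc : ConeData c.height c.slope T h ε)
    (ha : ∀ τ, c.angle τ = τ) (hT : T < r) (hr : r < Real.pi) (hr0 : 0 < r) (hδ : 0 < δ)
    (hδr : 2 * δ < r) :
    c.IsTraced r ε (swingAngle δ) (coneSlope c.slope h h' ρ δ 1) (coneHeight c.height h h' ρ δ 1) := by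
  have hP : ∀ R, coneSlope c.slope h h' ρ δ 1 R = c.slope (swingAngle δ R) := fun R => by
    rw [coneSlope]; ring
  have hA : ∀ R, coneHeight c.height h h' ρ δ 1 R = c.height (swingAngle δ R) := fun R => by
    rw [coneHeight]; ring
  have e0 : swingAngle δ 0 = -Real.pi := by rw [swingAngle_of_le hδ hδ.le, zero_sub]
  have er : swingAngle δ r = r := swingAngle_of_ge hδ hδr.le
  have hcont : ContinuousOn (swingAngle δ) (Icc 0 r) :=
    (contDiff_swingAngle hδ).continuous.continuousOn
  refine ⟨fun R h0 hR => ?_, fun τ hτ => ?_, fun ϑ h1 h2 => ?_, ?_⟩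
  · rw [hP, hA]
    have h1 : -Real.pi ≤ swingAngle δ R := e0 ▸ (strictMono_swingAngle hδ).monotone h0
    have h2 : swingAngle δ R < r := er ▸ strictMono_swingAngle hδ hR
    rcases lt_or_ge |swingAngle δ R| r with h3 | h3
    · exact Or.inl ⟨h3, _, ha _, rfl, rfl⟩
    · have h4 : swingAngle δ R ≤ -r := by
        rcases le_abs'.1 h3 with h4 | h4
        · exact h4
        · exact absurd h4 h2.not_ge
      exact Or.inr ⟨h3, abs_le.2 ⟨h1, by linarith⟩, hc.slope_left _ (by linarith),
        hc.left _ (by linarith)⟩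
  · rw [ha] at hτ
    obtain ⟨R, hR, h1⟩ := intermediate_value_Ioo hr0.le hcont
      (show τ ∈ Ioo _ _ by rw [e0, er]; exact ⟨by linarith [(abs_lt.1 hτ).1], (abs_lt.1 hτ).2⟩)
    exact ⟨R, hR.1, hR.2, by rw [h1, ha], by rw [hP, h1], by rw [hA, h1]⟩
  · obtain ⟨R, hR, h3⟩ := intermediate_value_Ico hr0.le hcont
      (show -ϑ ∈ Ico _ _ by rw [e0, er]; exact ⟨by linarith, by linarith⟩)
    refine ⟨R, hR.1, hR.2, by rw [h3, abs_neg, abs_of_pos (by linarith)], ?_, ?_⟩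
    · rw [hP, h3, hc.slope_left _ (by linarith)]
    · rw [hA, h3, hc.left _ (by linarith)]
  · rw [hP, e0, hc.slope_left _ (by linarith)]
    simp

section Cusp

variable {c : FrontCurve} {d D C b W : ℝ → ℝ} {r r₀ r₁ δ ρ h h' η T ε a b₀ M δ₀ C₀ L : ℝ}
  (hF : FoldData δ C b W C₀ L) (hc : CuspData c.height c.slope T h ε)
  (hD : AngleData D d r₀ r₁ η δ C₀ L)
  (hp : CuspParams r r₀ r₁ δ ρ h h' η T ε a b₀ M δ₀)

include hF hD hp

lemma cuspAngle_one {R : ℝ} (h0 : 0 < R) : cuspAngle δ C D 1 R = D (C R) := by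
  rw [cuspAngle_of_pos hF hD hp h0]; ring

omit hp in
lemma angle_near {R : ℝ} (hδ : 0 < δ) (hR : |R - 3 * δ| ≤ δ / 2) :
    D (C R) = r₀ + (η * (R - 3 * δ)) ^ 2 := by
  have h1 : ((R - 3 * δ) / δ) ^ 2 ≤ 1 / 4 := by
    rw [div_pow, div_le_iff₀ (by positivity), ← sq_abs]
    nlinarith [abs_nonneg (R - 3 * δ)]
  have hL := hF.L_pos
  have hq := hF.quad R hR
  rw [hD.right _ (by nlinarith), hq]
  field_simp
  ring

lemma angle_far {R : ℝ} (h0 : 0 < R) (hR : R < Real.pi) (h : δ / 2 ≤ |R - 3 * δ|) :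
    r₀ + (η * δ / 2) ^ 2 ≤ D (C R) := by
  have hδ := hp.δ_pos
  have hpi := Real.pi_gt_three
  have hδ1 := hp.δ_le
  have hanti := (strictAnti_angle hD).antitone
  rcases le_abs'.1 h with h1 | h1
  · refine le_trans (le_of_eq ?_) (hanti ((hF.strictMonoOn_C hδ hδ1).monotoneOn ⟨h0, by linarith⟩
      ⟨by positivity, by linarith⟩ (show R ≤ 5 / 2 * δ by linarith)))
    rw [angle_near hF hD hδ (by rw [abs_of_nonpos] <;> linarith)]
    ring
  · refine le_trans (le_of_eq ?_) (hanti ((hF.strictAntiOn_C hδ).antitoneOn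
      ⟨show 3 * δ ≤ 7 / 2 * δ by linarith, by linarith⟩ ⟨by linarith, hR⟩
      (show 7 / 2 * δ ≤ R by linarith)))
    rw [angle_near hF hD hδ (by rw [abs_of_nonneg] <;> linarith)]
    ring

lemma angle_outer {R : ℝ} (h0 : max ρ r₁ ≤ R) (hR : R < Real.pi) : D (C R) = R := by
  have h1 : ρ ≤ R := (le_max_left _ _).trans h0
  have hδ := hp.δ_pos
  have hR0 : 0 < R := by linarith [hp.δρ]
  rw [hF.C_right R (by linarith [hp.δρ]), angle_left hD hp hR0 hR ((le_max_right _ _).trans h0)]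

omit hp in
lemma continuousOn_angle {x y : ℝ} (h0 : 0 < x) (hy : y < Real.pi) :
    ContinuousOn (fun R => D (C R)) (Icc x y) := fun _ hR =>
  (hD.smooth.continuous.continuousAt.comp
    (hF.continuousAt_C (h0.trans_le hR.1) (hR.2.trans_lt hy))).continuousWithinAt

lemma exists_left {t : ℝ} (h0 : r₀ + (η * δ / 2) ^ 2 ≤ t) (ht : t < Real.pi) :
    ∃ R, 0 < R ∧ R ≤ 5 / 2 * δ ∧ D (C R) = t := by
  have hδ := hp.δ_pos
  have hx : 0 < min (δ / 2) (Real.pi - t) := lt_min (by linarith) (by linarith)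
  set x := min (δ / 2) (Real.pi - t) with hxd
  have hx1 : x ≤ δ / 2 := min_le_left _ _
  have hx2 : x ≤ Real.pi - t := min_le_right _ _
  have e1 : D (C x) = Real.pi - x := by
    rw [← cuspAngle_one hF hD hp hx, cuspAngle, if_pos (by linarith)]
  have e2 : D (C (5 / 2 * δ)) = r₀ + (η * δ / 2) ^ 2 := by
    rw [angle_near hF hD hδ (by rw [abs_of_nonpos] <;> linarith)]
    ring
  obtain ⟨R, hR, h1⟩ := intermediate_value_Icc' (show x ≤ 5 / 2 * δ by linarith)
    (continuousOn_angle hF hD hx (by linarith [Real.pi_gt_three, hp.δ_le]))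
    (show t ∈ Icc _ _ from ⟨by simpa only [e2] using h0, by simp only [e1]; linarith⟩)
  exact ⟨R, hx.trans_le hR.1, hR.2, h1⟩

lemma exists_right {t : ℝ} (h0 : r₀ + (η * δ / 2) ^ 2 ≤ t) (ht : t < r) :
    ∃ R, 7 / 2 * δ ≤ R ∧ R < r ∧ D (C R) = t := by
  have hδ := hp.δ_pos
  have hy : max (max ρ r₁) t < r := max_lt (max_lt hp.ρr hp.r₁_lt) ht
  have e2 : D (C (7 / 2 * δ)) = r₀ + (η * δ / 2) ^ 2 := by
    rw [angle_near hF hD hδ (by rw [abs_of_nonneg] <;> linarith)]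
    ring
  have e1 := angle_outer hF hD hp (le_max_left (max ρ r₁) t) (hy.trans hp.r_lt)
  have h2 : 7 / 2 * δ ≤ max (max ρ r₁) t :=
    le_trans (by linarith [hp.δρ]) ((le_max_left ρ r₁).trans (le_max_left _ _))
  obtain ⟨R, hR, h1⟩ := intermediate_value_Icc h2
    (continuousOn_angle hF hD (by linarith) (hy.trans hp.r_lt))
    (show t ∈ Icc _ _ from ⟨by simpa only [e2] using h0, by simp only [e1]; exact le_max_right _ _⟩)
  exact ⟨R, hR.1, hR.2.trans_lt hy, h1⟩

include hc

lemma cuspSlope_one {R : ℝ} (h0 : 0 < R) :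
    cuspSlope c.slope d h h' ρ δ η C b 1 R = c.slope (η * (R - 3 * δ)) := by
  have := (hD.pos (C R)).ne'
  rw [cuspSlope_of_pos hF hc hp h0, cuspMoment, cuspWeight]
  field_simp
  ring

theorem isTraced_cusp (ha : ∀ τ, c.angle τ = r₀ + τ ^ 2)
    (hq : r₀ + (η * δ / 2) ^ 2 < r) : c.IsTraced r ε (cuspAngle δ C D 1)
      (cuspSlope c.slope d h h' ρ δ η C b 1) (cuspHeight c.height h h' ρ δ η C b 1) := by
  have hδ := hp.δ_pos
  have hη := hp.η_pos
  have hr := hp.r_lt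
  have hr₀ := hp.r₀_pos
  have hTη := hp.Tη
  have hT := hp.T_pos
  have hθ := fun R h0 => cuspAngle_one hF hD hp (R := R) h0
  have hP := fun R h0 => cuspSlope_one (b := b) hF hc hD hp (R := R) h0
  have hA : ∀ R, cuspHeight c.height h h' ρ δ η C b 1 R = c.height (η * (R - 3 * δ)) := fun R => by
    rw [cuspHeight]; ring
  have hleft : ∀ R, R ≤ 5 / 2 * δ → c.slope (η * (R - 3 * δ)) = 0 ∧
      c.height (η * (R - 3 * δ)) = -ε := fun R hR =>
    ⟨slope_far hc hp (by rw [abs_of_nonpos] <;> linarith), height_left hc hp hR⟩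
  have hright : ∀ R, 7 / 2 * δ ≤ R → c.slope (η * (R - 3 * δ)) = 0 ∧
      c.height (η * (R - 3 * δ)) = h := fun R hR =>
    ⟨slope_far hc hp (by rw [abs_of_nonneg] <;> linarith), height_right hc hp hR⟩
  have hsq : ∀ t, r₀ + (η * δ / 2) ^ 2 ≤ t → T ≤ √(t - r₀) ∧ √(t - r₀) ^ 2 = t - r₀ := fun t ht =>
    ⟨hTη.trans (Real.le_sqrt_of_sq_le (by linarith)), Real.sq_sqrt (by nlinarith)⟩
  obtain ⟨z1, z2, z3⟩ := cusp_center (C := C) (D := D) (d := d) (b := b) (s := 1) hc hp hδ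
  rw [sub_zero] at z1
  have hA0 : cuspHeight c.height h h' ρ δ η C b 1 0 = -ε := by rw [z3]; ring
  refine ⟨fun R h0 hR => ?_, fun τ hτ => ?_, fun ϑ h1 h2 => ?_, by rw [z1, Real.sin_pi], z2⟩
  · rcases eq_or_lt_of_le h0 with rfl | h0
    · right
      rw [z1, abs_of_pos Real.pi_pos]
      exact ⟨hr.le, le_rfl, z2, hA0⟩
    obtain ⟨k1, k2⟩ := angle_mem hF hD hp h0 (hR.trans hr)
    rw [hθ R h0, hP R h0, hA, abs_of_pos k1]
    rcases le_or_gt |R - 3 * δ| (δ / 2) with h1 | h1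
    · have e := angle_near hF hD hδ h1
      refine Or.inl ⟨?_, _, (ha _).trans e.symm, rfl, rfl⟩
      have h3 : (η * (R - 3 * δ)) ^ 2 ≤ (η * δ / 2) ^ 2 := by
        rw [← sq_abs, abs_mul, abs_of_pos hη, mul_div_assoc]
        gcongr
      linarith
    · have hfar := angle_far hF hD hp h0 (hR.trans hr) h1.le
      obtain ⟨s1, s2⟩ := hsq _ hfar
      rcases le_abs'.1 h1.le with h2 | h2
      · obtain ⟨l1, l2⟩ := hleft R (by linarith)
        rcases lt_or_ge (D (C R)) r with h3 | h3
        · exact Or.inl ⟨h3, -√(D (C R) - r₀), by rw [ha, neg_sq, s2]; ring,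
            by rw [l1, hc.slope_left _ (by linarith)], by rw [l2, hc.left _ (by linarith)]⟩
        · exact Or.inr ⟨h3, k2.le, l1, l2⟩
      · obtain ⟨l1, l2⟩ := hright R (by linarith)
        have hy : max R (max ρ r₁) < r := max_lt hR (max_lt hp.ρr hp.r₁_lt)
        have h3 : D (C R) < r := by
          refine lt_of_le_of_lt ((strictAnti_angle hD).antitone ((hF.strictAntiOn_C hδ).antitoneOn
            ⟨by linarith, hR.trans hr⟩ ⟨le_trans (by linarith) (le_max_left R (max ρ r₁)),
              hy.trans hr⟩ (le_max_left _ _))) ?_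
          rwa [angle_outer hF hD hp (le_max_right _ _) (hy.trans hr)]
        exact Or.inl ⟨h3, √(D (C R) - r₀), by rw [ha, s2]; ring,
          by rw [l1, hc.slope_right _ s1], by rw [l2, hc.right _ s1]⟩
  · have hrpi : 3 * δ < r := hp.r₁_gt.trans hp.r₁_lt
    rw [ha, abs_of_pos (by positivity)] at hτ
    rcases le_or_gt |τ| (η * δ / 2) with h1 | h1
    · have e1 : η * (3 * δ + τ / η - 3 * δ) = τ := by field_simp; ring
      have h2 : |3 * δ + τ / η - 3 * δ| ≤ δ / 2 := by
        rw [add_sub_cancel_left, abs_div, abs_of_pos hη, div_le_iff₀ hη]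
        linarith
      obtain ⟨h3, h4⟩ := abs_le.1 h2
      have h0 : 0 < 3 * δ + τ / η := by linarith
      refine ⟨3 * δ + τ / η, h0, ?_, ?_, by rw [hP _ h0, e1], by rw [hA, e1]⟩
      · have := hp.δρ
        have := hp.ρr
        linarith
      · rw [hθ _ h0, angle_near hF hD hδ h2, e1, ha]
    · have h2 : r₀ + (η * δ / 2) ^ 2 ≤ r₀ + τ ^ 2 := by
        rw [← sq_abs τ]
        gcongr
      rcases lt_abs.1 h1 with h3 | h3
      · obtain ⟨R, k1, k2, k3⟩ := exists_right hF hD hp h2 hτ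
        obtain ⟨l1, l2⟩ := hright R k1
        have h0 : 0 < R := by linarith
        exact ⟨R, h0, k2, by rw [hθ R h0, k3, ha], by rw [hP R h0, l1, hc.slope_right _ (by linarith)],
          by rw [hA, l2, hc.right _ (by linarith)]⟩
      · obtain ⟨R, h0, k2, k3⟩ := exists_left hF hD hp h2 (hτ.trans hr)
        obtain ⟨l1, l2⟩ := hleft R k2
        exact ⟨R, h0, by linarith, by rw [hθ R h0, k3, ha],
          by rw [hP R h0, l1, hc.slope_left _ (by linarith)],
          by rw [hA, l2, hc.left _ (by linarith)]⟩
  · have hr0 : 3 * δ < r := hp.r₁_gt.trans hp.r₁_lt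
    rcases eq_or_lt_of_le h2 with rfl | h2
    · exact ⟨0, le_rfl, by linarith, by rw [z1, abs_of_pos Real.pi_pos], z2, hA0⟩
    · obtain ⟨R, h0, k2, k3⟩ := exists_left hF hD hp (hq.le.trans h1) h2
      obtain ⟨l1, l2⟩ := hleft R k2
      exact ⟨R, h0.le, by linarith, by rw [hθ R h0, k3, abs_of_pos (by linarith)],
        by rw [hP R h0, l1], by rw [hA, l2]⟩

theorem exists_foldFamily_flowRel (σ : ℝ) {R : ℝ} (hR : R < Real.pi) :
    ∃ l, 0 < l ∧ FlowRel (foldFamily σ h h' ρ δ C b) (outer .minus σ (cuspAngle δ C D)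
      (cuspSlope c.slope d h h' ρ δ η C b) (cuspHeight c.height h h' ρ δ η C b)) 1 0 R l := by
  have hδ := hp.δ_pos
  have hδρ := hp.δρ
  have hδ1 := hp.δ_le
  have hh := hp.h'_pos
  have hsh := Real.sqrt_pos.2 hh
  have hsq := Real.sq_sqrt hh.le
  have hpρ : 0 < ρ := hp.ρ_pos
  have hprof : 0 < profile h h' ρ R := hh.trans_le (le_profile hp.h'_le)
  rcases lt_or_ge R δ with h1 | h1
  · obtain ⟨v1, v2, v3, v4⟩ := foldFamily_small (σ := σ) (h := h) (h' := h') (δ := δ) (s := 1)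
      (C := C) (b := b) hpρ (show R ≤ ρ / 2 by linarith)
    obtain ⟨z1, z2, z3⟩ := cusp_center (C := C) (D := D) (d := d) (b := b) (s := 0) hc hp h1
    refine ⟨√h', hsh, ?_, ?_, ?_, ?_⟩
    · simp only [v1, outer, z1, z2, z3, Real.cos_pi_sub, hsq]; ring
    · simp only [v2, foldG, if_pos h1, outer, z1, z2, z3, Real.sin_pi_sub, hsq]; ring
    · simp only [v3, foldP, if_pos h1, outer, z1, Real.cos_pi_sub]; field_simp; ring
    · simp only [v4, outer, z1, Real.sin_pi_sub]; field_simp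
  have hR0 : 0 < R := by linarith
  have hs := Real.sin_pos_of_pos_of_lt_pi hR0 hR
  have z1 : cuspAngle δ C D 0 R = Real.pi / 2 - Real.arctan (C R) := by
    rw [cuspAngle_of_pos hF hD hp hR0]; ring
  have z2 : cuspSlope c.slope d h h' ρ δ η C b 0 R = foldSlope h h' ρ C b R := by
    have : 1 + C R ^ 2 ≠ 0 := by positivity
    rw [cuspSlope_of_pos hF hc hp hR0, cuspMoment, cuspWeight]
    field_simp
    ring
  have z3 : cuspHeight c.height h h' ρ δ η C b 0 R = foldHeight h h' ρ δ C b R := by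
    rw [cuspHeight]; ring
  rcases le_or_gt R (5 * δ) with h2 | h2
  · obtain ⟨v1, v2, v3, v4⟩ := foldFamily_small (σ := σ) (h := h) (h' := h') (δ := δ) (s := 1)
      (C := C) (b := b) hpρ (show R ≤ ρ / 2 by linarith)
    have hw : 0 < √(1 + C R ^ 2) := by positivity
    have hw2 : √(1 + C R ^ 2) ^ 2 = 1 + C R ^ 2 := Real.sq_sqrt (by positivity)
    have y1 : Real.cos (Real.pi / 2 - Real.arctan (C R)) = C R / √(1 + C R ^ 2) := by
      rw [Real.cos_pi_div_two_sub, Real.sin_arctan]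
    have y2 : Real.sin (Real.pi / 2 - Real.arctan (C R)) = 1 / √(1 + C R ^ 2) := by
      rw [Real.sin_pi_div_two_sub, Real.cos_arctan]
    have y3 : foldHeight h h' ρ δ C b R = h' * (b R * √(1 + C R ^ 2)) := by
      rw [foldHeight_of_pos hF hp hR0, profile_of_le hpρ (by linarith)]; ring
    have y4 : foldSlope h h' ρ C b R = h' * (√(1 + C R ^ 2) *
        (Real.sin R ^ 2 * Real.cos R * (1 + C R ^ 2) - b R * C R)) := by
      rw [foldSlope, profileSlope_of_le hpρ (by linarith), add_zero]
    refine ⟨√h' * Real.sin R * √(1 + C R ^ 2), by positivity, ?_, ?_, ?_, ?_⟩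
    · simp only [v1, outer, z1, z2, z3, y1, y2, y3, y4, mul_pow, hsq, hw2]; field_simp; ring
    · simp only [v2, hF.foldG_of_pos hδ1 hR0, outer, z1, z2, z3, y1, y2, y3, y4, mul_pow, hsq, hw2]
      field_simp
      ring
    · simp only [v3, hF.foldP_of_pos hδ1 hR0, outer, z1, y1]; field_simp; ring
    · simp only [v4, outer, z1, y2]; field_simp
  · obtain ⟨v2, v3⟩ := foldFamily_large (σ := σ) (h := h) (h' := h') (ρ := ρ) (s := 1)
      hF hδ hδ1 h2.le hR
    have y1 : Real.pi / 2 - Real.arctan (C R) = R := by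
      rw [hF.C_right R h2.le, arctan_cot hR0 hR]; ring
    rw [y1] at z1
    rw [foldSlope_of_ge hF hp h2.le hR] at z2
    rw [foldHeight_of_ge hF hp h2.le hR] at z3
    have hsq' := Real.sq_sqrt hprof.le
    have hs' := (Real.sqrt_pos.2 hprof).ne'
    refine ⟨√(profile h h' ρ R), Real.sqrt_pos.2 hprof, ?_, ?_, ?_, ?_⟩
    · simp only [foldFamily, outer, z1, z2, z3, hsq']; field_simp
    · simp only [v2, outer, z1, z2, z3, hsq']; field_simp
    · simp only [v3, outer, z1]; field_simp
    · simp only [foldFamily, outer, z1]; field_simp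

end Cusp

/-! ### The handleslide -/

section Main

variable {Y : Type*} [TopologicalSpace Y] [T2Space Y]
  [ChartedSpace (EuclideanSpace ℝ (Fin (2 * m + 1))) Y]
  {ξ : TangentField m Y} {ℓ : Sph m → Y} {L : Type*} [TopologicalSpace L]
  [ChartedSpace (EuclideanSpace ℝ (Fin m)) L]
  {N : StdNbhd ξ ℓ} {i : L → Y} {e : Sph m} {r a b h σ δ₀ ε : ℝ} {c : FrontCurve}

/-- A handleslide and the isotopy that realises it. -/
def IsSlide (N : StdNbhd ξ ℓ) (i : L → Y) (e : Sph m) (r a b σ ε : ℝ) (c : FrontCurve)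
    (κ : SurgerySign) : Prop :=
  (∃ f : L → Y, IsLegendrianEmbedding ξ f ∧ range f = N.handleslide e r a b σ ε c (range i)) ∧
  Disjoint (range ℓ) (N.handleslide e r a b σ ε c (range i)) ∧
  LegendrianIsotopic L (N.surgeredField κ) (N.inSurgered κ (range i))
    (N.inSurgered κ (N.handleslide e r a b σ ε c (range i)))

theorem SheetSetting.isSlide (S : SheetSetting N i e r a b h σ δ₀) {κ : SurgerySign}
    {f : PlaneFamily} {θ P A θ' P' A' : ℝ → ℝ → ℝ} (hm : 1 ≤ m) (hr : r < Real.pi) (hδ₀ : 0 ≤ δ₀)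
    (ho : OuterGood θ P A r a b h δ₀) (hs : ∀ R, θ 0 R = R ∧ P 0 R = 0 ∧ A 0 R = h)
    (hf : DiscFamily κ e r a b h σ δ₀ fun s x => coreProj κ (f.spun e s (x : Euc m)))
    (hcore : ∀ s, ∀ x ∈ cap e r, coreVec κ (f.spun e s (x : Euc m)) ≠ 0)
    (ho' : OuterGood θ' P' A' r a b h δ₀)
    (h0 : ∀ R < r, ∃ l, 0 < l ∧ FlowRel f (outer κ σ θ P A) 0 1 R l)
    (h1 : ∀ R < r, ∃ l, 0 < l ∧ FlowRel f (outer κ σ θ' P' A') 1 0 R l)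
    (hc : c.IsTraced r ε (θ' 1) (P' 1) (A' 1)) : IsSlide N i e r a b σ ε c κ := by
  have z0 : (0 : ℝ) ∈ Icc (0 : ℝ) 1 := ⟨le_rfl, zero_le_one⟩
  have z1 : (1 : ℝ) ∈ Icc (0 : ℝ) 1 := ⟨zero_le_one, le_rfl⟩
  have t1 : ¬(1 : ℝ) ≤ 1 / 2 := by norm_num
  have t2 : (4 : ℝ) * 1 - 3 = 1 := by norm_num
  have hW := ((ho.discFamily (e := e) κ S.sign hr hδ₀).concat hf fun x hx => by
    obtain ⟨l, hl, h2⟩ := h0 _ (axisAngle_mem hx).2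
    exact (h2.coreProj hl κ (hcore 0 x hx)).symm).concat
      (ho'.discFamily (e := e) κ S.sign hr hδ₀) fun x hx => by
    obtain ⟨l, hl, h2⟩ := h1 _ (axisAngle_mem hx).2
    simp only [if_neg t1, t2, Real.smoothTransition.one]
    exact h2.coreProj hl κ (hcore 1 x hx)
  have key := S.isotopic hW (fun x hx => by
    have h2 : (0 : ℝ) ≤ 1 / 2 := by norm_num
    simp only [mul_zero, Real.smoothTransition.zero, if_pos h2]
    refine (ho.gluing_discFamily κ S.sign hr z0 hx).imp_right fun h3 => ?_
    rw [h3, (hs _).1, (hs _).2.1, (hs _).2.2, spunJet_self]) fun x hx => by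
    simp only [if_neg t1, t2, Real.smoothTransition.one]
    exact (ho'.gluing_discFamily κ S.sign hr z1 hx).1
  simp only [if_neg t1, t2, Real.smoothTransition.one] at key
  rw [image_congr fun x hx => (ho'.gluing_discFamily κ S.sign hr z1 hx).2,
    hc.image_eq hm e hr, replaceDisc, image_union, ← union_assoc] at key
  exact key

theorem isSlide_cone (S : SheetSetting N i e r a b h σ δ₀) (hm : 1 ≤ m) (hr : r < Real.pi)
    (hr0 : 0 < r) (hδ₀ : 0 < δ₀) (hε : 0 < ε) (hεa : ε < a) (hεδ : ε ≤ δ₀ / 2)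
    (hc : c.IsCone r h ε) : IsSlide N i e r a b σ ε c .plus := by
  obtain ⟨hang, T, hT, hTr, hd⟩ := hc.exists_data
  obtain ⟨ρ, hρ0, hρ⟩ : ∃ ρ : ℝ, 0 < ρ ∧ ρ < min (1 / 2) r :=
    exists_between (lt_min (by norm_num) hr0)
  obtain ⟨hρ1, hρr⟩ := lt_min_iff.1 hρ
  obtain ⟨δ, hδ, hδ'⟩ : ∃ δ : ℝ, 0 < δ ∧ δ < min (ρ / 4) ((Real.pi - r) / 2) :=
    exists_between (lt_min (by linarith) (by linarith))
  obtain ⟨hδρ, hδr⟩ := lt_min_iff.1 hδ'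
  obtain ⟨M, hM0, hM⟩ := exists_swingDeriv_le hδ
  obtain ⟨h', h'0, hh'⟩ : ∃ h' : ℝ, 0 < h' ∧ h' < min (min h a) (δ₀ / 2 / (1 + M)) :=
    exists_between (lt_min (lt_min S.hh S.ha) (by positivity))
  obtain ⟨⟨k1, k2⟩, k3⟩ := (lt_min_iff.trans (and_congr_left' lt_min_iff)).1 hh'
  rw [lt_div_iff₀ (by positivity)] at k3
  have hδρ2 : 2 * δ < ρ / 2 := by linarith
  have hδr2 : 2 * δ < Real.pi - r := by linarith
  refine S.isSlide hm hr hδ₀.le (outerGood_profile hr S.ha hρ0 hρr h'0 k1.le S.hb)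
    (fun R => ⟨rfl, by simp, by simp⟩)
    (discFamily_swingFamily hr hδ hδρ2 hρ1.le hρr hδr2 S.ha h'0 k1.le S.hb S.sign hM hδ₀.le
      (by linarith)) (fun s x _ => coreVec_swingFamily S.sign x)
    (outerGood_cone hd hT hTr hr hδ hδρ2 hρr hδr2 h'0 k1.le S.hb hε hM k2 hεa k3.le hεδ)
    (fun R _ => ⟨_, ?_, swingFamily_flowRel h'0 k1.le hδ (Or.inl rfl)⟩)
    (fun R _ => ⟨_, ?_, swingFamily_flowRel_outer hδ hδρ2 h'0 k1.le rfl ?_ ?_⟩)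
    (hd.isTraced hang hTr hr hr0 hδ (by linarith))
  · exact div_pos two_pos (h'0.trans_le (le_profile k1.le))
  · exact div_pos two_pos (mul_pos (h'0.trans_le (le_profile k1.le)) (swingRoot_pos hδ))
  · rw [coneSlope]; ring
  · rw [coneHeight]; ring

theorem isSlide_cusp (S : SheetSetting N i e r a b h σ δ₀) (hm : 1 ≤ m) (hr : r < Real.pi)
    (hr0 : 0 < r) (hδ₀ : 0 < δ₀) (hε : 0 < ε) (hεa : ε < a) (hεδ : ε ≤ δ₀ / 2)
    (hc : c.IsCusp r h ε) : IsSlide N i e r a b σ ε c .minus := by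
  obtain ⟨r₀, T, hr₀, hT, hTr, hang, hd⟩ := hc.exists_data
  obtain ⟨ρ, hρ0, hρ⟩ : ∃ ρ : ℝ, 0 < ρ ∧ ρ < min (1 / 2) r :=
    exists_between (lt_min (by norm_num) hr0)
  obtain ⟨hρ1, hρr⟩ := lt_min_iff.1 hρ
  obtain ⟨δ, hδ, hδ'⟩ : ∃ δ : ℝ, 0 < δ ∧ δ < min (ρ / 10) (Real.pi - r) :=
    exists_between (lt_min (by linarith) (by linarith))
  obtain ⟨hδρ, hδr⟩ := lt_min_iff.1 hδ'
  have hδ1 : 5 * δ ≤ 1 / 4 := by linarith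
  have hδρ2 : 5 * δ < ρ / 2 := by linarith
  obtain ⟨C, bb, W, C₀, Lc, hF⟩ := exists_foldData hδ hδ1
  obtain ⟨B, hB0, hB⟩ := hF.exists_fold_bound hδ hδ1
  obtain ⟨M, hM1, hM⟩ := hF.exists_height_bound hδ hδ1
  obtain ⟨r₁, hr₁, hr₁r⟩ := exists_between (max_lt hTr (show 3 * δ < r by linarith))
  obtain ⟨hr₁T, hr₁δ⟩ := max_lt_iff.1 hr₁
  obtain ⟨η, hη⟩ : ∃ η : ℝ, η * δ / 2 = T := ⟨2 * T / δ, by field_simp⟩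
  have hη0 : 0 < η := by
    by_contra! h1
    nlinarith
  have hT2 : r₀ + (η * δ / 2) ^ 2 < r₁ := by rwa [hη]
  obtain ⟨D, d, hD⟩ := exists_angleData (by linarith) (hr₁r.trans hr) hη0 hδ hF.L_pos
    ((cot_le_cot (by linarith) hr₁δ.le (hr₁r.trans hr)).trans_lt hF.lt_C₀) hT2
  have hB3 : 0 < (2 + B) ^ 3 := by positivity
  have hM0 : 0 < M := by linarith
  have hh := S.hh
  have ha := S.ha
  obtain ⟨h', h'0, hh'⟩ : ∃ h' : ℝ, 0 < h' ∧
      h' < min (min h (δ₀ / 2) / (2 + B) ^ 3) (min (min a h) (δ₀ / 2) / M) :=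
    exists_between (by positivity)
  obtain ⟨k1, k2⟩ := lt_min_iff.1 hh'
  rw [lt_div_iff₀ (by positivity), lt_min_iff] at k1 k2
  obtain ⟨k2, k3⟩ := k2
  obtain ⟨k2, k4⟩ := lt_min_iff.1 k2
  have h'M : h' ≤ h' * M := le_mul_of_one_le_right h'0.le hM1
  have h'h : h' ≤ h := by linarith
  have hp : CuspParams r r₀ r₁ δ ρ h h' η T ε a b M δ₀ :=
    ⟨hδ, hδ1, hδρ2, hρr, hr, hr₀, hr₁δ, hr₁r, hδr, h'0, h'h, S.hb, hη0, hT, hη.ge, hε, hεa, hεδ,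
      hM1, k2, k4.le, k3.le⟩
  refine S.isSlide hm hr hδ₀.le (outerGood_profile hr ha hρ0 hρr h'0 h'h S.hb)
    (fun R => ⟨rfl, by simp, by simp⟩)
    (discFamily_foldFamily hF hδ hδ1 hr hδρ2 hρ1.le hρr ha h'0 h'h S.hb S.sign hB k1.1
      (by linarith [k1.2])) (fun s x hx => coreVec_foldFamily hF hδ hδ1 hr hδρ2 hρ1.le S.sign hx)
    (outerGood_cusp hF hd hD hp hM)
    (fun R _ => ⟨_, ?_, foldFamily_flowRel hF hδ hδ1 h'0 h'h (Or.inl rfl)⟩)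
    (fun R hR => exists_foldFamily_flowRel hF hd hD hp σ (hR.trans hr))
    (isTraced_cusp hF hd hD hp hang (hT2.trans hr₁r))
  exact Real.sqrt_pos.2 (h'0.trans_le (le_profile h'h))

end Main

end LegendrianSlide

end

open LegendrianSlide in
theorem mainTheorem10 {m : ℕ} (hm : 1 ≤ m)
    {Y : Type*} [TopologicalSpace Y] [T2Space Y]
    [ChartedSpace (EuclideanSpace ℝ (Fin (2 * m + 1))) Y] [IsManifold (𝓡 (2 * m + 1)) ∞ Y]
    (ξ : TangentField m Y) (hξ : IsContactStructure ξ)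
    -- the Legendrian sphere `Λ = range ℓ`
    (ℓ : Sph m → Y) (hℓ : IsLegendrianEmbedding ξ ℓ)
    -- the Legendrian submanifold `Σ = range i`
    {L : Type*} [TopologicalSpace L] [ChartedSpace (EuclideanSpace ℝ (Fin m)) L]
    [IsManifold (𝓡 m) ∞ L] (i : L → Y) (hi : IsLegendrianEmbedding ξ i)
    (hclosed : IsClosed (range i)) (hdisj : Disjoint (range ℓ) (range i))
    -- the standard neighbourhood of `Λ`, and the Darboux chart in which the front of `Σ` is a
    -- horizontal sheet at distance `h` above (`σ = 1`) or below (`σ = -1`) the front of `Λ`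
    (N : StdNbhd ξ ℓ) (e : Sph m) (r a b h σ : ℝ) (hσ : σ = 1 ∨ σ = -1)
    (hr : 0 < r) (hrpi : r < Real.pi) (ha : 0 < a) (hh : 0 < h) (hb : h < b)
    (hbox : frontBox e r a b σ ⊆ N.map.source)
    (hfront : ∀ w ∈ frontBox e r a b σ, N.map w ∈ range i ↔ w = jetMk w.1 0 (σ * h)) :
    ∃ ε₀ > 0, ∀ ε, 0 < ε → ε < ε₀ → ∀ c : FrontCurve,
      (c.IsCusp r h ε →
        (∃ f : L → Y, IsLegendrianEmbedding ξ f ∧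
          range f = N.handleslide e r a b σ ε c (range i)) ∧
        Disjoint (range ℓ) (N.handleslide e r a b σ ε c (range i)) ∧
        LegendrianIsotopic L (N.surgeredField .minus)
          (N.inSurgered .minus (range i))
          (N.inSurgered .minus (N.handleslide e r a b σ ε c (range i)))) ∧
      (c.IsCone r h ε →
        (∃ f : L → Y, IsLegendrianEmbedding ξ f ∧
          range f = N.handleslide e r a b σ ε c (range i)) ∧
        Disjoint (range ℓ) (N.handleslide e r a b σ ε c (range i)) ∧
        LegendrianIsotopic L (N.surgeredField .plus)
          (N.inSurgered .plus (range i))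
          (N.inSurgered .plus (N.handleslide e r a b σ ε c (range i)))) := by
  obtain ⟨δ₀, hδ₀, htube⟩ := exists_tube
    (N.map.isOpen_inter_preimage hclosed.isOpen_compl) fun x =>
      ⟨N.zero_mem x, fun hx => disjoint_left.1 hdisj ⟨x, (N.map_zero x).symm⟩ hx⟩
  have S : SheetSetting N i e r a b h σ δ₀ :=
    ⟨hi, hclosed, hdisj, hσ, ha, hh, hb, hbox, hfront, htube⟩
  refine ⟨min a (δ₀ / 2), lt_min ha (by linarith), fun ε hε hε₀ c => ?_⟩
  obtain ⟨hεa, hεδ⟩ := lt_min_iff.1 hε₀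
  exact ⟨isSlide_cusp S hm hrpi hr hδ₀ hε hεa hεδ.le, isSlide_cone S hm hrpi hr hδ₀ hε hεa hεδ.le⟩
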